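/- Let $D\in\{1,2,3\}$, $L>0$, $\beta>1$, let $\Lambda$ be the $(D-1)$-dimensional torus of side $L$, and let $J$ be a smooth, spherically symmetric, compactly supported probability density on $\mathbb R^D$. For functions $u$ on the cylinder $\mathbb R\times\Lambda$ (coordinates $x=(x_1,x^\perp)$), $J\star u$ is the convolution of $J$ over $\mathbb R^D$ with the periodic extension of $u$. Let $$f(s)=-\tfrac12 s^2+\tfrac1\beta\Big[\tfrac{1+s}2\ln\tfrac{1+s}2+\tfrac{1-s}2\ln\tfrac{1-s}2\Big],\qquad \sigma(s)=\beta(1-s^2),$$ let $m_\beta$ be the positive minimizer of $f$ on $[-1,1]$, and for measurable $m:\mathbb R\times\Lambda\to[-1,1]$ put $$\mathcal F(m)=\int_{\mathbb R\times\Lambda}[f(m)-f(m_\beta)]\,dx+\tfrac14\int_{\mathbb R\times\Lambda}\int_{\mathbb R^D}J(z)[m(x)-m(x-z)]^2\,dz\,dx,$$ $$\mathcal I(m)=\int_{\mathbb R\times\Lambda}\sigma(m)\,\Big|\nabla\Big(\tfrac1\beta\operatorname{arctanh}m-J\star m\Big)\Big|^2dx .$$ Let $\bar J(x_1)=\int_{\mathbb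 R^{D-1}}J(x_1,x^\perp)\,dx^\perp$ and let $\bar m_0:\mathbb R\to[-1,1]$ be the minimizer of the one-dimensional functional $$\mathcal F_1(m)=\int_{\mathbb R}[f(m)-f(m_\beta)]\,dx_1+\tfrac14\int_{\mathbb R}\int_{\mathbb R}\bar J(x_1-y_1)[m(x_1)-m(y_1)]^2\,dx_1dy_1$$ among measurable $m:\mathbb R\to[-1,1]$ such that $\operatorname{sgn}(x_1)m(x_1)\ge0$ and the limits $\lim_{x_1\to\pm\infty}\operatorname{sgn}(x_1)m(x_1)$ exist and are positive. Put $\bar m_a(x)=\bar m_0(x_1-a)$ and $$\mathcal B_a v=\frac{v}{\beta(1-\bar m_a^2)}-J\star v .$$ Let $\|v\|_{W^{s,2}}=\sum_{|\alpha|\le s}\|D^\alpha v\|_2$ for $s\in\mathbb N$. A solution on $[0,T)$ is a function $m(\cdot,t)$ on $\mathbb R\times\Lambda$ with values in $[-1,1]$ such that $t\mapsto m(t)-\bar m_0$ is continuous from $[0,T)$ to $L^2(\mathbb R\times\Lambda)$, is $C^1$ from $(0,T)$ to $L^2$, takes values in $W^{2,2}$ for $t\in(0,T)$, and satisfies $$\partial_t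 m=\nabla\cdot\big(\nabla m-\beta(1-m^2)(J\star\nabla m)\big)\qquad\text{for } t\in(0,T).$$ **Theorem.** For every $\varepsilon>0$ there is $\delta_1=\delta_1(\varepsilon,\beta,J,L)>0$ such that the following holds for every integer $s>D/2$, every $T$, every solution $m$ on $[0,T)$ and every choice of $a(t)$, $t\in[0,T)$, minimizing $a\mapsto\|m(t)-\bar m_a\|_{2}$ over $\mathbb R$. Write $\bar m=\bar m_{a(t)}$, $\mathcal B=\mathcal B_{a(t)}$ and $v(t)=m(t)-\bar m_{a(t)}$. The free energies $\mathcal F(m(t))$ and $\mathcal F(\bar m_{a(t)})$ are finite for all $t\in[0,T)$, and at every time $t\in[0,T)$ with $\|v(t)\|_{W^{s,2}}\le\delta_1$ both $\mathcal I(m(t))$ and the sum below are finite, $$-\mathcal I(m(t))\le-(1-3\varepsilon)\sum_{i=1}^{D}\int_{\mathbb R\times\Lambda}\sigma(\bar m)\big[(\mathcal B v(t))_{x_i}\big]^2dx ,$$ and, if $t>0$, the function $\tau\mapsto\mathcal F(m(\tau))-\mathcal F(\bar m_{a(\tau)})$ is differentiable at $\tau=t$ with $$\frac{d}{dt}\big[\mathcal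 F(m(t))-\mathcal F(\bar m)\big]=-\mathcal I(m(t)).$$ -/

import Mathlib

open MeasureTheory Filter Topology Set
open scoped ENNReal ContDiff

noncomputable section

namespace NonlocalFront

/-! ### The cylinder `ℝ × Λ` of dimension `D = d + 1`, `Λ` the `d`-dimensional torus of side `L` -/

/-- The cylinder `ℝ × Λ`; its `volume` is Lebesgue measure times the Haar measure of `Λ` of total
mass `L ^ d`. -/
abbrev Cyl (d : ℕ) (L : ℝ) : Type := ℝ × (Fin d → AddCircle L)

/-- The covering map `ℝ^D → ℝ × Λ`. Coordinate `0` is the longitudinal coordinate `x₁`. -/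
def proj {d : ℕ} (L : ℝ) (z : EuclideanSpace ℝ (Fin (d + 1))) : Cyl d L :=
  (z 0, fun j => ((z j.succ : ℝ) : AddCircle L))

/-- Classical partial derivative of a function on the cylinder in the `i`-th direction. -/
def partialDeriv {d : ℕ} {L : ℝ} (i : Fin (d + 1)) (φ : Cyl d L → ℝ) : Cyl d L → ℝ :=
  fun x => deriv (fun h : ℝ => φ (x + proj L (EuclideanSpace.single i h))) 0

/-- Iterated classical partial derivative `D^α φ`. -/
def multiDeriv {d : ℕ} {L : ℝ} (α : Fin (d + 1) → ℕ) (φ : Cyl d L → ℝ) : Cyl d L → ℝ :=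
  (List.finRange (d + 1)).foldr (fun i ψ => (partialDeriv i)^[α i] ψ) φ

/-- Test functions: smooth (that is, the periodic lift to `ℝ^D` is smooth) with compact support. -/
def IsTestFunction {d : ℕ} {L : ℝ} (φ : Cyl d L → ℝ) : Prop :=
  ContDiff ℝ ∞ (fun z : EuclideanSpace ℝ (Fin (d + 1)) => φ (proj L z)) ∧ HasCompactSupport φ

section Sobolev

variable {d : ℕ} {L : ℝ} [Fact (0 < L)]

/-- `g` is the distributional partial derivative of `h` in the `i`-th direction. -/
def IsWeakPartial (i : Fin (d + 1)) (h g : Cyl d L → ℝ) : Prop :=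
  LocallyIntegrable h ∧ LocallyIntegrable g ∧
    ∀ φ : Cyl d L → ℝ, IsTestFunction φ →
      ∫ x, h x * partialDeriv i φ x = - ∫ x, g x * φ x

/-- `g` is the distributional derivative `D^α h`. -/
def IsWeakDeriv (α : Fin (d + 1) → ℕ) (h g : Cyl d L → ℝ) : Prop :=
  LocallyIntegrable h ∧ LocallyIntegrable g ∧
    ∀ φ : Cyl d L → ℝ, IsTestFunction φ →
      ∫ x, h x * multiDeriv α φ x = (-1) ^ (∑ i, α i) * ∫ x, g x * φ x

/-- The multi-indices of order at most `s`. -/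
def multiIndices (d s : ℕ) : Finset (Fin (d + 1) → ℕ) :=
  (Fintype.piFinset fun _ => Finset.range (s + 1)).filter fun α => ∑ i, α i ≤ s

/-- The norm `‖v‖_{W^{s,2}} = ∑_{|α| ≤ s} ‖D^α v‖₂`, equal to `∞` when `v ∉ W^{s,2}`. (Distributional
derivatives are a.e. unique, so the infimum, which is over all families `w` of distributional
derivatives of `v`, is over equal values, and it is `∞` if there is no such family.) -/
def sobolevNorm (s : ℕ) (v : Cyl d L → ℝ) : ℝ≥0∞ :=
  ⨅ (w : (Fin (d + 1) → ℕ) → Cyl d L → ℝ)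
    (_ : ∀ α ∈ multiIndices d s, IsWeakDeriv α v (w α)),
    ∑ α ∈ multiIndices d s, eLpNorm (w α) 2 volume

/-- `∑_i ∫ ρ |h_{x_i}|² dx` for a weight `ρ ≥ 0`, with distributional derivatives `h_{x_i}`
(a.e. unique, so the infimum is over equal values); it is `∞` if `h` has no locally integrable
distributional gradient. -/
def weightedDirichlet (ρ h : Cyl d L → ℝ) : ℝ≥0∞ :=
  ⨅ (g : Fin (d + 1) → Cyl d L → ℝ) (_ : ∀ i, IsWeakPartial i h (g i)),
    ∑ i, ∫⁻ x, ENNReal.ofReal (ρ x * g i x ^ 2)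

end Sobolev

/-! ### Interaction kernel, free energy and front -/

/-- A smooth, spherically symmetric probability density on `ℝ^D` with compact support. -/
structure IsInteractionKernel {d : ℕ} (J : EuclideanSpace ℝ (Fin (d + 1)) → ℝ) : Prop where
  smooth : ContDiff ℝ ∞ J
  compactSupport : HasCompactSupport J
  radial : ∀ x y, ‖x‖ = ‖y‖ → J x = J y
  nonneg : ∀ x, 0 ≤ J x
  integral_eq_one : ∫ x, J x = 1

/-- The convolution `J ⋆ u` on the cylinder, i.e. the convolution over `ℝ^D` of `J` with the
periodic extension of `u`. -/
def conv {d : ℕ} {L : ℝ} (J : EuclideanSpace ℝ (Fin (d + 1)) → ℝ) (u : Cyl d L → ℝ) :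
    Cyl d L → ℝ :=
  fun x => ∫ z, J z * u (x - proj L z)

/-- The longitudinal marginal `J̄` of `J`. -/
def marginal {d : ℕ} (J : EuclideanSpace ℝ (Fin (d + 1)) → ℝ) (r : ℝ) : ℝ :=
  ∫ y : Fin d → ℝ, J (WithLp.toLp 2 (Fin.cons (α := fun _ => ℝ) r y))

/-- The double well potential `f` on `[-1, 1]`. -/
def potential (β s : ℝ) : ℝ :=
  -(1 / 2) * s ^ 2 + 1 / β * ((1 + s) / 2 * Real.log ((1 + s) / 2)
    + (1 - s) / 2 * Real.log ((1 - s) / 2))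

/-- `mβ` is the positive minimizer of the potential on `[-1, 1]`. -/
def IsPositiveMinimizer (β mβ : ℝ) : Prop :=
  0 < mβ ∧ mβ ≤ 1 ∧ ∀ s ∈ Icc (-1 : ℝ) 1, potential β mβ ≤ potential β s

/-- The mobility `σ`. -/
def mobility (β s : ℝ) : ℝ := β * (1 - s ^ 2)

/-- The one-dimensional free energy of a profile with values in `[-1, 1]`, for the kernel `K`. -/
def freeEnergy1 (β mβ : ℝ) (K : ℝ → ℝ) (m : ℝ → ℝ) : ℝ≥0∞ :=
  (∫⁻ x, ENNReal.ofReal (potential β (m x) - potential β mβ)) +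
    1 / 4 * ∫⁻ x, ∫⁻ y, ENNReal.ofReal (K (x - y) * (m x - m y) ^ 2)

/-- The competitors in the variational problem that defines the front. -/
structure IsFrontCompetitor (m : ℝ → ℝ) : Prop where
  measurable : Measurable m
  mem_Icc : ∀ x, m x ∈ Icc (-1 : ℝ) 1
  sign_mul_nonneg : ∀ x, 0 ≤ Real.sign x * m x
  limit_top : ∃ l, 0 < l ∧ Tendsto (fun x => Real.sign x * m x) atTop (𝓝 l)
  limit_bot : ∃ l, 0 < l ∧ Tendsto (fun x => Real.sign x * m x) atBot (𝓝 l)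

/-- `mbar` is the minimizing front `m̄₀` (unique up to null sets). -/
def IsFront (β mβ : ℝ) (K : ℝ → ℝ) (mbar : ℝ → ℝ) : Prop :=
  IsFrontCompetitor mbar ∧
    ∀ m, IsFrontCompetitor m → freeEnergy1 β mβ K mbar ≤ freeEnergy1 β mβ K m

/-- The planar front `m̄_a(x) = m̄₀(x₁ - a)` on the cylinder. -/
def planarFront {d : ℕ} {L : ℝ} (mbar : ℝ → ℝ) (a : ℝ) : Cyl d L → ℝ :=
  fun x => mbar (x.1 - a)

section Dynamics

variable {d : ℕ} {L : ℝ} [Fact (0 < L)]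

/-- The free energy of a profile on the cylinder with values in `[-1, 1]`; in the double
integral `y = x - z`. -/
def freeEnergy (β mβ : ℝ) (J : EuclideanSpace ℝ (Fin (d + 1)) → ℝ) (m : Cyl d L → ℝ) : ℝ≥0∞ :=
  (∫⁻ x, ENNReal.ofReal (potential β (m x) - potential β mβ)) +
    1 / 4 * ∫⁻ x, ∫⁻ z, ENNReal.ofReal (J z * (m x - m (x - proj L z)) ^ 2)

/-- The free energy dissipation `I(m) = ∫ σ(m) |∇ (β⁻¹ arctanh m - J ⋆ m)|² dx`. -/
def dissipation (β : ℝ) (J : EuclideanSpace ℝ (Fin (d + 1)) → ℝ) (m : Cyl d L → ℝ) : ℝ≥0∞ :=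
  weightedDirichlet (fun x => mobility β (m x))
    (fun x => 1 / β * Real.artanh (m x) - conv J m x)

/-- The linearized operator `B v = v / (β (1 - M²)) - J ⋆ v` at the profile `M`. -/
def linOp (β : ℝ) (J : EuclideanSpace ℝ (Fin (d + 1)) → ℝ) (M v : Cyl d L → ℝ) : Cyl d L → ℝ :=
  fun x => v x / (β * (1 - M x ^ 2)) - conv J v x

/-- The linearized dissipation `∑_i ∫ σ(M) [(B v)_{x_i}]² dx` at the profile `M`. -/
def linDissipation (β : ℝ) (J : EuclideanSpace ℝ (Fin (d + 1)) → ℝ) (M v : Cyl d L → ℝ) : ℝ≥0∞ :=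
  weightedDirichlet (fun x => mobility β (M x)) (linOp β J M v)

/-- `m` is a classical solution on `[0, T)` of `∂ₜ m = ∇ · (∇ m - β (1 - m²) (J ⋆ ∇ m))` with values
in `[-1, 1]`, in the class of `L²` perturbations of the front: `m(t) - m̄₀` is a curve in `L²`,
continuous on `[0, T)` and continuously differentiable on `(0, T)`, with values in `W^{2,2}` for
`t > 0`, and the equation holds at every `t > 0` (in the sense of distributions, both sides
being in `L²`). -/
structure IsSolution (β : ℝ) (J : EuclideanSpace ℝ (Fin (d + 1)) → ℝ) (mbar : ℝ → ℝ) (T : ℝ)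
    (m : ℝ → Cyl d L → ℝ) : Prop where
  mem_Icc : ∀ t ∈ Ico 0 T, ∀ᵐ x, m t x ∈ Icc (-1 : ℝ) 1
  regular : ∀ t ∈ Ioo 0 T, sobolevNorm 2 (m t - planarFront mbar 0) ≠ ⊤
  evolution : ∃ u u' : ℝ → Lp ℝ 2 (volume : Measure (Cyl d L)),
    (∀ t ∈ Ico 0 T, u t =ᵐ[volume] m t - planarFront mbar 0) ∧
    ContinuousOn u (Ico 0 T) ∧
    (∀ t ∈ Ioo 0 T, HasDerivAt u (u' t) t) ∧
    ContinuousOn u' (Ioo 0 T) ∧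
    ∀ t ∈ Ioo 0 T, ∃ p : Fin (d + 1) → Cyl d L → ℝ,
      (∀ i, IsWeakPartial i (m t) (p i)) ∧
      ∀ φ : Cyl d L → ℝ, IsTestFunction φ →
        ∫ x, u' t x * φ x =
          - ∑ i, ∫ x, (p i x - β * (1 - m t x ^ 2) * conv J (p i) x) * partialDeriv i φ x

/-- The planar front at `a` is a closest one to `m` in `L²`. -/
def IsClosestFront (mbar : ℝ → ℝ) (m : Cyl d L → ℝ) (a : ℝ) : Prop :=
  ∀ b : ℝ, eLpNorm (m - planarFront mbar a) 2 volume ≤ eLpNorm (m - planarFront mbar b) 2 volume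

end Dynamics

end NonlocalFront

end

open NonlocalFront

set_option linter.unusedSectionVars false

namespace NonlocalFront

/-! ### Hyperbolic functions -/

/-! The equation is the flow ∂ₜm = ∇·(σ(m)∇h) driven by the chemical potential h = β⁻¹ artanh m −
J⋆m, the first variation of the free energy. Formally the free energy therefore decreases at the
rate ∫ σ(m)|∇h|², the dissipation. At a front h vanishes identically, and its linearization there is
Bv. The dissipation is thus close to the quadratic form ∫ σ(m̄)|∇Bv|², and the task is to absorb the
error into a small multiple of that form.

The pointwise error satisfies |∇h − ∇Bv| ≤ C|v|(|∇v| + m̄'|v|) (`abs_chemDeriv_sub_le`), and the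
factor |v| is uniformly small by a Sobolev inequality in dimension at most three
(`exists_sobolev_bound`). It remains to bound ‖∇v‖₂ and ‖m̄'v‖₂ by ‖∇Bv‖₂. This coercivity
(`exists_coercivity`) needs v orthogonal to m̄', which is the first order condition satisfied by a
closest front (`integral_mul_deriv_eq_zero_of_isClosestFront`). The comparison is then
`exists_dissipation_comparison`.

Coercivity cannot pass through ‖v‖₂, because the unbounded cylinder has no Poincaré inequality. The
operator B is symmetric and annihilates the positive function m̄'. A Perron–Frobenius argument shows
that this spans its kernel, and a compactness argument turns this into the bound ‖u‖ ≤ C(‖Bu‖ + |⟨u,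
m̄'⟩|) (`exists_gap`). Slowly decaying exponential weights almost commute with B, so the bound
survives in weighted norms (`exists_weighted_gap`). Since Bv is orthogonal to m̄', a weighted
Poincaré inequality (`IsProfile.exists_weighted_poincare`) controls the weighted norm of Bv, hence
that of v, by ‖∇Bv‖₂. Finally B(∂ᵢv) differs from ∂ᵢ(Bv) by a term localized near the interface,
which the weighted norm controls, and the unweighted gap applied to ∂ᵢv closes the estimate.

All this rests on properties of the front, which is given only as a minimizer under a sign
constraint. Submodularity of the energy makes min(m(·+c), m) a minimizer again. This shows that the
nonlocal field K⋆m has the sign that the constraint asks for (`IsFront.avg_nonneg`), so that the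
constraint is inactive and the Euler–Lagrange equation m = tanh(β K⋆m) holds
(`IsFront.euler_lagrange`). The same minimizers, together with propagation of zeros, give
monotonicity. The inequality β(1 − l²) < 1 at the wells makes the equation a contraction far out and
gives exponential decay. `IsFront.exists_profile` collects the result.

For the time derivative, the free energy has a first order expansion with remainder quadratic in the
L² norm (`freeEnergy_expansion`), so it is differentiable along an L²-differentiable curve at a time
when m is uniformly close to a front (`hasDerivAt_freeEnergy`). The derivative ∫ h ∂ₜm is minus the
dissipation by the weak equation tested with h itself (`integral_chemicalPotential_mul`). The free
energy of a planar front does not depend on its position, so no regularity of a(t) is involved. -/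

theorem hasDerivAt_tanh (t : ℝ) : HasDerivAt Real.tanh (1 - Real.tanh t ^ 2) t := by
  have hc : Real.cosh t ≠ 0 := (Real.cosh_pos t).ne'
  have h := (Real.hasDerivAt_sinh t).div (Real.hasDerivAt_cosh t) hc
  have e : (fun t => Real.tanh t) = fun t => Real.sinh t / Real.cosh t :=
    funext fun t => Real.tanh_eq_sinh_div_cosh t
  change HasDerivAt (fun t => Real.tanh t) _ t
  rw [e]
  refine h.congr_deriv ?_
  rw [Real.tanh_eq_sinh_div_cosh]
  field_simp

theorem continuous_tanh : Continuous Real.tanh :=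
  continuous_iff_continuousAt.2 fun t => (hasDerivAt_tanh t).continuousAt

theorem one_sub_tanh_sq_pos (t : ℝ) : 0 < 1 - Real.tanh t ^ 2 := by
  nlinarith [Real.tanh_lt_one t, Real.neg_one_lt_tanh t]

theorem strictMono_tanh : StrictMono Real.tanh :=
  strictMono_of_deriv_pos fun t => by
    rw [(hasDerivAt_tanh t).deriv]; exact one_sub_tanh_sq_pos t

theorem tanh_mem_Ioo (t : ℝ) : Real.tanh t ∈ Ioo (-1 : ℝ) 1 :=
  ⟨Real.neg_one_lt_tanh t, Real.tanh_lt_one t⟩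

theorem tanh_nonneg {t : ℝ} (ht : 0 ≤ t) : 0 ≤ Real.tanh t := by
  simpa using strictMono_tanh.monotone ht

theorem tanh_nonpos {t : ℝ} (ht : t ≤ 0) : Real.tanh t ≤ 0 := by
  simpa using strictMono_tanh.monotone ht

/-- Concavity of the hyperbolic tangent on the positive half line. -/
theorem tanh_sub_tanh_le {a b : ℝ} (ha : 0 ≤ a) (hab : a ≤ b) :
    Real.tanh b - Real.tanh a ≤ (1 - Real.tanh a ^ 2) * (b - a) := by
  have hanti : AntitoneOn (deriv Real.tanh) (Icc a b) := by
    intro x hx y hy hxy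
    rw [(hasDerivAt_tanh x).deriv, (hasDerivAt_tanh y).deriv]
    have h1 := strictMono_tanh.monotone hxy
    have h2 := tanh_nonneg (ha.trans hx.1)
    nlinarith
  have := Convex.image_sub_le_mul_sub_of_deriv_le (convex_Icc a b)
    continuous_tanh.continuousOn
    (fun x _ => (hasDerivAt_tanh x).differentiableAt.differentiableWithinAt)
    (C := 1 - Real.tanh a ^ 2)
    (fun x hx => by
      rw [interior_Icc] at hx
      have := hanti (left_mem_Icc.2 hab) (Ioo_subset_Icc_self hx) hx.1.le
      rwa [(hasDerivAt_tanh a).deriv] at this) a (left_mem_Icc.2 hab) b (right_mem_Icc.2 hab) hab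
  exact this

theorem artanh_eq_half_sub_log {s : ℝ} (hs : s ∈ Ioo (-1 : ℝ) 1) :
    Real.artanh s = 1 / 2 * (Real.log ((1 + s) / 2) - Real.log ((1 - s) / 2)) := by
  have h1 : 0 < 1 + s := by linarith [hs.1]
  have h2 : 0 < 1 - s := by linarith [hs.2]
  rw [Real.artanh_eq_half_log (Ioo_subset_Icc_self hs), Real.log_div h1.ne' h2.ne',
    Real.log_div h1.ne' two_ne_zero, Real.log_div h2.ne' two_ne_zero]
  ring

theorem hasDerivAt_artanh {s : ℝ} (hs : s ∈ Ioo (-1 : ℝ) 1) :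
    HasDerivAt Real.artanh (1 / (1 - s ^ 2)) s := by
  have h1 : 0 < 1 + s := by linarith [hs.1]
  have h2 : 0 < 1 - s := by linarith [hs.2]
  have h12 : (1 - s ^ 2) ≠ 0 := by nlinarith
  have ha : HasDerivAt (fun s : ℝ => Real.log (1 + s)) (1 / (1 + s)) s :=
    ((hasDerivAt_id s).const_add 1).log h1.ne'
  have hb : HasDerivAt (fun s : ℝ => Real.log (1 - s)) (-1 / (1 - s)) s :=
    ((hasDerivAt_id s).const_sub 1).log h2.ne'
  have h := (ha.sub hb).const_mul (1 / 2)
  have he : (fun s : ℝ => 1 / 2 * (Real.log (1 + s) - Real.log (1 - s))) =ᶠ[𝓝 s] Real.artanh := by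
    filter_upwards [isOpen_Ioo.mem_nhds hs] with r hr
    have h1 : 0 < 1 + r := by linarith [hr.1]
    have h2 : 0 < 1 - r := by linarith [hr.2]
    rw [Real.artanh_eq_half_log (Ioo_subset_Icc_self hr), Real.log_div h1.ne' h2.ne']
  refine (h.congr_of_eventuallyEq he.symm).congr_deriv ?_
  field_simp
  ring

/-! ### The double well potential -/

/-- Relative entropy of the two-point distributions with means `s` and `s₀`. -/
noncomputable def relEnt (s s₀ : ℝ) : ℝ :=
  (1 + s) / 2 * (Real.log ((1 + s) / 2) - Real.log ((1 + s₀) / 2))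
    + (1 - s) / 2 * (Real.log ((1 - s) / 2) - Real.log ((1 - s₀) / 2))

/-- The entropy minus its tangent at s₀ is exactly a relative entropy, and −s²/2 contributes its own
exact second order remainder. The identity is formal in the logarithms, so s may be an endpoint. -/
theorem potential_eq_expansion (β : ℝ) {s₀ : ℝ} (h₀ : s₀ ∈ Ioo (-1 : ℝ) 1) (s : ℝ) :
    potential β s = potential β s₀ + (1 / β * Real.artanh s₀ - s₀) * (s - s₀)
      + (1 / β * relEnt s s₀ - (s - s₀) ^ 2 / 2) := by
  rw [artanh_eq_half_sub_log h₀, relEnt, potential, potential]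
  ring

/-- This is log x ≤ x − 1 at x = √(q/p): a Hellinger lower bound for one atom of the relative
entropy, valid at p = 0 as well. -/
theorem sq_sqrt_sub_le_mul_log {p q : ℝ} (hp : 0 ≤ p) (hq : 0 < q) :
    (√p - √q) ^ 2 ≤ p * (Real.log p - Real.log q) - p + q := by
  rcases hp.eq_or_lt with rfl | hp
  · simp [Real.sq_sqrt hq.le]
  · have h1 : Real.log (√(q / p)) ≤ √(q / p) - 1 :=
      Real.log_le_sub_one_of_pos (Real.sqrt_pos.2 (div_pos hq hp))
    rw [Real.log_sqrt (div_pos hq hp).le, Real.log_div hq.ne' hp.ne', Real.sqrt_div hq.le] at h1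
    have h2 : p * (√q / √p) = √p * √q := by
      have : √p ≠ 0 := (Real.sqrt_pos.2 hp).ne'
      field_simp
      rw [Real.sq_sqrt hp.le]
    nlinarith [Real.sq_sqrt hp.le, Real.sq_sqrt hq.le, mul_le_mul_of_nonneg_left h1 hp.le]

/-- The inequality log x ≤ x − 1 at x = p/q gives the χ² upper bound that pairs with the preceding
lower bound. -/
theorem mul_log_sub_log_le {p q : ℝ} (hp : 0 ≤ p) (hq : 0 < q) :
    p * (Real.log p - Real.log q) ≤ p - q + (p - q) ^ 2 / q := by
  rcases hp.eq_or_lt with rfl | hp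
  · have : (0 - q) ^ 2 / q = q := by field_simp; ring
    rw [this]; simp
  · have h1 : Real.log (p / q) ≤ p / q - 1 := Real.log_le_sub_one_of_pos (div_pos hp hq)
    rw [Real.log_div hp.ne' hq.ne'] at h1
    have h2 := mul_le_mul_of_nonneg_left h1 hp.le
    have h3 : p * (p / q - 1) = p - q + (p - q) ^ 2 / q := by field_simp; ring
    linarith

/-- Adding the Hellinger bounds for the two atoms cancels the linear terms, since both pairs of
weights sum to 1. Each atom contributes (s − s₀)²/16. -/
theorem relEnt_lower {s s₀ : ℝ} (hs : s ∈ Icc (-1 : ℝ) 1) (h₀ : s₀ ∈ Ioo (-1 : ℝ) 1) :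
    (s - s₀) ^ 2 / 8 ≤ relEnt s s₀ := by
  have key : ∀ {p q : ℝ}, 0 ≤ p → p ≤ 1 → 0 < q → q ≤ 1 → (p - q) ^ 2 / 4 ≤ (√p - √q) ^ 2 := by
    intro p q hp hp1 hq hq1
    have e : p - q = (√p - √q) * (√p + √q) := by
      nlinarith [Real.sq_sqrt hp, Real.sq_sqrt hq.le]
    have h1 : √p ≤ 1 := Real.sqrt_le_one.2 hp1
    have h2 : √q ≤ 1 := Real.sqrt_le_one.2 hq1
    have h3 : (√p + √q) ^ 2 ≤ 4 := by nlinarith [Real.sqrt_nonneg p, Real.sqrt_nonneg q]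
    rw [e, mul_pow]
    nlinarith [sq_nonneg (√p - √q)]
  have a1 : 0 ≤ (1 + s) / 2 := by linarith [hs.1]
  have a2 : 0 ≤ (1 - s) / 2 := by linarith [hs.2]
  have b1 : 0 < (1 + s₀) / 2 := by linarith [h₀.1]
  have b2 : 0 < (1 - s₀) / 2 := by linarith [h₀.2]
  have h1 := sq_sqrt_sub_le_mul_log a1 b1
  have h2 := sq_sqrt_sub_le_mul_log a2 b2
  have h3 := key a1 (by linarith [hs.2]) b1 (by linarith [h₀.2])
  have h4 := key a2 (by linarith [hs.1]) b2 (by linarith [h₀.1])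
  rw [relEnt]
  nlinarith

theorem relEnt_nonneg {s s₀ : ℝ} (hs : s ∈ Icc (-1 : ℝ) 1) (h₀ : s₀ ∈ Ioo (-1 : ℝ) 1) :
    0 ≤ relEnt s s₀ := le_trans (by positivity) (relEnt_lower hs h₀)

theorem relEnt_upper {s s₀ : ℝ} (hs : s ∈ Icc (-1 : ℝ) 1) (h₀ : s₀ ∈ Ioo (-1 : ℝ) 1) :
    relEnt s s₀ ≤ (s - s₀) ^ 2 / (1 - s₀ ^ 2) := by
  have a1 : 0 ≤ (1 + s) / 2 := by linarith [hs.1]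
  have a2 : 0 ≤ (1 - s) / 2 := by linarith [hs.2]
  have b1 : 0 < 1 + s₀ := by linarith [h₀.1]
  have b2 : 0 < 1 - s₀ := by linarith [h₀.2]
  have h1 := mul_log_sub_log_le a1 (half_pos b1)
  have h2 := mul_log_sub_log_le a2 (half_pos b2)
  have e : (s - s₀) ^ 2 / (1 - s₀ ^ 2) = ((1 + s) / 2 - (1 + s₀) / 2) ^ 2 / ((1 + s₀) / 2)
      + ((1 - s) / 2 - (1 - s₀) / 2) ^ 2 / ((1 - s₀) / 2) := by
    have : (1 - s₀ ^ 2) = (1 + s₀) * (1 - s₀) := by ring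
    rw [this]
    field_simp
    ring
  rw [relEnt, e]
  linarith

theorem measurable_artanh : Measurable Real.artanh := by
  unfold Real.artanh
  fun_prop

theorem potential_neg (β s : ℝ) : potential β (-s) = potential β s := by
  unfold potential; rw [← sub_eq_add_neg, sub_neg_eq_add]; ring

/-- Second order expansion of the potential at an interior point, uniform on `[-1, 1]`. -/
theorem abs_potential_sub_le {β : ℝ} (hβ : 1 < β) {c : ℝ} (hc : c < 1) {s s₀ : ℝ}
    (hs : s ∈ Icc (-1 : ℝ) 1) (h₀ : |s₀| ≤ c) :
    |potential β s - potential β s₀ - (1 / β * Real.artanh s₀ - s₀) * (s - s₀)|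
      ≤ (1 / (1 - c ^ 2) + 1) * (s - s₀) ^ 2 := by
  have hc0 : 0 ≤ c := (abs_nonneg _).trans h₀
  have h0 : s₀ ∈ Ioo (-1 : ℝ) 1 := by
    have := abs_le.1 h₀; exact ⟨by linarith, by linarith⟩
  rw [potential_eq_expansion β h0 s]
  have h1 := relEnt_nonneg hs h0
  have h2 := relEnt_upper hs h0
  have hsq : s₀ ^ 2 ≤ c ^ 2 := sq_le_sq' (by linarith [(abs_le.1 h₀).1]) (abs_le.1 h₀).2
  have hcc : 0 < 1 - c ^ 2 := by nlinarith
  have h3 : (s - s₀) ^ 2 / (1 - s₀ ^ 2) ≤ 1 / (1 - c ^ 2) * (s - s₀) ^ 2 := by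
    rw [div_eq_mul_one_div, mul_comm]
    gcongr
  have hb : 1 / β * relEnt s s₀ ≤ relEnt s s₀ := by
    have : 1 / β ≤ 1 := by rw [div_le_one (by linarith)]; exact hβ.le
    nlinarith
  have hb0 : 0 ≤ 1 / β * relEnt s s₀ := by positivity
  rw [abs_le]
  constructor
  · have : 0 ≤ 1 / (1 - c ^ 2) * (s - s₀) ^ 2 := by positivity
    nlinarith [sq_nonneg (s - s₀)]
  · nlinarith [sq_nonneg (s - s₀)]

/-- Quantitative minimality of `tanh (β h)` for the tilted entropy. -/
theorem tilted_entropy_le {β : ℝ} (hβ : 1 < β) (h : ℝ) {s : ℝ} (hs : s ∈ Icc (-1 : ℝ) 1) :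
    potential β (Real.tanh (β * h)) + Real.tanh (β * h) ^ 2 / 2 - h * Real.tanh (β * h)
      + (s - Real.tanh (β * h)) ^ 2 / (8 * β) ≤ potential β s + s ^ 2 / 2 - h * s := by
  have hβ0 : β ≠ 0 := by linarith
  rw [potential_eq_expansion β (tanh_mem_Ioo (β * h)) s, Real.artanh_tanh]
  have h1 := relEnt_lower hs (tanh_mem_Ioo (β * h))
  have h2 : 1 / β * ((s - Real.tanh (β * h)) ^ 2 / 8) ≤ 1 / β * relEnt s (Real.tanh (β * h)) :=
    mul_le_mul_of_nonneg_left h1 (by positivity)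
  have e : 1 / β * ((s - Real.tanh (β * h)) ^ 2 / 8) = (s - Real.tanh (β * h)) ^ 2 / (8 * β) := by
    field_simp
  have e2 : 1 / β * (β * h) = h := by field_simp
  rw [e2]
  nlinarith

/-- Convexity of the entropy along segments with an interior point. -/
theorem entropy_convex {β : ℝ} (hβ : 1 < β) {s T θ : ℝ} (hs : s ∈ Icc (-1 : ℝ) 1)
    (hT : T ∈ Ioo (-1 : ℝ) 1) (h0 : 0 < θ) (h1 : θ ≤ 1) :
    potential β (s + θ * (T - s)) + (s + θ * (T - s)) ^ 2 / 2
      ≤ (1 - θ) * (potential β s + s ^ 2 / 2) + θ * (potential β T + T ^ 2 / 2) := by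
  have hβ0 : β ≠ 0 := by linarith
  set S := s + θ * (T - s) with hS
  have hSI : S ∈ Ioo (-1 : ℝ) 1 := by
    constructor
    · nlinarith [hs.1, hT.1, mul_pos h0 (sub_pos.2 hT.1), mul_nonneg (sub_nonneg.2 h1) (sub_nonneg.2 hs.1)]
    · nlinarith [hs.2, hT.2, mul_pos h0 (sub_pos.2 hT.2), mul_nonneg (sub_nonneg.2 h1) (sub_nonneg.2 hs.2)]
  -- The intermediate point S is the minimizer for the tilt artanh S / β, so the entropy has a
  -- supporting line at S. Convexity follows by evaluating that line at the two ends.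
  have e : Real.tanh (β * (Real.artanh S / β)) = S := by
    rw [mul_div_cancel₀ _ hβ0, Real.tanh_artanh hSI]
  have k : ∀ r ∈ Icc (-1 : ℝ) 1, potential β S + S ^ 2 / 2 - Real.artanh S / β * S
      ≤ potential β r + r ^ 2 / 2 - Real.artanh S / β * r := by
    intro r hr
    have := tilted_entropy_le hβ (Real.artanh S / β) hr
    rw [e] at this
    have h3 : 0 ≤ (r - S) ^ 2 / (8 * β) := by positivity
    linarith
  have k1 := mul_le_mul_of_nonneg_left (k s hs) (sub_nonneg.2 h1)
  have k2 := mul_le_mul_of_nonneg_left (k T (Ioo_subset_Icc_self hT)) h0.le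
  have e2 : Real.artanh S / β * S
      = (1 - θ) * (Real.artanh S / β * s) + θ * (Real.artanh S / β * T) := by
    rw [hS]; ring
  nlinarith

/-- With tilt h = l the tilted entropy is the potential plus (s − l)²/2, up to a constant. It is
minimal at tanh(βl), while s = l minimizes both summands, so the two points coincide. In particular
l is interior. -/
theorem IsPositiveMinimizer.tanh_eq {β : ℝ} (hβ : 1 < β) {l : ℝ} (hl : IsPositiveMinimizer β l) :
    Real.tanh (β * l) = l := by
  have hm : l ∈ Icc (-1 : ℝ) 1 := ⟨by linarith [hl.1], hl.2.1⟩
  have h1 := tilted_entropy_le hβ l hm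
  have h2 := hl.2.2 _ (Ioo_subset_Icc_self (tanh_mem_Ioo (β * l)))
  have h3 : 0 ≤ (l - Real.tanh (β * l)) ^ 2 / (8 * β) := by positivity
  have h4 : (l - Real.tanh (β * l)) ^ 2 ≤ 0 := by nlinarith
  have h5 := pow_eq_zero_iff (two_ne_zero) |>.1 (le_antisymm h4 (sq_nonneg _))
  linarith

theorem IsPositiveMinimizer.mem_Ioo {β : ℝ} (hβ : 1 < β) {l : ℝ} (hl : IsPositiveMinimizer β l) :
    l ∈ Ioo (0 : ℝ) 1 := ⟨hl.1, by rw [← hl.tanh_eq hβ]; exact Real.tanh_lt_one _⟩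

/-- Put t = βl. From t < sinh t = l cosh t follows β < cosh t ≤ cosh² t = 1/(1 − l²). This
nondegeneracy of the wells makes the front equation a contraction at infinity and keeps the
linearized operator invertible there. -/
theorem IsPositiveMinimizer.mul_lt_one {β : ℝ} (hβ : 1 < β) {l : ℝ}
    (hl : IsPositiveMinimizer β l) : β * (1 - l ^ 2) < 1 := by
  set t := β * l with ht
  have ht0 : 0 < t := mul_pos (by linarith) hl.1
  have hc := Real.cosh_pos t
  have hs : t < Real.sinh t := Real.self_lt_sinh_iff.2 ht0
  have hc1 : 1 ≤ Real.cosh t := Real.one_le_cosh t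
  have e := hl.tanh_eq hβ
  rw [← ht, Real.tanh_eq_sinh_div_cosh] at e
  have e2 : Real.sinh t = l * Real.cosh t := by rw [← e]; field_simp
  have e3 : (1 - l ^ 2) * Real.cosh t ^ 2 = 1 := by
    have := Real.cosh_sq t
    nlinarith
  have h1 : β * l < l * Real.cosh t := by rw [← ht, ← e2]; exact hs
  have h2 : β < Real.cosh t := by nlinarith [hl.1]
  have h3 : β < Real.cosh t ^ 2 := by nlinarith
  have hpos : 0 < 1 - l ^ 2 := by
    have := hl.mem_Ioo hβ
    nlinarith [this.1, this.2]
  calc β * (1 - l ^ 2) < Real.cosh t ^ 2 * (1 - l ^ 2) := by gcongr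
    _ = 1 := by linarith

theorem IsPositiveMinimizer.artanh_eq {β : ℝ} (hβ : 1 < β) {l : ℝ}
    (hl : IsPositiveMinimizer β l) : 1 / β * Real.artanh l - l = 0 := by
  have h : Real.artanh l = β * l := by
    conv_lhs => rw [← hl.tanh_eq hβ]
    exact Real.artanh_tanh _
  have : β ≠ 0 := by linarith
  rw [h]; field_simp; ring

/-- The limits of the front enter as positive minimizers of their own. Equality of the minimal
values is enough, so their uniqueness is not needed. -/
theorem IsPositiveMinimizer.potential_eq {β l l' : ℝ} (hl : IsPositiveMinimizer β l)
    (hl' : IsPositiveMinimizer β l') : potential β l = potential β l' :=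
  le_antisymm (hl.2.2 _ ⟨by linarith [hl'.1], hl'.2.1⟩) (hl'.2.2 _ ⟨by linarith [hl.1], hl.2.1⟩)

/-- The potential is quadratically close to its minimum near either well. -/
theorem IsPositiveMinimizer.potential_sub_le {β : ℝ} (hβ : 1 < β) {l l₀ : ℝ}
    (hl : IsPositiveMinimizer β l) (hl₀ : IsPositiveMinimizer β l₀) {s χ : ℝ}
    (hs : s ∈ Icc (-1 : ℝ) 1) (hχ : χ = l₀ ∨ χ = -l₀) :
    potential β s - potential β l ≤ (1 / (1 - l₀ ^ 2) + 1) * (s - χ) ^ 2 := by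
  have hm := hl₀.mem_Ioo hβ
  have key : ∀ s ∈ Icc (-1 : ℝ) 1,
      potential β s - potential β l ≤ (1 / (1 - l₀ ^ 2) + 1) * (s - l₀) ^ 2 := by
    intro s hs
    have := (abs_le.1 (abs_potential_sub_le hβ hm.2 hs (abs_of_pos hm.1).le)).2
    rw [hl₀.artanh_eq hβ, zero_mul, sub_zero] at this
    rwa [hl.potential_eq hl₀]
  rcases hχ with rfl | rfl
  · exact key s hs
  · have := key (-s) ⟨by linarith [hs.2], by linarith [hs.1]⟩
    rw [potential_neg] at this
    convert this using 2
    ring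

theorem continuous_potential (β : ℝ) : Continuous (potential β) := by
  have h : ∀ g : ℝ → ℝ, Continuous g → Continuous fun s => g s * Real.log (g s) :=
    fun g hg => Real.continuous_mul_log.comp hg
  unfold potential
  have h1 := h (fun s => (1 + s) / 2) (by fun_prop)
  have h2 := h (fun s => (1 - s) / 2) (by fun_prop)
  fun_prop

end NonlocalFront

namespace NonlocalFront

/-! ### Averages over a probability measure on a group -/

theorem eLpNorm_two_sq {α : Type*} [MeasurableSpace α] (μ : Measure α) (f : α → ℝ) :
    eLpNorm f 2 μ ^ 2 = ∫⁻ x, ‖f x‖ₑ ^ 2 ∂μ := by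
  have := eLpNorm_nnreal_pow_eq_lintegral (f := f) (μ := μ) (p := 2) two_ne_zero
  simpa using this

theorem memLp_two_iff_lintegral {α : Type*} [MeasurableSpace α] {μ : Measure α} {f : α → ℝ}
    (hf : AEStronglyMeasurable f μ) : MemLp f 2 μ ↔ ∫⁻ x, ‖f x‖ₑ ^ 2 ∂μ < ⊤ := by
  rw [← eLpNorm_two_sq, MemLp, and_iff_right hf]
  simp [ENNReal.pow_lt_top_iff]

theorem enorm_sq_eq_ofReal (r : ℝ) : ‖r‖ₑ ^ 2 = ENNReal.ofReal (r ^ 2) := by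
  rw [← enorm_pow, Real.enorm_of_nonneg (sq_nonneg r)]

theorem lintegral_enorm_sq {α : Type*} [MeasurableSpace α] {μ : Measure α} {f : α → ℝ}
    (hf : MemLp f 2 μ) : ∫⁻ x, ‖f x‖ₑ ^ 2 ∂μ = ENNReal.ofReal (∫ x, f x ^ 2 ∂μ) := by
  rw [ofReal_integral_eq_lintegral_ofReal hf.integrable_sq (ae_of_all _ fun x => sq_nonneg _)]
  simp_rw [enorm_sq_eq_ofReal]

theorem enorm_integral_sq_le {α : Type*} [MeasurableSpace α] {ν : Measure α}
    [IsProbabilityMeasure ν] {f : α → ℝ} (hf : AEStronglyMeasurable f ν) :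
    ‖∫ y, f y ∂ν‖ₑ ^ 2 ≤ ∫⁻ y, ‖f y‖ₑ ^ 2 ∂ν := by
  rw [← eLpNorm_two_sq]
  gcongr
  calc ‖∫ y, f y ∂ν‖ₑ ≤ ∫⁻ y, ‖f y‖ₑ ∂ν := enorm_integral_le_lintegral_enorm _
    _ = eLpNorm f 1 ν := eLpNorm_one_eq_lintegral_enorm.symm
    _ ≤ eLpNorm f 2 ν := eLpNorm_le_eLpNorm_of_exponent_le (by norm_num) hf

section Averages

variable {G : Type*} [AddCommGroup G] [MeasurableSpace G]

/-- The average of the translates of `u` over the measure `ν`. -/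
noncomputable def avg (ν : Measure G) (u : G → ℝ) (x : G) : ℝ := ∫ y, u (x - y) ∂ν

/-- The increment of `u` over a step. -/
def incr (u : G → ℝ) (p : G × G) : ℝ := u p.1 - u (p.1 - p.2)

variable [MeasurableAdd₂ G] [MeasurableNeg G]
  {μ : Measure G} [SigmaFinite μ] [μ.IsAddLeftInvariant]
  {ν : Measure G} [IsProbabilityMeasure ν]

/-- For each fixed step this is a translation, so Fubini suffices. The step law ν is an arbitrary
probability measure, so the line and the cylinder are treated together. -/
theorem measurePreserving_shear :
    MeasurePreserving (fun p : G × G => (p.1 - p.2, p.2)) (μ.prod ν) (μ.prod ν) := by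
  have hm : Measurable (fun p : G × G => (p.1 - p.2, p.2)) := by fun_prop
  refine ⟨hm, ?_⟩
  ext s hs
  rw [Measure.map_apply hm hs, Measure.prod_apply_symm (hm hs), Measure.prod_apply_symm hs]
  refine lintegral_congr fun y => ?_
  have h := measure_preimage_add_right μ (-y) ((fun x => (x, y)) ⁻¹' s)
  rw [← h]
  congr 1
  ext x
  simp [sub_eq_add_neg]

/-- This involution exchanges the two ends of a jump. Every symmetry of the interaction used below
is a change of variables along it. -/
theorem measurePreserving_shear_neg [ν.IsNegInvariant] :
    MeasurePreserving (fun p : G × G => (p.1 - p.2, -p.2)) (μ.prod ν) (μ.prod ν) := by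
  have h2 : MeasurePreserving (Prod.map id Neg.neg : G × G → G × G) (μ.prod ν) (μ.prod ν) :=
    (MeasurePreserving.id μ).prod (Measure.measurePreserving_neg ν)
  exact h2.comp measurePreserving_shear

theorem quasiMeasurePreserving_sub_prod :
    Measure.QuasiMeasurePreserving (fun p : G × G => p.1 - p.2) (μ.prod ν) μ :=
  Measure.quasiMeasurePreserving_fst.comp measurePreserving_shear.quasiMeasurePreserving

theorem measurePreserving_sub_prod :
    MeasurePreserving (fun p : G × G => p.1 - p.2) (μ.prod ν) μ := by
  have h : MeasurePreserving (Prod.fst : G × G → G) (μ.prod ν) μ := measurePreserving_fst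
  exact h.comp measurePreserving_shear

theorem aestronglyMeasurable_sub_prod {u : G → ℝ} (hu : AEStronglyMeasurable u μ) :
    AEStronglyMeasurable (fun p : G × G => u (p.1 - p.2)) (μ.prod ν) :=
  hu.comp_quasiMeasurePreserving quasiMeasurePreserving_sub_prod

theorem aestronglyMeasurable_incr {u : G → ℝ} (hu : AEStronglyMeasurable u μ) :
    AEStronglyMeasurable (incr u) (μ.prod ν) :=
  (hu.comp_quasiMeasurePreserving Measure.quasiMeasurePreserving_fst).sub
    (aestronglyMeasurable_sub_prod hu)

theorem lintegral_enorm_integral_sq_le {F : G × G → ℝ} (hF : AEStronglyMeasurable F (μ.prod ν)) :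
    ∫⁻ x, ‖∫ y, F (x, y) ∂ν‖ₑ ^ 2 ∂μ ≤ ∫⁻ p, ‖F p‖ₑ ^ 2 ∂(μ.prod ν) := by
  rw [lintegral_prod _ (hF.enorm.pow_const 2)]
  refine lintegral_mono_ae ?_
  filter_upwards [hF.prodMk_left] with x hx
  exact enorm_integral_sq_le hx

theorem memLp_sub_prod {u : G → ℝ} (hu : MemLp u 2 μ) :
    MemLp (fun p : G × G => u (p.1 - p.2)) 2 (μ.prod ν) :=
  hu.comp_measurePreserving measurePreserving_sub_prod

theorem memLp_fst {u : G → ℝ} (hu : MemLp u 2 μ) :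
    MemLp (fun p : G × G => u p.1) 2 (μ.prod ν) :=
  hu.comp_measurePreserving measurePreserving_fst

theorem aestronglyMeasurable_avg {u : G → ℝ} (hu : AEStronglyMeasurable u μ) :
    AEStronglyMeasurable (avg ν u) μ :=
  (aestronglyMeasurable_sub_prod (ν := ν) hu).integral_prod_right'

theorem eLpNorm_avg_le {u : G → ℝ} (hu : AEStronglyMeasurable u μ) :
    eLpNorm (avg ν u) 2 μ ≤ eLpNorm u 2 μ := by
  have h1 := lintegral_enorm_integral_sq_le
    (aestronglyMeasurable_sub_prod (ν := ν) hu)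
  have h2 : ∫⁻ p, ‖u (p.1 - p.2)‖ₑ ^ 2 ∂(μ.prod ν) = eLpNorm u 2 μ ^ 2 := by
    rw [← eLpNorm_two_sq _ (fun p : G × G => u (p.1 - p.2))]
    congr 1
    exact eLpNorm_comp_measurePreserving hu measurePreserving_sub_prod
  rw [h2] at h1
  have h3 : eLpNorm (avg ν u) 2 μ ^ 2 ≤ eLpNorm u 2 μ ^ 2 := by
    rw [eLpNorm_two_sq]; exact h1
  exact (ENNReal.pow_le_pow_left_iff two_ne_zero).1 h3

theorem memLp_avg {u : G → ℝ} (hu : MemLp u 2 μ) : MemLp (avg ν u) 2 μ :=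
  ⟨aestronglyMeasurable_avg hu.1, (eLpNorm_avg_le hu.1).trans_lt hu.2⟩

theorem integrable_mul_sub_prod {u w : G → ℝ} (hu : MemLp u 2 μ) (hw : MemLp w 2 μ) :
    Integrable (fun p : G × G => w p.1 * u (p.1 - p.2)) (μ.prod ν) :=
  (memLp_fst hw).integrable_mul (memLp_sub_prod hu)

theorem integral_mul_avg {u w : G → ℝ} (hu : MemLp u 2 μ) (hw : MemLp w 2 μ) :
    ∫ x, w x * avg ν u x ∂μ = ∫ p, w p.1 * u (p.1 - p.2) ∂(μ.prod ν) := by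
  rw [integral_prod _ (integrable_mul_sub_prod hu hw)]
  refine integral_congr_ae (ae_of_all _ fun x => ?_)
  simp only [avg, integral_const_mul]

theorem integral_shear_neg [ν.IsNegInvariant] (F : G × G → ℝ) :
    ∫ p, F (p.1 - p.2, -p.2) ∂(μ.prod ν) = ∫ p, F p ∂(μ.prod ν) := by
  let S : G × G ≃ᵐ G × G :=
    { toFun := fun p => (p.1 - p.2, -p.2)
      invFun := fun p => (p.1 - p.2, -p.2)
      left_inv := fun p => by simp
      right_inv := fun p => by simp
      measurable_toFun := by
        change Measurable (fun p : G × G => (p.1 - p.2, -p.2)); fun_prop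
      measurable_invFun := by
        change Measurable (fun p : G × G => (p.1 - p.2, -p.2)); fun_prop }
  exact (measurePreserving_shear_neg (μ := μ) (ν := ν)).integral_comp S.measurableEmbedding F

theorem integral_mul_avg_comm [ν.IsNegInvariant] {u w : G → ℝ} (hu : MemLp u 2 μ)
    (hw : MemLp w 2 μ) : ∫ x, w x * avg ν u x ∂μ = ∫ x, avg ν w x * u x ∂μ := by
  have e : ∫ x, avg ν w x * u x ∂μ = ∫ x, u x * avg ν w x ∂μ := by simp_rw [mul_comm]
  rw [e, integral_mul_avg hu hw, integral_mul_avg hw hu, ← integral_shear_neg]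
  refine integral_congr_ae (ae_of_all _ fun p => ?_)
  simp [mul_comm]

/-! ### The nonlocal interaction energy -/

theorem memLp_incr {u : G → ℝ} (hu : MemLp u 2 μ) : MemLp (incr u) 2 (μ.prod ν) :=
  (memLp_fst hu).sub (memLp_sub_prod hu)

theorem lintegral_incr_sq {u : G → ℝ} (hu : MemLp (incr u) 2 (μ.prod ν)) :
    ∫⁻ x, ∫⁻ y, ENNReal.ofReal ((u x - u (x - y)) ^ 2) ∂ν ∂μ
      = ENNReal.ofReal (∫ p, incr u p ^ 2 ∂(μ.prod ν)) := by
  rw [← lintegral_enorm_sq hu, lintegral_prod _ (hu.1.enorm.pow_const 2)]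
  simp_rw [enorm_sq_eq_ofReal, incr]

theorem memLp_incr_of_lintegral {u : G → ℝ} (hu : AEStronglyMeasurable u μ)
    (h : ∫⁻ x, ∫⁻ y, ENNReal.ofReal ((u x - u (x - y)) ^ 2) ∂ν ∂μ ≠ ⊤) :
    MemLp (incr u) 2 (μ.prod ν) := by
  have hm := aestronglyMeasurable_incr (ν := ν) hu
  rw [memLp_two_iff_lintegral hm, lintegral_prod _ (hm.enorm.pow_const 2)]
  simp_rw [enorm_sq_eq_ofReal, incr]
  exact lt_top_iff_ne_top.2 h

/-- A front has nonzero limits and is not in L²; only its increments are. Square integrability of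
the increments makes y ↦ m(x − y) integrable for almost every x, which is what separates the two
terms. -/
theorem integral_incr_prodMk {m : G → ℝ} (hm : AEStronglyMeasurable m μ)
    (hD : MemLp (incr m) 2 (μ.prod ν)) :
    ∀ᵐ x ∂μ, ∫ y, incr m (x, y) ∂ν = m x - avg ν m x := by
  have h := (memLp_two_iff_lintegral hD.1).1 hD
  rw [lintegral_prod _ (hD.1.enorm.pow_const 2)] at h
  filter_upwards [hD.1.prodMk_left, (aestronglyMeasurable_sub_prod (ν := ν) hm).prodMk_left,
    ae_lt_top' ((hD.1.enorm.pow_const 2).lintegral_prod_right') h.ne] with x h1 h2 h3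
  have hL : MemLp (fun y => incr m (x, y)) 2 ν := (memLp_two_iff_lintegral h1).2 h3
  have hi : Integrable (fun y => m (x - y)) ν := by
    have : (fun y => m (x - y)) = fun y => m x - incr m (x, y) := by
      funext y; simp [incr]
    rw [this]
    exact (integrable_const _).sub (hL.integrable (by norm_num))
  simp only [incr, avg]
  rw [integral_sub (integrable_const _) hi]
  simp

/-- Jensen's inequality bounds the averaged increment by the square integral of the increments, so
finite interaction energy is enough even when m itself is not square integrable. -/
theorem memLp_sub_avg {m : G → ℝ} (hm : AEStronglyMeasurable m μ)
    (hD : MemLp (incr m) 2 (μ.prod ν)) : MemLp (fun x => m x - avg ν m x) 2 μ := by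
  have hme : AEStronglyMeasurable (fun x => m x - avg ν m x) μ :=
    hm.sub (aestronglyMeasurable_avg hm)
  refine (memLp_two_iff_lintegral hme).2 ?_
  calc ∫⁻ x, ‖m x - avg ν m x‖ₑ ^ 2 ∂μ = ∫⁻ x, ‖∫ y, incr m (x, y) ∂ν‖ₑ ^ 2 ∂μ := by
        refine lintegral_congr_ae ?_
        filter_upwards [integral_incr_prodMk hm hD] with x hx
        rw [hx]
    _ ≤ _ := lintegral_enorm_integral_sq_le hD.1
    _ < ⊤ := (memLp_two_iff_lintegral hD.1).1 hD

/-- A discrete integration by parts: reversing the jump turns the term with w(x − y) into minus the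
term with w(x). Only w has to be in L². -/
theorem integral_incr_mul [ν.IsNegInvariant] {m w : G → ℝ} (hm : AEStronglyMeasurable m μ)
    (hD : MemLp (incr m) 2 (μ.prod ν)) (hw : MemLp w 2 μ) :
    ∫ p, incr m p * incr w p ∂(μ.prod ν) = 2 * ∫ x, w x * (m x - avg ν m x) ∂μ := by
  have h1 : Integrable (fun p : G × G => w p.1 * incr m p) (μ.prod ν) :=
    (memLp_fst hw).integrable_mul hD
  have h2 : Integrable (fun p : G × G => w (p.1 - p.2) * incr m p) (μ.prod ν) :=
    (memLp_sub_prod hw).integrable_mul hD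
  have e1 : ∫ p, w p.1 * incr m p ∂(μ.prod ν) = ∫ x, w x * (m x - avg ν m x) ∂μ := by
    rw [integral_prod _ h1]
    refine integral_congr_ae ?_
    filter_upwards [integral_incr_prodMk hm hD] with x hx
    simp only [integral_const_mul, hx]
  have e2 : ∫ p, w (p.1 - p.2) * incr m p ∂(μ.prod ν)
      = - ∫ p, w p.1 * incr m p ∂(μ.prod ν) := by
    rw [← integral_shear_neg, ← integral_neg]
    refine integral_congr_ae (ae_of_all _ fun p => ?_)
    simp only [incr, sub_neg_eq_add, sub_add_cancel]
    ring
  calc ∫ p, incr m p * incr w p ∂(μ.prod ν)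
      = ∫ p, (w p.1 * incr m p - w (p.1 - p.2) * incr m p) ∂(μ.prod ν) := by
        refine integral_congr_ae (ae_of_all _ fun p => ?_)
        simp only [incr]; ring
    _ = _ := by rw [integral_sub h1 h2, e2, e1]; ring

theorem incr_add (u w : G → ℝ) : incr (u + w) = incr u + incr w := by
  funext p; simp [incr]; ring

theorem integral_incr_sq {w : G → ℝ} [ν.IsNegInvariant] (hw : MemLp w 2 μ) :
    ∫ p, incr w p ^ 2 ∂(μ.prod ν) = 2 * ∫ x, w x ^ 2 ∂μ - 2 * ∫ x, w x * avg ν w x ∂μ := by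
  have h := integral_incr_mul hw.1 (memLp_incr (ν := ν) hw) hw
  have h3 : Integrable (fun x => w x * avg ν w x) μ := hw.integrable_mul (memLp_avg hw)
  calc ∫ p, incr w p ^ 2 ∂(μ.prod ν) = ∫ p, incr w p * incr w p ∂(μ.prod ν) := by simp_rw [sq]
    _ = 2 * ∫ x, (w x ^ 2 - w x * avg ν w x) ∂μ := by
        rw [h]; congr 2; funext x; ring
    _ = _ := by rw [integral_sub hw.integrable_sq h3]; ring

theorem integral_sq_avg_le {w : G → ℝ} (hw : MemLp w 2 μ) :
    ∫ x, avg ν w x ^ 2 ∂μ ≤ ∫ x, w x ^ 2 ∂μ := by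
  have h := eLpNorm_avg_le (ν := ν) hw.1
  have h2 : eLpNorm (avg ν w) 2 μ ^ 2 ≤ eLpNorm w 2 μ ^ 2 := by gcongr
  rw [eLpNorm_two_sq, eLpNorm_two_sq, lintegral_enorm_sq hw,
    lintegral_enorm_sq (memLp_avg hw)] at h2
  exact (ENNReal.ofReal_le_ofReal_iff (integral_nonneg fun x => sq_nonneg _)).1 h2

theorem integral_incr_sq_le {w : G → ℝ} [ν.IsNegInvariant] (hw : MemLp w 2 μ) :
    ∫ p, incr w p ^ 2 ∂(μ.prod ν) ≤ 4 * ∫ x, w x ^ 2 ∂μ := by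
  have h3 : Integrable (fun x => w x * avg ν w x) μ := hw.integrable_mul (memLp_avg hw)
  have h4 : ∫ x, -(w x ^ 2 / 2 + avg ν w x ^ 2 / 2) ∂μ ≤ ∫ x, w x * avg ν w x ∂μ :=
    integral_mono ((hw.integrable_sq.div_const 2).add
      ((memLp_avg hw).integrable_sq.div_const 2)).neg h3
      fun x => by dsimp only; nlinarith [sq_nonneg (w x + avg ν w x)]
  rw [integral_neg, integral_add (hw.integrable_sq.div_const 2)
    ((memLp_avg hw).integrable_sq.div_const 2), integral_div, integral_div] at h4
  rw [integral_incr_sq hw]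
  linarith [integral_sq_avg_le (ν := ν) hw]

/-- The free energy for a general translation invariant interaction. -/
noncomputable def energy (μ ν : Measure G) (β mβ : ℝ) (m : G → ℝ) : ℝ≥0∞ :=
  (∫⁻ x, ENNReal.ofReal (potential β (m x) - potential β mβ) ∂μ) +
    1 / 4 * ∫⁻ x, ∫⁻ y, ENNReal.ofReal ((m x - m (x - y)) ^ 2) ∂ν ∂μ

theorem energy_congr_ae {β mβ : ℝ} {m m' : G → ℝ} (h : m =ᵐ[μ] m') :
    energy μ ν β mβ m = energy μ ν β mβ m' := by
  unfold energy
  congr 1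
  · refine lintegral_congr_ae ?_
    filter_upwards [h] with x hx
    rw [hx]
  · congr 1
    refine lintegral_congr_ae ?_
    have h2 : ∀ᵐ p : G × G ∂(μ.prod ν), m (p.1 - p.2) = m' (p.1 - p.2) :=
      quasiMeasurePreserving_sub_prod.ae h
    filter_upwards [h, Measure.ae_ae_of_ae_prod h2] with x hx hx2
    refine lintegral_congr_ae ?_
    filter_upwards [hx2] with y hy
    rw [hx, hy]

theorem energy_comp_sub {β mβ : ℝ} (m : G → ℝ) (a : G) :
    energy μ ν β mβ (fun x => m (x - a)) = energy μ ν β mβ m := by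
  unfold energy
  congr 1
  · have h := lintegral_add_right_eq_self (μ := μ)
      (fun x => ENNReal.ofReal (potential β (m x) - potential β mβ)) (-a)
    simpa [sub_eq_add_neg] using h
  · congr 1
    have h := lintegral_add_right_eq_self (μ := μ)
      (fun x => ∫⁻ y, ENNReal.ofReal ((m x - m (x - y)) ^ 2) ∂ν) (-a)
    rw [← h]
    refine lintegral_congr fun x => lintegral_congr fun y => ?_
    rw [← sub_eq_add_neg, sub_right_comm]

/-- Expansion of the free energy: the difference is the potential part, the first variation of
the interaction, and a quadratic form. -/
theorem energy_expansion [ν.IsNegInvariant] {β mβ : ℝ} {m w : G → ℝ}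
    (hm : AEStronglyMeasurable m μ) (hw : MemLp w 2 μ)
    (hmin : ∀ s ∈ Icc (-1 : ℝ) 1, potential β mβ ≤ potential β s)
    (hmI : ∀ᵐ x ∂μ, m x ∈ Icc (-1 : ℝ) 1) (hwI : ∀ᵐ x ∂μ, m x + w x ∈ Icc (-1 : ℝ) 1)
    (hE : energy μ ν β mβ m ≠ ⊤)
    (hf : Integrable (fun x => potential β (m x + w x) - potential β (m x)) μ) :
    energy μ ν β mβ (m + w) ≠ ⊤ ∧
      (energy μ ν β mβ (m + w)).toReal = (energy μ ν β mβ m).toReal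
        + ∫ x, (potential β (m x + w x) - potential β (m x)) ∂μ
        + ∫ x, w x * (m x - avg ν m x) ∂μ
        + 1 / 4 * ∫ p, incr w p ^ 2 ∂(μ.prod ν) := by
  have hE1 : (∫⁻ x, ENNReal.ofReal (potential β (m x) - potential β mβ) ∂μ) ≠ ⊤ :=
    fun h => hE (by simp [energy, h])
  have hE2 : ∫⁻ x, ∫⁻ y, ENNReal.ofReal ((m x - m (x - y)) ^ 2) ∂ν ∂μ ≠ ⊤ := by
    intro h
    refine hE ?_
    rw [energy, h, ENNReal.mul_top (by simp)]
    simp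
  have hD := memLp_incr_of_lintegral hm hE2
  have hDw := memLp_incr (ν := ν) hw
  have hpm : AEStronglyMeasurable (fun x => potential β (m x) - potential β mβ) μ :=
    ((continuous_potential β).comp_aestronglyMeasurable hm).sub aestronglyMeasurable_const
  have hpn : 0 ≤ᵐ[μ] fun x => potential β (m x) - potential β mβ := by
    filter_upwards [hmI] with x hx
    exact sub_nonneg.2 (hmin _ hx)
  have hpn' : 0 ≤ᵐ[μ] fun x => potential β (m x + w x) - potential β mβ := by
    filter_upwards [hwI] with x hx
    exact sub_nonneg.2 (hmin _ hx)
  have hpi : Integrable (fun x => potential β (m x) - potential β mβ) μ := by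
    refine ⟨hpm, ?_⟩
    rw [hasFiniteIntegral_iff_ofReal hpn]
    exact lt_top_iff_ne_top.2 hE1
  have hpi' : Integrable (fun x => potential β (m x + w x) - potential β mβ) μ := by
    refine (hpi.add hf).congr (ae_of_all _ fun x => ?_)
    simp
  have hDs : MemLp (incr (m + w)) 2 (μ.prod ν) := by rw [incr_add]; exact hD.add hDw
  have A : energy μ ν β mβ m = ENNReal.ofReal (∫ x, (potential β (m x) - potential β mβ) ∂μ)
      + 1 / 4 * ENNReal.ofReal (∫ p, incr m p ^ 2 ∂(μ.prod ν)) := by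
    rw [energy, lintegral_incr_sq hD, ofReal_integral_eq_lintegral_ofReal hpi hpn]
  have B : energy μ ν β mβ (m + w)
      = ENNReal.ofReal (∫ x, (potential β (m x + w x) - potential β mβ) ∂μ)
      + 1 / 4 * ENNReal.ofReal (∫ p, incr (m + w) p ^ 2 ∂(μ.prod ν)) := by
    rw [energy, lintegral_incr_sq hDs, ofReal_integral_eq_lintegral_ofReal hpi' hpn']
    rfl
  have tr : ∀ a b : ℝ, 0 ≤ a → 0 ≤ b →
      (ENNReal.ofReal a + 1 / 4 * ENNReal.ofReal b).toReal = a + 1 / 4 * b := by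
    intro a b ha hb
    rw [ENNReal.toReal_add ENNReal.ofReal_ne_top
      (ENNReal.mul_ne_top (by simp) ENNReal.ofReal_ne_top), ENNReal.toReal_mul,
      ENNReal.toReal_ofReal ha, ENNReal.toReal_ofReal hb]
    simp
  refine ⟨?_, ?_⟩
  · rw [B]
    exact ENNReal.add_ne_top.2 ⟨ENNReal.ofReal_ne_top,
      ENNReal.mul_ne_top (by simp) ENNReal.ofReal_ne_top⟩
  · rw [A, B, tr _ _ (integral_nonneg_of_ae hpn) (integral_nonneg fun _ => sq_nonneg _),
      tr _ _ (integral_nonneg_of_ae hpn') (integral_nonneg fun _ => sq_nonneg _)]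
    have e1 : ∫ x, (potential β (m x + w x) - potential β mβ) ∂μ
        = ∫ x, (potential β (m x) - potential β mβ) ∂μ
          + ∫ x, (potential β (m x + w x) - potential β (m x)) ∂μ := by
      rw [← integral_add hpi hf]
      congr 1; funext x; ring
    have e2 : ∫ p, incr (m + w) p ^ 2 ∂(μ.prod ν) = ∫ p, incr m p ^ 2 ∂(μ.prod ν)
        + 2 * ∫ p, incr m p * incr w p ∂(μ.prod ν) + ∫ p, incr w p ^ 2 ∂(μ.prod ν) := by
      have i1 : Integrable (fun p => incr m p * incr w p) (μ.prod ν) := hD.integrable_mul hDw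
      have i2 : Integrable (fun p => incr m p ^ 2 + 2 * (incr m p * incr w p)) (μ.prod ν) :=
        hD.integrable_sq.add (i1.const_mul 2)
      rw [← integral_const_mul, ← integral_add hD.integrable_sq (i1.const_mul 2),
        ← integral_add i2 hDw.integrable_sq]
      congr 1; funext p; rw [incr_add]; simp only [Pi.add_apply]; ring
    rw [e1, e2, integral_incr_mul hm hD hw]
    ring

/-- Submodularity of the free energy. -/
theorem energy_sup_add_inf_le {β mβ : ℝ} {m w : G → ℝ} (hm : AEStronglyMeasurable m μ)
    (hw : AEStronglyMeasurable w μ) :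
    energy μ ν β mβ (fun x => max (m x) (w x)) + energy μ ν β mβ (fun x => min (m x) (w x))
      ≤ energy μ ν β mβ m + energy μ ν β mβ w := by
  have hp : ∀ u : G → ℝ, AEStronglyMeasurable u μ →
      AEMeasurable (fun x => ENNReal.ofReal (potential β (u x) - potential β mβ)) μ :=
    fun u hu => (((continuous_potential β).comp_aestronglyMeasurable hu).sub
      aestronglyMeasurable_const).aemeasurable.ennreal_ofReal
  have hq : ∀ u : G → ℝ, AEStronglyMeasurable u μ →
      AEMeasurable (fun p : G × G => ENNReal.ofReal ((u p.1 - u (p.1 - p.2)) ^ 2)) (μ.prod ν) :=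
    fun u hu => ((aestronglyMeasurable_incr (ν := ν) hu).pow 2).aemeasurable.ennreal_ofReal
  have hM : AEStronglyMeasurable (fun x => max (m x) (w x)) μ := hm.sup hw
  have hN : AEStronglyMeasurable (fun x => min (m x) (w x)) μ := hm.inf hw
  have hl : ∀ u : G → ℝ, AEStronglyMeasurable u μ → energy μ ν β mβ u
      = (∫⁻ x, ENNReal.ofReal (potential β (u x) - potential β mβ) ∂μ)
        + 1 / 4 * ∫⁻ p, ENNReal.ofReal ((u p.1 - u (p.1 - p.2)) ^ 2) ∂(μ.prod ν) := by
    intro u hu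
    rw [energy, lintegral_prod _ (hq u hu)]
  rw [hl _ hM, hl _ hN, hl _ hm, hl _ hw]
  have k1 : (∫⁻ x, ENNReal.ofReal (potential β (max (m x) (w x)) - potential β mβ) ∂μ)
      + (∫⁻ x, ENNReal.ofReal (potential β (min (m x) (w x)) - potential β mβ) ∂μ)
      = (∫⁻ x, ENNReal.ofReal (potential β (m x) - potential β mβ) ∂μ)
      + (∫⁻ x, ENNReal.ofReal (potential β (w x) - potential β mβ) ∂μ) := by
    rw [← lintegral_add_left' (hp _ hM), ← lintegral_add_left' (hp _ hm)]
    refine lintegral_congr fun x => ?_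
    rcases le_total (m x) (w x) with h | h
    · simp [h, add_comm]
    · simp [h]
  have k2 : (∫⁻ p, ENNReal.ofReal ((max (m p.1) (w p.1) - max (m (p.1 - p.2)) (w (p.1 - p.2))) ^ 2)
        ∂(μ.prod ν))
      + (∫⁻ p, ENNReal.ofReal ((min (m p.1) (w p.1) - min (m (p.1 - p.2)) (w (p.1 - p.2))) ^ 2)
        ∂(μ.prod ν))
      ≤ (∫⁻ p, ENNReal.ofReal ((m p.1 - m (p.1 - p.2)) ^ 2) ∂(μ.prod ν))
      + (∫⁻ p, ENNReal.ofReal ((w p.1 - w (p.1 - p.2)) ^ 2) ∂(μ.prod ν)) := by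
    rw [← lintegral_add_left' (hq _ hM), ← lintegral_add_left' (hq _ hm)]
    refine lintegral_mono fun p => ?_
    rw [← ENNReal.ofReal_add (sq_nonneg _) (sq_nonneg _),
      ← ENNReal.ofReal_add (sq_nonneg _) (sq_nonneg _)]
    refine ENNReal.ofReal_le_ofReal ?_
    generalize m p.1 = a
    generalize w p.1 = b
    generalize m (p.1 - p.2) = c
    generalize w (p.1 - p.2) = e
    -- If the two pairs are ordered alike, both sides agree. If not, the right side exceeds the left
    -- by twice the product of the two gaps.
    rcases le_total a b with h | h <;> rcases le_total c e with h' | h' <;>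
      simp only [max_eq_left, max_eq_right, min_eq_left, min_eq_right, h, h'] <;>
      nlinarith [mul_nonneg (sub_nonneg.2 h) (sub_nonneg.2 h')]
  calc _ = ((∫⁻ x, ENNReal.ofReal (potential β (max (m x) (w x)) - potential β mβ) ∂μ)
      + (∫⁻ x, ENNReal.ofReal (potential β (min (m x) (w x)) - potential β mβ) ∂μ))
      + 1 / 4 * ((∫⁻ p, ENNReal.ofReal
          ((max (m p.1) (w p.1) - max (m (p.1 - p.2)) (w (p.1 - p.2))) ^ 2) ∂(μ.prod ν))
        + (∫⁻ p, ENNReal.ofReal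
          ((min (m p.1) (w p.1) - min (m (p.1 - p.2)) (w (p.1 - p.2))) ^ 2) ∂(μ.prod ν))) := by
        ring
    _ ≤ _ := by
        rw [k1]
        refine (add_le_add_right (mul_le_mul_right k2 _) _).trans_eq ?_
        ring

end Averages

end NonlocalFront

namespace NonlocalFront

/-! ### One-dimensional kernels -/

/-- An even continuously differentiable probability density on the line, supported in
`[-R, R]`. -/
structure IsLineKernel (K : ℝ → ℝ) (R : ℝ) : Prop where
  contDiff : ContDiff ℝ 1 K
  nonneg : ∀ x, 0 ≤ K x
  even : ∀ x, K (-x) = K x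
  integral_eq_one : ∫ x, K x = 1
  pos : 0 < R
  eq_zero : ∀ x, R < |x| → K x = 0

/-- The measure with density `K`. -/
noncomputable def lineMeasure (K : ℝ → ℝ) : Measure ℝ :=
  volume.withDensity fun z => ENNReal.ofReal (K z)

section Line

variable {K : ℝ → ℝ} {R : ℝ}

theorem IsLineKernel.continuous (hK : IsLineKernel K R) : Continuous K := hK.contDiff.continuous

theorem IsLineKernel.hasCompactSupport (hK : IsLineKernel K R) : HasCompactSupport K :=
  HasCompactSupport.of_support_subset_isCompact (isCompact_Icc (a := -R) (b := R)) fun x hx => by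
    by_contra h
    refine hx (hK.eq_zero x ?_)
    rw [mem_Icc, ← abs_le, not_le] at h
    exact h

theorem IsLineKernel.integrable (hK : IsLineKernel K R) : Integrable K :=
  hK.continuous.integrable_of_hasCompactSupport hK.hasCompactSupport

theorem IsLineKernel.isProbabilityMeasure (hK : IsLineKernel K R) :
    IsProbabilityMeasure (lineMeasure K) := ⟨by
  rw [lineMeasure, withDensity_apply _ MeasurableSet.univ, Measure.restrict_univ,
    ← ofReal_integral_eq_lintegral_ofReal hK.integrable (ae_of_all _ hK.nonneg),
    hK.integral_eq_one, ENNReal.ofReal_one]⟩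

theorem IsLineKernel.measurable_ofReal (hK : IsLineKernel K R) :
    Measurable fun z => ENNReal.ofReal (K z) := hK.continuous.measurable.ennreal_ofReal

theorem IsLineKernel.isNegInvariant (hK : IsLineKernel K R) :
    (lineMeasure K).IsNegInvariant := ⟨by
  ext s hs
  rw [Measure.neg_apply, lineMeasure, withDensity_apply _ hs.neg, withDensity_apply _ hs,
    ← lintegral_indicator hs.neg, ← lintegral_indicator hs,
    ← lintegral_neg_eq_self (μ := (volume : Measure ℝ))]
  refine lintegral_congr fun x => ?_
  have hx : -x ∈ -s ↔ x ∈ s := by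
    change - -x ∈ s ↔ x ∈ s
    rw [neg_neg]
  by_cases h : x ∈ s
  · rw [indicator_of_mem (hx.2 h), indicator_of_mem h, hK.even]
  · rw [indicator_of_notMem (fun h' => h (hx.1 h')), indicator_of_notMem h]⟩

theorem IsLineKernel.lintegral_lineMeasure (hK : IsLineKernel K R) {g : ℝ → ℝ≥0∞}
    (hg : Measurable g) : ∫⁻ z, g z ∂lineMeasure K = ∫⁻ z, ENNReal.ofReal (K z) * g z := by
  rw [lineMeasure, lintegral_withDensity_eq_lintegral_mul _ hK.measurable_ofReal hg]
  rfl

theorem IsLineKernel.integral_lineMeasure (hK : IsLineKernel K R) (g : ℝ → ℝ) :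
    ∫ z, g z ∂lineMeasure K = ∫ z, K z * g z := by
  rw [lineMeasure, integral_withDensity_eq_integral_toReal_smul hK.measurable_ofReal
    (ae_of_all _ fun _ => ENNReal.ofReal_lt_top)]
  simp [ENNReal.toReal_ofReal (hK.nonneg _)]

theorem IsLineKernel.ae_abs_le (hK : IsLineKernel K R) : ∀ᵐ z ∂lineMeasure K, |z| ≤ R := by
  rw [lineMeasure, ae_withDensity_iff hK.measurable_ofReal]
  refine ae_of_all _ fun z hz => ?_
  by_contra h
  rw [hK.eq_zero z (not_le.1 h)] at hz
  simp at hz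

theorem IsLineKernel.absolutelyContinuous : lineMeasure K ≪ volume :=
  withDensity_absolutelyContinuous _ _

theorem IsLineKernel.avg_eq (hK : IsLineKernel K R) (u : ℝ → ℝ) (x : ℝ) :
    avg (lineMeasure K) u x = ∫ z, K z * u (x - z) := hK.integral_lineMeasure _

/-- The kernel measure has a density, so averages depend only on the almost everywhere class, and at
every point. This allows exchanging the front for its continuous representative. -/
theorem IsLineKernel.avg_congr_ae {u v : ℝ → ℝ} (h : u =ᵐ[volume] v) :
    avg (lineMeasure K) u = avg (lineMeasure K) v := by
  funext x
  refine integral_congr_ae (IsLineKernel.absolutelyContinuous.ae_le ?_)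
  exact (quasiMeasurePreserving_sub_left volume x).ae h

theorem integrable_of_bounded {α : Type*} [MeasurableSpace α] {ν : Measure α} [IsFiniteMeasure ν]
    {u : α → ℝ} (hu : AEStronglyMeasurable u ν) {C : ℝ} (hC : ∀ x, |u x| ≤ C) : Integrable u ν :=
  Integrable.of_bound hu C (ae_of_all _ hC)

theorem IsLineKernel.integrable_shift (hK : IsLineKernel K R) {u : ℝ → ℝ} (hu : Measurable u)
    {C : ℝ} (hC : ∀ x, |u x| ≤ C) (x : ℝ) : Integrable (fun y => u (x - y)) (lineMeasure K) :=
  have := hK.isProbabilityMeasure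
  integrable_of_bounded (hu.comp (by fun_prop)).aestronglyMeasurable fun _ => hC _

theorem IsLineKernel.avg_mono (hK : IsLineKernel K R) {u v : ℝ → ℝ} (hu : Measurable u)
    {C : ℝ} (hC : ∀ x, |u x| ≤ C) (hv : Measurable v) {C' : ℝ} (hC' : ∀ x, |v x| ≤ C') {x x' : ℝ}
    (h : ∀ y, |y| ≤ R → u (x - y) ≤ v (x' - y)) :
    avg (lineMeasure K) u x ≤ avg (lineMeasure K) v x' := by
  refine integral_mono_ae (hK.integrable_shift hu hC x) (hK.integrable_shift hv hC' x') ?_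
  filter_upwards [hK.ae_abs_le] with y hy
  exact h y hy

theorem IsLineKernel.avg_const (hK : IsLineKernel K R) (c x : ℝ) :
    avg (lineMeasure K) (fun _ => c) x = c := by
  have := hK.isProbabilityMeasure
  simp [avg]

theorem IsLineKernel.abs_avg_le (hK : IsLineKernel K R) {u : ℝ → ℝ}
    {C : ℝ} (hC : ∀ x, |u x| ≤ C) (x : ℝ) : |avg (lineMeasure K) u x| ≤ C := by
  have := hK.isProbabilityMeasure
  have := norm_integral_le_of_norm_le_const (μ := lineMeasure K)
    (ae_of_all _ fun y => (Real.norm_eq_abs (u (x - y))).le.trans (hC (x - y)))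
  simpa [avg] using this

theorem locallyIntegrable_of_bounded {u : ℝ → ℝ} (hu : Measurable u) {C : ℝ}
    (hC : ∀ x, |u x| ≤ C) : LocallyIntegrable u :=
  (locallyIntegrable_const C).mono hu.aestronglyMeasurable (ae_of_all _ fun x => by
    rw [Real.norm_eq_abs, Real.norm_eq_abs]; exact (hC x).trans (le_abs_self C))

theorem IsLineKernel.avg_eq_convolution (hK : IsLineKernel K R) (u : ℝ → ℝ) :
    avg (lineMeasure K) u = convolution K u (ContinuousLinearMap.mul ℝ ℝ) volume := by
  funext x
  rw [hK.avg_eq]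
  rfl

theorem IsLineKernel.continuous_avg (hK : IsLineKernel K R) {u : ℝ → ℝ} (hu : Measurable u)
    {C : ℝ} (hC : ∀ x, |u x| ≤ C) : Continuous (avg (lineMeasure K) u) := by
  rw [hK.avg_eq_convolution]
  exact hK.hasCompactSupport.continuous_convolution_left _ hK.continuous
    (locallyIntegrable_of_bounded hu hC)

theorem IsLineKernel.hasDerivAt_avg_left (hK : IsLineKernel K R) {u : ℝ → ℝ} (hu : Measurable u)
    {C : ℝ} (hC : ∀ x, |u x| ≤ C) (x : ℝ) :
    HasDerivAt (avg (lineMeasure K) u) (∫ z, deriv K z * u (x - z)) x := by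
  rw [hK.avg_eq_convolution]
  exact hK.hasCompactSupport.hasDerivAt_convolution_left _ hK.contDiff
    (locallyIntegrable_of_bounded hu hC) x

theorem IsLineKernel.continuous_avg_deriv (hK : IsLineKernel K R) {u : ℝ → ℝ} (hu : Measurable u)
    {C : ℝ} (hC : ∀ x, |u x| ≤ C) : Continuous fun x => ∫ z, deriv K z * u (x - z) :=
  hK.hasCompactSupport.deriv.continuous_convolution_left (ContinuousLinearMap.mul ℝ ℝ)
    (hK.contDiff.continuous_deriv_one) (locallyIntegrable_of_bounded hu hC)

/-- The kernel and its derivative are bounded. -/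
theorem IsLineKernel.exists_bound (hK : IsLineKernel K R) :
    ∃ C, 0 < C ∧ (∀ z, |K z| ≤ C) ∧ ∀ z, |deriv K z| ≤ C := by
  obtain ⟨C, hC⟩ := hK.hasCompactSupport.exists_bound_of_continuous hK.continuous
  obtain ⟨C', hC'⟩ := hK.hasCompactSupport.deriv.exists_bound_of_continuous
    hK.contDiff.continuous_deriv_one
  refine ⟨max (max C C') 1, by positivity, fun z => (hC z).trans ?_, fun z => (hC' z).trans ?_⟩
  · exact (le_max_left _ _).trans (le_max_left _ _)
  · exact (le_max_right _ _).trans (le_max_left _ _)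

theorem IsLineKernel.deriv_eq_zero (hK : IsLineKernel K R) {x : ℝ} (hx : R < |x|) :
    deriv K x = 0 := by
  have : K =ᶠ[𝓝 x] fun _ => 0 := by
    filter_upwards [(isOpen_lt continuous_const continuous_abs).mem_nhds hx] with y hy
    exact hK.eq_zero y hy
  rw [this.deriv_eq]; simp

/-- The same average can also be differentiated through the kernel
(`IsLineKernel.hasDerivAt_avg_left`). Comparing the two derivatives yields the equation satisfied by
the derivative of the front. -/
theorem IsLineKernel.hasDerivAt_avg_right (hK : IsLineKernel K R) {u u' : ℝ → ℝ} {C C' : ℝ}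
    (hC : ∀ x, |u x| ≤ C) (hu : ∀ x, HasDerivAt u (u' x) x) (hu' : Measurable u')
    (hC' : ∀ x, |u' x| ≤ C') (x : ℝ) :
    HasDerivAt (avg (lineMeasure K) u) (avg (lineMeasure K) u' x) x := by
  have := hK.isProbabilityMeasure
  have hm : Measurable u := (continuous_iff_continuousAt.2 fun x => (hu x).continuousAt).measurable
  refine (hasDerivAt_integral_of_dominated_loc_of_deriv_le (s := univ) (bound := fun _ => C')
    (F := fun x y => u (x - y)) (F' := fun x y => u' (x - y)) univ_mem
    (Eventually.of_forall fun x => (hK.integrable_shift hm hC x).1) (hK.integrable_shift hm hC x)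
    (hK.integrable_shift hu' hC' x).1 (ae_of_all _ fun y z _ => hC' _) (integrable_const _)
    (ae_of_all _ fun y z _ => ?_)).2
  exact (hu (z - y)).comp_sub_const z y

theorem IsLineKernel.freeEnergy1_eq (hK : IsLineKernel K R) (β mβ : ℝ) {m : ℝ → ℝ}
    (hm : Measurable m) : freeEnergy1 β mβ K m = energy volume (lineMeasure K) β mβ m := by
  unfold freeEnergy1 energy
  congr 2
  refine lintegral_congr fun x => ?_
  rw [hK.lintegral_lineMeasure (by fun_prop),
    ← lintegral_sub_left_eq_self (μ := (volume : Measure ℝ)) _ x]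
  refine lintegral_congr fun y => ?_
  rw [ENNReal.ofReal_mul (hK.nonneg _), sub_sub_cancel]

end Line

/-! ### Competitors -/

theorem tendsto_sign_mul_atTop {m : ℝ → ℝ} {l : ℝ} :
    Tendsto (fun x => Real.sign x * m x) atTop (𝓝 l) ↔ Tendsto m atTop (𝓝 l) := by
  refine tendsto_congr' ?_
  filter_upwards [eventually_gt_atTop 0] with x hx
  rw [Real.sign_of_pos hx, one_mul]

theorem tendsto_sign_mul_atBot {m : ℝ → ℝ} {l : ℝ} :
    Tendsto (fun x => Real.sign x * m x) atBot (𝓝 l) ↔ Tendsto m atBot (𝓝 (-l)) := by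
  have : (fun x => Real.sign x * m x) =ᶠ[atBot] fun x => -m x := by
    filter_upwards [eventually_lt_atBot 0] with x hx
    rw [Real.sign_of_neg hx, neg_one_mul]
  rw [tendsto_congr' this]
  exact ⟨fun h => by simpa using h.neg, fun h => by simpa using h.neg⟩

theorem isFrontCompetitor_iff {m : ℝ → ℝ} : IsFrontCompetitor m ↔
    Measurable m ∧ (∀ x, m x ∈ Icc (-1 : ℝ) 1) ∧ (∀ x, 0 < x → 0 ≤ m x) ∧ (∀ x, x < 0 → m x ≤ 0) ∧
      (∃ l, 0 < l ∧ Tendsto m atTop (𝓝 l)) ∧ ∃ l, 0 < l ∧ Tendsto m atBot (𝓝 (-l)) := by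
  constructor
  · intro h
    refine ⟨h.measurable, h.mem_Icc, fun x hx => ?_, fun x hx => ?_, ?_, ?_⟩
    · have := h.sign_mul_nonneg x
      rwa [Real.sign_of_pos hx, one_mul] at this
    · have := h.sign_mul_nonneg x
      rw [Real.sign_of_neg hx] at this
      linarith
    · simpa only [tendsto_sign_mul_atTop] using h.limit_top
    · simpa only [tendsto_sign_mul_atBot] using h.limit_bot
  · rintro ⟨h1, h2, h3, h4, h5, h6⟩
    refine ⟨h1, h2, fun x => ?_, ?_, ?_⟩
    · rcases lt_trichotomy x 0 with h | rfl | h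
      · rw [Real.sign_of_neg h]; linarith [h4 x h]
      · simp
      · rw [Real.sign_of_pos h]; linarith [h3 x h]
    · simpa only [tendsto_sign_mul_atTop] using h5
    · simpa only [tendsto_sign_mul_atBot] using h6

theorem IsFrontCompetitor.abs_le_one {m : ℝ → ℝ} (h : IsFrontCompetitor m) (x : ℝ) : |m x| ≤ 1 :=
  abs_le.2 (h.mem_Icc x)

/-- The step profile joining `-l'` to `l`. -/
noncomputable def stepProfile (l l' : ℝ) (x : ℝ) : ℝ := if 0 ≤ x then l else -l'

theorem measurable_stepProfile (l l' : ℝ) : Measurable (stepProfile l l') :=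
  Measurable.ite measurableSet_Ici measurable_const measurable_const

theorem isFrontCompetitor_stepProfile {l : ℝ} (hl : 0 < l) (hl1 : l ≤ 1) :
    IsFrontCompetitor (stepProfile l l) := by
  refine isFrontCompetitor_iff.2 ⟨measurable_stepProfile l l, fun x => ?_, fun x hx => ?_,
    fun x hx => ?_, ⟨l, hl, ?_⟩, ⟨l, hl, ?_⟩⟩
  · unfold stepProfile; split_ifs <;> constructor <;> linarith
  · rw [stepProfile, if_pos hx.le]; exact hl.le
  · rw [stepProfile, if_neg (not_le.2 hx)]; linarith
  · refine tendsto_const_nhds.congr' ?_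
    filter_upwards [eventually_ge_atTop 0] with x hx
    rw [stepProfile, if_pos hx]
  · refine tendsto_const_nhds.congr' ?_
    filter_upwards [eventually_lt_atBot 0] with x hx
    rw [stepProfile, if_neg (not_le.2 hx)]

theorem IsFrontCompetitor.neg_comp_neg {m : ℝ → ℝ} (h : IsFrontCompetitor m) :
    IsFrontCompetitor fun x => -m (-x) := by
  obtain ⟨h1, h2, h3, h4, ⟨l, hl, h5⟩, ⟨l', hl', h6⟩⟩ := isFrontCompetitor_iff.1 h
  refine isFrontCompetitor_iff.2 ⟨(h1.comp measurable_neg).neg, fun x => ?_, fun x hx => ?_,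
    fun x hx => ?_, ⟨l', hl', ?_⟩, ⟨l, hl, ?_⟩⟩
  · exact ⟨by linarith [(h2 (-x)).2], by linarith [(h2 (-x)).1]⟩
  · linarith [h4 (-x) (by linarith)]
  · linarith [h3 (-x) (by linarith)]
  · simpa using (h6.comp tendsto_neg_atTop_atBot).neg
  · exact (h5.comp tendsto_neg_atBot_atTop).neg

/-- The translate alone may be positive on (−c, 0); taking the minimum with m restores the sign
condition there. -/
theorem IsFrontCompetitor.min_shift {m : ℝ → ℝ} (h : IsFrontCompetitor m) {c : ℝ} (hc : 0 ≤ c) :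
    IsFrontCompetitor fun x => min (m (x + c)) (m x) := by
  obtain ⟨h1, h2, h3, h4, ⟨l, hl, h5⟩, ⟨l', hl', h6⟩⟩ := isFrontCompetitor_iff.1 h
  refine isFrontCompetitor_iff.2 ⟨(h1.comp (measurable_add_const c)).min h1, fun x => ?_,
    fun x hx => ?_, fun x hx => ?_, ⟨l, hl, ?_⟩, ⟨l', hl', ?_⟩⟩
  · exact ⟨le_min (h2 _).1 (h2 _).1, (min_le_right _ _).trans (h2 _).2⟩
  · exact le_min (h3 _ (by linarith)) (h3 _ hx)
  · exact (min_le_right _ _).trans (h4 x hx)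
  · simpa using (h5.comp (tendsto_atTop_add_const_right atTop c tendsto_id)).min h5
  · simpa using (h6.comp (tendsto_atBot_add_const_right atBot c tendsto_id)).min h6

/-- The translation goes to the right here: the values that the translate may have with the wrong
sign, on (0, c), are cut off by the maximum with m. -/
theorem IsFrontCompetitor.max_shift {m : ℝ → ℝ} (h : IsFrontCompetitor m) {c : ℝ} (hc : 0 ≤ c) :
    IsFrontCompetitor fun x => max (m x) (m (x - c)) := by
  obtain ⟨h1, h2, h3, h4, ⟨l, hl, h5⟩, ⟨l', hl', h6⟩⟩ := isFrontCompetitor_iff.1 h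
  refine isFrontCompetitor_iff.2 ⟨h1.max (h1.comp (measurable_sub_const c)), fun x => ?_,
    fun x hx => ?_, fun x hx => ?_, ⟨l, hl, ?_⟩, ⟨l', hl', ?_⟩⟩
  · exact ⟨(h2 _).1.trans (le_max_left _ _), max_le (h2 _).2 (h2 _).2⟩
  · exact (h3 _ hx).trans (le_max_left _ _)
  · exact max_le (h4 _ hx) (h4 _ (by linarith))
  · simpa [sub_eq_add_neg] using h5.max (h5.comp (tendsto_atTop_add_const_right atTop (-c) tendsto_id))
  · simpa [sub_eq_add_neg] using h6.max (h6.comp (tendsto_atBot_add_const_right atBot (-c) tendsto_id))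

end NonlocalFront

namespace NonlocalFront

/-! ### Minimality of the front and its Euler–Lagrange equation. -/

section Front

variable {K : ℝ → ℝ} {R β mβ : ℝ}

theorem IsFront.energy_le (hK : IsLineKernel K R) {m m' : ℝ → ℝ} (hm : IsFront β mβ K m)
    (hm' : IsFrontCompetitor m') :
    energy volume (lineMeasure K) β mβ m ≤ energy volume (lineMeasure K) β mβ m' := by
  rw [← hK.freeEnergy1_eq β mβ hm.1.measurable, ← hK.freeEnergy1_eq β mβ hm'.measurable]
  exact hm.2 m' hm'

theorem isFront_of_energy_le (hK : IsLineKernel K R) {m m' : ℝ → ℝ} (hm : IsFront β mβ K m)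
    (hm' : IsFrontCompetitor m') (h : energy volume (lineMeasure K) β mβ m'
      ≤ energy volume (lineMeasure K) β mβ m) : IsFront β mβ K m' := by
  refine ⟨hm', fun q hq => ?_⟩
  rw [hK.freeEnergy1_eq β mβ hm'.measurable, hK.freeEnergy1_eq β mβ hq.measurable]
  exact h.trans (hm.energy_le hK hq)

/-- A step between the wells has no potential energy, and only points within the range R of the jump
interact across it. This makes the minimum finite. -/
theorem energy_stepProfile_ne_top (hK : IsLineKernel K R) :
    energy volume (lineMeasure K) β mβ (stepProfile mβ mβ) ≠ ⊤ := by
  have h1 : ∀ x, potential β (stepProfile mβ mβ x) - potential β mβ = 0 := by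
    intro x; unfold stepProfile; split_ifs <;> simp [potential_neg]
  have h2 : ∫⁻ x, ∫⁻ y, ENNReal.ofReal ((stepProfile mβ mβ x - stepProfile mβ mβ (x - y)) ^ 2)
      ∂(lineMeasure K) ≤ ∫⁻ x, (Icc (-R) R).indicator (fun _ => ENNReal.ofReal (4 * mβ ^ 2)) x := by
    refine lintegral_mono fun x => ?_
    have := hK.isProbabilityMeasure
    by_cases hx : x ∈ Icc (-R) R
    · rw [indicator_of_mem hx]
      refine (lintegral_mono (g := fun _ => ENNReal.ofReal (4 * mβ ^ 2)) fun y =>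
        ENNReal.ofReal_le_ofReal ?_).trans (by simp)
      unfold stepProfile
      split_ifs <;> nlinarith [sq_nonneg mβ]
    · rw [indicator_of_notMem hx, nonpos_iff_eq_zero, lintegral_eq_zero_iff
        (by have := measurable_stepProfile mβ mβ; fun_prop)]
      filter_upwards [hK.ae_abs_le] with y hy
      have hy := abs_le.1 hy
      rw [mem_Icc, not_and_or, not_le, not_le] at hx
      unfold stepProfile
      rcases hx with hx | hx
      · rw [if_neg (by linarith), if_neg (by linarith)]; simp
      · rw [if_pos (by linarith [hK.pos]), if_pos (by linarith)]; simp
  unfold energy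
  simp only [h1, ENNReal.ofReal_zero, lintegral_zero, zero_add]
  refine ENNReal.mul_ne_top (by simp) (ne_top_of_le_ne_top ?_ h2)
  rw [lintegral_indicator measurableSet_Icc, lintegral_const]
  simp [ENNReal.mul_eq_top]

theorem IsFront.energy_ne_top (hK : IsLineKernel K R) (hl : IsPositiveMinimizer β mβ) {m : ℝ → ℝ}
    (hm : IsFront β mβ K m) : energy volume (lineMeasure K) β mβ m ≠ ⊤ :=
  ne_top_of_le_ne_top (energy_stepProfile_ne_top hK)
    (hm.energy_le hK (isFrontCompetitor_stepProfile hl.1 hl.2.1))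

/-- By submodularity the energies of the minimum and the maximum of m(·+c) and m add up to at most
twice the minimal energy. The maximum is a translate of a competitor, so its energy is at least
minimal; since the minimal energy is finite it may be cancelled. -/
theorem IsFront.min_shift (hK : IsLineKernel K R) (hl : IsPositiveMinimizer β mβ) {m : ℝ → ℝ}
    (hm : IsFront β mβ K m) {c : ℝ} (hc : 0 ≤ c) :
    IsFront β mβ K fun x => min (m (x + c)) (m x) := by
  have := hK.isProbabilityMeasure
  have hmm := hm.1.measurable
  have e1 : energy volume (lineMeasure K) β mβ (fun x => m (x + c))
      = energy volume (lineMeasure K) β mβ m := by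
    simpa using energy_comp_sub (μ := volume) (ν := lineMeasure K) (β := β) (mβ := mβ) m (-c)
  have e2 : energy volume (lineMeasure K) β mβ (fun x => max (m (x + c)) (m x))
      = energy volume (lineMeasure K) β mβ (fun x => max (m x) (m (x - c))) := by
    have := energy_comp_sub (μ := volume) (ν := lineMeasure K) (β := β) (mβ := mβ)
      (fun x => max (m x) (m (x - c))) (-c)
    simpa using this
  have h := energy_sup_add_inf_le (μ := volume) (ν := lineMeasure K) (β := β) (mβ := mβ)
    (m := fun x => m (x + c)) (w := m) (hmm.comp (measurable_add_const c)).aestronglyMeasurable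
    hmm.aestronglyMeasurable
  rw [e1, e2] at h
  have h3 := hm.energy_le hK (hm.1.max_shift hc)
  refine isFront_of_energy_le hK hm (hm.1.min_shift hc) ?_
  have h4 := hm.energy_ne_top hK hl
  exact (ENNReal.add_le_add_iff_left h4).1 ((add_le_add_left h3 _).trans h)

theorem energy_neg_comp_neg (hK : IsLineKernel K R) (m : ℝ → ℝ) :
    energy volume (lineMeasure K) β mβ (fun x => -m (-x))
      = energy volume (lineMeasure K) β mβ m := by
  have := hK.isNegInvariant
  unfold energy
  congr 1
  · rw [← lintegral_neg_eq_self (μ := (volume : Measure ℝ))]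
    simp [potential_neg]
  · congr 1
    rw [← lintegral_neg_eq_self (μ := (volume : Measure ℝ))]
    refine lintegral_congr fun x => ?_
    rw [← lintegral_neg_eq_self (μ := lineMeasure K)]
    refine lintegral_congr fun y => ?_
    change ENNReal.ofReal ((-m (- -x) - -m (-(-x - -y))) ^ 2) = _
    rw [show -(-x - -y) = x - y by ring, neg_neg]
    congr 1
    ring

theorem IsFront.neg_comp_neg (hK : IsLineKernel K R) {m : ℝ → ℝ} (hm : IsFront β mβ K m) :
    IsFront β mβ K fun x => -m (-x) :=
  isFront_of_energy_le hK hm hm.1.neg_comp_neg (energy_neg_comp_neg hK m).le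

theorem memLp_of_bounded_support {w : ℝ → ℝ} (hw : Measurable w) {C n : ℝ} (hC : ∀ x, |w x| ≤ C)
    (hs : ∀ x, n < |x| → w x = 0) (p : ℝ≥0∞) : MemLp w p := by
  have : w = (Icc (-n) n).indicator w := by
    funext x
    by_cases hx : x ∈ Icc (-n) n
    · rw [indicator_of_mem hx]
    · rw [indicator_of_notMem hx]
      rw [mem_Icc, ← abs_le, not_le] at hx
      exact hs x hx
  rw [this, memLp_indicator_iff_restrict measurableSet_Icc]
  exact MemLp.of_bound hw.aestronglyMeasurable C (ae_of_all _ hC)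

/-- Minimality of the front against a bounded, boundedly supported perturbation. -/
theorem IsFront.variation_nonneg (hK : IsLineKernel K R)
    (hl : IsPositiveMinimizer β mβ) {m w : ℝ → ℝ}
    (hm : IsFront β mβ K m) (hw : Measurable w) {n : ℝ} (hs : ∀ x, n < |x| → w x = 0)
    (hwI : ∀ x, m x + w x ∈ Icc (-1 : ℝ) 1) {c : ℝ}
    (hc : IsFrontCompetitor fun x => m (x + c) + w (x + c)) :
    Integrable (fun x => (potential β (m x + w x) + (m x + w x) ^ 2 / 2)
      - (potential β (m x) + m x ^ 2 / 2) - w x * avg (lineMeasure K) m x) ∧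
    0 ≤ (∫ x, ((potential β (m x + w x) + (m x + w x) ^ 2 / 2) - (potential β (m x) + m x ^ 2 / 2)
      - w x * avg (lineMeasure K) m x)) - 1 / 2 * ∫ x, w x * avg (lineMeasure K) w x := by
  have := hK.isProbabilityMeasure
  have := hK.isNegInvariant
  have hmm := hm.1.measurable
  have hwb : ∀ x, |w x| ≤ 2 := fun x => by
    have h1 := hwI x
    have h2 := hm.1.mem_Icc x
    rw [abs_le]; constructor <;> linarith [h1.1, h1.2, h2.1, h2.2]
  have hw2 := memLp_of_bounded_support hw hwb hs 2
  have hw1 : Integrable w := memLp_one_iff_integrable.1 (memLp_of_bounded_support hw hwb hs 1)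
  have hmp := (continuous_potential β).measurable
  obtain ⟨C, hC⟩ := (isCompact_Icc (a := (-1 : ℝ)) (b := 1)).exists_bound_of_continuousOn
    (continuous_potential β).continuousOn
  have hf : Integrable (fun x => potential β (m x + w x) - potential β (m x)) := by
    refine memLp_one_iff_integrable.1 (memLp_of_bounded_support (C := C + C) (n := n)
      ((hmp.comp (hmm.add hw)).sub (hmp.comp hmm)) (fun x => ?_) (fun x hx => ?_) 1)
    · exact (abs_sub _ _).trans (add_le_add (hC _ (hwI x)) (hC _ (hm.1.mem_Icc x)))
    · simp [hs x hx]
  have hE := hm.energy_ne_top hK hl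
  obtain ⟨h1, h2⟩ := energy_expansion hmm.aestronglyMeasurable hw2 hl.2.2
    (ae_of_all _ hm.1.mem_Icc) (ae_of_all _ hwI) hE hf
  -- Only some translate of the perturbed profile has to satisfy the sign condition, because the
  -- energy does not see translations.
  have h3 : energy volume (lineMeasure K) β mβ m ≤ energy volume (lineMeasure K) β mβ (m + w) := by
    have e := energy_comp_sub (μ := volume) (ν := lineMeasure K) (β := β) (mβ := mβ) (m + w) (-c)
    rw [← e]
    simpa using hm.energy_le hK hc
  have h4 := ENNReal.toReal_mono h1 h3
  rw [h2, integral_incr_sq hw2] at h4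
  have hA : Continuous (avg (lineMeasure K) m) := hK.continuous_avg hmm hm.1.abs_le_one
  have i1 : Integrable (fun x => w x * (m x - avg (lineMeasure K) m x)) := by
    refine hw1.mul_bdd (c := 2) (hmm.sub hA.measurable).aestronglyMeasurable
      (ae_of_all _ fun x => ?_)
    have a := hm.1.abs_le_one x
    have b := hK.abs_avg_le hm.1.abs_le_one x
    exact (abs_sub _ _).trans (by linarith)
  have e0 : (fun x => (potential β (m x + w x) + (m x + w x) ^ 2 / 2)
      - (potential β (m x) + m x ^ 2 / 2) - w x * avg (lineMeasure K) m x)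
      = fun x => (potential β (m x + w x) - potential β (m x))
        + w x * (m x - avg (lineMeasure K) m x) + 1 / 2 * w x ^ 2 := by
    funext x; ring
  have i2 : Integrable (fun x => (potential β (m x + w x) - potential β (m x))
        + w x * (m x - avg (lineMeasure K) m x)) := hf.add i1
  rw [e0]
  refine ⟨i2.add (hw2.integrable_sq.const_mul _), ?_⟩
  rw [integral_add i2 (hw2.integrable_sq.const_mul _), integral_add hf i1, integral_const_mul]
  linarith

/-- The nonlocal field of a front is nonnegative on the positive half line. -/
theorem IsFront.avg_nonneg (hβ : 1 < β) (hK : IsLineKernel K R) (hl : IsPositiveMinimizer β mβ)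
    {m : ℝ → ℝ} (hm : IsFront β mβ K m) {c : ℝ} (hc : 0 < c) :
    0 ≤ avg (lineMeasure K) m c := by
  by_contra! hneg
  -- The new minimizer lies below x ↦ m(x + c), so the negative field at c is carried to the origin.
  -- There a change of sign of the profile can be repaired by a translation.
  have hQ := hm.min_shift hK hl hc.le
  set Q : ℝ → ℝ := fun x => min (m (x + c)) (m x) with hQdef
  have hcomp := isFrontCompetitor_iff.1 hQ.1
  have hA : Continuous (avg (lineMeasure K) Q) := hK.continuous_avg hQ.1.measurable hQ.1.abs_le_one
  have h0 : avg (lineMeasure K) Q 0 < 0 := by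
    refine lt_of_le_of_lt (hK.avg_mono hQ.1.measurable hQ.1.abs_le_one hm.1.measurable
      hm.1.abs_le_one (x' := c) fun y _ => ?_) hneg
    simp only [hQdef]
    refine (min_le_left _ _).trans_eq ?_
    congr 1; ring
  set κ := - avg (lineMeasure K) Q 0 / 2 with hκ
  have hκ0 : 0 < κ := by linarith
  have hev : ∀ᶠ x in 𝓝 (0 : ℝ), avg (lineMeasure K) Q x < -κ :=
    hA.continuousAt.eventually_lt continuousAt_const (by linarith)
  obtain ⟨η, hη, hball⟩ := Metric.eventually_nhds_iff.1 hev
  set ε := min (κ / 2) (1 / 2) with hε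
  have hε0 : 0 < ε := by positivity
  have hεκ : ε ≤ κ / 2 := min_le_left _ _
  have hε1 : ε ≤ 1 / 2 := min_le_right _ _
  -- The perturbed profile takes the small value −ε on [0, η). That interval adjoins the negative
  -- half line, so after translation by η the profile is again a competitor.
  set w : ℝ → ℝ := (Ico 0 η).indicator fun x => -(Q x + ε) with hwdef
  have hwm : Measurable w := ((hQ.1.measurable.add_const ε).neg).indicator measurableSet_Ico
  have hws : ∀ x, η < |x| → w x = 0 := fun x hx => by
    refine indicator_of_notMem (fun h => ?_) _
    rw [abs_of_nonneg h.1] at hx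
    linarith [h.2]
  have hsum : ∀ x, Q x + w x = if x ∈ Ico 0 η then -ε else Q x := fun x => by
    by_cases hx : x ∈ Ico 0 η
    · rw [if_pos hx, hwdef, indicator_of_mem hx]; ring
    · rw [if_neg hx, hwdef, indicator_of_notMem hx, add_zero]
  have hwI : ∀ x, Q x + w x ∈ Icc (-1 : ℝ) 1 := fun x => by
    rw [hsum]
    split_ifs
    · constructor <;> linarith
    · exact hQ.1.mem_Icc x
  obtain ⟨q1, q2, q3, q4, ⟨l, hl0, q5⟩, ⟨l', hl', q6⟩⟩ := hcomp
  have hcc : IsFrontCompetitor fun x => Q (x + η) + w (x + η) := by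
    refine isFrontCompetitor_iff.2 ⟨(q1.add hwm).comp (measurable_add_const η),
      fun x => hwI _, fun x hx => ?_, fun x hx => ?_, ⟨l, hl0, ?_⟩, ⟨l', hl', ?_⟩⟩
    · rw [hsum, if_neg (fun h => by linarith [h.2])]
      exact q3 _ (by linarith)
    · rw [hsum]
      split_ifs with h
      · linarith
      · refine q4 _ ?_
        by_contra h'
        exact h ⟨not_lt.1 h', by linarith⟩
    · refine (q5.comp (tendsto_atTop_add_const_right atTop η tendsto_id)).congr' ?_
      filter_upwards [eventually_gt_atTop 0] with x hx
      rw [hsum, if_neg (fun h => by linarith [h.2])]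
      rfl
    · refine (q6.comp (tendsto_atBot_add_const_right atBot η tendsto_id)).congr' ?_
      filter_upwards [eventually_lt_atBot (-η)] with x hx
      rw [hsum, if_neg (fun h => by linarith [h.1])]
      rfl
  obtain ⟨hint, hvar⟩ := hQ.variation_nonneg hK hl hwm hws hwI hcc
  have hwneg : ∀ᵐ x, w x ≤ 0 := by
    have : ∀ᵐ x : ℝ, x ≠ 0 := by simp [ae_iff]
    filter_upwards [this] with x hx
    by_cases h : x ∈ Ico 0 η
    · rw [hwdef, indicator_of_mem h]
      linarith [q3 x (lt_of_le_of_ne h.1 hx.symm)]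
    · rw [hwdef, indicator_of_notMem h]
  have hq : 0 ≤ ∫ x, w x * avg (lineMeasure K) w x := by
    have havg : ∀ x, avg (lineMeasure K) w x ≤ 0 := fun x => by
      refine integral_nonpos_of_ae (IsLineKernel.absolutelyContinuous.ae_le ?_)
      exact (quasiMeasurePreserving_sub_left volume x).ae hwneg
    refine integral_nonneg_of_ae ?_
    filter_upwards [hwneg] with x hx
    exact mul_nonneg_of_nonpos_of_nonpos hx (havg x)
  -- On [0, η) the field lowers the energy density by at least εκ. The entropy at −ε exceeds its
  -- minimum at 0 by at most ε², and ε ≤ κ/2 makes the balance negative.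
  have hle : (∫ x, ((potential β (Q x + w x) + (Q x + w x) ^ 2 / 2)
      - (potential β (Q x) + Q x ^ 2 / 2) - w x * avg (lineMeasure K) Q x))
      ≤ ∫ x, (Ico 0 η).indicator (fun _ => -(ε * (κ - ε))) x := by
    refine integral_mono_ae hint ((integrable_indicator_iff measurableSet_Ico).2
      (integrableOn_const (by simp) enorm_ne_top)) ?_
    have : ∀ᵐ x : ℝ, x ≠ 0 := by simp [ae_iff]
    filter_upwards [this] with x hx
    by_cases h : x ∈ Ico 0 η
    · rw [hsum, if_pos h, indicator_of_mem h, hwdef, indicator_of_mem h]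
      have hQ0 : 0 ≤ Q x := q3 x (lt_of_le_of_ne h.1 hx.symm)
      have hav : avg (lineMeasure K) Q x < -κ := hball (by
        rw [Real.dist_eq, sub_zero, abs_of_nonneg h.1]; exact h.2)
      have t1 := tilted_entropy_le hβ 0 (hQ.1.mem_Icc x)
      simp only [mul_zero, Real.tanh_zero, zero_mul, sub_zero] at t1
      have t2 : 0 ≤ Q x ^ 2 / (8 * β) := by positivity
      have t3 := potential_eq_expansion β (s₀ := 0) (by norm_num) (-ε)
      have t4 := relEnt_upper (s := -ε) (s₀ := 0) ⟨by linarith, by linarith⟩ (by norm_num)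
      have t5 : 1 / β * relEnt (-ε) 0 ≤ 1 / β * ε ^ 2 := by
        refine mul_le_mul_of_nonneg_left (t4.trans_eq (by ring)) (by positivity)
      have t6 : 1 / β * ε ^ 2 ≤ ε ^ 2 := by
        have : 1 / β ≤ 1 := by rw [div_le_one (by linarith)]; exact hβ.le
        nlinarith
      rw [Real.artanh_zero] at t3
      have t7 : (Q x + ε) * avg (lineMeasure K) Q x ≤ -(ε * κ) := by nlinarith
      nlinarith
    · rw [hsum, if_neg h, indicator_of_notMem h, hwdef, indicator_of_notMem h]
      simp
  rw [integral_indicator measurableSet_Ico, setIntegral_const] at hle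
  simp only [smul_eq_mul] at hle
  have hvol : volume.real (Ico 0 η) = η := by
    rw [Real.volume_real_Ico_of_le hη.le, sub_zero]
  rw [hvol] at hle
  have : 0 < η * (ε * (κ - ε)) := by
    have : 0 < κ - ε := by linarith
    positivity
  linarith

theorem avg_neg_comp_neg (hK : IsLineKernel K R) (m : ℝ → ℝ) (x : ℝ) :
    avg (lineMeasure K) (fun x => -m (-x)) x = -avg (lineMeasure K) m (-x) := by
  have := hK.isNegInvariant
  unfold avg
  rw [integral_neg, ← integral_neg_eq_self]
  congr 2; funext y; congr 1; ring

theorem IsFront.avg_nonpos (hβ : 1 < β) (hK : IsLineKernel K R) (hl : IsPositiveMinimizer β mβ)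
    {m : ℝ → ℝ} (hm : IsFront β mβ K m) {c : ℝ} (hc : c < 0) :
    avg (lineMeasure K) m c ≤ 0 := by
  have := (hm.neg_comp_neg hK).avg_nonneg hβ hK hl (neg_pos.2 hc)
  rw [avg_neg_comp_neg hK, neg_neg] at this
  linarith

/-- The Euler-Lagrange equation of the front. -/
theorem IsFront.euler_lagrange (hβ : 1 < β) (hK : IsLineKernel K R)
    (hl : IsPositiveMinimizer β mβ) {m : ℝ → ℝ} (hm : IsFront β mβ K m) :
    ∀ᵐ x, m x = Real.tanh (β * avg (lineMeasure K) m x) := by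
  have hA : Continuous (avg (lineMeasure K) m) := hK.continuous_avg hm.1.measurable hm.1.abs_le_one
  have := hK.isProbabilityMeasure
  set T : ℝ → ℝ := fun x => Real.tanh (β * avg (lineMeasure K) m x) with hT
  have hTc : Continuous T := continuous_tanh.comp (continuous_const.mul hA)
  have hmm := hm.1.measurable
  -- The perturbation moves m towards T by the fraction θ. Convexity and quantitative minimality
  -- lower the linear part by θ/(8β)·∫g², whereas the interaction term can restore at most θ²/2·∫g².
  -- With θ = 1/(8β) half of the gain survives, which forces g = 0.
  set θ : ℝ := 1 / (8 * β) with hθ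
  have hθ0 : 0 < θ := by positivity
  have hθ1 : θ ≤ 1 := by
    rw [hθ, div_le_one (by positivity)]; linarith
  have key : ∀ n : ℕ, ∀ᵐ x, x ∈ Icc (-(n : ℝ)) n → m x = T x := by
    intro n
    set g : ℝ → ℝ := (Icc (-(n : ℝ)) n).indicator fun x => T x - m x with hg
    set w : ℝ → ℝ := fun x => θ * g x with hw
    have hgm : Measurable g := (hTc.measurable.sub hmm).indicator measurableSet_Icc
    have hwm : Measurable w := hgm.const_mul θ
    have hgs : ∀ x, (n : ℝ) < |x| → g x = 0 := fun x hx =>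
      indicator_of_notMem (s := Icc (-(n : ℝ)) n) (fun h => (not_le.2 hx) (abs_le.2 h)) _
    have hgb : ∀ x, |g x| ≤ 2 := fun x => by
      by_cases h : x ∈ Icc (-(n : ℝ)) n
      · rw [hg, indicator_of_mem h]
        have := tanh_mem_Ioo (β * avg (lineMeasure K) m x)
        have h2 := hm.1.mem_Icc x
        rw [abs_le]; constructor <;> linarith [this.1, this.2, h2.1, h2.2]
      · rw [hg, indicator_of_notMem h]; simp
    have hws : ∀ x, (n : ℝ) < |x| → w x = 0 := fun x hx => by simp [hw, hgs x hx]
    have hdich : ∀ x, g x = T x - m x ∨ g x = 0 := fun x => by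
      by_cases h : x ∈ Icc (-(n : ℝ)) n
      · left; rw [hg, indicator_of_mem h]
      · right; rw [hg, indicator_of_notMem h]
    have hconv : ∀ (x : ℝ) (P : ℝ → Prop), P (m x) → P ((1 - θ) * m x + θ * T x) →
        P (m x + w x) := fun x P h1 h2 => by
      rcases hdich x with h | h
      · convert h2 using 1; simp only [hw, h]; ring
      · convert h1 using 1; simp [hw, h]
    obtain ⟨c1, c2, c3, c4, ⟨l, hl0, c5⟩, ⟨l', hl', c6⟩⟩ := isFrontCompetitor_iff.1 hm.1
    have hwI : ∀ x, m x + w x ∈ Icc (-1 : ℝ) 1 := fun x => by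
      refine hconv x (fun s => s ∈ Icc (-1 : ℝ) 1) (c2 x) ?_
      have h1 := tanh_mem_Ioo (β * avg (lineMeasure K) m x)
      have h2 := c2 x
      constructor
      · nlinarith [h1.1, h2.1, hT]
      · nlinarith [h1.2, h2.2, hT]
    have hcc : IsFrontCompetitor fun x => m (x + 0) + w (x + 0) := by
      simp only [add_zero]
      refine isFrontCompetitor_iff.2 ⟨hmm.add hwm, hwI, fun x hx => ?_, fun x hx => ?_,
        ⟨l, hl0, c5.congr' ?_⟩, ⟨l', hl', c6.congr' ?_⟩⟩
      · refine hconv x (fun s => 0 ≤ s) (c3 x hx) ?_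
        -- The sign of the nonlocal field enters here: it makes T, and hence the convex combination,
        -- satisfy the sign constraint.
        have : 0 ≤ T x := tanh_nonneg (mul_nonneg (by linarith) (hm.avg_nonneg hβ hK hl hx))
        have := c3 x hx
        have : 0 ≤ 1 - θ := by linarith
        positivity
      · refine hconv x (fun s => s ≤ 0) (c4 x hx) ?_
        have h1 : T x ≤ 0 := tanh_nonpos
          (mul_nonpos_of_nonneg_of_nonpos (by linarith) (hm.avg_nonpos hβ hK hl hx))
        have h2 := c4 x hx
        nlinarith
      · filter_upwards [eventually_gt_atTop (n : ℝ)] with x hx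
        rw [hws x (hx.trans_le (le_abs_self x)), add_zero]
      · filter_upwards [eventually_lt_atBot (-(n : ℝ))] with x hx
        rw [hws x (lt_of_lt_of_le (by linarith) (neg_le_abs x)), add_zero]
    obtain ⟨hint, hvar⟩ := hm.variation_nonneg hK hl hwm hws hwI hcc
    have hg2 := memLp_of_bounded_support hgm hgb hgs 2
    have hw2 : MemLp w 2 := hg2.const_mul θ
    have hle : (∫ x, ((potential β (m x + w x) + (m x + w x) ^ 2 / 2)
        - (potential β (m x) + m x ^ 2 / 2) - w x * avg (lineMeasure K) m x))
        ≤ ∫ x, -(θ ^ 2) * g x ^ 2 := by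
      refine integral_mono hint (hg2.integrable_sq.const_mul _) fun x => ?_
      rcases hdich x with h | h
      · have t1 := entropy_convex hβ (c2 x) (tanh_mem_Ioo (β * avg (lineMeasure K) m x)) hθ0 hθ1
        have t2 := mul_le_mul_of_nonneg_left
          (tilted_entropy_le hβ (avg (lineMeasure K) m x) (c2 x)) hθ0.le
        have e : θ * ((m x - Real.tanh (β * avg (lineMeasure K) m x)) ^ 2 / (8 * β))
          = θ ^ 2 * (m x - Real.tanh (β * avg (lineMeasure K) m x)) ^ 2 := by
          rw [hθ]; ring
        simp only [hw, h, hT]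
        nlinarith
      · simp [hw, h]
    have hq : -(1 / 2 * ∫ x, w x * avg (lineMeasure K) w x) ≤ 1 / 2 * ∫ x, w x ^ 2 := by
      have := hK.isNegInvariant
      have h1 := integral_incr_sq_le (ν := lineMeasure K) hw2
      have i3 : Integrable (fun x => w x * avg (lineMeasure K) w x) :=
        hw2.integrable_mul (memLp_avg hw2)
      have h2 : ∫ x, -(w x ^ 2 / 2 + avg (lineMeasure K) w x ^ 2 / 2)
          ≤ ∫ x, w x * avg (lineMeasure K) w x :=
        integral_mono ((hw2.integrable_sq.div_const 2).add
          ((memLp_avg hw2).integrable_sq.div_const 2)).neg i3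
          fun x => by dsimp only; nlinarith [sq_nonneg (w x + avg (lineMeasure K) w x)]
      rw [integral_neg, integral_add (hw2.integrable_sq.div_const 2)
        ((memLp_avg hw2).integrable_sq.div_const 2), integral_div, integral_div] at h2
      linarith [integral_sq_avg_le (ν := lineMeasure K) hw2]
    have e3 : ∫ x, w x ^ 2 = θ ^ 2 * ∫ x, g x ^ 2 := by
      rw [← integral_const_mul]; congr 1; funext x; simp only [hw]; ring
    rw [integral_const_mul] at hle
    have h0 : ∫ x, g x ^ 2 ≤ 0 := by
      have : 0 < θ ^ 2 := by positivity
      rw [e3] at hq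
      nlinarith
    have h1 : ∫ x, g x ^ 2 = 0 := le_antisymm h0 (integral_nonneg fun x => sq_nonneg _)
    rw [integral_eq_zero_iff_of_nonneg (fun x => sq_nonneg _) hg2.integrable_sq] at h1
    filter_upwards [h1] with x hx hxI
    rw [hg] at hx
    simp only [indicator_of_mem hxI, Pi.zero_apply] at hx
    have := pow_eq_zero_iff two_ne_zero |>.1 hx
    linarith
  filter_upwards [ae_all_iff.2 key] with x hx
  obtain ⟨n, hn⟩ := exists_nat_ge |x|
  exact hx n (abs_le.1 hn)

end Front

end NonlocalFront

namespace NonlocalFront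

/-! ### Propagation of zeros -/

/-- If a nonnegative continuous function has vanishing average at each of its zeros, then its zero
set is invariant under the translations coming from the space carrying the kernel. -/
theorem eq_zero_of_propagation {E : Type*} [NormedAddCommGroup E] [NormedSpace ℝ E]
    [MeasurableSpace E] [BorelSpace E] {μ : Measure E} [μ.IsOpenPosMeasure]
    [IsFiniteMeasureOnCompacts μ]
    {G : Type*} [AddCommGroup G] [TopologicalSpace G] [IsTopologicalAddGroup G] (π : E →+ G)
    (hπ : Continuous π) {J : E → ℝ} (hJ : Continuous J) (hJs : HasCompactSupport J)
    (hJ0 : ∀ z, 0 ≤ J z) (hJe : ∀ z, J (-z) = J z) (hJ1 : ∃ z, J z ≠ 0)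
    {u : G → ℝ} (hu : Continuous u) (hu0 : ∀ x, 0 ≤ u x)
    (h : ∀ x, u x = 0 → ∫ z, J z * u (x - π z) ∂μ = 0) {x : G} (hx : u x = 0) (z : E) :
    u (x + π z) = 0 := by
  have h1 : ∀ y, u y = 0 → ∀ z, J z ≠ 0 → u (y - π z) = 0 := by
    intro y hy z hz
    by_contra hne
    have hc : Continuous fun z => J z * u (y - π z) := by fun_prop
    have hpos := hc.integral_pos_of_hasCompactSupport_nonneg_nonzero (μ := μ) (x := z)
      hJs.mul_right (fun z => mul_nonneg (hJ0 z) (hu0 _)) (mul_ne_zero hz hne)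
    exact hpos.ne' (h y hy)
  obtain ⟨z₀, hz₀⟩ := hJ1
  have hU : IsOpen {z | J z ≠ 0} := isOpen_ne_fun hJ continuous_const
  obtain ⟨r, hr, hball⟩ := Metric.isOpen_iff.1 hU z₀ hz₀
  set Z : Set E := {z | u (x + π z) = 0} with hZ
  have hclosed : IsClosed Z := isClosed_eq (by fun_prop) continuous_const
  have hopen : IsOpen Z := by
    -- From a zero one steps back by z₀ and then forward by a point near z₀. Both steps lie in the
    -- support by evenness of the kernel, so a whole ball of displacements is reached. The zero set
    -- is then open and closed in a connected space.
    refine Metric.isOpen_iff.2 fun z hz => ⟨r, hr, fun z' hz' => ?_⟩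
    have a1 := h1 _ hz z₀ hz₀
    have a2 : J (-(z₀ + (z' - z))) ≠ 0 := by
      rw [hJe]
      refine hball ?_
      rw [Metric.mem_ball, dist_eq_norm, add_sub_cancel_left]
      rwa [Metric.mem_ball, dist_eq_norm] at hz'
    have a3 := h1 _ a1 _ a2
    change u (x + π z') = 0
    convert a3 using 2
    simp only [map_neg, map_add, map_sub]
    abel
  have huniv : Z = univ := IsClopen.eq_univ ⟨hclosed, hopen⟩ ⟨0, by simpa [hZ] using hx⟩
  have : z ∈ Z := by rw [huniv]; trivial
  exact this

/-! ### The profile of the front -/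

/-- The front profile `M` with its first two derivatives, its limits `-l'` and `l`, and its
exponential decay. -/
structure IsProfile (β : ℝ) (K M P P₂ : ℝ → ℝ) (l l' c C lam : ℝ) : Prop where
  hasDerivAt : ∀ x, HasDerivAt M (P x) x
  hasDerivAt_deriv : ∀ x, HasDerivAt P (P₂ x) x
  continuous_deriv₂ : Continuous P₂
  pos : ∀ x, 0 < P x
  eq_tanh : ∀ x, M x = Real.tanh (β * avg (lineMeasure K) M x)
  deriv_eq : ∀ x, P x = β * (1 - M x ^ 2) * avg (lineMeasure K) P x
  abs_le : ∀ x, |M x| ≤ c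
  lt_one : c < 1
  deriv_le : ∀ x, P x ≤ C * Real.exp (-lam * |x|)
  deriv₂_le : ∀ x, |P₂ x| ≤ C * Real.exp (-lam * |x|)
  sub_le : ∀ x, |M x - l| ≤ C * Real.exp (-lam * x)
  add_le : ∀ x, |M x + l'| ≤ C * Real.exp (lam * x)
  minimizer : IsPositiveMinimizer β l
  minimizer' : IsPositiveMinimizer β l'
  lam_pos : 0 < lam

/-! ### Regularity, monotonicity and decay of the front. -/

section Front

variable {K : ℝ → ℝ} {R β mβ : ℝ}

theorem IsLineKernel.exists_ne_zero (hK : IsLineKernel K R) : ∃ z, K z ≠ 0 := by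
  by_contra! h
  have := hK.integral_eq_one
  simp [h] at this

theorem IsLineKernel.eq_zero_of_propagation (hK : IsLineKernel K R) {u : ℝ → ℝ}
    (hu : Continuous u) (hu0 : ∀ x, 0 ≤ u x)
    (h : ∀ x, u x = 0 → avg (lineMeasure K) u x = 0) {x : ℝ} (hx : u x = 0) (z : ℝ) : u z = 0 := by
  have := NonlocalFront.eq_zero_of_propagation (μ := volume) (AddMonoidHom.id ℝ) continuous_id
    hK.continuous hK.hasCompactSupport hK.nonneg hK.even hK.exists_ne_zero hu hu0
    (fun x hx => by rw [← h x hx, hK.avg_eq]; rfl) hx (z - x)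
  simpa using this

theorem IsLineKernel.tendsto_avg (hK : IsLineKernel K R) {u : ℝ → ℝ} (hu : Measurable u) {C : ℝ}
    (hC : ∀ x, |u x| ≤ C) {l : ℝ} (hl : Tendsto u atTop (𝓝 l)) :
    Tendsto (avg (lineMeasure K) u) atTop (𝓝 l) := by
  have := hK.isProbabilityMeasure
  refine Metric.tendsto_nhds.2 fun ε hε => ?_
  obtain ⟨X, hX⟩ := eventually_atTop.1 (Metric.tendsto_nhds.1 hl (ε / 2) (half_pos hε))
  filter_upwards [eventually_ge_atTop (X + R)] with x hx
  have hi := hK.integrable_shift hu hC x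
  have e : avg (lineMeasure K) u x - l = ∫ y, (u (x - y) - l) ∂lineMeasure K := by
    rw [integral_sub hi (integrable_const l)]; simp [avg]
  have hb : ‖∫ y, (u (x - y) - l) ∂lineMeasure K‖ ≤ ε / 2 := by
    have := norm_integral_le_of_norm_le_const (μ := lineMeasure K) (f := fun y => u (x - y) - l)
      (C := ε / 2) (by
        filter_upwards [hK.ae_abs_le] with y hy
        have := hX (x - y) (by linarith [(abs_le.1 hy).2])
        rw [Real.dist_eq] at this
        exact this.le)
    simpa using this
  rw [Real.dist_eq, e, ← Real.norm_eq_abs]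
  linarith

theorem eq_of_ae_eq_of_tendsto {u v : ℝ → ℝ} (h : u =ᵐ[volume] v) {a b : ℝ}
    (hu : Tendsto u atTop (𝓝 a)) (hv : Tendsto v atTop (𝓝 b)) : a = b := by
  by_contra hne
  have h1 : ∀ᶠ x in atTop, u x ≠ v x := by
    have := (hu.sub hv).eventually_ne (sub_ne_zero.2 hne)
    filter_upwards [this] with x hx
    exact sub_ne_zero.1 hx
  obtain ⟨X, hX⟩ := eventually_atTop.1 h1
  have h2 : volume (Ici X) = 0 := measure_mono_null (fun x hx => hX x hx) h
  simp at h2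

/-- A limit with larger potential would cost a fixed positive energy density on a whole half line,
against finiteness of the energy. -/
theorem IsFront.minimizer_of_tendsto (hK : IsLineKernel K R)
    (hl : IsPositiveMinimizer β mβ) {m : ℝ → ℝ} (hm : IsFront β mβ K m) {l : ℝ} (hl0 : 0 < l)
    (h : Tendsto m atTop (𝓝 l)) : IsPositiveMinimizer β l := by
  have hl1 : l ≤ 1 := le_of_tendsto h (Eventually.of_forall fun x => (hm.1.mem_Icc x).2)
  refine ⟨hl0, hl1, fun s hs => le_trans ?_ (hl.2.2 s hs)⟩
  by_contra! hlt
  have hE := hm.energy_ne_top hK hl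
  have h1 : Tendsto (fun x => potential β (m x)) atTop (𝓝 (potential β l)) :=
    ((continuous_potential β).tendsto l).comp h
  set δ := (potential β l - potential β mβ) / 2 with hδ
  have hδ0 : 0 < δ := by linarith
  obtain ⟨X, hX⟩ := eventually_atTop.1
    (h1.eventually_const_lt (u := potential β mβ + δ) (by linarith))
  refine hE ?_
  have : (⊤ : ℝ≥0∞) ≤ ∫⁻ x, ENNReal.ofReal (potential β (m x) - potential β mβ) :=
    calc (⊤ : ℝ≥0∞) = ∫⁻ _ in Ici X, ENNReal.ofReal δ := by
          rw [lintegral_const, Measure.restrict_apply MeasurableSet.univ, univ_inter,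
            Real.volume_Ici, ENNReal.mul_top (by simpa using hδ0)]
      _ ≤ ∫⁻ x in Ici X, ENNReal.ofReal (potential β (m x) - potential β mβ) := by
          refine setLIntegral_mono' measurableSet_Ici fun x hx => ENNReal.ofReal_le_ofReal ?_
          linarith [hX x hx]
      _ ≤ _ := setLIntegral_le_lintegral _ _
  rw [energy, top_le_iff.1 this, top_add]

/-- The continuous representative of the front. -/
noncomputable def smoothFront (β : ℝ) (K m : ℝ → ℝ) (x : ℝ) : ℝ :=
  Real.tanh (β * avg (lineMeasure K) m x)

theorem IsFront.ae_eq_smoothFront (hβ : 1 < β) (hK : IsLineKernel K R)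
    (hl : IsPositiveMinimizer β mβ) {m : ℝ → ℝ} (hm : IsFront β mβ K m) :
    m =ᵐ[volume] smoothFront β K m := hm.euler_lagrange hβ hK hl

theorem IsFront.continuous_smoothFront (hK : IsLineKernel K R)
    {m : ℝ → ℝ} (hm : IsFront β mβ K m) : Continuous (smoothFront β K m) :=
  continuous_tanh.comp (continuous_const.mul (hK.continuous_avg hm.1.measurable hm.1.abs_le_one))

theorem abs_smoothFront_le_one (m : ℝ → ℝ) (x : ℝ) : |smoothFront β K m x| ≤ 1 :=
  abs_le.2 (Ioo_subset_Icc_self (tanh_mem_Ioo _))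

theorem IsFront.smoothFront_eq (hβ : 1 < β) (hK : IsLineKernel K R)
    (hl : IsPositiveMinimizer β mβ) {m : ℝ → ℝ} (hm : IsFront β mβ K m) (x : ℝ) :
    smoothFront β K m x = Real.tanh (β * avg (lineMeasure K) (smoothFront β K m) x) := by
  rw [← IsLineKernel.avg_congr_ae (hm.ae_eq_smoothFront hβ hK hl)]
  rfl

theorem IsFront.tendsto_smoothFront (hβ : 1 < β) (hK : IsLineKernel K R)
    (hl : IsPositiveMinimizer β mβ) {m : ℝ → ℝ} (hm : IsFront β mβ K m) :
    ∃ l, IsPositiveMinimizer β l ∧ Tendsto (smoothFront β K m) atTop (𝓝 l) := by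
  obtain ⟨-, -, -, -, ⟨l, hl0, h5⟩, -⟩ := isFrontCompetitor_iff.1 hm.1
  have h1 := hK.tendsto_avg hm.1.measurable hm.1.abs_le_one h5
  have h2 : Tendsto (smoothFront β K m) atTop (𝓝 (Real.tanh (β * l))) :=
    (continuous_tanh.tendsto _).comp (h1.const_mul β)
  have h3 := eq_of_ae_eq_of_tendsto (hm.ae_eq_smoothFront hβ hK hl) h5 h2
  exact ⟨l, hm.minimizer_of_tendsto hK hl hl0 h5, by rwa [← h3] at h2⟩

theorem smoothFront_neg_comp_neg (hK : IsLineKernel K R) (m : ℝ → ℝ) :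
    smoothFront β K (fun x => -m (-x)) = fun x => -smoothFront β K m (-x) := by
  funext x
  simp only [smoothFront, avg_neg_comp_neg hK, mul_neg, Real.tanh_neg]

/-- The minimum Q of M and its translate by h > 0 is a minimizer and solves the Euler–Lagrange
equation. At a zero of M − Q ≥ 0, injectivity of tanh makes the average of M − Q vanish, so the zero
propagates and M ≤ M(·+h) everywhere. Otherwise M > M(·+h) everywhere; iterating gives M ≥ l > 0 on
the whole line, against the negative limit at −∞. -/
theorem IsFront.monotone_smoothFront (hβ : 1 < β) (hK : IsLineKernel K R)
    (hl : IsPositiveMinimizer β mβ) {m : ℝ → ℝ} (hm : IsFront β mβ K m) :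
    Monotone (smoothFront β K m) := by
  set M := smoothFront β K m with hM
  have hMc : Continuous M := hm.continuous_smoothFront hK
  have hMb : ∀ x, |M x| ≤ 1 := abs_smoothFront_le_one m
  have hβ0 : β ≠ 0 := by linarith
  have key : ∀ h : ℝ, 0 < h → ∀ x, M x ≤ M (x + h) := by
    intro h hh
    have hQ := hm.min_shift hK hl hh.le
    set Q : ℝ → ℝ := fun x => min (M (x + h)) (M x) with hQd
    have hQc : Continuous Q := (hMc.comp (continuous_id.add continuous_const)).min hMc
    have hQb : ∀ x, |Q x| ≤ 1 := fun x =>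
      abs_le.2 ⟨le_min (abs_le.1 (hMb _)).1 (abs_le.1 (hMb _)).1,
        (min_le_right _ _).trans (abs_le.1 (hMb _)).2⟩
    have hae := hm.ae_eq_smoothFront hβ hK hl
    have hae2 : (fun x => m (x + h)) =ᵐ[volume] fun x => M (x + h) :=
      (quasiMeasurePreserving_add_right volume h).ae_eq_comp hae
    have hQae : (fun x => min (m (x + h)) (m x)) =ᵐ[volume] Q := by
      filter_upwards [hae, hae2] with x h1 h2
      simp only [h1, h2, hQd, hM]
    have hEL : ∀ x, Q x = Real.tanh (β * avg (lineMeasure K) Q x) := by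
      have h1 := hQ.ae_eq_smoothFront hβ hK hl
      have h2 : Q =ᵐ[volume] fun x => Real.tanh (β * avg (lineMeasure K) Q x) := by
        refine hQae.symm.trans (h1.trans ?_)
        refine ae_of_all _ fun x => ?_
        rw [smoothFront, IsLineKernel.avg_congr_ae hQae]
      have h3 := Continuous.ae_eq_iff_eq volume hQc
        (continuous_tanh.comp (continuous_const.mul (hK.continuous_avg hQc.measurable hQb))) |>.1 h2
      exact fun x => congrFun h3 x
    have hprop : ∀ x, M x - Q x = 0 → avg (lineMeasure K) (fun x => M x - Q x) x = 0 := by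
      intro x hx
      have h1 : M x = Q x := sub_eq_zero.1 hx
      rw [hEL x, hM, hm.smoothFront_eq hβ hK hl x, ← hM] at h1
      have h2 := mul_left_cancel₀ hβ0 (strictMono_tanh.injective h1)
      unfold avg at h2 ⊢
      rw [integral_sub (hK.integrable_shift hMc.measurable hMb x)
        (hK.integrable_shift hQc.measurable hQb x), h2, sub_self]
    by_contra! hcon
    have hpos : ∀ x, M (x + h) < M x := by
      intro x
      by_contra! hle
      obtain ⟨x₀, hx₀⟩ := hcon
      have h0 : M x - Q x = 0 := by simp [hQd, hle]
      have := hK.eq_zero_of_propagation (hMc.sub hQc)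
        (fun x => sub_nonneg.2 (min_le_right _ _)) hprop h0 x₀
      simp only [Pi.sub_apply, hQd, min_eq_left hx₀.le] at this
      linarith
    obtain ⟨l, hlm, hlt⟩ := hm.tendsto_smoothFront hβ hK hl
    obtain ⟨l', hlm', hlt'⟩ := (hm.neg_comp_neg hK).tendsto_smoothFront hβ hK hl
    rw [smoothFront_neg_comp_neg hK] at hlt'
    have hge : ∀ x, l ≤ M x := by
      intro x
      have hn : ∀ n : ℕ, M (x + n * h) ≤ M x := by
        intro n
        induction n with
        | zero => simp
        | succ n ih =>
          refine le_trans (le_of_eq_of_le ?_ (hpos (x + n * h)).le) ih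
          push_cast; ring_nf
      have ht : Tendsto (fun n : ℕ => x + n * h) atTop atTop :=
        tendsto_atTop_add_const_left _ _ (tendsto_natCast_atTop_atTop.atTop_mul_const hh)
      exact le_of_tendsto (hlt.comp ht) (Eventually.of_forall hn)
    have : l' ≤ -l := le_of_tendsto hlt' (Eventually.of_forall fun x => by linarith [hge (-x)])
    linarith [hlm.1, hlm'.1]
  intro x y hxy
  rcases hxy.eq_or_lt with rfl | hlt
  · exact le_rfl
  · have := key (y - x) (sub_pos.2 hlt) x
    rwa [add_sub_cancel] at this

/-- Each step of length R gains a factor κ, which is the rate −log κ / R. The induction counts the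
steps back to X, where the crude bound takes over. -/
theorem exp_bound_of_contraction {e : ℝ → ℝ} {κ R X B : ℝ} (hκ0 : 0 < κ) (hκ : κ < 1) (hR : 0 < R)
    (hB : ∀ x, e x ≤ B) (hB0 : 0 ≤ B) (h : ∀ x, X ≤ x → e x ≤ κ * e (x - R)) :
    ∃ C lam, 0 < lam ∧ 0 ≤ C ∧ ∀ x, e x ≤ C * Real.exp (-lam * x) := by
  set lam := -Real.log κ / R with hlam
  have hlam0 : 0 < lam := div_pos (neg_pos.2 (Real.log_neg hκ0 hκ)) hR
  have hk : Real.exp (-lam * R) = κ := by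
    rw [hlam, neg_mul, div_mul_cancel₀ _ hR.ne', neg_neg, Real.exp_log hκ0]
  have key : ∀ n : ℕ, ∀ x, x ≤ X + n * R → e x ≤ B * Real.exp (-lam * (x - X)) := by
    intro n
    induction n with
    | zero =>
      intro x hx
      refine (hB x).trans (le_mul_of_one_le_right hB0 (Real.one_le_exp ?_))
      simp only [Nat.cast_zero, zero_mul, add_zero] at hx
      nlinarith
    | succ n ih =>
      intro x hx
      rcases le_total x X with hxX | hxX
      · exact (hB x).trans (le_mul_of_one_le_right hB0 (Real.one_le_exp (by nlinarith)))
      · have h1 := ih (x - R) (by push_cast at hx; linarith)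
        calc e x ≤ κ * e (x - R) := h x hxX
          _ ≤ κ * (B * Real.exp (-lam * (x - R - X))) := by gcongr
          _ = B * Real.exp (-lam * (x - X)) := by
            rw [← hk, mul_left_comm, ← Real.exp_add]; congr 2; ring
  refine ⟨B * Real.exp (lam * X), lam, hlam0, by positivity, fun x => ?_⟩
  obtain ⟨n, hn⟩ := exists_nat_ge ((x - X) / R)
  rw [div_le_iff₀ hR] at hn
  refine (key n x (by linarith)).trans_eq ?_
  rw [mul_assoc, ← Real.exp_add]; congr 2; ring

/-- Where M is positive, concavity of tanh gives l − M ≤ β(1 − M²)(l − K⋆M), and monotonicity gives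
K⋆M(x) ≥ M(x − R). Far out β(1 − M²) stays below some κ < 1, which leaves a contraction over steps
of length R. -/
theorem IsFront.exists_decay (hβ : 1 < β) (hK : IsLineKernel K R)
    (hl : IsPositiveMinimizer β mβ) {m : ℝ → ℝ} (hm : IsFront β mβ K m) :
    ∃ l C lam, IsPositiveMinimizer β l ∧ 0 < lam ∧ 0 ≤ C ∧
      ∀ x, |smoothFront β K m x - l| ≤ C * Real.exp (-lam * x) := by
  obtain ⟨l, hlm, hlt⟩ := hm.tendsto_smoothFront hβ hK hl
  have hmono := hm.monotone_smoothFront hβ hK hl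
  have hEL := hm.smoothFront_eq hβ hK hl
  have hMc := hm.continuous_smoothFront hK
  set M := smoothFront β K m with hM
  have hMb : ∀ x, |M x| ≤ 1 := abs_smoothFront_le_one m
  have hMl : ∀ x, M x ≤ l := fun x => hmono.ge_of_tendsto hlt x
  have hl1 := hlm.mem_Ioo hβ
  have hcon := hlm.mul_lt_one hβ
  set κ := (β * (1 - l ^ 2) + 1) / 2 with hκ
  have hκ0 : 0 < κ := by
    have : 0 < β * (1 - l ^ 2) := mul_pos (by linarith) (by nlinarith [hl1.1, hl1.2])
    linarith
  have hκ1 : κ < 1 := by linarith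
  have hev1 : ∀ᶠ x in atTop, β * (1 - M x ^ 2) < κ :=
    ((hlt.pow 2).const_sub 1 |>.const_mul β).eventually_lt_const (by linarith)
  have hev2 : ∀ᶠ x in atTop, 0 < M x := hlt.eventually_const_lt hl1.1
  obtain ⟨X, hX⟩ := eventually_atTop.1 (hev1.and hev2)
  obtain ⟨C, lam, hlam, hC, hdec⟩ := exp_bound_of_contraction (e := fun x => l - M x) (X := X)
    (B := 2) hκ0 hκ1 hK.pos (fun x => by linarith [(abs_le.1 (hMb x)).1, hl1.2]) (by norm_num)
    (fun x hx => by
      obtain ⟨h1, h2⟩ := hX x hx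
      have hav : l - avg (lineMeasure K) M x ≤ l - M (x - R) := by
        have := hK.avg_mono (u := fun _ => M (x - R)) measurable_const (C := 1)
          (fun _ => hMb _) hMc.measurable hMb (x := x) (x' := x)
          (fun y hy => hmono (by linarith [(abs_le.1 hy).2]))
        rw [hK.avg_const] at this
        linarith
      have hav0 : avg (lineMeasure K) M x ≤ l := by
        have := hK.avg_mono hMc.measurable hMb (v := fun _ => l) measurable_const (C' := l)
          (fun _ => (abs_of_pos hl1.1).le) (x := x) (x' := x)
          (fun y hy => hMl _)
        rwa [hK.avg_const] at this
      have hav1 : 0 ≤ avg (lineMeasure K) M x := by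
        by_contra! hneg
        have : M x ≤ 0 := by
          rw [hEL x]; exact tanh_nonpos (mul_nonpos_of_nonneg_of_nonpos (by linarith) hneg.le)
        linarith
      have ht := tanh_sub_tanh_le (a := β * avg (lineMeasure K) M x) (b := β * l)
        (by positivity) (by gcongr)
      rw [hlm.tanh_eq hβ, ← hEL x] at ht
      have h3 : 0 ≤ 1 - M x ^ 2 := by nlinarith [hMl x, hl1.2]
      have h4 : 0 ≤ l - M (x - R) := sub_nonneg.2 (hMl _)
      calc l - M x ≤ (1 - M x ^ 2) * (β * l - β * avg (lineMeasure K) M x) := ht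
        _ = (β * (1 - M x ^ 2)) * (l - avg (lineMeasure K) M x) := by ring
        _ ≤ (β * (1 - M x ^ 2)) * (l - M (x - R)) := by gcongr
        _ ≤ κ * (l - M (x - R)) := by gcongr)
  refine ⟨l, C, lam, hlm, hlam, hC, fun x => ?_⟩
  rw [abs_sub_comm, abs_of_nonneg (sub_nonneg.2 (hMl x))]
  exact hdec x

theorem IsLineKernel.abs_integral_deriv_le (hK : IsLineKernel K R) {B : ℝ}
    (hB : ∀ z, |deriv K z| ≤ B) {g : ℝ → ℝ} {S : ℝ} (hS : ∀ z, |z| ≤ R → |g z| ≤ S) :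
    |∫ z, deriv K z * g z| ≤ 2 * R * B * S := by
  have e : ∫ z, deriv K z * g z = ∫ z in Icc (-R) R, deriv K z * g z := by
    rw [setIntegral_eq_integral_of_forall_compl_eq_zero]
    intro z hz
    rw [mem_Icc, ← abs_le, not_le] at hz
    rw [hK.deriv_eq_zero hz, zero_mul]
  have hB0 : 0 ≤ B := (abs_nonneg _).trans (hB 0)
  rw [e, ← Real.norm_eq_abs]
  refine (norm_setIntegral_le_of_norm_le_const (C := B * S) (by simp) fun z hz => ?_).trans_eq ?_
  · rw [Real.norm_eq_abs, abs_mul]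
    exact mul_le_mul (hB z) (hS z (abs_le.2 hz)) (abs_nonneg _) hB0
  · rw [Real.volume_real_Icc_of_le (by linarith [hK.pos])]; ring

/-- The front is almost everywhere equal to a profile. -/
theorem IsFront.exists_profile (hβ : 1 < β) (hK : IsLineKernel K R)
    (hl : IsPositiveMinimizer β mβ) {m : ℝ → ℝ} (hm : IsFront β mβ K m) :
    ∃ M P P₂ l l' c C lam, m =ᵐ[volume] M ∧ IsProfile β K M P P₂ l l' c C lam := by
  obtain ⟨l, C₁, lam₁, hl1, hlam₁, hC₁, hdec₁⟩ := hm.exists_decay hβ hK hl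
  obtain ⟨l', C₂, lam₂, hl2, hlam₂, hC₂, hdec₂⟩ := (hm.neg_comp_neg hK).exists_decay hβ hK hl
  rw [smoothFront_neg_comp_neg hK] at hdec₂
  have hmono := hm.monotone_smoothFront hβ hK hl
  have hEL := hm.smoothFront_eq hβ hK hl
  have hMc := hm.continuous_smoothFront hK
  have hae := hm.ae_eq_smoothFront hβ hK hl
  set M := smoothFront β K m with hM
  have hMb : ∀ x, |M x| ≤ 1 := abs_smoothFront_le_one m
  obtain ⟨B, hB0, hBK, hBK'⟩ := hK.exists_bound
  have hR := hK.pos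
  -- The derivative in M = tanh(β K⋆M) is placed on the kernel, so continuity of M is enough.
  set P : ℝ → ℝ := fun x => (1 - M x ^ 2) * (β * ∫ z, deriv K z * M (x - z)) with hP
  have hMd : ∀ x, HasDerivAt M (P x) x := fun x => by
    have h1 := (hK.hasDerivAt_avg_left hMc.measurable hMb x).const_mul β
    have h2 := (hasDerivAt_tanh (β * avg (lineMeasure K) M x)).comp x h1
    rw [← hEL x] at h2
    refine h2.congr_of_eventuallyEq (Eventually.of_forall fun y => ?_)
    exact hEL y
  have hPc : Continuous P :=
    (continuous_const.sub (hMc.pow 2)).mul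
      (continuous_const.mul (hK.continuous_avg_deriv hMc.measurable hMb))
  have hPd : P = deriv M := funext fun x => (hMd x).deriv.symm
  have hP0 : ∀ x, 0 ≤ P x := fun x => by rw [hPd]; exact hmono.deriv_nonneg
  have hMs0 : ∀ x, 0 ≤ 1 - M x ^ 2 := fun x => by
    have := hMb x; rw [abs_le] at this; nlinarith [this.1, this.2]
  have hMs1 : ∀ x, 1 - M x ^ 2 ≤ 1 := fun x => by nlinarith [sq_nonneg (M x)]
  have hPle : ∀ x S, |∫ z, deriv K z * M (x - z)| ≤ S → P x ≤ β * S := fun x S h => by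
    have hS : 0 ≤ S := (abs_nonneg _).trans h
    calc P x ≤ (1 - M x ^ 2) * (β * S) := by
          refine mul_le_mul_of_nonneg_left ?_ (hMs0 x)
          exact mul_le_mul_of_nonneg_left ((le_abs_self _).trans h) (by linarith)
      _ ≤ 1 * (β * S) := mul_le_mul_of_nonneg_right (hMs1 x) (by positivity)
      _ = β * S := one_mul _
  have hPb : ∀ x, |P x| ≤ β * (2 * R * B * 1) := fun x => by
    rw [abs_of_nonneg (hP0 x)]
    exact hPle x _ (hK.abs_integral_deriv_le hBK' fun z _ => hMb _)
  -- Now that M is differentiable, the derivative of K⋆M is also K⋆P, and uniqueness of the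
  -- derivative gives the linear equation for P.
  have hPeq : ∀ x, P x = β * (1 - M x ^ 2) * avg (lineMeasure K) P x := fun x => by
    have h1 := hK.hasDerivAt_avg_right hMb hMd hPc.measurable hPb x
    have h2 := (hK.hasDerivAt_avg_left hMc.measurable hMb x).unique h1
    simp only [hP]
    rw [h2]
    ring
  have hMs : ∀ x, 0 < 1 - M x ^ 2 := fun x => by rw [hEL x]; exact one_sub_tanh_sq_pos _
  -- A zero of P propagates through its linear equation, so P would vanish identically and M would
  -- be constant. That is incompatible with limits of opposite sign.
  have hPpos : ∀ x, 0 < P x := by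
    by_contra! hcon
    obtain ⟨x₀, hx₀⟩ := hcon
    have hz := hK.eq_zero_of_propagation hPc hP0 (fun x hx => by
      have := hPeq x
      rw [hx] at this
      have h2 : β * (1 - M x ^ 2) ≠ 0 := mul_ne_zero (by linarith) (hMs x).ne'
      exact (mul_eq_zero.1 this.symm).resolve_left h2) (le_antisymm hx₀ (hP0 x₀))
    have hconst : ∀ x, M x = M 0 := fun x =>
      is_const_of_deriv_eq_zero (fun x => (hMd x).differentiableAt)
        (fun x => by rw [(hMd x).deriv, hz x]) x 0
    obtain ⟨a, ha, hat⟩ := hm.tendsto_smoothFront hβ hK hl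
    obtain ⟨a', ha', hat'⟩ := (hm.neg_comp_neg hK).tendsto_smoothFront hβ hK hl
    rw [smoothFront_neg_comp_neg hK, ← hM] at hat'
    rw [← hM] at hat
    have t1 : Tendsto M atTop (𝓝 (M 0)) := tendsto_const_nhds.congr fun x => (hconst x).symm
    have t2 : Tendsto (fun x => -M (-x)) atTop (𝓝 (-M 0)) :=
      tendsto_const_nhds.congr fun x => by rw [hconst (-x)]
    have h1 := tendsto_nhds_unique hat t1
    have h2 := tendsto_nhds_unique hat' t2
    linarith [ha.1, ha'.1]
  set P₂ : ℝ → ℝ := fun x => β * ((-(2 * M x * P x)) * avg (lineMeasure K) P x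
    + (1 - M x ^ 2) * ∫ z, deriv K z * P (x - z)) with hP₂
  have hPd2 : ∀ x, HasDerivAt P (P₂ x) x := fun x => by
    have h1 := hK.hasDerivAt_avg_left hPc.measurable hPb x
    have h2 := (((hMd x).pow 2).const_sub 1).mul h1 |>.const_mul β
    have h3 : P = fun x => β * ((1 - M x ^ 2) * avg (lineMeasure K) P x) := by
      funext x; rw [hPeq x]; ring
    rw [h3]
    rw [← h3]
    refine (h2.congr_of_eventuallyEq (Eventually.of_forall fun y => ?_)).congr_deriv ?_
    · exact congrFun h3 y
    · simp only [hP₂, Nat.cast_ofNat, Nat.add_one_sub_one, pow_one, Pi.pow_apply]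
  have hP₂c : Continuous P₂ := by
    have h1 := hK.continuous_avg hPc.measurable hPb
    have h2 := hK.continuous_avg_deriv hPc.measurable hPb
    fun_prop
  set lam := min lam₁ lam₂ with hlam
  have hlam0 : 0 < lam := lt_min hlam₁ hlam₂
  set C₀ := max (max C₁ C₂) 2 with hC₀
  have hC₀1 : C₁ ≤ C₀ := (le_max_left _ _).trans (le_max_left _ _)
  have hC₀2 : C₂ ≤ C₀ := (le_max_right _ _).trans (le_max_left _ _)
  have hC₀3 : 2 ≤ C₀ := le_max_right _ _
  -- The two ends come with their own rates and constants. The smaller rate serves for both: on the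
  -- half line where the exponential is at least 1, the trivial bound 2 ≤ C₀ takes over.
  have side : ∀ {e C' lam' : ℝ} (x : ℝ), 0 ≤ C' → lam ≤ lam' → C' ≤ C₀ → e ≤ 2 →
      e ≤ C' * Real.exp (-lam' * x) → e ≤ C₀ * Real.exp (-lam * x) := by
    intro e C' lam' x hC' hlam' hCC he2 he
    rcases le_total 0 x with hx | hx
    · refine he.trans (mul_le_mul hCC (Real.exp_le_exp.2 (by nlinarith)) (Real.exp_pos _).le
        (by linarith))
    · refine he2.trans (hC₀3.trans (le_mul_of_one_le_right (by linarith) (Real.one_le_exp ?_)))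
      nlinarith
  have hl1' := hl1.mem_Ioo hβ
  have hl2' := hl2.mem_Ioo hβ
  have hd1 : ∀ x, |M x - l| ≤ C₀ * Real.exp (-lam * x) := fun x =>
    side x hC₁ (min_le_left _ _) hC₀1 (by
      have := abs_le.1 (hMb x)
      rw [abs_le]; constructor <;> linarith [this.1, this.2, hl1'.1, hl1'.2]) (hdec₁ x)
  have hd2 : ∀ x, |M x + l'| ≤ C₀ * Real.exp (lam * x) := fun x => by
    have h : |-M (- -x) - l'| ≤ C₂ * Real.exp (-lam₂ * -x) := hdec₂ (-x)
    rw [neg_neg, ← abs_neg, show -(-M x - l') = M x + l' by ring] at h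
    have := side (-x) hC₂ (min_le_right _ _) hC₀2 (by
      have := abs_le.1 (hMb x)
      rw [abs_le]; constructor <;> linarith [this.1, this.2, hl2'.1, hl2'.2]) h
    rwa [show -lam * -x = lam * x by ring] at this
  -- The derivative of the kernel integrates to zero against constants, so the limiting value can be
  -- subtracted from M and the decay of M passes to P.
  have hsub : ∀ a x, |a| ≤ 1 → ∫ z, deriv K z * M (x - z) = ∫ z, deriv K z * (M (x - z) - a) := by
    intro a x ha
    have hb : ∀ x, |M x - a| ≤ 2 := fun x => (abs_sub _ _).trans (by linarith [hMb x])
    have h1 := hK.hasDerivAt_avg_left (hMc.sub continuous_const).measurable hb x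
    have h2 := (hK.hasDerivAt_avg_left hMc.measurable hMb x).sub_const a
    have e : avg (lineMeasure K) (fun x => M x - a) = fun x => avg (lineMeasure K) M x - a := by
      have := hK.isProbabilityMeasure
      funext x
      unfold avg
      rw [integral_sub (hK.integrable_shift hMc.measurable hMb x) (integrable_const _)]
      simp
    rw [← e] at h2
    exact h2.unique h1
  have hPexp : ∀ x, P x ≤ β * (2 * R * B * (C₀ * Real.exp (lam * R))) * Real.exp (-lam * |x|) := by
    intro x
    have hh : ∀ S, |∫ z, deriv K z * M (x - z)| ≤ 2 * R * B * (C₀ * Real.exp (lam * R) * S) →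
        P x ≤ β * (2 * R * B * (C₀ * Real.exp (lam * R))) * S := fun S h => by
      refine (hPle x _ h).trans_eq (by ring)
    refine hh _ ?_
    rcases le_total 0 x with hx | hx
    · rw [hsub l x (by rw [abs_of_pos hl1'.1]; exact hl1'.2.le)]
      refine hK.abs_integral_deriv_le hBK' fun z hz => (hd1 _).trans ?_
      rw [mul_assoc, ← Real.exp_add, abs_of_nonneg hx]
      refine mul_le_mul_of_nonneg_left (Real.exp_le_exp.2 ?_) (by linarith)
      nlinarith [(abs_le.1 hz).2]
    · rw [hsub (-l') x (by rw [abs_neg, abs_of_pos hl2'.1]; exact hl2'.2.le)]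
      refine hK.abs_integral_deriv_le hBK' fun z hz => ?_
      rw [sub_neg_eq_add]
      refine (hd2 _).trans ?_
      rw [mul_assoc, ← Real.exp_add, abs_of_nonpos hx]
      refine mul_le_mul_of_nonneg_left (Real.exp_le_exp.2 ?_) (by linarith)
      nlinarith [(abs_le.1 hz).1]
  set C₃ := β * (2 * R * B * (C₀ * Real.exp (lam * R))) with hC₃
  have hC₃0 : 0 ≤ C₃ := by positivity
  have hβ0 : 0 ≤ β := by linarith
  have hPshift : ∀ x z, |z| ≤ R → P (x - z) ≤ C₃ * Real.exp (lam * R) * Real.exp (-lam * |x|) := by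
    intro x z hz
    refine (hPexp _).trans ?_
    rw [show C₃ * Real.exp (lam * R) * Real.exp (-lam * |x|)
      = C₃ * Real.exp (lam * R + -lam * |x|) by rw [Real.exp_add]; ring]
    refine mul_le_mul_of_nonneg_left (Real.exp_le_exp.2 ?_) hC₃0
    have := abs_sub_abs_le_abs_sub x (x - z)
    rw [sub_sub_cancel] at this
    nlinarith
  set D := C₃ * Real.exp (lam * R) with hD
  have hD0 : 0 ≤ D := by positivity
  have hAb : ∀ x, |avg (lineMeasure K) P x| ≤ β * (2 * R * B * 1) := fun x =>
    hK.abs_avg_le hPb x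
  have hP₂exp : ∀ x, |P₂ x| ≤ β * (2 * C₃ * (β * (2 * R * B * 1)) + 2 * R * B * D)
      * Real.exp (-lam * |x|) := by
    intro x
    have h1 : |∫ z, deriv K z * P (x - z)| ≤ 2 * R * B * (D * Real.exp (-lam * |x|)) :=
      hK.abs_integral_deriv_le hBK' fun z hz => by
        rw [abs_of_nonneg (hP0 _)]; exact hPshift x z hz
    have h2 : |(-(2 * M x * P x)) * avg (lineMeasure K) P x|
        ≤ 2 * (C₃ * Real.exp (-lam * |x|)) * (β * (2 * R * B * 1)) := by
      rw [abs_mul, abs_neg, abs_mul, abs_mul, abs_two]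
      refine mul_le_mul ?_ (hAb x) (abs_nonneg _) (by positivity)
      rw [abs_of_nonneg (hP0 x)]
      calc 2 * |M x| * P x ≤ 2 * 1 * P x := by
            refine mul_le_mul_of_nonneg_right ?_ (hP0 x); linarith [hMb x]
        _ ≤ 2 * (C₃ * Real.exp (-lam * |x|)) := by linarith [hPexp x]
    have h3 : |(1 - M x ^ 2) * ∫ z, deriv K z * P (x - z)|
        ≤ 2 * R * B * (D * Real.exp (-lam * |x|)) := by
      rw [abs_mul, abs_of_nonneg (hMs0 x)]
      calc _ ≤ 1 * |∫ z, deriv K z * P (x - z)| :=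
            mul_le_mul_of_nonneg_right (hMs1 x) (abs_nonneg _)
        _ ≤ _ := by rw [one_mul]; exact h1
    simp only [hP₂]
    rw [abs_mul, abs_of_nonneg hβ0]
    calc _ ≤ β * (2 * (C₃ * Real.exp (-lam * |x|)) * (β * (2 * R * B * 1))
          + 2 * R * B * (D * Real.exp (-lam * |x|))) := by
          refine mul_le_mul_of_nonneg_left ((abs_add_le _ _).trans (add_le_add h2 h3)) hβ0
      _ = _ := by ring
  set C₄ := β * (2 * C₃ * (β * (2 * R * B * 1)) + 2 * R * B * D) with hC₄
  -- The bound c = tanh β comes from |K⋆M| ≤ 1 in the Euler–Lagrange equation. It keeps M uniformly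
  -- away from ±1.
  refine ⟨M, P, P₂, l, l', Real.tanh β, max (max C₀ C₃) C₄, lam, hae, ?_⟩
  have up : ∀ {y C' e : ℝ}, y ≤ C' * Real.exp e → C' ≤ max (max C₀ C₃) C₄ →
      y ≤ max (max C₀ C₃) C₄ * Real.exp e := fun h1 h2 =>
    h1.trans (mul_le_mul_of_nonneg_right h2 (Real.exp_pos _).le)
  have u0 : C₀ ≤ max (max C₀ C₃) C₄ := (le_max_left _ _).trans (le_max_left _ _)
  have u3 : C₃ ≤ max (max C₀ C₃) C₄ := (le_max_right _ _).trans (le_max_left _ _)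
  have u4 : C₄ ≤ max (max C₀ C₃) C₄ := le_max_right _ _
  exact
    { hasDerivAt := hMd
      hasDerivAt_deriv := hPd2
      continuous_deriv₂ := hP₂c
      pos := hPpos
      eq_tanh := hEL
      deriv_eq := hPeq
      abs_le := fun x => by
        have h1 := abs_le.1 (hK.abs_avg_le hMb x)
        rw [hEL x, abs_le, ← Real.tanh_neg]
        exact ⟨strictMono_tanh.monotone (by nlinarith [h1.1]),
          strictMono_tanh.monotone (by nlinarith [h1.2])⟩
      lt_one := Real.tanh_lt_one β
      deriv_le := fun x => up (hPexp x) u3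
      deriv₂_le := fun x => up (hP₂exp x) u4
      sub_le := fun x => up (hd1 x) u0
      add_le := fun x => up (hd2 x) u0
      minimizer := hl1
      minimizer' := hl2
      lam_pos := hlam0 }

end Front

end NonlocalFront

namespace NonlocalFront

/-! ### Geometry and measure of the cylinder -/

/-- The Euclidean space covering the cylinder. -/
abbrev Cover (d : ℕ) : Type := EuclideanSpace ℝ (Fin (d + 1))

section Cylinder

variable {d : ℕ} {L : ℝ}

theorem proj_add (z w : Cover d) : proj L (z + w) = proj L z + proj L w := by
  ext <;> simp [proj]

theorem proj_zero : proj L (0 : Cover d) = 0 := by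
  ext <;> simp [proj]

/-- The covering map as a homomorphism. -/
noncomputable def projHom (d : ℕ) (L : ℝ) : Cover d →+ Cyl d L where
  toFun := proj L
  map_zero' := proj_zero
  map_add' := proj_add

theorem proj_neg (z : Cover d) : proj L (-z) = -proj L z := map_neg (projHom d L) z

theorem proj_sub (z w : Cover d) : proj L (z - w) = proj L z - proj L w :=
  map_sub (projHom d L) z w

/-- Openness and surjectivity let continuity descend from periodic lifts to functions on the
cylinder. -/
theorem isOpenQuotientMap_proj : IsOpenQuotientMap (proj L : Cover d → Cyl d L) := by
  let e₁ : (Fin (d + 1) → ℝ) ≃ₜ ℝ × (Fin d → ℝ) :=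
    { toFun := fun z => (z 0, fun j => z j.succ)
      invFun := fun p => Fin.cons p.1 p.2
      left_inv := fun z => by
        funext i
        refine Fin.cases ?_ (fun j => ?_) i <;> simp
      right_inv := fun p => by simp
      continuous_toFun := by fun_prop
      continuous_invFun := by
        refine continuous_pi fun i => ?_
        refine Fin.cases ?_ (fun j => ?_) i
        · simpa using continuous_fst
        · simpa using (show Continuous fun p : ℝ × (Fin d → ℝ) => p.2 j by fun_prop) }
  have h1 := (EuclideanSpace.equiv (Fin (d + 1)) ℝ).toHomeomorph.isOpenQuotientMap
  have h2 := e₁.isOpenQuotientMap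
  have h3 : IsOpenQuotientMap (Prod.map (id : ℝ → ℝ)
      (Pi.map fun (_ : Fin d) (r : ℝ) => (r : AddCircle L))) :=
    IsOpenQuotientMap.id.prodMap (IsOpenQuotientMap.piMap fun _ =>
      QuotientAddGroup.isOpenQuotientMap_mk)
  exact h3.comp (h2.comp h1)

theorem continuous_proj : Continuous (proj L : Cover d → Cyl d L) :=
  isOpenQuotientMap_proj.continuous

theorem surjective_proj : Function.Surjective (proj L : Cover d → Cyl d L) :=
  isOpenQuotientMap_proj.surjective

theorem continuous_of_lift {φ : Cyl d L → ℝ} (h : Continuous fun z : Cover d => φ (proj L z)) :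
    Continuous φ := isOpenQuotientMap_proj.continuous_comp_iff.1 h

variable [Fact (0 < L)]

instance : (volume : Measure (Fin d → AddCircle L)).IsAddHaarMeasure :=
  inferInstanceAs (Measure.pi fun _ => (volume : Measure (AddCircle L))).IsAddHaarMeasure

instance : (volume : Measure (Cyl d L)).IsAddHaarMeasure :=
  inferInstanceAs
    ((volume : Measure ℝ).prod (volume : Measure (Fin d → AddCircle L))).IsAddHaarMeasure

instance : (volume : Measure (Cyl d L)).Regular :=
  Measure.Regular.of_sigmaCompactSpace_of_isLocallyFiniteMeasure _

instance : (volume : Measure (Cyl d L)).IsNegInvariant :=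
  Measure.IsAddHaarMeasure.isNegInvariant_of_innerRegular volume

/-- Fubini replaces a fundamental domain. For a null set N, translation invariance makes the pairs
(x, z) with x − π(z) ∈ N null, so some x = π(w) has a null set of z with π(w − z) ∈ N. Reflection in
the covering space then gives the preimage of N. -/
theorem quasiMeasurePreserving_proj :
    Measure.QuasiMeasurePreserving (proj L : Cover d → Cyl d L) volume volume := by
  have hm : Measurable (proj L : Cover d → Cyl d L) := continuous_proj.measurable
  refine ⟨hm, Measure.AbsolutelyContinuous.mk fun N hN hN0 => ?_⟩
  rw [Measure.map_apply hm hN]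
  have hmeas : Measurable fun p : Cyl d L × Cover d => p.1 - proj L p.2 :=
    measurable_fst.sub (hm.comp measurable_snd)
  have h1 : ((volume : Measure (Cyl d L)).prod (volume : Measure (Cover d)))
      ((fun p : Cyl d L × Cover d => p.1 - proj L p.2) ⁻¹' N) = 0 := by
    rw [Measure.prod_apply_symm (hmeas hN)]
    refine (lintegral_congr fun z => ?_).trans lintegral_zero
    have := measure_preimage_add_right (volume : Measure (Cyl d L)) (-proj L z) N
    rw [← hN0, ← this]
    congr 1
  rw [Measure.measure_prod_null (hmeas hN)] at h1
  obtain ⟨x, hx⟩ := h1.exists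
  obtain ⟨w, rfl⟩ := surjective_proj x
  have h4 : volume ((fun z : Cover d => w - z) ⁻¹' (proj L ⁻¹' N)) = 0 := by
    have h5 : (fun z : Cover d => w - z) ⁻¹' (proj L ⁻¹' N)
        = (fun z : Cover d => proj L w - proj L z) ⁻¹' N := by
      ext z; simp [proj_sub]
    rw [h5]; exact hx
  rw [← h4]
  exact ((Measure.measurePreserving_sub_left (volume : Measure (Cover d)) w).measure_preimage
    (hm hN).nullMeasurableSet).symm

/-- Integrals over balls of the covering space are controlled by integrals over the cylinder. -/
theorem exists_lintegral_closedBall_le (r : ℝ) (hr : 0 < r) :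
    ∃ C : ℝ≥0∞, C ≠ ⊤ ∧ ∀ F : Cyl d L → ℝ≥0∞, Measurable F →
      ∫⁻ z in Metric.closedBall (0 : Cover d) r, F (proj L z) ≤ C * ∫⁻ x, F x := by
  have hm : Measurable (proj L : Cover d → Cyl d L) := continuous_proj.measurable
  set B := Metric.closedBall (0 : Cover d) r with hB
  set B' := Metric.closedBall (0 : Cover d) (r + r) with hB'
  set S : Set (Cyl d L) := proj L '' B with hS
  have hSc : IsCompact S := (isCompact_closedBall _ _).image continuous_proj
  have hS0 : volume S ≠ 0 := by
    intro h0
    have h1 := quasiMeasurePreserving_proj.preimage_null h0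
    have h2 : volume B = 0 := measure_mono_null (subset_preimage_image _ _) h1
    have h3 : 0 < volume B := Metric.measure_closedBall_pos _ _ hr
    exact h3.ne' h2
  refine ⟨volume B' / volume S, ENNReal.div_ne_top (isCompact_closedBall _ _).measure_ne_top hS0,
    fun F hF => ?_⟩
  set I := ∫⁻ z in B, F (proj L z) with hI
  -- For each x in the image of the ball, a translation of the covering space carries B into B'.
  -- Averaging over the image, which has positive measure, replaces the count of sheets by the ratio
  -- of two volumes.
  have h1 : ∀ x ∈ S, I ≤ ∫⁻ z in B', F (proj L z - x) := by
    rintro x ⟨w, hw, rfl⟩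
    rw [hI, ← lintegral_indicator measurableSet_closedBall,
      ← lintegral_indicator measurableSet_closedBall,
      ← lintegral_sub_right_eq_self (μ := (volume : Measure (Cover d))) _ w]
    refine lintegral_mono fun z => ?_
    by_cases hz : z - w ∈ B
    · rw [indicator_of_mem hz]
      have hz' : z ∈ B' := by
        rw [hB, mem_closedBall_zero_iff] at hz hw
        rw [hB', mem_closedBall_zero_iff]
        calc ‖z‖ = ‖(z - w) + w‖ := by rw [sub_add_cancel]
          _ ≤ _ := (norm_add_le _ _).trans (add_le_add hz hw)
      rw [indicator_of_mem hz', proj_sub]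
    · rw [indicator_of_notMem hz]; exact zero_le
  have h2 : volume S * I ≤ ∫⁻ x, ∫⁻ z in B', F (proj L z - x) :=
    calc volume S * I = ∫⁻ _ in S, I := by
          rw [lintegral_const, Measure.restrict_apply MeasurableSet.univ, univ_inter, mul_comm]
      _ ≤ ∫⁻ x in S, ∫⁻ z in B', F (proj L z - x) :=
          setLIntegral_mono' hSc.measurableSet fun x hx => h1 x hx
      _ ≤ _ := setLIntegral_le_lintegral _ _
  have h3 : ∫⁻ x, ∫⁻ z in B', F (proj L z - x) = volume B' * ∫⁻ x, F x := by
    have hF' : Measurable (Function.uncurry fun (x : Cyl d L) (z : Cover d) =>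
        F (proj L z - x)) := hF.comp ((hm.comp measurable_snd).sub measurable_fst)
    rw [lintegral_lintegral_swap hF'.aemeasurable]
    simp_rw [lintegral_sub_left_eq_self (μ := (volume : Measure (Cyl d L)))]
    rw [lintegral_const, Measure.restrict_apply MeasurableSet.univ, univ_inter, mul_comm]
  rw [h3] at h2
  rw [ENNReal.mul_comm_div, ← mul_div_assoc, ENNReal.le_div_iff_mul_le (Or.inl hS0)
    (Or.inl hSc.measure_ne_top), mul_comm]
  exact h2

theorem locallyIntegrable_lift {u : Cyl d L → ℝ} (hu : LocallyIntegrable u) :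
    LocallyIntegrable fun z : Cover d => u (proj L z) := by
  have hm : Measurable (proj L : Cover d → Cyl d L) := continuous_proj.measurable
  have hae := hu.aestronglyMeasurable
  have haez : AEStronglyMeasurable (fun z : Cover d => u (proj L z)) volume :=
    hae.comp_quasiMeasurePreserving quasiMeasurePreserving_proj
  rw [locallyIntegrable_iff]
  intro k hk
  obtain ⟨r, hr⟩ := hk.isBounded.subset_closedBall (0 : Cover d)
  have hr' : k ⊆ Metric.closedBall (0 : Cover d) (max r 1) :=
    hr.trans (Metric.closedBall_subset_closedBall (le_max_left _ _))
  refine IntegrableOn.mono_set ?_ hr'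
  obtain ⟨C, hC, hle⟩ := exists_lintegral_closedBall_le (d := d) (L := L) (max r 1)
    (lt_max_of_lt_right one_pos)
  set B := Metric.closedBall (0 : Cover d) (max r 1) with hB
  have hSc : IsCompact (proj L '' B) := (isCompact_closedBall _ _).image continuous_proj
  refine ⟨haez.restrict, ?_⟩
  rw [hasFiniteIntegral_iff_enorm]
  have h1 := hle ((proj L '' B).indicator fun x => ‖hae.mk u x‖ₑ)
    (hae.stronglyMeasurable_mk.enorm.indicator hSc.measurableSet)
  have h2 : ∫⁻ z in B, ‖u (proj L z)‖ₑ
      = ∫⁻ z in B, (proj L '' B).indicator (fun x => ‖hae.mk u x‖ₑ) (proj L z) := by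
    refine setLIntegral_congr_fun_ae measurableSet_closedBall ?_
    filter_upwards [quasiMeasurePreserving_proj.ae hae.ae_eq_mk] with z hz hzB
    rw [indicator_of_mem (mem_image_of_mem _ hzB), hz]
  rw [h2]
  refine h1.trans_lt (ENNReal.mul_lt_top hC.lt_top ?_)
  rw [lintegral_indicator hSc.measurableSet]
  have h3 := hu.integrableOn_isCompact hSc
  have h4 : ∫⁻ x in proj L '' B, ‖hae.mk u x‖ₑ = ∫⁻ x in proj L '' B, ‖u x‖ₑ := by
    refine lintegral_congr_ae (ae_restrict_of_ae ?_)
    filter_upwards [hae.ae_eq_mk] with x hx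
    rw [hx]
  rw [h4]
  exact h3.2

/-! ### Convolution with smooth kernels -/

/-- A smooth even compactly supported probability density. -/
structure IsSmoothKernel (J : Cover d → ℝ) : Prop where
  smooth : ContDiff ℝ ∞ J
  compactSupport : HasCompactSupport J
  nonneg : ∀ x, 0 ≤ J x
  even : ∀ x, J (-x) = J x
  integral_eq_one : ∫ x, J x = 1

theorem IsInteractionKernel.isSmoothKernel {J : Cover d → ℝ} (h : IsInteractionKernel J) :
    IsSmoothKernel J :=
  ⟨h.smooth, h.compactSupport, h.nonneg, fun x => h.radial _ _ (norm_neg x), h.integral_eq_one⟩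

/-- The measure on the cylinder carried by a kernel. -/
noncomputable def kernelMeasure (L : ℝ) (J : Cover d → ℝ) : Measure (Cyl d L) :=
  ((volume : Measure (Cover d)).withDensity fun z => ENNReal.ofReal (J z)).map (proj L)

variable {J : Cover d → ℝ}

theorem IsSmoothKernel.continuous (hJ : IsSmoothKernel J) : Continuous J := hJ.smooth.continuous

theorem IsSmoothKernel.integrable (hJ : IsSmoothKernel J) : Integrable J :=
  hJ.continuous.integrable_of_hasCompactSupport hJ.compactSupport

theorem IsSmoothKernel.measurable_ofReal (hJ : IsSmoothKernel J) :
    Measurable fun z => ENNReal.ofReal (J z) := hJ.continuous.measurable.ennreal_ofReal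

theorem IsSmoothKernel.isProbabilityMeasure (hJ : IsSmoothKernel J) :
    IsProbabilityMeasure (kernelMeasure L J) := by
  have : IsProbabilityMeasure
      ((volume : Measure (Cover d)).withDensity fun z => ENNReal.ofReal (J z)) := ⟨by
    rw [withDensity_apply _ MeasurableSet.univ, Measure.restrict_univ,
      ← ofReal_integral_eq_lintegral_ofReal hJ.integrable (ae_of_all _ hJ.nonneg),
      hJ.integral_eq_one, ENNReal.ofReal_one]⟩
  exact Measure.isProbabilityMeasure_map continuous_proj.measurable.aemeasurable

theorem kernelMeasure_absolutelyContinuous : kernelMeasure L J ≪ volume :=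
  ((withDensity_absolutelyContinuous _ _).map continuous_proj.measurable).trans
    quasiMeasurePreserving_proj.absolutelyContinuous

theorem IsSmoothKernel.isNegInvariant (hJ : IsSmoothKernel J) :
    (kernelMeasure L J).IsNegInvariant := ⟨by
  have hm : Measurable (proj L : Cover d → Cyl d L) := continuous_proj.measurable
  ext s hs
  have hs' : MeasurableSet (Neg.neg ⁻¹' s : Set (Cyl d L)) := hs.preimage measurable_neg
  change (kernelMeasure L J).map Neg.neg s = _
  rw [Measure.map_apply measurable_neg hs, kernelMeasure, Measure.map_apply hm hs',
    Measure.map_apply hm hs, withDensity_apply _ (hm hs'), withDensity_apply _ (hm hs),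
    ← lintegral_indicator (hm hs'), ← lintegral_indicator (hm hs),
    ← lintegral_neg_eq_self (μ := (volume : Measure (Cover d)))]
  refine lintegral_congr fun z => ?_
  have hz : -z ∈ proj L ⁻¹' (Neg.neg ⁻¹' s) ↔ z ∈ proj L ⁻¹' s := by
    simp [proj_neg]
  by_cases h : z ∈ proj L ⁻¹' s
  · rw [indicator_of_mem (hz.2 h), indicator_of_mem h, hJ.even]
  · rw [indicator_of_notMem (fun h' => h (hz.1 h')), indicator_of_notMem h]⟩

theorem aestronglyMeasurable_shift {u : Cyl d L → ℝ} (hu : AEStronglyMeasurable u) (x : Cyl d L) :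
    AEStronglyMeasurable (fun y => u (x - y)) (kernelMeasure L J) :=
  (hu.comp_quasiMeasurePreserving (quasiMeasurePreserving_sub_left volume x)).mono_ac
    kernelMeasure_absolutelyContinuous

theorem IsSmoothKernel.conv_eq_avg (hJ : IsSmoothKernel J) {u : Cyl d L → ℝ}
    (hu : AEStronglyMeasurable u) : conv J u = avg (kernelMeasure L J) u := by
  funext x
  rw [avg, kernelMeasure, integral_map continuous_proj.measurable.aemeasurable
    (aestronglyMeasurable_shift hu x), integral_withDensity_eq_integral_toReal_smul
    hJ.measurable_ofReal (ae_of_all _ fun _ => ENNReal.ofReal_lt_top)]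
  simp [conv, ENNReal.toReal_ofReal (hJ.nonneg _)]

theorem IsSmoothKernel.ae_mem_support (hJ : IsSmoothKernel J) :
    ∀ᵐ y ∂kernelMeasure L J, y ∈ proj L '' tsupport J := by
  have hc : IsCompact (proj L '' tsupport J) :=
    IsCompact.image (f := proj L) hJ.compactSupport continuous_proj
  refine (ae_map_iff (p := fun y => y ∈ proj L '' tsupport J)
    continuous_proj.measurable.aemeasurable hc.measurableSet).2 ?_
  rw [ae_withDensity_iff hJ.measurable_ofReal]
  refine ae_of_all _ fun z hz => mem_image_of_mem _ (subset_tsupport _ ?_)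
  intro h0
  simp [h0] at hz

theorem conv_congr_ae {u v : Cyl d L → ℝ} (h : u =ᵐ[volume] v) : conv J u = conv J v := by
  funext x
  refine integral_congr_ae ?_
  have h1 := quasiMeasurePreserving_proj.ae ((quasiMeasurePreserving_sub_left volume x).ae h)
  filter_upwards [h1] with z hz
  rw [hz]

theorem IsSmoothKernel.freeEnergy_eq (hJ : IsSmoothKernel J) (β mβ : ℝ) {m : Cyl d L → ℝ}
    (hm : AEStronglyMeasurable m) :
    freeEnergy β mβ J m = energy volume (kernelMeasure L J) β mβ m := by
  unfold freeEnergy energy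
  congr 2
  refine lintegral_congr fun x => ?_
  have h1 : AEMeasurable (fun y => ENNReal.ofReal ((m x - m (x - y)) ^ 2)) (kernelMeasure L J) :=
    ((aestronglyMeasurable_const.sub (aestronglyMeasurable_shift hm x)).pow
      2).aemeasurable.ennreal_ofReal
  have h2 : AEMeasurable (fun z => ENNReal.ofReal ((m x - m (x - proj L z)) ^ 2))
      ((volume : Measure (Cover d)).withDensity fun z => ENNReal.ofReal (J z)) :=
    h1.comp_aemeasurable continuous_proj.measurable.aemeasurable
  rw [kernelMeasure, lintegral_map' h1 continuous_proj.measurable.aemeasurable,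
    lintegral_withDensity_eq_lintegral_mul₀' hJ.measurable_ofReal.aemeasurable h2]
  refine lintegral_congr fun z => ?_
  simp only [Pi.mul_apply]
  rw [ENNReal.ofReal_mul (hJ.nonneg z)]

theorem freeEnergy_congr_ae (β mβ : ℝ) (hJ : IsSmoothKernel J) {m m' : Cyl d L → ℝ}
    (hm : AEStronglyMeasurable m) (h : m =ᵐ[volume] m') :
    freeEnergy β mβ J m = freeEnergy β mβ J m' := by
  have := hJ.isProbabilityMeasure (L := L)
  rw [hJ.freeEnergy_eq β mβ hm, hJ.freeEnergy_eq β mβ (hm.congr h), energy_congr_ae h]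

end Cylinder

end NonlocalFront

namespace NonlocalFront

/-! ### The marginal of the kernel -/

section Marginal

variable {d : ℕ} {J : Cover d → ℝ}

/-- The point of the covering space with given longitudinal and transversal coordinates. -/
noncomputable def coverMk (p : ℝ × (Fin d → ℝ)) : Cover d :=
  WithLp.toLp 2 (Fin.cons (α := fun _ => ℝ) p.1 p.2)

theorem coverMk_zero (p : ℝ × (Fin d → ℝ)) : coverMk p 0 = p.1 := rfl

theorem coverMk_succ (p : ℝ × (Fin d → ℝ)) (j : Fin d) : coverMk p j.succ = p.2 j := rfl

theorem measurePreserving_coverMk :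
    MeasurePreserving (coverMk (d := d)) volume volume := by
  have h1 := (volume_preserving_piFinSuccAbove (fun _ : Fin (d + 1) => ℝ) 0).symm
  have h2 := EuclideanSpace.volume_preserving_symm_measurableEquiv_toLp (Fin (d + 1))
  have h3 := h2.symm.comp h1
  have h4 : (⇑(MeasurableEquiv.toLp 2 (Fin (d + 1) → ℝ)).symm.symm ∘
      ⇑(MeasurableEquiv.piFinSuccAbove (fun _ : Fin (d + 1) => ℝ) 0).symm) = coverMk := by
    funext p
    ext i
    refine Fin.cases ?_ (fun j => ?_) i <;>
    simp [coverMk, MeasurableEquiv.piFinSuccAbove, Fin.insertNthEquiv]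
  rw [← h4]
  exact h3

/-- `coverMk` as a continuous linear map. -/
noncomputable def coverMkL (d : ℕ) : ℝ × (Fin d → ℝ) →L[ℝ] Cover d :=
  LinearMap.toContinuousLinearMap
    { toFun := coverMk
      map_add' := fun p q => by
        ext i
        refine Fin.cases ?_ (fun j => ?_) i <;> simp [coverMk]
      map_smul' := fun c p => by
        ext i
        refine Fin.cases ?_ (fun j => ?_) i <;> simp [coverMk] }

theorem abs_apply_le_norm (z : Cover d) (i : Fin (d + 1)) : |z i| ≤ ‖z‖ := by
  simpa using PiLp.norm_apply_le z i

theorem norm_snd_le_coverMk (p : ℝ × (Fin d → ℝ)) : ‖p.2‖ ≤ ‖coverMk p‖ :=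
  (pi_norm_le_iff_of_nonneg (norm_nonneg _)).2 fun j => by
    simpa [coverMk_succ] using abs_apply_le_norm (coverMk p) j.succ

theorem marginal_eq (r : ℝ) : marginal J r = ∫ y : Fin d → ℝ, J (coverMk (r, y)) := rfl

theorem exists_eq_zero_of_lt_norm (hJ : IsSmoothKernel J) :
    ∃ R, 0 < R ∧ ∀ z, R < ‖z‖ → J z = 0 := by
  obtain ⟨R, hR⟩ := hJ.compactSupport.isBounded.subset_closedBall (0 : Cover d)
  refine ⟨max R 1, lt_max_of_lt_right one_pos, fun z hz => ?_⟩
  by_contra h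
  have := hR (subset_tsupport _ h)
  rw [mem_closedBall_zero_iff] at this
  exact absurd (this.trans (le_max_left _ _)) (not_le.2 hz)

/-- Outside the transversal ball of radius R the integrand vanishes whatever the longitudinal
coordinate, so one integrable majorant serves for differentiating under the integral and for
continuity of the derivative. -/
theorem IsSmoothKernel.isLineKernel_marginal (hJ : IsSmoothKernel J) :
    ∃ R, IsLineKernel (marginal J) R := by
  obtain ⟨R, hR0, hR⟩ := exists_eq_zero_of_lt_norm hJ
  have hC1 : ContDiff ℝ 1 J := hJ.smooth.of_le (by exact_mod_cast le_top)
  have hfc : Continuous (fderiv ℝ J) := hC1.continuous_fderiv one_ne_zero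
  have hfs : HasCompactSupport (fderiv ℝ J) := hJ.compactSupport.fderiv ℝ
  obtain ⟨C, hC⟩ := hfc.bounded_above_of_compact_support hfs
  set e : Cover d := coverMk (1, 0) with he
  have hcm : Continuous (coverMk (d := d)) := (coverMkL d).continuous
  have hline : ∀ (r : ℝ) (y : Fin d → ℝ),
      HasDerivAt (fun r => J (coverMk (r, y))) (fderiv ℝ J (coverMk (r, y)) e) r := by
    intro r y
    have h1 : HasDerivAt (fun r : ℝ => coverMk (r, y)) e r := by
      have h2 : HasDerivAt (fun r : ℝ => (r, y)) ((1 : ℝ), (0 : Fin d → ℝ)) r :=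
        (hasDerivAt_id r).prodMk (hasDerivAt_const r y)
      exact (coverMkL d).hasFDerivAt.comp_hasDerivAt r h2
    exact ((hC1.differentiable one_ne_zero) _).hasFDerivAt.comp_hasDerivAt r h1
  have hout : ∀ (r : ℝ) (y : Fin d → ℝ), R < ‖y‖ → fderiv ℝ J (coverMk (r, y)) = 0 := by
    intro r y hy
    have : J =ᶠ[𝓝 (coverMk (r, y))] fun _ => 0 := by
      have ho : IsOpen {z : Cover d | R < ‖z‖} := isOpen_lt continuous_const continuous_norm
      filter_upwards [ho.mem_nhds (hy.trans_le (norm_snd_le_coverMk (r, y)))] with z hz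
      exact hR z hz
    rw [this.fderiv_eq]; simp
  set b : (Fin d → ℝ) → ℝ := (Metric.closedBall 0 R).indicator fun _ => C * ‖e‖ with hb
  have hbi : Integrable b :=
    (integrable_indicator_iff measurableSet_closedBall).2
      (integrableOn_const (isCompact_closedBall _ _).measure_ne_top)
  have hbd : ∀ r y, ‖fderiv ℝ J (coverMk (r, y)) e‖ ≤ b y := by
    intro r y
    by_cases hy : y ∈ Metric.closedBall 0 R
    · rw [hb, indicator_of_mem hy]
      exact (ContinuousLinearMap.le_opNorm _ _).trans
        (mul_le_mul_of_nonneg_right (hC _) (norm_nonneg _))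
    · rw [hb, indicator_of_notMem hy, hout r y (by simpa using hy)]; simp
  have hint : ∀ r, Integrable fun y => J (coverMk (r, y)) := by
    intro r
    refine Continuous.integrable_of_hasCompactSupport
      (hJ.continuous.comp (hcm.comp (by fun_prop))) ?_
    refine HasCompactSupport.of_support_subset_isCompact (isCompact_closedBall (0 : Fin d → ℝ) R)
      fun y hy => ?_
    by_contra h
    refine hy (hR _ ?_)
    rw [mem_closedBall_zero_iff, not_le] at h
    exact h.trans_le (norm_snd_le_coverMk (r, y))
  have hder : ∀ r, HasDerivAt (marginal J) (∫ y, fderiv ℝ J (coverMk (r, y)) e) r := by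
    intro r
    refine (hasDerivAt_integral_of_dominated_loc_of_deriv_le (bound := b) (s := univ)
      (F := fun r y => J (coverMk (r, y))) (F' := fun r y => fderiv ℝ J (coverMk (r, y)) e)
      univ_mem ?_ (hint r) ?_ (ae_of_all _ fun y r _ => hbd r y) hbi
      (ae_of_all _ fun y r _ => hline r y)).2
    · exact Eventually.of_forall fun r => (hint r).aestronglyMeasurable
    · exact ((hfc.comp (hcm.comp (by fun_prop : Continuous fun y : Fin d → ℝ =>
        (r, y)))).clm_apply continuous_const).aestronglyMeasurable
  refine ⟨R, ?_, fun r => integral_nonneg fun _ => hJ.nonneg _, fun r => ?_, ?_, hR0, fun r hr => ?_⟩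
  · rw [contDiff_one_iff_deriv]
    refine ⟨fun r => (hder r).differentiableAt, ?_⟩
    have : deriv (marginal J) = fun r => ∫ y, fderiv ℝ J (coverMk (r, y)) e :=
      funext fun r => (hder r).deriv
    rw [this]
    refine continuous_of_dominated (bound := b) (fun r => ?_)
      (fun r => ae_of_all _ fun y => hbd r y) hbi (ae_of_all _ fun y => ?_)
    · exact ((hfc.comp (hcm.comp (by fun_prop : Continuous fun y : Fin d → ℝ =>
        (r, y)))).clm_apply continuous_const).aestronglyMeasurable
    · exact (hfc.comp (hcm.comp (by fun_prop : Continuous fun r : ℝ =>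
        (r, y)))).clm_apply continuous_const
  · rw [marginal_eq, marginal_eq, ← integral_neg_eq_self]
    refine integral_congr_ae (ae_of_all _ fun y => ?_)
    have : coverMk (-r, -y) = -coverMk (r, y) := (coverMkL d).map_neg (r, y)
    change J (coverMk (-r, -y)) = J (coverMk (r, y))
    rw [this, hJ.even]
  · have h1 : Integrable (fun p => J (coverMk p)) ((volume : Measure ℝ).prod volume) :=
      (measurePreserving_coverMk (d := d)).integrable_comp_of_integrable hJ.integrable
    have h2 : ∫ p, J (coverMk (d := d) p) = ∫ z, J z := by
      rw [← (measurePreserving_coverMk (d := d)).map_eq, integral_map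
        measurePreserving_coverMk.aemeasurable hJ.continuous.aestronglyMeasurable]
    rw [hJ.integral_eq_one, Measure.volume_eq_prod, integral_prod _ h1] at h2
    exact h2
  · rw [marginal_eq]
    refine (integral_congr_ae (ae_of_all _ fun y => ?_)).trans (integral_zero _ _)
    exact hR _ (hr.trans_le (by simpa [coverMk_zero] using abs_apply_le_norm (coverMk (r, y)) 0))

/-- Fubini integrates out the transversal variables of the kernel. This is how the one-dimensional
front becomes a stationary profile on the cylinder. -/
theorem IsSmoothKernel.conv_longitudinal {L : ℝ} (hJ : IsSmoothKernel J) {g : ℝ → ℝ}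
    (hg : Measurable g) {C : ℝ} (hC : ∀ r, |g r| ≤ C) (x : Cyl d L) :
    conv J (fun x => g x.1) x = avg (lineMeasure (marginal J)) g x.1 := by
  obtain ⟨R, hK⟩ := hJ.isLineKernel_marginal
  rw [hK.avg_eq]
  set F : Cover d → ℝ := fun z => J z * g (x.1 - z 0) with hF
  have hFi : Integrable F := by
    refine hJ.integrable.mul_bdd (c := C) ?_ (ae_of_all _ fun _ => hC _)
    exact (hg.comp (measurable_const.sub (by fun_prop))).aestronglyMeasurable
  have h1 : Integrable (fun p => F (coverMk p)) ((volume : Measure ℝ).prod volume) :=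
    (measurePreserving_coverMk (d := d)).integrable_comp_of_integrable hFi
  have h2 : ∫ p, F (coverMk (d := d) p) = ∫ z, F z := by
    rw [← (measurePreserving_coverMk (d := d)).map_eq, integral_map
      measurePreserving_coverMk.aemeasurable]
    rw [measurePreserving_coverMk.map_eq]
    exact hFi.aestronglyMeasurable
  rw [Measure.volume_eq_prod] at h2
  rw [integral_prod _ h1] at h2
  refine Eq.trans ?_ (h2.symm.trans ?_)
  · rfl
  · refine integral_congr_ae (ae_of_all _ fun r => ?_)
    simp only [hF, coverMk_zero]
    rw [integral_mul_const]
    rfl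

end Marginal

end NonlocalFront

namespace NonlocalFront

/-! ### Smooth functions on the cylinder -/

section SmoothFunctions

variable {d : ℕ} {L : ℝ}

/-- `g` is the classical partial derivative of `f` in the `i`-th direction. -/
def HasPartial (i : Fin (d + 1)) (f g : Cyl d L → ℝ) : Prop :=
  ∀ x, HasDerivAt (fun h : ℝ => f (x + proj L (EuclideanSpace.single i h))) (g x) 0

/-- The periodic lift is smooth. -/
def IsSmoothFn (φ : Cyl d L → ℝ) : Prop :=
  ContDiff ℝ ∞ fun z : Cover d => φ (proj L z)

variable {i j : Fin (d + 1)} {f g φ ψ : Cyl d L → ℝ}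

theorem single_add_single (h k : ℝ) :
    EuclideanSpace.single i (h + k) = EuclideanSpace.single i h + EuclideanSpace.single i k := by
  ext j; by_cases hj : j = i <;> simp [hj]

theorem single_zero' : EuclideanSpace.single i (0 : ℝ) = 0 := by
  ext j; by_cases hj : j = i <;> simp [hj]

theorem single_eq_smul (h : ℝ) :
    EuclideanSpace.single i h = h • EuclideanSpace.single i (1 : ℝ) := by
  ext j; by_cases hj : j = i <;> simp [hj]

theorem HasPartial.hasDerivAt (hf : HasPartial i f g) (x : Cyl d L) (h : ℝ) :
    HasDerivAt (fun h : ℝ => f (x + proj L (EuclideanSpace.single i h)))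
      (g (x + proj L (EuclideanSpace.single i h))) h := by
  have h1 := hf (x + proj L (EuclideanSpace.single i h))
  rw [← sub_self h] at h1
  have h2 := h1.comp_sub_const h h
  refine h2.congr_of_eventuallyEq (Eventually.of_forall fun k => ?_)
  have : x + proj L (EuclideanSpace.single i h) + proj L (EuclideanSpace.single i (k - h))
      = x + proj L (EuclideanSpace.single i k) := by
    rw [add_assoc, ← proj_add, ← single_add_single]; congr 3; ring
  change f (x + _) = f _
  rw [this]

theorem HasPartial.partialDeriv_eq (hf : HasPartial i f g) : partialDeriv i f = g :=
  funext fun x => (hf x).deriv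

theorem HasPartial.mul (hf : HasPartial i f g) (hφ : HasPartial i φ ψ) :
    HasPartial i (fun x => f x * φ x) (fun x => g x * φ x + f x * ψ x) := fun x => by
  have := (hf x).mul (hφ x)
  simp only [single_zero', proj_zero, add_zero] at this
  exact this

theorem continuous_proj_single (i : Fin (d + 1)) :
    Continuous fun h : ℝ => proj L (EuclideanSpace.single i h : Cover d) := by
  have h1 : Continuous fun h : ℝ => h • (EuclideanSpace.single i 1 : Cover d) :=
    continuous_id.smul continuous_const
  refine (continuous_proj.comp h1).congr fun h => ?_
  rw [single_eq_smul h]; rfl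

theorem HasPartial.eq_zero_of_notMem_tsupport (hf : HasPartial i f g) {x : Cyl d L}
    (hx : x ∉ tsupport f) : g x = 0 := by
  have h1 : f =ᶠ[𝓝 x] 0 := notMem_tsupport_iff_eventuallyEq.1 hx
  have hc : Tendsto (fun h : ℝ => x + proj L (EuclideanSpace.single i h)) (𝓝 0) (𝓝 x) := by
    have : Continuous fun h : ℝ => x + proj L (EuclideanSpace.single i h) :=
      continuous_const.add (continuous_proj_single i)
    have h3 := this.tendsto 0
    simpa [single_zero', proj_zero] using h3
  have h2 : HasDerivAt (fun h : ℝ => f (x + proj L (EuclideanSpace.single i h))) 0 0 :=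
    (hasDerivAt_const (0 : ℝ) (0 : ℝ)).congr_of_eventuallyEq (hc.eventually h1)
  exact (hf x).unique h2

theorem HasPartial.hasCompactSupport (hf : HasPartial i f g) (hs : HasCompactSupport f) :
    HasCompactSupport g :=
  hs.mono' fun x hx => by
    by_contra h
    exact hx (hf.eq_zero_of_notMem_tsupport h)

theorem IsSmoothFn.continuous (hφ : IsSmoothFn φ) : Continuous φ :=
  continuous_of_lift (ContDiff.continuous hφ)

theorem IsSmoothFn.differentiable (hφ : IsSmoothFn φ) :
    Differentiable ℝ fun z : Cover d => φ (proj L z) :=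
  ContDiff.differentiable hφ (by simp)

theorem IsSmoothFn.hasDerivAt_line (hφ : IsSmoothFn φ) (z w : Cover d) (t : ℝ) :
    HasDerivAt (fun t : ℝ => φ (proj L (z + t • w)))
      (fderiv ℝ (fun z : Cover d => φ (proj L z)) (z + t • w) w) t := by
  have h1 : HasDerivAt (fun t : ℝ => z + t • w) w t := by
    simpa using ((hasDerivAt_id t).smul_const w).const_add z
  exact ((hφ.differentiable _).hasFDerivAt).comp_hasDerivAt t h1

theorem IsSmoothFn.partialDeriv_lift (hφ : IsSmoothFn φ) (z : Cover d) :
    partialDeriv i φ (proj L z)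
      = fderiv ℝ (fun z : Cover d => φ (proj L z)) z (EuclideanSpace.single i 1) := by
  have h1 := hφ.hasDerivAt_line z (EuclideanSpace.single i 1) 0
  simp only [zero_smul, add_zero] at h1
  rw [← h1.deriv, partialDeriv]
  congr 1
  funext h
  rw [single_eq_smul, proj_add]

theorem IsSmoothFn.hasPartial (hφ : IsSmoothFn φ) (i : Fin (d + 1)) :
    HasPartial i φ (partialDeriv i φ) := fun x => by
  obtain ⟨z, rfl⟩ := surjective_proj x
  have h1 := hφ.hasDerivAt_line z (EuclideanSpace.single i 1) 0
  simp only [zero_smul, add_zero] at h1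
  rw [hφ.partialDeriv_lift]
  refine h1.congr_of_eventuallyEq (Eventually.of_forall fun h => ?_)
  change φ _ = φ _
  rw [single_eq_smul, proj_add]

theorem IsSmoothFn.partialDeriv (hφ : IsSmoothFn φ) (i : Fin (d + 1)) :
    IsSmoothFn (partialDeriv i φ) := by
  have h1 : ContDiff ℝ ∞ (fderiv ℝ fun z : Cover d => φ (proj L z)) :=
    ContDiff.fderiv_right hφ (by simp)
  unfold IsSmoothFn
  simp_rw [hφ.partialDeriv_lift]
  exact h1.clm_apply contDiff_const

theorem eq_sum_single (w : Cover d) : w = ∑ i, w i • EuclideanSpace.single i (1 : ℝ) := by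
  ext j
  simp [Finset.sum_apply, Pi.single_apply]

theorem IsSmoothFn.hasDerivAt_line' (hφ : IsSmoothFn φ) (x : Cyl d L) (w : Cover d) (t : ℝ) :
    HasDerivAt (fun t : ℝ => φ (x + proj L (t • w)))
      (∑ i, w i * NonlocalFront.partialDeriv i φ (x + proj L (t • w))) t := by
  obtain ⟨z, rfl⟩ := surjective_proj x
  have h1 := hφ.hasDerivAt_line z w t
  have h2 : fderiv ℝ (fun z : Cover d => φ (proj L z)) (z + t • w) w
      = ∑ i, w i * NonlocalFront.partialDeriv i φ (proj L z + proj L (t • w)) := by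
    conv_lhs => rw [eq_sum_single w]
    rw [map_sum]
    refine Finset.sum_congr rfl fun i _ => ?_
    rw [← eq_sum_single, ← proj_add, hφ.partialDeriv_lift, map_smul, smul_eq_mul]
  rw [← h2]
  refine h1.congr_of_eventuallyEq (Eventually.of_forall fun h => ?_)
  change φ _ = φ _
  rw [proj_add]

theorem IsSmoothFn.partialDeriv_comm (hφ : IsSmoothFn φ) (i j : Fin (d + 1)) :
    NonlocalFront.partialDeriv i (NonlocalFront.partialDeriv j φ)
      = NonlocalFront.partialDeriv j (NonlocalFront.partialDeriv i φ) := by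
  funext x
  obtain ⟨z, rfl⟩ := surjective_proj x
  set Φ : Cover d → ℝ := fun z => φ (proj L z) with hΦ
  have hd : Differentiable ℝ (fderiv ℝ Φ) :=
    (ContDiff.fderiv_right (m := ∞) hφ (by simp)).differentiable (by simp)
  have key : ∀ i j : Fin (d + 1),
      NonlocalFront.partialDeriv i (NonlocalFront.partialDeriv j φ) (proj L z)
      = fderiv ℝ (fderiv ℝ Φ) z (EuclideanSpace.single i 1) (EuclideanSpace.single j 1) := by
    intro i j
    rw [(hφ.partialDeriv j).partialDeriv_lift]
    simp_rw [hφ.partialDeriv_lift]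
    rw [fderiv_clm_apply (hd z) (differentiableAt_const _)]
    simp [hΦ]
  rw [key, key]
  have hs : IsSymmSndFDerivAt ℝ Φ z :=
    (ContDiff.contDiffAt hφ).isSymmSndFDerivAt (by simp only [minSmoothness_of_isRCLikeNormedField]; exact WithTop.coe_le_coe.2 (le_top (a := (2 : ℕ∞))))
  exact hs _ _

theorem IsSmoothFn.mul (hφ : IsSmoothFn φ) (hψ : IsSmoothFn ψ) :
    IsSmoothFn fun x => φ x * ψ x := ContDiff.mul hφ hψ

theorem isSmoothFn_longitudinal {ζ : ℝ → ℝ} (hζ : ContDiff ℝ ∞ ζ) :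
    IsSmoothFn fun x : Cyl d L => ζ x.1 := by
  have : ContDiff ℝ ∞ fun z : Cover d => z 0 :=
    (EuclideanSpace.proj (𝕜 := ℝ) (0 : Fin (d + 1))).contDiff
  exact hζ.comp this

theorem hasPartial_longitudinal {ζ ζ' : ℝ → ℝ} (hζ : ∀ r, HasDerivAt ζ (ζ' r) r) :
    HasPartial i (fun x : Cyl d L => ζ x.1) (fun x => if i = 0 then ζ' x.1 else 0) := fun x => by
  by_cases hi : i = 0
  · subst hi
    have h1 : HasDerivAt (fun h : ℝ => x.1 + h) 1 0 := by
      simpa using (hasDerivAt_id (0 : ℝ)).const_add x.1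
    have h2 : HasDerivAt (fun h : ℝ => ζ (x.1 + h)) (ζ' x.1 * 1) 0 :=
      HasDerivAt.comp (0 : ℝ) (by simpa using hζ x.1) h1
    simpa [proj] using h2
  · have : ∀ h : ℝ, (EuclideanSpace.single i h : Cover d) 0 = 0 := fun h => by
      simp [Ne.symm hi]
    simp only [hi, if_false, Prod.fst_add]
    simp [proj, Ne.symm hi, hasDerivAt_const]

theorem IsTestFunction.isSmoothFn (hφ : IsTestFunction φ) : IsSmoothFn φ := hφ.1

theorem IsTestFunction.continuous (hφ : IsTestFunction φ) : Continuous φ := hφ.isSmoothFn.continuous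

theorem IsTestFunction.partialDeriv (hφ : IsTestFunction φ) (i : Fin (d + 1)) :
    IsTestFunction (partialDeriv i φ) :=
  ⟨hφ.isSmoothFn.partialDeriv i, (hφ.isSmoothFn.hasPartial i).hasCompactSupport hφ.2⟩

end SmoothFunctions

/-! ### Distributional derivatives and convolution on the cylinder. -/

section Conv

variable {d : ℕ} {L : ℝ} [Fact (0 < L)] {i : Fin (d + 1)} {f g φ u : Cyl d L → ℝ}
  {J : Cover d → ℝ}

theorem exists_abs_le_of_hasCompactSupport (hf : Continuous f) (hs : HasCompactSupport f) :
    ∃ C, ∀ x, |f x| ≤ C := hf.bounded_above_of_compact_support hs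

theorem IsTestFunction.memLp (hφ : IsTestFunction φ) : MemLp φ 2 volume :=
  hφ.continuous.memLp_of_hasCompactSupport hφ.2

theorem IsTestFunction.integrable_mul (hφ : IsTestFunction φ) (hu : LocallyIntegrable u) :
    Integrable fun x => u x * φ x := by
  have := hu.integrable_smul_right_of_hasCompactSupport hφ.continuous hφ.2
  simpa using this

/-- The integral of the partial derivative of a compactly supported function vanishes. -/
theorem HasPartial.integral_eq_zero (hf : HasPartial i f g) (hfc : Continuous f)
    (hgc : Continuous g) (hs : HasCompactSupport f) : ∫ x, g x = 0 := by
  have hgs := hf.hasCompactSupport hs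
  obtain ⟨C, hC⟩ := exists_abs_le_of_hasCompactSupport hgc hgs
  have hline := continuous_proj_single (L := L) i
  set K : Set (Cyl d L) := (fun p : Cyl d L × ℝ => p.1 - proj L (EuclideanSpace.single i p.2)) ''
    (tsupport g ×ˢ Icc (-1) 1) with hK
  have hKc : IsCompact K := by
    refine IsCompact.image (IsCompact.prod hgs isCompact_Icc) ?_
    exact continuous_fst.sub (hline.comp continuous_snd)
  have hder := hasDerivAt_integral_of_dominated_loc_of_deriv_le (μ := (volume : Measure (Cyl d L)))
    (F := fun (h : ℝ) (x : Cyl d L) => f (x + proj L (EuclideanSpace.single i h)))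
    (F' := fun (h : ℝ) (x : Cyl d L) => g (x + proj L (EuclideanSpace.single i h)))
    (x₀ := (0 : ℝ)) (s := Icc (-1) 1) (bound := K.indicator fun _ => C)
    (Icc_mem_nhds (by norm_num) (by norm_num))
    (Eventually.of_forall fun h => (hfc.comp (continuous_id.add
      continuous_const)).aestronglyMeasurable)
    (by simpa [single_zero', proj_zero] using hfc.integrable_of_hasCompactSupport hs)
    (hgc.comp (continuous_id.add continuous_const)).aestronglyMeasurable
    (ae_of_all _ fun x h hh => by
      by_cases hx : x + proj L (EuclideanSpace.single i h) ∈ tsupport g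
      · have : x ∈ K := ⟨(x + proj L (EuclideanSpace.single i h), h), ⟨hx, hh⟩, by simp⟩
        rw [indicator_of_mem this]
        exact hC _
      · rw [image_eq_zero_of_notMem_tsupport hx, norm_zero]
        exact indicator_nonneg (fun _ _ => (abs_nonneg _).trans (hC 0)) _)
    ((integrable_indicator_iff hKc.measurableSet).2
      (integrableOn_const hKc.measure_ne_top))
    (ae_of_all _ fun x h _ => hf.hasDerivAt x h)
  have hconst : (fun h : ℝ => ∫ x : Cyl d L, f (x + proj L (EuclideanSpace.single i h)))
      = fun _ => ∫ x : Cyl d L, f x := by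
    funext h
    exact integral_add_right_eq_self f _
  have h2 := hder.2
  rw [hconst] at h2
  have h3 := h2.unique (hasDerivAt_const _ _)
  simpa [single_zero', proj_zero] using h3

/-- Classical partial derivatives are distributional ones. -/
theorem HasPartial.isWeakPartial (hf : HasPartial i f g) (hfc : Continuous f)
    (hgc : Continuous g) : IsWeakPartial i f g := by
  refine ⟨hfc.locallyIntegrable, hgc.locallyIntegrable, fun φ hφ => ?_⟩
  have h1 := (hf.mul (hφ.isSmoothFn.hasPartial i)).integral_eq_zero
    (hfc.mul hφ.continuous) ((hgc.mul hφ.continuous).add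
    (hfc.mul (hφ.partialDeriv i).continuous)) hφ.2.mul_left
  rw [integral_add (hφ.integrable_mul hgc.locallyIntegrable)
    ((hφ.partialDeriv i).integrable_mul hfc.locallyIntegrable)] at h1
  linarith

theorem conv_lift (u : Cyl d L → ℝ) (z : Cover d) :
    conv J u (proj L z) = convolution J (fun z => u (proj L z)) (ContinuousLinearMap.mul ℝ ℝ)
      volume z := by
  simp [conv, convolution, proj_sub]

theorem IsSmoothKernel.isSmoothFn_conv (hJ : IsSmoothKernel J) (hu : LocallyIntegrable u) :
    IsSmoothFn (conv J u) := by
  unfold IsSmoothFn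
  simp_rw [conv_lift]
  exact hJ.compactSupport.contDiff_convolution_left (n := ⊤) _ hJ.smooth (locallyIntegrable_lift hu)

theorem conv_eq_zero_of_notMem {K : Set (Cyl d L)} (hu : ∀ x, x ∉ K → u x = 0) {x : Cyl d L}
    (hx : x ∉ (fun p : Cyl d L × Cover d => p.1 + proj L p.2) '' (K ×ˢ tsupport J)) :
    conv J u x = 0 := by
  refine (integral_congr_ae (ae_of_all _ fun z => ?_)).trans (integral_zero _ _)
  by_cases hz : z ∈ tsupport J
  · have : x - proj L z ∉ K := fun h => hx ⟨(x - proj L z, z), ⟨h, hz⟩, by simp⟩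
    simp [hu _ this]
  · simp [image_eq_zero_of_notMem_tsupport hz]

theorem IsSmoothKernel.isCompact_add (hJ : IsSmoothKernel J) {K : Set (Cyl d L)}
    (hK : IsCompact K) :
    IsCompact ((fun p : Cyl d L × Cover d => p.1 + proj L p.2) '' (K ×ˢ tsupport J)) :=
  (hK.prod hJ.compactSupport).image
    (continuous_fst.add (continuous_proj.comp continuous_snd))

theorem IsSmoothKernel.isTestFunction_conv (hJ : IsSmoothKernel J) (hu : LocallyIntegrable u)
    (hs : HasCompactSupport u) : IsTestFunction (conv J u) :=
  ⟨hJ.isSmoothFn_conv hu, HasCompactSupport.intro (hJ.isCompact_add hs) fun _ hx =>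
    conv_eq_zero_of_notMem (fun _ hy => image_eq_zero_of_notMem_tsupport hy) hx⟩

theorem IsSmoothKernel.integrable_mul_of_bounded (hJ : IsSmoothKernel J) (hf : Continuous f) {C : ℝ}
    (hC : ∀ x, |f x| ≤ C) (x : Cyl d L) : Integrable fun z => J z * f (x - proj L z) :=
  hJ.integrable.mul_bdd (c := C) (hf.comp (continuous_const.sub continuous_proj)).aestronglyMeasurable
    (ae_of_all _ fun _ => hC _)

theorem IsSmoothKernel.hasPartial_conv (hJ : IsSmoothKernel J) (hf : HasPartial i f g)
    (hfc : Continuous f) (hgc : Continuous g) {C C' : ℝ} (hC : ∀ x, |f x| ≤ C)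
    (hC' : ∀ x, |g x| ≤ C') : HasPartial i (conv J f) (conv J g) := fun x => by
  have hder := hasDerivAt_integral_of_dominated_loc_of_deriv_le (μ := (volume : Measure (Cover d)))
    (F := fun (h : ℝ) z => J z * f (x + proj L (EuclideanSpace.single i h) - proj L z))
    (F' := fun (h : ℝ) z => J z * g (x + proj L (EuclideanSpace.single i h) - proj L z))
    (x₀ := (0 : ℝ)) (s := univ) (bound := fun z => J z * C') univ_mem
    (Eventually.of_forall fun h => (hJ.integrable_mul_of_bounded hfc hC _).aestronglyMeasurable)
    (hJ.integrable_mul_of_bounded hfc hC _)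
    (hJ.integrable_mul_of_bounded hgc hC' _).aestronglyMeasurable
    (ae_of_all _ fun z h _ => by
      rw [Real.norm_eq_abs, abs_mul, abs_of_nonneg (hJ.nonneg z)]
      exact mul_le_mul_of_nonneg_left (hC' _) (hJ.nonneg z))
    (hJ.integrable.mul_const _)
    (ae_of_all _ fun z h _ => by
      have h1 := (hf.hasDerivAt (x - proj L z) h).const_mul (J z)
      have e : ∀ h : ℝ, x - proj L z + proj L (EuclideanSpace.single i h)
        = x + proj L (EuclideanSpace.single i h) - proj L z := fun h => by abel
      simp_rw [e] at h1
      exact h1)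
  have h2 := hder.2
  simp only [single_zero', proj_zero, add_zero] at h2
  exact h2

theorem IsSmoothKernel.partialDeriv_conv (hJ : IsSmoothKernel J) (hφ : IsTestFunction φ) :
    partialDeriv i (conv J φ) = conv J (partialDeriv i φ) := by
  obtain ⟨C, hC⟩ := exists_abs_le_of_hasCompactSupport hφ.continuous hφ.2
  obtain ⟨C', hC'⟩ := exists_abs_le_of_hasCompactSupport (hφ.partialDeriv i).continuous
    (hφ.partialDeriv i).2
  exact (hJ.hasPartial_conv (hφ.isSmoothFn.hasPartial i) hφ.continuous
    (hφ.partialDeriv i).continuous hC hC').partialDeriv_eq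

theorem IsSmoothKernel.memLp_conv (hJ : IsSmoothKernel J) (hu : MemLp u 2 volume) :
    MemLp (conv J u) 2 volume := by
  have := hJ.isProbabilityMeasure (L := L)
  rw [hJ.conv_eq_avg hu.1]
  exact memLp_avg hu

theorem IsSmoothKernel.eLpNorm_conv_le (hJ : IsSmoothKernel J) (hu : AEStronglyMeasurable u) :
    eLpNorm (conv J u) 2 volume ≤ eLpNorm u 2 volume := by
  have := hJ.isProbabilityMeasure (L := L)
  rw [hJ.conv_eq_avg hu]
  exact eLpNorm_avg_le hu

theorem IsSmoothKernel.integral_mul_conv_comm (hJ : IsSmoothKernel J) {w : Cyl d L → ℝ}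
    (hu : MemLp u 2 volume) (hw : MemLp w 2 volume) :
    ∫ x, w x * conv J u x = ∫ x, conv J w x * u x := by
  have := hJ.isProbabilityMeasure (L := L)
  have := hJ.isNegInvariant (L := L)
  rw [hJ.conv_eq_avg hu.1, hJ.conv_eq_avg hw.1]
  exact integral_mul_avg_comm hu hw

theorem locallyIntegrable_of_memLp (hu : MemLp u 2 volume) : LocallyIntegrable u :=
  hu.locallyIntegrable (by norm_num)

/-- Convolution commutes with distributional derivatives. -/
theorem IsWeakPartial.convolve (hJ : IsSmoothKernel J) (h : IsWeakPartial i u g)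
    (hu : MemLp u 2 volume) (hg : MemLp g 2 volume) :
    IsWeakPartial i (conv J u) (conv J g) := by
  refine ⟨locallyIntegrable_of_memLp (hJ.memLp_conv hu),
    locallyIntegrable_of_memLp (hJ.memLp_conv hg), fun φ hφ => ?_⟩
  have h1 := h.2.2 _ (hJ.isTestFunction_conv hφ.continuous.locallyIntegrable hφ.2)
  rw [hJ.partialDeriv_conv hφ] at h1
  rw [hJ.integral_mul_conv_comm (hφ.partialDeriv i).memLp hu,
    hJ.integral_mul_conv_comm hφ.memLp hg] at h1
  exact h1

end Conv

/-! ### Mollification -/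

section Mollifier

variable {d : ℕ} {L : ℝ}

/-- The bump functions used for mollification. -/
noncomputable def mollBump (d n : ℕ) : ContDiffBump (0 : Cover d) :=
  ⟨1 / (2 * ((n : ℝ) + 1)), 1 / ((n : ℝ) + 1), by positivity, by
    have : (0 : ℝ) < (n : ℝ) + 1 := by positivity
    apply one_div_lt_one_div_of_lt this
    linarith⟩

/-- A sequence of mollifiers. -/
noncomputable def moll (d n : ℕ) : Cover d → ℝ := (mollBump d n).normed volume

theorem isSmoothKernel_moll (d n : ℕ) : IsSmoothKernel (moll d n) :=
  ⟨(mollBump d n).contDiff_normed (n := ⊤), (mollBump d n).hasCompactSupport_normed,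
    (mollBump d n).nonneg_normed, (mollBump d n).normed_neg, (mollBump d n).integral_normed⟩

theorem norm_le_of_mem_tsupport_moll {n : ℕ} {z : Cover d} (hz : z ∈ tsupport (moll d n)) :
    ‖z‖ ≤ 1 / ((n : ℝ) + 1) := by
  rw [moll, ContDiffBump.tsupport_normed_eq, mem_closedBall_zero_iff] at hz
  exact hz

variable [Fact (0 < L)] {u : Cyl d L → ℝ}

theorem measurePreserving_sub_const (y : Cyl d L) :
    MeasurePreserving (fun x : Cyl d L => x - y) volume volume :=
  measurePreserving_sub_right volume y

/-- Continuity of translations in L² is continuity of composition with a continuous family of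
measure preserving maps, evaluated at the identity. -/
theorem tendsto_eLpNorm_translate (hu : MemLp u 2 volume) :
    Tendsto (fun y : Cyl d L => eLpNorm (fun x => u (x - y) - u x) 2 volume) (𝓝 0) (𝓝 0) := by
  let G : C(Cyl d L × Cyl d L, Cyl d L) := ⟨fun p => p.2 - p.1, by fun_prop⟩
  have hG : Continuous G.curry := G.curry.continuous
  have hmp : ∀ y, MeasurePreserving (G.curry y) volume volume := measurePreserving_sub_const
  have h1 := (continuous_const (y := hu.toLp u)).compMeasurePreservingLp hG hmp (by norm_num)
  have h2 := (h1.tendsto 0).sub (tendsto_const_nhds (x := hu.toLp u))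
  have e0 : Lp.compMeasurePreserving (G.curry 0) (hmp 0) (hu.toLp u) = hu.toLp u := by
    rw [Lp.toLp_compMeasurePreserving]
    refine MemLp.toLp_congr _ _ (ae_of_all _ fun x => ?_)
    simp [G]
  rw [e0, sub_self] at h2
  have h3 := (continuous_enorm.tendsto _).comp h2
  rw [enorm_zero] at h3
  refine h3.congr fun y => ?_
  simp only [Function.comp]
  rw [Lp.toLp_compMeasurePreserving, ← MemLp.toLp_sub, Lp.enorm_toLp]
  rfl

/-- By Jensen the squared L² error is at most the average, over the kernel measure, of the squared
L² norms of increments. Every step in that average has a lift of norm at most 1/(n + 1), so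
continuity of translations applies. -/
theorem tendsto_eLpNorm_moll (hu : MemLp u 2 volume) :
    Tendsto (fun n => eLpNorm (conv (moll d n) u - u) 2 volume) atTop (𝓝 0) := by
  have h0 := (tendsto_eLpNorm_translate hu).comp
    ((continuous_proj (d := d) (L := L)).tendsto' 0 0 proj_zero)
  rw [ENNReal.tendsto_nhds_zero] at h0 ⊢
  intro ε hε
  have h1 := h0 ε hε
  obtain ⟨r, hr, hball⟩ := Metric.eventually_nhds_iff_ball.1 h1
  obtain ⟨N, hN⟩ := exists_nat_one_div_lt hr
  filter_upwards [eventually_ge_atTop N] with n hn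
  have hJ := isSmoothKernel_moll d n
  have := hJ.isProbabilityMeasure (L := L)
  set ν := kernelMeasure L (moll d n) with hν
  have hF : AEStronglyMeasurable (incr u) ((volume : Measure (Cyl d L)).prod ν) :=
    aestronglyMeasurable_incr hu.1
  have h2 := lintegral_enorm_integral_sq_le hF
  have h3 : eLpNorm (conv (moll d n) u - u) 2 volume ^ 2
      = ∫⁻ x, ‖∫ y, incr u (x, y) ∂ν‖ₑ ^ 2 := by
    rw [eLpNorm_two_sq]
    refine lintegral_congr_ae ?_
    filter_upwards [integral_incr_prodMk hu.1 (memLp_incr (ν := ν) hu)] with x hx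
    rw [hx, Pi.sub_apply, hJ.conv_eq_avg hu.1, ← enorm_neg]
    congr 2; ring
  have h4 : ∫⁻ p, ‖incr u p‖ₑ ^ 2 ∂((volume : Measure (Cyl d L)).prod ν) ≤ ε ^ 2 := by
    rw [lintegral_prod_symm _ (hF.enorm.pow_const 2)]
    calc ∫⁻ y, (∫⁻ x, ‖incr u (x, y)‖ₑ ^ 2) ∂ν ≤ ∫⁻ _, ε ^ 2 ∂ν := by
          refine lintegral_mono_ae ?_
          filter_upwards [hJ.ae_mem_support (L := L)] with y hy
          obtain ⟨z, hz, rfl⟩ := hy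
          have hz' : z ∈ Metric.ball (0 : Cover d) r := by
            rw [mem_ball_zero_iff]
            refine ((norm_le_of_mem_tsupport_moll hz).trans ?_).trans_lt hN
            apply one_div_le_one_div_of_le (by positivity)
            have : (N : ℝ) ≤ n := by exact_mod_cast hn
            linarith
          have h5 := hball z hz'
          have h6 : eLpNorm (fun x => u (x - proj L z) - u x) 2 volume ^ 2 ≤ ε ^ 2 := by
            gcongr; exact h5
          rw [eLpNorm_two_sq] at h6
          refine le_trans (le_of_eq (lintegral_congr fun x => ?_)) h6
          rw [incr, ← enorm_neg]
          congr 2; ring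
      _ = ε ^ 2 := by simp
  have h7 := (h3.le.trans h2).trans h4
  exact (ENNReal.pow_le_pow_left_iff two_ne_zero).1 h7

theorem exists_seq_tendsto_ae_moll (hu : MemLp u 2 volume) :
    ∃ ns : ℕ → ℕ, StrictMono ns ∧
      ∀ᵐ x, Tendsto (fun n => conv (moll d (ns n)) u x) atTop (𝓝 (u x)) :=
  (tendstoInMeasure_of_tendsto_eLpNorm two_ne_zero
    (fun n => ((isSmoothKernel_moll d n).memLp_conv hu).1) hu.1
    (tendsto_eLpNorm_moll hu)).exists_seq_tendsto_ae

theorem IsSmoothKernel.abs_conv_le {J : Cover d → ℝ} (hJ : IsSmoothKernel J) {C : ℝ}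
    (hC : ∀ᵐ x, |u x| ≤ C) (x : Cyl d L) : |conv J u x| ≤ C := by
  have h1 : ∀ᵐ z : Cover d, |u (x - proj L z)| ≤ C :=
    quasiMeasurePreserving_proj.ae ((quasiMeasurePreserving_sub_left volume x).ae hC)
  have h2 : ‖conv J u x‖ ≤ ∫ z, J z * C := by
    refine norm_integral_le_of_norm_le (hJ.integrable.mul_const C) ?_
    filter_upwards [h1] with z hz
    rw [norm_mul, Real.norm_eq_abs, Real.norm_eq_abs, abs_of_nonneg (hJ.nonneg z)]
    exact mul_le_mul_of_nonneg_left hz (hJ.nonneg z)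
  rwa [integral_mul_const, hJ.integral_eq_one, one_mul] at h2

/-- It suffices to integrate over compact sets. Mollified indicators are test functions bounded by 1
with supports in one compact set, and a subsequence converges almost everywhere, so dominated
convergence applies. -/
theorem ae_eq_zero_of_integral_test_eq_zero (hu : LocallyIntegrable u)
    (h : ∀ φ : Cyl d L → ℝ, IsTestFunction φ → ∫ x, u x * φ x = 0) : u =ᵐ[volume] 0 := by
  refine ae_eq_zero_of_forall_setIntegral_isCompact_eq_zero' hu fun K hK => ?_
  set χ : Cyl d L → ℝ := K.indicator fun _ => 1 with hχ
  have hχi : Integrable χ := (integrable_indicator_iff hK.measurableSet).2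
    (integrableOn_const hK.measure_ne_top)
  have hχ2 : MemLp χ 2 volume := memLp_indicator_const 2 hK.measurableSet 1
    (Or.inr hK.measure_ne_top)
  have hχs : HasCompactSupport χ := HasCompactSupport.intro hK fun x hx => indicator_of_notMem hx _
  have hχ1 : ∀ᵐ x, |χ x| ≤ 1 := ae_of_all _ fun x => by
    by_cases hx : x ∈ K <;> simp [hχ, hx]
  obtain ⟨ns, hns, hlim⟩ := exists_seq_tendsto_ae_moll hχ2
  set K' : Set (Cyl d L) := (fun p : Cyl d L × Cover d => p.1 + proj L p.2) ''
    (K ×ˢ Metric.closedBall 0 1) with hK'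
  have hK'c : IsCompact K' := (hK.prod (isCompact_closedBall _ _)).image
    (continuous_fst.add (continuous_proj.comp continuous_snd))
  have hzero : ∀ n x, x ∉ K' → conv (moll d n) χ x = 0 := by
    intro n x hx
    refine conv_eq_zero_of_notMem (K := K) (fun y hy => indicator_of_notMem hy _) fun hx' => hx ?_
    obtain ⟨p, ⟨hp1, hp2⟩, rfl⟩ := hx'
    refine ⟨p, ⟨hp1, ?_⟩, rfl⟩
    rw [mem_closedBall_zero_iff]
    refine (norm_le_of_mem_tsupport_moll hp2).trans ?_
    rw [div_le_one (by positivity)]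
    have : (0 : ℝ) ≤ n := n.cast_nonneg
    linarith
  have hT : Tendsto (fun n => ∫ x, u x * conv (moll d (ns n)) χ x) atTop
      (𝓝 (∫ x, u x * χ x)) := by
    refine tendsto_integral_of_dominated_convergence (K'.indicator fun x => |u x|) (fun n => ?_)
      ?_ (fun n => ae_of_all _ fun x => ?_) ?_
    · exact hu.aestronglyMeasurable.mul ((isSmoothKernel_moll d _).memLp_conv hχ2).1
    · exact (integrable_indicator_iff hK'c.measurableSet).2
        (hu.integrableOn_isCompact hK'c).abs
    · by_cases hx : x ∈ K'
      · rw [indicator_of_mem hx, norm_mul, Real.norm_eq_abs, Real.norm_eq_abs]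
        exact mul_le_of_le_one_right (abs_nonneg _)
          ((isSmoothKernel_moll d _).abs_conv_le hχ1 x)
      · rw [hzero _ x hx]; simp [hx]
    · filter_upwards [hlim] with x hx
      exact hx.const_mul _
  have h0 : ∀ n, ∫ x, u x * conv (moll d (ns n)) χ x = 0 := fun n =>
    h _ ((isSmoothKernel_moll d _).isTestFunction_conv hχi.locallyIntegrable hχs)
  simp_rw [h0] at hT
  have h1 := tendsto_nhds_unique hT tendsto_const_nhds
  rw [← h1, ← integral_indicator hK.measurableSet]
  refine integral_congr_ae (ae_of_all _ fun x => ?_)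
  by_cases hx : x ∈ K <;> simp [hχ, hx]

theorem IsWeakPartial.ae_unique {i : Fin (d + 1)} {g g' : Cyl d L → ℝ} (h : IsWeakPartial i u g)
    (h' : IsWeakPartial i u g') : g =ᵐ[volume] g' := by
  have h1 := ae_eq_zero_of_integral_test_eq_zero (h.2.1.sub h'.2.1) fun φ hφ => by
    have e : ∀ x, (g - g') x * φ x = g x * φ x - g' x * φ x := fun x => by
      simp [sub_mul]
    simp_rw [e]
    rw [integral_sub (hφ.integrable_mul h.2.1) (hφ.integrable_mul h'.2.1)]
    have e1 := h.2.2 φ hφ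
    have e2 := h'.2.2 φ hφ
    linarith
  filter_upwards [h1] with x hx
  simpa [sub_eq_zero] using hx

/-- Both sides are continuous and are weak derivatives of the same function, so almost everywhere
equality is equality at every point. Mollified functions thus have classical derivatives given by
mollified weak ones. -/
theorem IsWeakPartial.partialDeriv_conv {J : Cover d → ℝ} (hJ : IsSmoothKernel J)
    {i : Fin (d + 1)} {g : Cyl d L → ℝ} (h : IsWeakPartial i u g) (hu : MemLp u 2 volume)
    (hg : MemLp g 2 volume) : partialDeriv i (NonlocalFront.conv J u)
      = NonlocalFront.conv J g := by
  have hs := hJ.isSmoothFn_conv (locallyIntegrable_of_memLp hu)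
  have h1 := (hs.hasPartial i).isWeakPartial hs.continuous (hs.partialDeriv i).continuous
  exact Continuous.ae_eq_iff_eq volume (hs.partialDeriv i).continuous
    (hJ.isSmoothFn_conv (locallyIntegrable_of_memLp hg)).continuous |>.1
    (h1.ae_unique (h.convolve hJ hu hg))

end Mollifier

end NonlocalFront

namespace NonlocalFront

/-! ### Convergence in `L²` -/

section LTwo

variable {X : Type*} [MeasurableSpace X] {μ : Measure X}

theorem tendsto_toLp {f : ℕ → X → ℝ} {g : X → ℝ} (hf : ∀ n, MemLp (f n) 2 μ) (hg : MemLp g 2 μ)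
    (h : Tendsto (fun n => eLpNorm (f n - g) 2 μ) atTop (𝓝 0)) :
    Tendsto (fun n => (hf n).toLp (f n)) atTop (𝓝 (hg.toLp g)) :=
  (Lp.tendsto_Lp_iff_tendsto_eLpNorm'' _ _ _ _).2 h

theorem tendsto_eLpNorm_of_tendsto {f : ℕ → X → ℝ} {g : X → ℝ} (hf : ∀ n, MemLp (f n) 2 μ)
    (hg : MemLp g 2 μ) (h : Tendsto (fun n => eLpNorm (f n - g) 2 μ) atTop (𝓝 0)) :
    Tendsto (fun n => eLpNorm (f n) 2 μ) atTop (𝓝 (eLpNorm g 2 μ)) := by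
  have := (continuous_enorm.tendsto _).comp (tendsto_toLp hf hg h)
  simpa [Function.comp_def, Lp.enorm_toLp] using this

theorem integral_mul_eq_inner {u w : X → ℝ} (hu : MemLp u 2 μ) (hw : MemLp w 2 μ) :
    ∫ x, u x * w x ∂μ = inner ℝ (hu.toLp u) (hw.toLp w) := by
  rw [L2.inner_def]
  refine integral_congr_ae ?_
  filter_upwards [hu.coeFn_toLp, hw.coeFn_toLp] with x h1 h2
  rw [h1, h2]
  simp [mul_comm]

theorem tendsto_integral_mul {f h : ℕ → X → ℝ} {g k : X → ℝ} (hf : ∀ n, MemLp (f n) 2 μ)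
    (hg : MemLp g 2 μ) (hh : ∀ n, MemLp (h n) 2 μ) (hk : MemLp k 2 μ)
    (h1 : Tendsto (fun n => eLpNorm (f n - g) 2 μ) atTop (𝓝 0))
    (h2 : Tendsto (fun n => eLpNorm (h n - k) 2 μ) atTop (𝓝 0)) :
    Tendsto (fun n => ∫ x, f n x * h n x ∂μ) atTop (𝓝 (∫ x, g x * k x ∂μ)) := by
  simp_rw [fun n => integral_mul_eq_inner (hf n) (hh n), integral_mul_eq_inner hg hk]
  exact (tendsto_toLp hf hg h1).inner (tendsto_toLp hh hk h2)

theorem eLpNorm_const_tendsto {g : X → ℝ} :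
    Tendsto (fun _ : ℕ => eLpNorm (g - g) 2 μ) atTop (𝓝 0) := by simp

theorem eLpNorm_mul_le_of_bounded {a u : X → ℝ} {C : ℝ} (ha : ∀ᵐ x ∂μ, |a x| ≤ C) :
    eLpNorm (fun x => a x * u x) 2 μ ≤ ENNReal.ofReal C * eLpNorm u 2 μ := by
  refine eLpNorm_le_mul_eLpNorm_of_ae_le_mul ?_ 2
  filter_upwards [ha] with x hx
  rw [norm_mul, Real.norm_eq_abs (a x)]
  exact mul_le_mul_of_nonneg_right hx (norm_nonneg _)

theorem memLp_mul_of_bounded {a u : X → ℝ} {C : ℝ} (ham : AEStronglyMeasurable a μ)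
    (ha : ∀ᵐ x ∂μ, |a x| ≤ C) (hu : MemLp u 2 μ) : MemLp (fun x => a x * u x) 2 μ :=
  ⟨ham.mul hu.1, (eLpNorm_mul_le_of_bounded ha).trans_lt
    (ENNReal.mul_lt_top ENNReal.ofReal_lt_top hu.2)⟩

theorem tendsto_eLpNorm_mul_zero {a : ℕ → X → ℝ} {u : X → ℝ} {C : ℝ}
    (ham : ∀ n, AEStronglyMeasurable (a n) μ) (ha : ∀ n, ∀ᵐ x ∂μ, |a n x| ≤ C)
    (hlim : ∀ᵐ x ∂μ, Tendsto (fun n => a n x) atTop (𝓝 0)) (hu : MemLp u 2 μ) :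
    Tendsto (fun n => eLpNorm (fun x => a n x * u x) 2 μ) atTop (𝓝 0) := by
  have h1 : Tendsto (fun n => ∫⁻ x, ‖a n x * u x‖ₑ ^ 2 ∂μ) atTop (𝓝 (∫⁻ _, 0 ∂μ)) := by
    refine tendsto_lintegral_of_dominated_convergence' (fun x => ‖C * u x‖ₑ ^ 2) (fun n => ?_)
      (fun n => ?_) ?_ ?_
    · exact ((ham n).mul hu.1).enorm.pow_const 2
    · filter_upwards [ha n] with x hx
      gcongr
      rw [enorm_mul, enorm_mul]
      gcongr
      exact enorm_le_iff_norm_le.2 (hx.trans (le_abs_self C))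
    · exact ((memLp_two_iff_lintegral (hu.const_mul C).1).1 (hu.const_mul C)).ne
    · filter_upwards [hlim] with x hx
      have h2 : Tendsto (fun n => a n x * u x) atTop (𝓝 0) := by
        simpa using hx.mul_const (u x)
      have h3 := ((ENNReal.continuous_pow 2).comp continuous_enorm).tendsto' (0 : ℝ) 0 (by simp)
      exact h3.comp h2
  simp only [lintegral_zero] at h1
  simp_rw [← eLpNorm_two_sq] at h1
  have h2 := (ENNReal.continuous_rpow_const (y := (1 / 2 : ℝ))).tendsto 0 |>.comp h1
  rw [ENNReal.zero_rpow_of_pos (by norm_num)] at h2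
  refine h2.congr fun n => ?_
  simp only [Function.comp]
  rw [← ENNReal.rpow_natCast, ← ENNReal.rpow_mul]
  norm_num

theorem tendsto_eLpNorm_mul {a : ℕ → X → ℝ} {b : X → ℝ} {u : ℕ → X → ℝ} {v : X → ℝ} {C : ℝ}
    (ham : ∀ n, AEStronglyMeasurable (a n) μ) (ha : ∀ n, ∀ᵐ x ∂μ, |a n x| ≤ C)
    (hlim : ∀ᵐ x ∂μ, Tendsto (fun n => a n x) atTop (𝓝 (b x))) (hu : ∀ n, MemLp (u n) 2 μ)
    (hv : MemLp v 2 μ) (h : Tendsto (fun n => eLpNorm (u n - v) 2 μ) atTop (𝓝 0)) :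
    Tendsto (fun n => eLpNorm ((fun x => a n x * u n x) - fun x => b x * v x) 2 μ) atTop
      (𝓝 0) := by
  have hbm : AEStronglyMeasurable b μ := aestronglyMeasurable_of_tendsto_ae atTop ham hlim
  have hb : ∀ᵐ x ∂μ, |b x| ≤ C := by
    filter_upwards [hlim, ae_all_iff.2 ha] with x h1 h2
    exact le_of_tendsto h1.abs (Eventually.of_forall h2)
  have h1 := tendsto_eLpNorm_mul_zero (a := fun n x => a n x - b x) (C := C + C)
    (fun n => (ham n).sub hbm) (fun n => by
      filter_upwards [ha n, hb] with x h1 h2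
      exact (abs_sub _ _).trans (add_le_add h1 h2)) (by
      filter_upwards [hlim] with x hx
      simpa using hx.sub_const (b x)) hv
  have h2 : Tendsto (fun n => ENNReal.ofReal C * eLpNorm (u n - v) 2 μ) atTop (𝓝 0) := by
    simpa using ENNReal.Tendsto.const_mul h (Or.inr ENNReal.ofReal_ne_top)
  have h3 := h2.add h1
  rw [add_zero] at h3
  refine tendsto_of_tendsto_of_tendsto_of_le_of_le tendsto_const_nhds h3 (fun _ => zero_le)
    fun n => ?_
  have e : ((fun x => a n x * u n x) - fun x => b x * v x)
      = (fun x => a n x * (u n - v) x) + fun x => (a n x - b x) * v x := by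
    funext x; simp only [Pi.sub_apply, Pi.add_apply]; ring
  rw [e]
  refine (eLpNorm_add_le ((ham n).mul ((hu n).1.sub hv.1)) (((ham n).sub hbm).mul hv.1)
    (by norm_num)).trans ?_
  exact add_le_add (eLpNorm_mul_le_of_bounded (ha n)) le_rfl

end LTwo

/-! ### Calculus of distributional derivatives -/

section WeakPartial

variable {d : ℕ} {L : ℝ} [Fact (0 < L)] {i : Fin (d + 1)} {u v f g : Cyl d L → ℝ}

theorem IsWeakPartial.congr (h : IsWeakPartial i u f) (hu : u =ᵐ[volume] v)
    (hf : f =ᵐ[volume] g) : IsWeakPartial i v g := by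
  refine ⟨h.1.congr hu, h.2.1.congr hf, fun φ hφ => ?_⟩
  have e1 : ∫ x, v x * partialDeriv i φ x = ∫ x, u x * partialDeriv i φ x :=
    integral_congr_ae (by filter_upwards [hu] with x hx; rw [hx])
  have e2 : ∫ x, g x * φ x = ∫ x, f x * φ x :=
    integral_congr_ae (by filter_upwards [hf] with x hx; rw [hx])
  rw [e1, e2, h.2.2 φ hφ]

theorem IsWeakPartial.add (h : IsWeakPartial i u f) (h' : IsWeakPartial i v g) :
    IsWeakPartial i (fun x => u x + v x) fun x => f x + g x := by
  refine ⟨h.1.add h'.1, h.2.1.add h'.2.1, fun φ hφ => ?_⟩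
  simp_rw [add_mul]
  rw [integral_add ((hφ.partialDeriv i).integrable_mul h.1)
    ((hφ.partialDeriv i).integrable_mul h'.1), integral_add (hφ.integrable_mul h.2.1)
    (hφ.integrable_mul h'.2.1), h.2.2 φ hφ, h'.2.2 φ hφ]
  ring

theorem IsWeakPartial.sub (h : IsWeakPartial i u f) (h' : IsWeakPartial i v g) :
    IsWeakPartial i (fun x => u x - v x) fun x => f x - g x := by
  refine ⟨h.1.sub h'.1, h.2.1.sub h'.2.1, fun φ hφ => ?_⟩
  simp_rw [sub_mul]
  rw [integral_sub ((hφ.partialDeriv i).integrable_mul h.1)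
    ((hφ.partialDeriv i).integrable_mul h'.1), integral_sub (hφ.integrable_mul h.2.1)
    (hφ.integrable_mul h'.2.1), h.2.2 φ hφ, h'.2.2 φ hφ]
  ring

theorem HasPartial.translate (h : HasPartial i u f) (y : Cyl d L) :
    HasPartial i (fun x => u (x + y)) fun x => f (x + y) := fun x => by
  have := h (x + y)
  simpa only [add_right_comm] using this

theorem IsTestFunction.translate {φ : Cyl d L → ℝ} (hφ : IsTestFunction φ) (y : Cyl d L) :
    IsTestFunction fun x => φ (x + y) := by
  refine ⟨?_, hφ.2.comp_homeomorph (Homeomorph.addRight y)⟩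
  obtain ⟨w, rfl⟩ := surjective_proj y
  change ContDiff ℝ ∞ fun z : Cover d => φ (proj L z + proj L w)
  simp_rw [← proj_add]
  exact hφ.1.comp (f := fun z : Cover d => z + w) (contDiff_id.add contDiff_const)

theorem IsWeakPartial.translate (h : IsWeakPartial i u f) (hu : MemLp u 2 volume)
    (hf : MemLp f 2 volume) (y : Cyl d L) :
    IsWeakPartial i (fun x => u (x - y)) fun x => f (x - y) := by
  refine ⟨locallyIntegrable_of_memLp (hu.comp_measurePreserving (measurePreserving_sub_const y)),
    locallyIntegrable_of_memLp (hf.comp_measurePreserving (measurePreserving_sub_const y)),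
    fun φ hφ => ?_⟩
  have h1 := h.2.2 _ (hφ.translate y)
  rw [((hφ.isSmoothFn.hasPartial i).translate y).partialDeriv_eq] at h1
  rw [← integral_sub_right_eq_self (μ := (volume : Measure (Cyl d L)))
    (fun x => u x * partialDeriv i φ (x + y)) y, ← integral_sub_right_eq_self
    (μ := (volume : Measure (Cyl d L))) (fun x => f x * φ (x + y)) y] at h1
  simpa using h1

/-- Test functions are dense in `H¹`. -/
theorem exists_testFunction_seq {g : Fin (d + 1) → Cyl d L → ℝ} (hu : MemLp u 2 volume)
    (hg : ∀ i, MemLp (g i) 2 volume) (h : ∀ i, IsWeakPartial i u (g i)) :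
    ∃ φ : ℕ → Cyl d L → ℝ, (∀ n, IsTestFunction (φ n)) ∧
      Tendsto (fun n => eLpNorm (φ n - u) 2 volume) atTop (𝓝 0) ∧
      ∀ i, Tendsto (fun n => eLpNorm (partialDeriv i (φ n) - g i) 2 volume) atTop (𝓝 0) := by
  -- The cutoff acts in the longitudinal variable only, since the torus is already compact. It is
  -- dilated by the factor n + 1.
  let ζ : ContDiffBump (0 : ℝ) := ⟨1, 2, one_pos, by norm_num⟩
  have hζ : ContDiff ℝ ∞ ζ := ζ.contDiff
  have hζ1 : ∀ r, |ζ r| ≤ 1 := fun r => by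
    rw [abs_of_nonneg ζ.nonneg]; exact ζ.le_one
  obtain ⟨C, hC⟩ : ∃ C, ∀ r, |deriv ζ r| ≤ C :=
    (hζ.continuous_deriv (by simp)).bounded_above_of_compact_support ζ.hasCompactSupport.deriv
  set sc : ℕ → ℝ := fun n => 1 / ((n : ℝ) + 1) with hsc
  have hsc0 : Tendsto sc atTop (𝓝 0) := tendsto_one_div_add_atTop_nhds_zero_nat
  have hscpos : ∀ n, 0 < sc n := fun n => by positivity
  have hsc1 : ∀ n, sc n ≤ 1 := fun n => by
    rw [hsc]; simp only
    rw [div_le_one (by positivity)]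
    linarith [(n.cast_nonneg : (0 : ℝ) ≤ n)]
  have hz : ∀ n, ContDiff ℝ ∞ fun r => ζ (r * sc n) := fun n =>
    hζ.comp (contDiff_id.mul contDiff_const)
  have hzd : ∀ n r, HasDerivAt (fun r => ζ (r * sc n)) (deriv ζ (r * sc n) * sc n) r := fun n r => by
    have h1 : HasDerivAt (fun r => r * sc n) (sc n) r := by
      simpa using (hasDerivAt_id r).mul_const (sc n)
    exact (hζ.differentiable (by simp) _).hasDerivAt.comp r h1
  set w : ℕ → Cyl d L → ℝ := fun n => conv (moll d n) u with hw
  have hws : ∀ n, IsSmoothFn (w n) := fun n =>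
    (isSmoothKernel_moll d n).isSmoothFn_conv (locallyIntegrable_of_memLp hu)
  have hwd : ∀ n i, HasPartial i (w n) (conv (moll d n) (g i)) := fun n i => by
    have := (hws n).hasPartial i
    rwa [(h i).partialDeriv_conv (isSmoothKernel_moll d n) hu (hg i)] at this
  have hdφ : ∀ n i, partialDeriv i (fun x => ζ (x.1 * sc n) * w n x)
      = fun x => (if i = 0 then deriv ζ (x.1 * sc n) * sc n else 0) * w n x
        + ζ (x.1 * sc n) * conv (moll d n) (g i) x := fun n i =>
    ((hasPartial_longitudinal (hzd n)).mul (hwd n i)).partialDeriv_eq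
  have hwm : ∀ n, MemLp (w n) 2 volume := fun n => (isSmoothKernel_moll d n).memLp_conv hu
  have hgm : ∀ n i, MemLp (conv (moll d n) (g i)) 2 volume := fun n i =>
    (isSmoothKernel_moll d n).memLp_conv (hg i)
  have hzm : ∀ n, AEStronglyMeasurable (fun x : Cyl d L => ζ (x.1 * sc n)) volume := fun n =>
    (ζ.continuous.comp (continuous_fst.mul continuous_const)).aestronglyMeasurable
  have hzlim : ∀ x : Cyl d L, Tendsto (fun n => ζ (x.1 * sc n)) atTop (𝓝 1) := fun x => by
    have h1 : Tendsto (fun n => x.1 * sc n) atTop (𝓝 0) := by simpa using hsc0.const_mul x.1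
    have h2 := (ζ.continuous.tendsto 0).comp h1
    rwa [ζ.one_of_mem_closedBall (Metric.mem_closedBall_self ζ.rIn_pos.le)] at h2
  have key : ∀ (q : Cyl d L → ℝ), MemLp q 2 volume →
      Tendsto (fun n => eLpNorm ((fun x => ζ (x.1 * sc n) * conv (moll d n) q x) - q) 2 volume)
        atTop (𝓝 0) := fun q hq => by
    have := tendsto_eLpNorm_mul (b := fun _ => 1) hzm (fun n => ae_of_all _ fun x => hζ1 _)
      (ae_of_all _ hzlim) (fun n => (isSmoothKernel_moll d n).memLp_conv hq) hq
      (tendsto_eLpNorm_moll hq)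
    simpa only [one_mul] using this
  -- Differentiating the dilated cutoff produces the factor `sc n`, which tends to 0 and removes
  -- this term from the product rule in the limit.
  have key2 : ∀ i : Fin (d + 1), Tendsto (fun n => eLpNorm (fun x : Cyl d L =>
      (if i = 0 then deriv ζ (x.1 * sc n) * sc n else 0) * w n x) 2 volume) atTop (𝓝 0) := by
    intro i
    have hm : ∀ n, AEStronglyMeasurable (fun x : Cyl d L =>
        if i = 0 then deriv ζ (x.1 * sc n) * sc n else 0) volume := fun n => by
      split_ifs
      · exact (((hζ.continuous_deriv (by simp)).comp
          (continuous_fst.mul continuous_const)).mul continuous_const).aestronglyMeasurable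
      · exact aestronglyMeasurable_const
    have hb : ∀ n (x : Cyl d L), |if i = 0 then deriv ζ (x.1 * sc n) * sc n else 0|
        ≤ C * sc n := fun n x => by
      have hC0 : 0 ≤ C := (abs_nonneg _).trans (hC 0)
      split_ifs
      · rw [abs_mul, abs_of_pos (hscpos n)]
        exact mul_le_mul_of_nonneg_right (hC _) (hscpos n).le
      · rw [abs_zero]; exact mul_nonneg hC0 (hscpos n).le
    have := tendsto_eLpNorm_mul (b := fun _ => 0) (C := C) hm (fun n => ae_of_all _ fun x =>
      (hb n x).trans (mul_le_of_le_one_right ((abs_nonneg _).trans (hC 0)) (hsc1 n)))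
      (ae_of_all _ fun x => squeeze_zero_norm (fun n => hb n x)
        (by simpa using hsc0.const_mul C)) hwm hu (tendsto_eLpNorm_moll hu)
    simpa only [zero_mul, Pi.sub_def, sub_zero] using this
  refine ⟨fun n x => ζ (x.1 * sc n) * w n x, fun n => ?_, key u hu, fun i => ?_⟩
  · refine ⟨(isSmoothFn_longitudinal (hz n)).mul (hws n), HasCompactSupport.intro
      (K := Icc (-(2 / sc n)) (2 / sc n) ×ˢ univ) (isCompact_Icc.prod isCompact_univ)
      fun x hx => ?_⟩
    have : 2 ≤ dist (x.1 * sc n) 0 := by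
      by_contra hlt
      refine hx ⟨?_, mem_univ _⟩
      rw [dist_zero_right, Real.norm_eq_abs, abs_mul, abs_of_pos (hscpos n), not_le,
        ← lt_div_iff₀ (hscpos n)] at hlt
      exact abs_le.1 hlt.le
    change ζ (x.1 * sc n) * w n x = 0
    rw [ζ.zero_of_le_dist this, zero_mul]
  · have h1 := (key2 i).add (key (g i) (hg i))
    rw [add_zero] at h1
    refine tendsto_of_tendsto_of_tendsto_of_le_of_le tendsto_const_nhds h1 (fun _ => zero_le)
      fun n => ?_
    simp only
    rw [hdφ n i]
    refine le_trans (le_of_eq ?_) (eLpNorm_add_le ?_ (((hzm n).mul (hgm n i).1).sub (hg i).1)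
      (by norm_num))
    · congr 1
      funext x
      simp only [Pi.sub_apply, Pi.add_apply]
      ring
    · by_cases hi : i = 0
      · simp only [hi, if_true]
        exact (((hζ.continuous_deriv (by simp)).comp
          (continuous_fst.mul continuous_const)).mul continuous_const).aestronglyMeasurable.mul
          (hwm n).1
      · simp only [hi, if_false, zero_mul]
        exact aestronglyMeasurable_const

/-- A bilinear weak formulation that holds for test functions holds in `H¹`. -/
theorem integral_eq_of_testFunction {g p : Fin (d + 1) → Cyl d L → ℝ} (hv : MemLp v 2 volume)
    (hp : ∀ i, MemLp (p i) 2 volume)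
    (heq : ∀ φ : Cyl d L → ℝ, IsTestFunction φ →
      ∫ x, v x * φ x = - ∑ i, ∫ x, p i x * partialDeriv i φ x)
    (hu : MemLp u 2 volume) (hg : ∀ i, MemLp (g i) 2 volume)
    (h : ∀ i, IsWeakPartial i u (g i)) :
    ∫ x, v x * u x = - ∑ i, ∫ x, p i x * g i x := by
  obtain ⟨φ, hφ, h1, h2⟩ := exists_testFunction_seq hu hg h
  have l1 := tendsto_integral_mul (fun _ => hv) hv (fun n => (hφ n).memLp) hu
    eLpNorm_const_tendsto h1
  have l2 := (tendsto_finsetSum Finset.univ fun i _ => tendsto_integral_mul (fun _ => hp i)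
    (hp i) (fun n => ((hφ n).partialDeriv i).memLp) (hg i) eLpNorm_const_tendsto (h2 i)).neg
  refine tendsto_nhds_unique l1 (l2.congr fun n => ?_)
  exact (heq _ (hφ n)).symm

/-- Chain rule. -/
theorem IsWeakPartial.chain {Γ Γr Γs : ℝ → ℝ → ℝ} {B C : ℝ}
    (hΓ : ∀ r s, |s| ≤ B → HasFDerivAt (fun p : ℝ × ℝ => Γ p.1 p.2)
      (Γr r s • ContinuousLinearMap.fst ℝ ℝ ℝ + Γs r s • ContinuousLinearMap.snd ℝ ℝ ℝ) (r, s))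
    (hr : ContinuousOn (fun p : ℝ × ℝ => Γr p.1 p.2) {p | |p.2| ≤ B})
    (hs : ContinuousOn (fun p : ℝ × ℝ => Γs p.1 p.2) {p | |p.2| ≤ B})
    (hb : ∀ r s, |s| ≤ B → |Γ r s| ≤ C ∧ |Γr r s| ≤ C ∧ |Γs r s| ≤ C)
    (h : IsWeakPartial i u g) (hu : MemLp u 2 volume) (hg : MemLp g 2 volume)
    (huB : ∀ᵐ x, |u x| ≤ B) :
    IsWeakPartial i (fun x => Γ x.1 (u x))
      (fun x => Γs x.1 (u x) * g x + if i = 0 then Γr x.1 (u x) else 0) := by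
  have hcΓ : ContinuousOn (fun p : ℝ × ℝ => Γ p.1 p.2) {p | |p.2| ≤ B} := fun p hp =>
    (hΓ p.1 p.2 hp).continuousAt.continuousWithinAt
  obtain ⟨ns, hns, hlim⟩ := exists_seq_tendsto_ae_moll hu
  set w : ℕ → Cyl d L → ℝ := fun n => conv (moll d (ns n)) u with hw
  have hws : ∀ n, IsSmoothFn (w n) := fun n =>
    (isSmoothKernel_moll d _).isSmoothFn_conv (locallyIntegrable_of_memLp hu)
  have hwd : ∀ n, HasPartial i (w n) (conv (moll d (ns n)) g) := fun n => by
    have := (hws n).hasPartial i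
    rwa [h.partialDeriv_conv (isSmoothKernel_moll d _) hu hg] at this
  -- Mollification preserves the bound B, so the approximations stay where Γ is controlled. No
  -- extension of Γ beyond the strip is required; this matters for the inverse hyperbolic tangent.
  have hwB : ∀ n x, |w n x| ≤ B := fun n x => (isSmoothKernel_moll d _).abs_conv_le huB x
  have hgc : ∀ n, Continuous (conv (moll d (ns n)) g) := fun n =>
    ((isSmoothKernel_moll d _).isSmoothFn_conv (locallyIntegrable_of_memLp hg)).continuous
  have hcomp : ∀ {F : ℝ → ℝ → ℝ}, ContinuousOn (fun p : ℝ × ℝ => F p.1 p.2) {p | |p.2| ≤ B} →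
      ∀ n, Continuous fun x : Cyl d L => F x.1 (w n x) := fun {F} hF n =>
    hF.comp_continuous (continuous_fst.prodMk (hws n).continuous) fun x => hwB n x
  have htend : ∀ {F : ℝ → ℝ → ℝ}, ContinuousOn (fun p : ℝ × ℝ => F p.1 p.2) {p | |p.2| ≤ B} →
      ∀ᵐ x : Cyl d L, Tendsto (fun n => F x.1 (w n x)) atTop (𝓝 (F x.1 (u x))) := by
    intro F hF
    filter_upwards [hlim, huB] with x hx hxB
    have h1 : Tendsto (fun n => (x.1, w n x)) atTop (𝓝[{p : ℝ × ℝ | |p.2| ≤ B}] (x.1, u x)) :=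
      tendsto_nhdsWithin_iff.2 ⟨tendsto_const_nhds.prodMk_nhds hx,
        Eventually.of_forall fun n => hwB n x⟩
    exact (hF (x.1, u x) hxB).tendsto.comp h1
  have hmeas : ∀ {F : ℝ → ℝ → ℝ}, ContinuousOn (fun p : ℝ × ℝ => F p.1 p.2) {p | |p.2| ≤ B} →
      AEStronglyMeasurable (fun x : Cyl d L => F x.1 (u x)) volume := fun {F} hF =>
    aestronglyMeasurable_of_tendsto_ae atTop (fun n => (hcomp hF n).aestronglyMeasurable)
      (htend hF)
  have hsg : MemLp (fun x => Γs x.1 (u x) * g x) 2 volume :=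
    memLp_mul_of_bounded (C := C) (hmeas hs) (by
      filter_upwards [huB] with x hx using (hb _ _ hx).2.2) hg
  have hli : ∀ {F : ℝ → ℝ → ℝ}, ContinuousOn (fun p : ℝ × ℝ => F p.1 p.2) {p | |p.2| ≤ B} →
      (∀ r s, |s| ≤ B → |F r s| ≤ C) → LocallyIntegrable (fun x : Cyl d L => F x.1 (u x)) :=
    fun {F} hF hFb => (memLp_top_of_bound (hmeas hF) C (by
      filter_upwards [huB] with x hx using hFb _ _ hx)).locallyIntegrable (by norm_num)
  have hrF : LocallyIntegrable (fun x : Cyl d L => if i = 0 then Γr x.1 (u x) else 0) := by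
    split_ifs
    · exact hli hr fun r s h => (hb r s h).2.1
    · exact locallyIntegrable_const 0
  refine ⟨hli hcΓ fun r s h => (hb r s h).1, (locallyIntegrable_of_memLp hsg).add hrF,
    fun φ hφ => ?_⟩
  have hdct : ∀ {F : ℝ → ℝ → ℝ}, ContinuousOn (fun p : ℝ × ℝ => F p.1 p.2) {p | |p.2| ≤ B} →
      (∀ r s, |s| ≤ B → |F r s| ≤ C) → ∀ ψ : Cyl d L → ℝ, IsTestFunction ψ →
      Tendsto (fun n => ∫ x : Cyl d L, F x.1 (w n x) * ψ x) atTop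
        (𝓝 (∫ x : Cyl d L, F x.1 (u x) * ψ x)) := by
    intro F hF hFb ψ hψ
    refine tendsto_integral_of_dominated_convergence (fun x => C * |ψ x|) (fun n =>
      ((hcomp hF n).mul hψ.continuous).aestronglyMeasurable)
      (((hψ.continuous.integrable_of_hasCompactSupport hψ.2).abs).const_mul C)
      (fun n => ae_of_all _ fun x => ?_) ?_
    · rw [norm_mul, Real.norm_eq_abs, Real.norm_eq_abs]
      exact mul_le_mul_of_nonneg_right (hFb _ _ (hwB n x)) (abs_nonneg _)
    · filter_upwards [htend hF] with x hx
      exact hx.mul_const _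
  have happ : ∀ n, ∫ x : Cyl d L, Γ x.1 (w n x) * partialDeriv i φ x
      = -((∫ x : Cyl d L, (Γs x.1 (w n x) * conv (moll d (ns n)) g x) * φ x)
        + if i = 0 then ∫ x : Cyl d L, Γr x.1 (w n x) * φ x else 0) := by
    intro n
    have hc0 := continuous_proj_single (L := L) i
    have hP : HasPartial i (fun x : Cyl d L => Γ x.1 (w n x)) (fun x =>
        Γs x.1 (w n x) * conv (moll d (ns n)) g x + if i = 0 then Γr x.1 (w n x) else 0) := by
      intro x
      have h1 := hasPartial_longitudinal (d := d) (L := L) (i := i) (fun r => hasDerivAt_id r) x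
      have h2 := h1.prodMk (hwd n x)
      have h3 := HasFDerivAt.comp_hasDerivAt (0 : ℝ) (f := fun h : ℝ =>
        ((x + proj L (EuclideanSpace.single i h)).1, w n (x + proj L (EuclideanSpace.single i h))))
        (by simpa [single_zero', proj_zero] using hΓ x.1 (w n x) (hwB n x)) h2
      refine h3.congr_deriv ?_
      by_cases hi : i = 0 <;> simp [hi, add_comm]
    have hc1 : Continuous fun x : Cyl d L => if i = 0 then Γr x.1 (w n x) else 0 := by
      split_ifs
      · exact hcomp hr n
      · exact continuous_const
    have h4 := (hP.isWeakPartial (hcomp hcΓ n) (((hcomp hs n).mul (hgc n)).add hc1)).2.2 φ hφ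
    rw [h4]
    simp_rw [add_mul]
    have hc2 : Continuous fun x : Cyl d L => Γs x.1 (w n x) * conv (moll d (ns n)) g x :=
      (hcomp hs n).mul (hgc n)
    rw [integral_add (hφ.integrable_mul hc2.locallyIntegrable)
      (hφ.integrable_mul hc1.locallyIntegrable)]
    by_cases hi : i = 0 <;> simp [hi]
  have l1 := hdct hcΓ (fun r s h => (hb r s h).1) _ (hφ.partialDeriv i)
  have l2 := tendsto_integral_mul (fun n => memLp_mul_of_bounded (C := C)
    (hcomp hs n).aestronglyMeasurable (ae_of_all _ fun x => (hb _ _ (hwB n x)).2.2)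
    ((isSmoothKernel_moll d (ns n)).memLp_conv hg)) hsg (fun _ => hφ.memLp) hφ.memLp
    (tendsto_eLpNorm_mul (C := C) (fun n => (hcomp hs n).aestronglyMeasurable)
      (fun n => ae_of_all _ fun x => (hb _ _ (hwB n x)).2.2) (htend hs)
      (fun n => (isSmoothKernel_moll d (ns n)).memLp_conv hg) hg
      ((tendsto_eLpNorm_moll hg).comp hns.tendsto_atTop)) eLpNorm_const_tendsto
  have l3 : Tendsto (fun n => if i = 0 then ∫ x : Cyl d L, Γr x.1 (w n x) * φ x else 0) atTop
      (𝓝 (if i = 0 then ∫ x : Cyl d L, Γr x.1 (u x) * φ x else 0)) := by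
    split_ifs
    · exact hdct hr (fun r s h => (hb r s h).2.1) φ hφ
    · exact tendsto_const_nhds
  rw [tendsto_nhds_unique l1 ((l2.add l3).neg.congr fun n => (happ n).symm)]
  simp_rw [add_mul]
  rw [integral_add (hφ.integrable_mul (locallyIntegrable_of_memLp hsg)) (hφ.integrable_mul hrF)]
  by_cases hi : i = 0 <;> simp [hi]

end WeakPartial

end NonlocalFront

namespace NonlocalFront

/-! ### Translations of weakly differentiable functions. -/

section Translate

variable {d : ℕ} {L : ℝ} [Fact (0 < L)] {i : Fin (d + 1)} {u v f g φ : Cyl d L → ℝ}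

theorem sq_sum_mul_le (w : Cover d) (a : Fin (d + 1) → ℝ) :
    (∑ i, w i * a i) ^ 2 ≤ ‖w‖ ^ 2 * ∑ i, a i ^ 2 := by
  rw [EuclideanSpace.real_norm_sq_eq]
  exact Finset.sum_mul_sq_le_sq_mul_sq _ _ _

theorem continuous_line (x : Cyl d L) (w : Cover d) :
    Continuous fun t : ℝ => x + proj L (t • w) :=
  continuous_const.add (continuous_proj.comp (continuous_id.smul continuous_const))

instance : IsProbabilityMeasure ((volume : Measure ℝ).restrict (Ioc 0 1)) := ⟨by simp⟩

/-- The increment is the integral of the directional derivative along the segment. Jensen in the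
segment parameter, Cauchy–Schwarz in the components and translation invariance in x give the bound;
w is taken in the covering space so that its length is meaningful. -/
theorem IsSmoothFn.lintegral_translate_le (hφ : IsSmoothFn φ) (w : Cover d) :
    ∫⁻ x, ‖φ (x + proj L w) - φ x‖ₑ ^ 2
      ≤ ENNReal.ofReal (‖w‖ ^ 2) * ∑ i, ∫⁻ x, ‖NonlocalFront.partialDeriv i φ x‖ₑ ^ 2 := by
  have hc : ∀ i, Continuous (NonlocalFront.partialDeriv i φ) := fun i => (hφ.partialDeriv i).continuous
  have hjc : Continuous fun p : Cyl d L × ℝ => p.1 + proj L (p.2 • w) :=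
    continuous_fst.add (continuous_proj.comp (continuous_snd.smul continuous_const))
  have hpt : ∀ x, ‖φ (x + proj L w) - φ x‖ₑ ^ 2
      ≤ ∫⁻ t in Ioc (0 : ℝ) 1, ENNReal.ofReal (‖w‖ ^ 2) *
        ∑ i, ‖NonlocalFront.partialDeriv i φ (x + proj L (t • w))‖ₑ ^ 2 := by
    intro x
    have hF : Continuous fun t : ℝ => ∑ i, w i * NonlocalFront.partialDeriv i φ (x + proj L (t • w)) :=
      continuous_finsetSum _ fun i _ => continuous_const.mul ((hc i).comp (continuous_line x w))
    have h1 := intervalIntegral.integral_eq_sub_of_hasDerivAt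
      (fun t _ => hφ.hasDerivAt_line' x w t) (hF.intervalIntegrable 0 1)
    rw [one_smul, zero_smul, proj_zero, add_zero, intervalIntegral.integral_of_le zero_le_one] at h1
    rw [← h1]
    refine (enorm_integral_sq_le hF.aestronglyMeasurable).trans (lintegral_mono fun t => ?_)
    rw [enorm_sq_eq_ofReal]
    simp_rw [enorm_sq_eq_ofReal]
    rw [← ENNReal.ofReal_sum_of_nonneg (fun _ _ => sq_nonneg _), ← ENNReal.ofReal_mul (sq_nonneg _)]
    exact ENNReal.ofReal_le_ofReal (sq_sum_mul_le _ _)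
  have hm : Measurable (Function.uncurry fun (x : Cyl d L) (t : ℝ) => ENNReal.ofReal (‖w‖ ^ 2) *
        ∑ i, ‖NonlocalFront.partialDeriv i φ (x + proj L (t • w))‖ₑ ^ 2) := by
    refine measurable_const.mul (Finset.measurable_sum _ fun i _ => ?_)
    exact (((hc i).comp hjc).measurable.enorm).pow_const 2
  calc ∫⁻ x, ‖φ (x + proj L w) - φ x‖ₑ ^ 2
      ≤ ∫⁻ x, ∫⁻ t in Ioc (0 : ℝ) 1, ENNReal.ofReal (‖w‖ ^ 2) *
        ∑ i, ‖NonlocalFront.partialDeriv i φ (x + proj L (t • w))‖ₑ ^ 2 := lintegral_mono hpt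
    _ = ∫⁻ t in Ioc (0 : ℝ) 1, ∫⁻ x, ENNReal.ofReal (‖w‖ ^ 2) *
        ∑ i, ‖NonlocalFront.partialDeriv i φ (x + proj L (t • w))‖ₑ ^ 2 :=
        lintegral_lintegral_swap hm.aemeasurable
    _ = ∫⁻ t in Ioc (0 : ℝ) 1, ENNReal.ofReal (‖w‖ ^ 2) *
        ∑ i, ∫⁻ x, ‖NonlocalFront.partialDeriv i φ x‖ₑ ^ 2 := by
        refine lintegral_congr fun t => ?_
        rw [lintegral_const_mul' _ _ ENNReal.ofReal_ne_top, lintegral_finsetSum]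
        · congr 1
          refine Finset.sum_congr rfl fun i _ => ?_
          exact lintegral_add_right_eq_self (fun x => ‖NonlocalFront.partialDeriv i φ x‖ₑ ^ 2) _
        · intro i _
          exact (((hc i).comp (continuous_id.add continuous_const)).measurable.enorm).pow_const 2
    _ = _ := by simp

theorem lintegral_translate_le {g : Fin (d + 1) → Cyl d L → ℝ} (hu : MemLp u 2 volume)
    (hg : ∀ i, MemLp (g i) 2 volume) (h : ∀ i, IsWeakPartial i u (g i)) (w : Cover d) :
    ∫⁻ x, ‖u (x + proj L w) - u x‖ₑ ^ 2
      ≤ ENNReal.ofReal (‖w‖ ^ 2) * ∑ i, ∫⁻ x, ‖g i x‖ₑ ^ 2 := by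
  obtain ⟨φ, hφ, h1, h2⟩ := exists_testFunction_seq hu hg h
  have hmp : MeasurePreserving (fun x : Cyl d L => x + proj L w) volume volume :=
    measurePreserving_add_right volume _
  have htr : ∀ {q : Cyl d L → ℝ}, MemLp q 2 volume →
      MemLp (fun x => q (x + proj L w) - q x) 2 volume := fun {q} hq =>
    (hq.comp_measurePreserving hmp).sub hq
  have l1 : Tendsto (fun n => eLpNorm ((fun x => φ n (x + proj L w) - φ n x)
      - fun x => u (x + proj L w) - u x) 2 volume) atTop (𝓝 0) := by
    have h3 := h1.add h1
    rw [add_zero] at h3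
    refine tendsto_of_tendsto_of_tendsto_of_le_of_le tendsto_const_nhds h3 (fun _ => zero_le)
      fun n => ?_
    have hd := (hφ n).memLp.sub hu
    have e : ((fun x => φ n (x + proj L w) - φ n x) - fun x => u (x + proj L w) - u x)
        = (fun x => (φ n - u) (x + proj L w)) - (φ n - u) := by
      funext x; simp only [Pi.sub_apply]; ring
    rw [e]
    refine (eLpNorm_sub_le (hd.comp_measurePreserving hmp).1 hd.1 (by norm_num)).trans ?_
    refine add_le_add (le_of_eq ?_) le_rfl
    exact eLpNorm_comp_measurePreserving hd.1 hmp
  have l2 := tendsto_eLpNorm_of_tendsto (fun n => htr (hφ n).memLp) (htr hu) l1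
  have l3 := fun i => tendsto_eLpNorm_of_tendsto (fun n => ((hφ n).partialDeriv i).memLp) (hg i)
    (h2 i)
  have l4 := ((ENNReal.continuous_pow 2).tendsto _).comp l2
  have l5 := ENNReal.Tendsto.const_mul (a := ENNReal.ofReal (‖w‖ ^ 2))
    (tendsto_finsetSum Finset.univ fun i _ =>
      ((ENNReal.continuous_pow 2).tendsto _).comp (l3 i)) (Or.inr ENNReal.ofReal_ne_top)
  have l6 := le_of_tendsto_of_tendsto' l4 l5 fun n => by
    simp only [Function.comp, eLpNorm_two_sq]
    exact (hφ n).isSmoothFn.lintegral_translate_le w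
  simpa only [eLpNorm_two_sq] using l6

end Translate

/-! ### Multi-indices -/

section MultiIndex

variable {d : ℕ} {L : ℝ} {φ : Cyl d L → ℝ}

theorem IsSmoothFn.iterate (hφ : IsSmoothFn φ) (i : Fin (d + 1)) (n : ℕ) :
    IsSmoothFn ((NonlocalFront.partialDeriv i)^[n] φ) := by
  induction n with
  | zero => exact hφ
  | succ n ih => rw [Function.iterate_succ_apply']; exact ih.partialDeriv i

theorem IsSmoothFn.iterate_comm (hφ : IsSmoothFn φ) (i k : Fin (d + 1)) (n : ℕ) :
    (NonlocalFront.partialDeriv k)^[n] (NonlocalFront.partialDeriv i φ)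
      = NonlocalFront.partialDeriv i ((NonlocalFront.partialDeriv k)^[n] φ) := by
  induction n with
  | zero => rfl
  | succ n ih => rw [Function.iterate_succ_apply', Function.iterate_succ_apply', ih,
      (hφ.iterate k n).partialDeriv_comm]

theorem IsSmoothFn.foldr (hφ : IsSmoothFn φ) (α : Fin (d + 1) → ℕ) (l : List (Fin (d + 1))) :
    IsSmoothFn (l.foldr (fun i ψ => (NonlocalFront.partialDeriv i)^[α i] ψ) φ) := by
  induction l with
  | nil => exact hφ
  | cons k l ih => exact ih.iterate k _

theorem IsSmoothFn.foldr_comm (hφ : IsSmoothFn φ) (α : Fin (d + 1) → ℕ) (i : Fin (d + 1))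
    (l : List (Fin (d + 1))) :
    l.foldr (fun i ψ => (NonlocalFront.partialDeriv i)^[α i] ψ) (NonlocalFront.partialDeriv i φ)
      = NonlocalFront.partialDeriv i
        (l.foldr (fun i ψ => (NonlocalFront.partialDeriv i)^[α i] ψ) φ) := by
  induction l with
  | nil => rfl
  | cons k l ih =>
    rw [List.foldr_cons, List.foldr_cons, ih, (hφ.foldr α l).iterate_comm]

theorem foldr_congr_notMem (α : Fin (d + 1) → ℕ) (i : Fin (d + 1)) (l : List (Fin (d + 1)))
    (hi : i ∉ l) :
    l.foldr (fun k ψ => (partialDeriv k)^[(α + Pi.single i 1 : Fin (d + 1) → ℕ) k] ψ) φ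
      = l.foldr (fun k ψ => (partialDeriv k)^[α k] ψ) φ := by
  refine List.foldr_ext _ _ _ fun k hk ψ => ?_
  have : k ≠ i := fun h => hi (h ▸ hk)
  simp [this]

/-- Mixed partial derivatives commute, so the extra derivative can be moved innermost, where it
falls directly on the test function. -/
theorem IsSmoothFn.multiDeriv_add_single (hφ : IsSmoothFn φ) (α : Fin (d + 1) → ℕ)
    (i : Fin (d + 1)) :
    multiDeriv (α + Pi.single i 1) φ = multiDeriv α (NonlocalFront.partialDeriv i φ) := by
  have key : ∀ l : List (Fin (d + 1)), l.Nodup → i ∈ l →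
      l.foldr (fun k ψ => (NonlocalFront.partialDeriv k)^[(α + Pi.single i 1 : Fin (d + 1) → ℕ) k] ψ) φ
        = l.foldr (fun k ψ => (NonlocalFront.partialDeriv k)^[α k] ψ)
          (NonlocalFront.partialDeriv i φ) := by
    intro l
    induction l with
    | nil => intro _ h; simp at h
    | cons k l ih =>
      intro hn hi
      rw [List.nodup_cons] at hn
      rw [List.foldr_cons, List.foldr_cons]
      by_cases hk : i = k
      · subst hk
        rw [foldr_congr_notMem α i l hn.1, hφ.foldr_comm]
        simp [Function.iterate_succ_apply]
      · rw [ih hn.2 ((List.mem_cons.1 hi).resolve_left hk)]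
        have : (α + Pi.single i 1 : Fin (d + 1) → ℕ) k = α k := by simp [Ne.symm hk]
        rw [this]
  exact key _ (List.nodup_finRange _) (List.mem_finRange i)

theorem multiDeriv_zero : multiDeriv (0 : Fin (d + 1) → ℕ) φ = φ := by
  unfold multiDeriv
  induction List.finRange (d + 1) with
  | nil => rfl
  | cons k l ih => simp

theorem mem_multiIndices {s : ℕ} {α : Fin (d + 1) → ℕ} :
    α ∈ multiIndices d s ↔ ∑ i, α i ≤ s := by
  rw [multiIndices, Finset.mem_filter, and_iff_right_iff_imp]
  intro h
  rw [Fintype.mem_piFinset]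
  intro i
  rw [Finset.mem_range, Nat.lt_succ_iff]
  exact (Finset.single_le_sum (fun _ _ => Nat.zero_le _) (Finset.mem_univ i)).trans h

variable [Fact (0 < L)] {v w w' : Cyl d L → ℝ}

/-- Testing the derivative of order α + eᵢ against φ is testing that of order α against ∂ᵢφ. Thus
neighbouring entries of a family of weak derivatives differ by one weak partial derivative. -/
theorem IsWeakDeriv.isWeakPartial {α : Fin (d + 1) → ℕ} {i : Fin (d + 1)}
    (h : IsWeakDeriv α v w) (h' : IsWeakDeriv (α + Pi.single i 1) v w') :
    IsWeakPartial i w w' := by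
  refine ⟨h.2.1, h'.2.1, fun φ hφ => ?_⟩
  have h1 := h'.2.2 φ hφ
  rw [hφ.isSmoothFn.multiDeriv_add_single, h.2.2 _ (hφ.partialDeriv i)] at h1
  have e : ∑ k, (α + Pi.single i 1 : Fin (d + 1) → ℕ) k = ∑ k, α k + 1 := by
    simp [Finset.sum_add_distrib]
  rw [e, pow_succ, mul_assoc] at h1
  have := mul_left_cancel₀ (pow_ne_zero _ (by norm_num)) h1
  linarith

theorem IsWeakDeriv.ae_eq_of_zero (h : IsWeakDeriv 0 v w) : v =ᵐ[volume] w := by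
  have h1 := ae_eq_zero_of_integral_test_eq_zero (h.1.sub h.2.1) fun φ hφ => by
    have e : ∀ x, (v - w) x * φ x = v x * φ x - w x * φ x := fun x => by simp [sub_mul]
    simp_rw [e]
    rw [integral_sub (hφ.integrable_mul h.1) (hφ.integrable_mul h.2.1)]
    have := h.2.2 φ hφ
    rw [multiDeriv_zero] at this
    rw [this]
    simp
  filter_upwards [h1] with x hx
  simpa [sub_eq_zero] using hx

theorem exists_weakDeriv_of_sobolevNorm_lt {s : ℕ} {A : ℝ≥0∞} (h : sobolevNorm s v < A) :
    ∃ w : (Fin (d + 1) → ℕ) → Cyl d L → ℝ, (∀ α, ∑ i, α i ≤ s → IsWeakDeriv α v (w α)) ∧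
      ∀ α, ∑ i, α i ≤ s → eLpNorm (w α) 2 volume < A := by
  rw [sobolevNorm, iInf_lt_iff] at h
  obtain ⟨w, h⟩ := h
  rw [iInf_lt_iff] at h
  obtain ⟨hw, h⟩ := h
  refine ⟨w, fun α hα => hw α (mem_multiIndices.2 hα), fun α hα => lt_of_le_of_lt ?_ h⟩
  exact Finset.single_le_sum (f := fun α => eLpNorm (w α) 2 volume) (fun _ _ => zero_le)
    (mem_multiIndices.2 hα)

end MultiIndex

end NonlocalFront

namespace NonlocalFront

/-! ### The Sobolev inequality in dimension at most three -/

section SobolevInequality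

variable {d : ℕ} {L : ℝ} [Fact (0 < L)]

theorem lintegral_sq_le_measure_mul {X : Type*} [MeasurableSpace X] {μ : Measure X}
    {F : X → ℝ≥0∞} (hF : AEMeasurable F μ) :
    ∫⁻ x, F x ∂μ ≤ (∫⁻ x, F x ^ 2 ∂μ) ^ (1 / 2 : ℝ) * μ univ ^ (1 / 2 : ℝ) := by
  have h := ENNReal.lintegral_mul_le_Lp_mul_Lq μ Real.HolderConjugate.two_two hF
    (aemeasurable_const (b := (1 : ℝ≥0∞)))
  simpa using h

/-- Averages over dilated balls. -/
theorem exists_ball_average_bound :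
    ∃ C : ℝ≥0∞, C ≠ ⊤ ∧ ∀ (F : Cyl d L → ℝ≥0∞), Measurable F → ∀ (x : Cyl d L) (t : ℝ),
      0 < t → t ≤ 1 →
      ∫⁻ y in Metric.closedBall (0 : Cover d) 1, F (x + proj L (t • y))
        ≤ C * ENNReal.ofReal ((t ^ (d + 1))⁻¹) ^ (1 / 2 : ℝ) * (∫⁻ x, F x ^ 2) ^ (1 / 2 : ℝ) := by
  obtain ⟨C₁, hC₁, h₁⟩ := exists_lintegral_closedBall_le (d := d) (L := L) 1 one_pos
  set B := Metric.closedBall (0 : Cover d) 1 with hB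
  refine ⟨volume B ^ (1 / 2 : ℝ) * C₁ ^ (1 / 2 : ℝ), ENNReal.mul_ne_top
    (ENNReal.rpow_ne_top_of_nonneg (by norm_num) (isCompact_closedBall _ _).measure_ne_top)
    (ENNReal.rpow_ne_top_of_nonneg (by norm_num) hC₁), fun F hF x t ht0 ht1 => ?_⟩
  have hmeas : Measurable fun y : Cover d => x + proj L y :=
    (continuous_const.add continuous_proj).measurable
  have hG : Measurable fun y : Cover d => F (x + proj L (t • y)) :=
    hF.comp (hmeas.comp (measurable_const_smul t))
  have h2 : ∫⁻ y in B, F (x + proj L (t • y)) ^ 2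
      ≤ ENNReal.ofReal ((t ^ (d + 1))⁻¹) * (C₁ * ∫⁻ x, F x ^ 2) := by
    set G : Cover d → ℝ≥0∞ := B.indicator fun z => F (x + proj L z) ^ 2 with hGdef
    have hGm : Measurable G := ((hF.comp hmeas).pow_const 2).indicator measurableSet_closedBall
    calc ∫⁻ y in B, F (x + proj L (t • y)) ^ 2 ≤ ∫⁻ y, G (t • y) := by
          rw [← lintegral_indicator measurableSet_closedBall]
          refine lintegral_mono fun y => ?_
          by_cases hy : y ∈ B
          · have hy' : t • y ∈ B := by
              rw [hB, mem_closedBall_zero_iff] at hy ⊢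
              rw [norm_smul, Real.norm_eq_abs, abs_of_pos ht0]
              exact mul_le_one₀ ht1 (norm_nonneg _) hy
            rw [indicator_of_mem hy, hGdef, indicator_of_mem hy']
          · rw [indicator_of_notMem hy]; exact zero_le
      _ = ENNReal.ofReal ((t ^ (d + 1))⁻¹) * ∫⁻ z, G z := by
          rw [← lintegral_map hGm (measurable_const_smul t),
            Measure.map_addHaar_smul _ ht0.ne', lintegral_smul_measure, smul_eq_mul]
          rw [finrank_euclideanSpace, Fintype.card_fin, abs_of_pos (by positivity)]
      _ ≤ _ := by
          gcongr
          rw [hGdef, lintegral_indicator measurableSet_closedBall]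
          refine (h₁ (fun z => F (x + z) ^ 2) ((hF.comp (measurable_const_add x)).pow_const 2)).trans
            (le_of_eq ?_)
          rw [lintegral_add_left_eq_self (fun z => F z ^ 2)]
  refine (lintegral_sq_le_measure_mul hG.aemeasurable).trans ?_
  rw [Measure.restrict_apply_univ]
  calc _ ≤ (ENNReal.ofReal ((t ^ (d + 1))⁻¹) * (C₁ * ∫⁻ x, F x ^ 2)) ^ (1 / 2 : ℝ)
        * volume B ^ (1 / 2 : ℝ) := by gcongr
    _ = _ := by
      rw [ENNReal.mul_rpow_of_nonneg _ _ (by norm_num), ENNReal.mul_rpow_of_nonneg _ _ (by norm_num)]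
      ring

/-- The ray bound is averaged over y in the unit ball. For fixed t, Cauchy–Schwarz and the dilation
y ↦ ty cost t^(−(d+1)/2), so the weight is at most t^(k−(d+1)/2) ≤ t^(−1/2). This is integrable, and
the hypothesis on k is exactly what gives the exponent −1/2. -/
theorem exists_sup_bound_of_radial {k : ℕ} (hk : d + 1 ≤ 2 * k + 1) :
    ∃ C : ℝ≥0∞, C ≠ ⊤ ∧ ∀ (V h : Cyl d L → ℝ), Continuous h →
      (∀ (x : Cyl d L) (y : Cover d), ‖y‖ ≤ 1 → ‖V x‖ₑ ≤
        ∫⁻ t in Ioc (0 : ℝ) 1, ENNReal.ofReal (t ^ k) * ‖h (x + proj L (t • y))‖ₑ) →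
      ∀ x, ‖V x‖ₑ ≤ C * eLpNorm h 2 volume := by
  obtain ⟨C₁, hC₁, h₁⟩ := exists_ball_average_bound (d := d) (L := L)
  set B := Metric.closedBall (0 : Cover d) 1 with hB
  have hB0 : volume B ≠ 0 := (Metric.measure_closedBall_pos _ _ one_pos).ne'
  have hBt : volume B ≠ ⊤ := (isCompact_closedBall _ _).measure_ne_top
  set T : ℝ≥0∞ := ∫⁻ t in Ioc (0 : ℝ) 1, ENNReal.ofReal (t ^ (-(1 / 2) : ℝ)) with hT
  have hTt : T ≠ ⊤ := by
    have h1 : IntervalIntegrable (fun t : ℝ => t ^ (-(1 / 2) : ℝ)) volume 0 1 :=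
      intervalIntegral.intervalIntegrable_rpow' (by norm_num)
    rw [intervalIntegrable_iff_integrableOn_Ioc_of_le zero_le_one] at h1
    exact ((hasFiniteIntegral_iff_ofReal ((ae_restrict_iff' measurableSet_Ioc).2
      (ae_of_all _ fun t ht => Real.rpow_nonneg ht.1.le _))).1 h1.2).ne
  refine ⟨(volume B)⁻¹ * (T * C₁), ENNReal.mul_ne_top (ENNReal.inv_ne_top.2 hB0)
    (ENNReal.mul_ne_top hTt hC₁), fun V h hh hV x => ?_⟩
  have hjc : Continuous fun p : Cover d × ℝ => x + proj L (p.2 • p.1) :=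
    continuous_const.add (continuous_proj.comp (continuous_snd.smul continuous_fst))
  have hm : Measurable (Function.uncurry fun (y : Cover d) (t : ℝ) =>
      ENNReal.ofReal (t ^ k) * ‖h (x + proj L (t • y))‖ₑ) :=
    ((measurable_snd.pow_const k).ennreal_ofReal).mul (hh.comp hjc).measurable.enorm
  have hnorm : (∫⁻ x, ‖h x‖ₑ ^ 2) ^ (1 / 2 : ℝ) = eLpNorm h 2 volume := by
    rw [← eLpNorm_two_sq, ← ENNReal.rpow_natCast, ← ENNReal.rpow_mul]
    norm_num
  have h2 : volume B * ‖V x‖ₑ ≤ T * C₁ * eLpNorm h 2 volume :=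
    calc volume B * ‖V x‖ₑ = ∫⁻ _ in B, ‖V x‖ₑ := by
          rw [lintegral_const, Measure.restrict_apply_univ, mul_comm]
      _ ≤ ∫⁻ y in B, ∫⁻ t in Ioc (0 : ℝ) 1,
          ENNReal.ofReal (t ^ k) * ‖h (x + proj L (t • y))‖ₑ :=
          setLIntegral_mono' measurableSet_closedBall fun y hy => hV x y
            (mem_closedBall_zero_iff.1 hy)
      _ = ∫⁻ t in Ioc (0 : ℝ) 1, ∫⁻ y in B,
          ENNReal.ofReal (t ^ k) * ‖h (x + proj L (t • y))‖ₑ :=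
          lintegral_lintegral_swap hm.aemeasurable
      _ ≤ ∫⁻ t in Ioc (0 : ℝ) 1, ENNReal.ofReal (t ^ (-(1 / 2) : ℝ)) *
          (C₁ * eLpNorm h 2 volume) := by
          refine setLIntegral_mono' measurableSet_Ioc fun t ht => ?_
          rw [lintegral_const_mul' _ _ ENNReal.ofReal_ne_top]
          have h3 := h₁ (fun x => ‖h x‖ₑ) hh.measurable.enorm x t ht.1 ht.2
          rw [hnorm] at h3
          have h4 : ENNReal.ofReal (t ^ k) * ENNReal.ofReal ((t ^ (d + 1))⁻¹) ^ (1 / 2 : ℝ)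
              ≤ ENNReal.ofReal (t ^ (-(1 / 2) : ℝ)) := by
            rw [ENNReal.ofReal_rpow_of_pos (by have := ht.1; positivity),
              ← ENNReal.ofReal_mul (by have := ht.1; positivity)]
            refine ENNReal.ofReal_le_ofReal ?_
            rw [← Real.rpow_natCast t k, ← Real.rpow_natCast t (d + 1), ← Real.rpow_neg ht.1.le,
              ← Real.rpow_mul ht.1.le, ← Real.rpow_add ht.1]
            refine Real.rpow_le_rpow_of_exponent_ge ht.1 ht.2 ?_
            have : ((d + 1 : ℕ) : ℝ) ≤ 2 * k + 1 := by exact_mod_cast hk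
            linarith
          calc _ ≤ ENNReal.ofReal (t ^ k) * (C₁ * ENNReal.ofReal ((t ^ (d + 1))⁻¹) ^ (1 / 2 : ℝ)
                * eLpNorm h 2 volume) := by gcongr
            _ = (ENNReal.ofReal (t ^ k) * ENNReal.ofReal ((t ^ (d + 1))⁻¹) ^ (1 / 2 : ℝ))
                * (C₁ * eLpNorm h 2 volume) := by ring
            _ ≤ _ := by gcongr
      _ = T * C₁ * eLpNorm h 2 volume := by
          rw [lintegral_mul_const _ (by fun_prop), ← hT]; ring
  calc ‖V x‖ₑ = (volume B)⁻¹ * (volume B * ‖V x‖ₑ) := by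
        rw [← mul_assoc, ENNReal.inv_mul_cancel hB0 hBt, one_mul]
    _ ≤ (volume B)⁻¹ * (T * C₁ * eLpNorm h 2 volume) := by gcongr
    _ = _ := by ring

theorem abs_apply_le_one {y : Cover d} (hy : ‖y‖ ≤ 1) (i : Fin (d + 1)) : |y i| ≤ 1 :=
  (abs_apply_le_norm y i).trans hy

theorem enorm_le_lintegral_of_deriv {G G' : ℝ → ℝ} (hG : ∀ t, HasDerivAt G (G' t) t)
    (hc : Continuous G') {k : ℕ} {H : ℝ → ℝ} (h : ∀ t ∈ Ioc (0 : ℝ) 1, |G' t| ≤ t ^ k * |H t|) :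
    ‖G 1 - G 0‖ₑ ≤ ∫⁻ t in Ioc (0 : ℝ) 1, ENNReal.ofReal (t ^ k) * ‖H t‖ₑ := by
  have h1 := intervalIntegral.integral_eq_sub_of_hasDerivAt (a := 0) (b := 1)
    (fun t _ => hG t) (hc.intervalIntegrable 0 1)
  rw [intervalIntegral.integral_of_le zero_le_one] at h1
  rw [← h1]
  refine (enorm_integral_le_lintegral_enorm _).trans (setLIntegral_mono' measurableSet_Ioc
    fun t ht => ?_)
  rw [← ofReal_norm, ← ofReal_norm, ← ENNReal.ofReal_mul (by have := ht.1; positivity)]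
  exact ENNReal.ofReal_le_ofReal (h t ht)

theorem abs_sum_mul_le {y : Cover d} (hy : ‖y‖ ≤ 1) (a : Fin (d + 1) → ℝ) :
    |∑ i, y i * a i| ≤ ∑ i, |a i| := by
  refine (Finset.abs_sum_le_sum_abs _ _).trans (Finset.sum_le_sum fun i _ => ?_)
  rw [abs_mul]
  exact mul_le_of_le_one_left (abs_nonneg _) (abs_apply_le_one hy i)

/-- The function (1 − t)V(x + ty) vanishes at t = 1 and equals V(x) at t = 0, so V(x) is minus the
integral of its derivative. -/
theorem IsSmoothFn.radial_bound_one {V : Cyl d L → ℝ} (hV : IsSmoothFn V) (x : Cyl d L)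
    (y : Cover d) (hy : ‖y‖ ≤ 1) :
    ‖V x‖ₑ ≤ ∫⁻ t in Ioc (0 : ℝ) 1, ENNReal.ofReal (t ^ 0) *
      ‖(fun x => |V x| + ∑ i, |NonlocalFront.partialDeriv i V x|) (x + proj L (t • y))‖ₑ := by
  have hf := hV.hasDerivAt_line' x y
  set f : ℝ → ℝ := fun t => V (x + proj L (t • y)) with hfdef
  set f₁ : ℝ → ℝ := fun t => ∑ i, y i * NonlocalFront.partialDeriv i V (x + proj L (t • y)) with hf₁
  have hcf : Continuous f := hV.continuous.comp (continuous_line x y)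
  have hcf₁ : Continuous f₁ := continuous_finsetSum _ fun i _ =>
    continuous_const.mul ((hV.partialDeriv i).continuous.comp (continuous_line x y))
  have hG : ∀ t, HasDerivAt (fun t => (1 - t) * f t) (-f t + (1 - t) * f₁ t) t := fun t => by
    have := ((hasDerivAt_id t).const_sub 1).mul (hf t)
    refine this.congr_deriv ?_
    simp [hf₁]
  have h1 := enorm_le_lintegral_of_deriv (k := 0) hG
    (hcf.neg.add ((continuous_const.sub continuous_id).mul hcf₁))
    (H := fun t => (fun x => |V x| + ∑ i, |NonlocalFront.partialDeriv i V x|)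
      (x + proj L (t • y))) (fun t ht => by
      have hpos : 0 ≤ |V (x + proj L (t • y))|
          + ∑ i, |NonlocalFront.partialDeriv i V (x + proj L (t • y))| := by positivity
      have h2 := abs_sum_mul_le hy fun i => NonlocalFront.partialDeriv i V (x + proj L (t • y))
      simp only [pow_zero, one_mul, abs_of_nonneg hpos]
      refine (abs_add_le _ _).trans (add_le_add (abs_neg _).le ?_)
      rw [abs_mul, abs_of_nonneg (by linarith [ht.2])]
      exact (mul_le_of_le_one_left (abs_nonneg _) (by linarith [ht.1])).trans h2)
  have e : (1 - 1) * f 1 - (1 - 0) * f 0 = -V x := by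
    simp [hfdef, proj_zero]
  rw [e, enorm_neg] at h1
  exact h1

theorem IsSmoothFn.radial_bound_two {V : Cyl d L → ℝ} (hV : IsSmoothFn V) (x : Cyl d L)
    (y : Cover d) (hy : ‖y‖ ≤ 1) :
    ‖V x‖ₑ ≤ ∫⁻ t in Ioc (0 : ℝ) 1, ENNReal.ofReal (t ^ 1) *
      ‖(fun x => 2 * |V x| + 4 * ∑ i, |NonlocalFront.partialDeriv i V x|
        + ∑ i, ∑ j, |NonlocalFront.partialDeriv j (NonlocalFront.partialDeriv i V) x|)
          (x + proj L (t • y))‖ₑ := by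
  have hf := hV.hasDerivAt_line' x y
  have hf' := fun i => (hV.partialDeriv i).hasDerivAt_line' x y
  set f : ℝ → ℝ := fun t => V (x + proj L (t • y)) with hfdef
  set f₁ : ℝ → ℝ := fun t => ∑ i, y i * NonlocalFront.partialDeriv i V (x + proj L (t • y)) with hf₁
  set f₂ : ℝ → ℝ := fun t => ∑ i, y i * ∑ j, y j *
    NonlocalFront.partialDeriv j (NonlocalFront.partialDeriv i V) (x + proj L (t • y)) with hf₂
  have hd₁ : ∀ t, HasDerivAt f₁ (f₂ t) t := fun t =>
    HasDerivAt.fun_sum fun i _ => (hf' i t).const_mul (y i)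
  have hcf : Continuous f := hV.continuous.comp (continuous_line x y)
  have hcf₁ : Continuous f₁ := continuous_iff_continuousAt.2 fun t => (hd₁ t).continuousAt
  have hcf₂ : Continuous f₂ := continuous_finsetSum _ fun i _ => continuous_const.mul
    (continuous_finsetSum _ fun j _ => continuous_const.mul
      (((hV.partialDeriv i).partialDeriv j).continuous.comp (continuous_line x y)))
  -- With g = (1 − t)²f the function is tg' − g, whose derivative is tg''. It vanishes at t = 1 and
  -- equals −V(x) at t = 0. The factor t is the gain that reaches dimension three.
  have hG : ∀ t, HasDerivAt (fun t => t * (-2 * (1 - t) * f t + (1 - t) ^ 2 * f₁ t)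
      - (1 - t) ^ 2 * f t) (t * (2 * f t - 4 * (1 - t) * f₁ t + (1 - t) ^ 2 * f₂ t)) t := by
    intro t
    have hs : HasDerivAt (fun t : ℝ => 1 - t) (-1) t := (hasDerivAt_id t).const_sub 1
    have hs2 : HasDerivAt (fun t : ℝ => (1 - t) ^ 2) (2 * (1 - t) * -1) t := by
      have h2 : HasDerivAt (fun t : ℝ => (1 - t) ^ 2) _ t := hs.pow 2
      exact h2.congr_deriv (by simp)
    have := ((hasDerivAt_id t).mul (((hs.const_mul (-2)).mul (hf t)).add (hs2.mul (hd₁ t)))).sub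
      (hs2.mul (hf t))
    refine this.congr_deriv ?_
    simp only [id, Pi.mul_apply, Pi.add_apply]
    ring
  have h1 := enorm_le_lintegral_of_deriv (k := 1) hG (by fun_prop)
    (H := fun t => (fun x => 2 * |V x| + 4 * ∑ i, |NonlocalFront.partialDeriv i V x|
        + ∑ i, ∑ j, |NonlocalFront.partialDeriv j (NonlocalFront.partialDeriv i V) x|)
          (x + proj L (t • y))) (fun t ht => by
      have hpos : 0 ≤ 2 * |V (x + proj L (t • y))|
          + 4 * ∑ i, |NonlocalFront.partialDeriv i V (x + proj L (t • y))| + ∑ i, ∑ j,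
          |NonlocalFront.partialDeriv j (NonlocalFront.partialDeriv i V) (x + proj L (t • y))| := by
        positivity
      have h2 : |f₁ t| ≤ _ := abs_sum_mul_le hy fun i =>
        NonlocalFront.partialDeriv i V (x + proj L (t • y))
      have h3 : |f₂ t| ≤ ∑ i, ∑ j,
          |NonlocalFront.partialDeriv j (NonlocalFront.partialDeriv i V) (x + proj L (t • y))| :=
        (abs_sum_mul_le hy _).trans (Finset.sum_le_sum fun i _ => abs_sum_mul_le hy _)
      have ht0 : 0 ≤ 1 - t := by linarith [ht.2]
      have ht1 : 1 - t ≤ 1 := by linarith [ht.1]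
      simp only [pow_one, abs_of_nonneg hpos]
      rw [abs_mul, abs_of_pos ht.1]
      refine mul_le_mul_of_nonneg_left ?_ ht.1.le
      refine (abs_add_le _ _).trans (add_le_add ((abs_sub _ _).trans (add_le_add ?_ ?_)) ?_)
      · rw [abs_mul, abs_two]
      · rw [abs_mul, abs_mul, abs_of_nonneg ht0, abs_of_pos (four_pos : (0 : ℝ) < 4)]
        calc 4 * (1 - t) * |f₁ t| ≤ 4 * 1 * |f₁ t| := by gcongr
          _ ≤ _ := by rw [mul_one]; exact mul_le_mul_of_nonneg_left h2 (by norm_num)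
      · rw [abs_mul, abs_of_nonneg (sq_nonneg _)]
        exact (mul_le_of_le_one_left (abs_nonneg _) (pow_le_one₀ ht0 ht1)).trans h3)
  have e : 1 * (-2 * (1 - 1) * f 1 + (1 - 1) ^ 2 * f₁ 1) - (1 - 1) ^ 2 * f 1
      - (0 * (-2 * (1 - 0) * f 0 + (1 - 0) ^ 2 * f₁ 0) - (1 - 0) ^ 2 * f 0) = V x := by
    simp [hfdef, proj_zero]
  rw [e] at h1
  exact h1

theorem eLpNorm_sum_abs_le {ι : Type*} (s : Finset ι) {F : ι → Cyl d L → ℝ}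
    (hF : ∀ i ∈ s, AEStronglyMeasurable (F i) volume) {A : ℝ≥0∞}
    (hA : ∀ i ∈ s, eLpNorm (F i) 2 volume ≤ A) :
    eLpNorm (fun x => ∑ i ∈ s, |F i x|) 2 volume ≤ s.card * A := by
  have e : (fun x => ∑ i ∈ s, |F i x|) = ∑ i ∈ s, fun x => ‖F i x‖ := by
    funext x; simp
  rw [e]
  refine (eLpNorm_sum_le (fun i hi => (hF i hi).norm) (by norm_num)).trans ?_
  rw [← nsmul_eq_mul]
  refine Finset.sum_le_card_nsmul _ _ _ fun i hi => ?_
  rw [eLpNorm_norm]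
  exact hA i hi

/-- A bound for smooth functions, transferred to weakly differentiable ones by mollification. -/
theorem ae_abs_le_of_moll {v : Cyl d L → ℝ} (hv : MemLp v 2 volume) {A : ℝ}
    (h : ∀ n x, |conv (moll d n) v x| ≤ A) : ∀ᵐ x, |v x| ≤ A := by
  obtain ⟨ns, -, hlim⟩ := exists_seq_tendsto_ae_moll hv
  filter_upwards [hlim] with x hx
  exact le_of_tendsto hx.abs (Eventually.of_forall fun n => h _ x)

/-- In dimension one a single derivative suffices; in dimensions two and three the condition s > D/2
forces s ≥ 2, and two derivatives suffice. No higher ones are used, so the constant does not depend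
on s, as is required when δ is chosen before s. Mollification reduces everything to smooth
functions. -/
theorem exists_sobolev_bound (hD : d + 1 ≤ 3) :
    ∃ C : ℝ, 0 < C ∧ ∀ (s : ℕ), ((d + 1 : ℕ) : ℝ) / 2 < (s : ℝ) →
      ∀ (v : Cyl d L → ℝ) (A : ℝ), sobolevNorm s v < ENNReal.ofReal A →
      ∃ g : Fin (d + 1) → Cyl d L → ℝ, MemLp v 2 volume ∧ (∀ i, IsWeakPartial i v (g i)) ∧
        (∀ i, MemLp (g i) 2 volume) ∧ ∀ᵐ x, |v x| ≤ C * A := by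
  obtain ⟨C₂, hC₂, h₂⟩ := exists_sup_bound_of_radial (d := d) (L := L) (k := 1) (by omega)
  -- The first order bound exists only for d = 0. Packaging it with that hypothesis allows one
  -- constant to be fixed beforehand in all dimensions.
  have hone : ∃ C₁ : ℝ≥0∞, C₁ ≠ ⊤ ∧ (d = 0 → ∀ (V h : Cyl d L → ℝ), Continuous h →
      (∀ (x : Cyl d L) (y : Cover d), ‖y‖ ≤ 1 → ‖V x‖ₑ ≤
        ∫⁻ t in Ioc (0 : ℝ) 1, ENNReal.ofReal (t ^ 0) * ‖h (x + proj L (t • y))‖ₑ) →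
      ∀ x, ‖V x‖ₑ ≤ C₁ * eLpNorm h 2 volume) := by
    by_cases hd : d = 0
    · obtain ⟨C₁, hC₁, h₁⟩ := exists_sup_bound_of_radial (d := d) (L := L) (k := 0) (by omega)
      exact ⟨C₁, hC₁, fun _ => h₁⟩
    · exact ⟨0, by simp, fun h => absurd h hd⟩
  obtain ⟨C₁, hC₁, h₁⟩ := hone
  set N : ℝ≥0∞ := 2 + 4 * (d + 1 : ℕ) + (d + 1 : ℕ) * (d + 1 : ℕ) with hN
  have hNt : N ≠ ⊤ := by
    rw [hN]
    exact_mod_cast ENNReal.natCast_ne_top (2 + 4 * (d + 1) + (d + 1) * (d + 1))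
  set C := (C₁ * N + C₂ * N).toReal + 1 with hC
  have hCt : C₁ * N + C₂ * N ≠ ⊤ :=
    ENNReal.add_ne_top.2 ⟨ENNReal.mul_ne_top hC₁ hNt, ENNReal.mul_ne_top hC₂ hNt⟩
  have hC0 : 0 < C := by positivity
  refine ⟨C, hC0, fun s hs v A hA => ?_⟩
  have hA0 : 0 < A := by
    by_contra h
    rw [ENNReal.ofReal_of_nonpos (not_lt.1 h)] at hA
    exact not_lt_zero hA
  obtain ⟨w, hw, hwA⟩ := exists_weakDeriv_of_sobolevNorm_lt hA
  have hs1 : 1 ≤ s := by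
    rcases Nat.eq_zero_or_pos s with h | h
    · subst h
      exfalso
      have : (0 : ℝ) ≤ ((d + 1 : ℕ) : ℝ) / 2 := by positivity
      simp only [CharP.cast_eq_zero] at hs
      linarith
    · exact h
  have hm : ∀ α : Fin (d + 1) → ℕ, ∑ i, α i ≤ s → MemLp (w α) 2 volume := fun α hα =>
    ⟨(hw α hα).2.1.aestronglyMeasurable, (hwA α hα).trans ENNReal.ofReal_lt_top⟩
  have e1 : ∀ i : Fin (d + 1), ∑ k, (Pi.single i 1 : Fin (d + 1) → ℕ) k = 1 := fun i => by simp
  have e0 : ∑ k, (0 : Fin (d + 1) → ℕ) k = 0 := by simp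
  have hv0 : v =ᵐ[volume] w 0 := (hw 0 (by simp)).ae_eq_of_zero
  have hv : MemLp v 2 volume := (memLp_congr_ae hv0).2 (hm 0 (by simp))
  have hvA : eLpNorm v 2 volume ≤ ENNReal.ofReal A := by
    rw [eLpNorm_congr_ae hv0]; exact (hwA 0 (by simp)).le
  set g : Fin (d + 1) → Cyl d L → ℝ := fun i => w (Pi.single i 1) with hg
  have hgm : ∀ i, MemLp (g i) 2 volume := fun i => hm _ (by rw [e1]; exact hs1)
  have hgA : ∀ i, eLpNorm (g i) 2 volume ≤ ENNReal.ofReal A := fun i =>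
    (hwA _ (by rw [e1]; exact hs1)).le
  have hgw : ∀ i, IsWeakPartial i v (g i) := fun i => by
    have h3 := (hw 0 (by simp)).isWeakPartial (i := i) (w' := g i) (by
      rw [zero_add]; exact hw _ (by rw [e1]; exact hs1))
    exact h3.congr hv0.symm (EventuallyEq.refl _ _)
  refine ⟨g, hv, hgw, hgm, ae_abs_le_of_moll hv fun n x => ?_⟩
  have hJ := isSmoothKernel_moll d n
  set V := conv (moll d n) v with hV
  have hVs : IsSmoothFn V := hJ.isSmoothFn_conv (locallyIntegrable_of_memLp hv)
  have hV1 : ∀ i, partialDeriv i V = conv (moll d n) (g i) := fun i =>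
    (hgw i).partialDeriv_conv hJ hv (hgm i)
  have hVA : eLpNorm V 2 volume ≤ ENNReal.ofReal A := (hJ.eLpNorm_conv_le hv.1).trans hvA
  have hV1A : ∀ i, eLpNorm (partialDeriv i V) 2 volume ≤ ENNReal.ofReal A := fun i => by
    rw [hV1]; exact (hJ.eLpNorm_conv_le (hgm i).1).trans (hgA i)
  have hsum1 := eLpNorm_sum_abs_le Finset.univ
    (fun i _ => (hVs.partialDeriv i).continuous.aestronglyMeasurable) (fun i _ => hV1A i)
  rw [Finset.card_univ, Fintype.card_fin] at hsum1
  have hVabs : eLpNorm (fun x => |V x|) 2 volume ≤ ENNReal.ofReal A := by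
    have : eLpNorm (fun x => ‖V x‖) 2 volume = eLpNorm V 2 volume := eLpNorm_norm _
    simp only [Real.norm_eq_abs] at this
    rwa [this]
  have hc1 : Continuous fun x => ∑ i, |partialDeriv i V x| :=
    continuous_finsetSum _ fun i _ => (hVs.partialDeriv i).continuous.abs
  have hfin : ‖V x‖ₑ ≤ (C₁ * N + C₂ * N) * ENNReal.ofReal A := by
    by_cases hs2 : 2 ≤ s
    · have hV2A : ∀ i j, eLpNorm (partialDeriv j (partialDeriv i V)) 2 volume
          ≤ ENNReal.ofReal A := fun i j => by
        have hij : ∑ k, (Pi.single i 1 + Pi.single j 1 : Fin (d + 1) → ℕ) k ≤ s := by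
          simp only [Pi.add_apply, Finset.sum_add_distrib, e1]; omega
        have h3 := (hw (Pi.single i 1) (by rw [e1]; exact hs1)).isWeakPartial (i := j) (hw _ hij)
        rw [hV1, h3.partialDeriv_conv hJ (hgm i) (hm _ hij)]
        exact (hJ.eLpNorm_conv_le (hm _ hij).1).trans (hwA _ hij).le
      have hsum2 := eLpNorm_sum_abs_le (Finset.univ ×ˢ Finset.univ)
        (F := fun p : Fin (d + 1) × Fin (d + 1) => partialDeriv p.2 (partialDeriv p.1 V))
        (fun p _ => ((hVs.partialDeriv p.1).partialDeriv p.2).continuous.aestronglyMeasurable)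
        (fun p _ => hV2A p.1 p.2)
      simp only [Finset.sum_product, Finset.card_product, Finset.card_univ, Fintype.card_fin]
        at hsum2
      have hc2 : Continuous fun x => ∑ i, ∑ j, |partialDeriv j (partialDeriv i V) x| :=
        continuous_finsetSum _ fun i _ => continuous_finsetSum _ fun j _ =>
          ((hVs.partialDeriv i).partialDeriv j).continuous.abs
      have hc3 : Continuous fun x => 2 * |V x| + 4 * ∑ i, |partialDeriv i V x|
          + ∑ i, ∑ j, |partialDeriv j (partialDeriv i V) x| :=
        ((continuous_const.mul hVs.continuous.abs).add (continuous_const.mul hc1)).add hc2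
      have h4 := h₂ V _ hc3 (fun x y hy => hVs.radial_bound_two x y hy) x
      refine h4.trans ?_
      have h5 : eLpNorm (fun x => 2 * |V x| + 4 * ∑ i, |partialDeriv i V x|
          + ∑ i, ∑ j, |partialDeriv j (partialDeriv i V) x|) 2 volume
          ≤ N * ENNReal.ofReal A := by
        refine (eLpNorm_add_le ((continuous_const.mul hVs.continuous.abs).add
          (continuous_const.mul hc1)).aestronglyMeasurable hc2.aestronglyMeasurable
          (by norm_num)).trans ?_
        rw [hN, add_mul]
        refine add_le_add ((eLpNorm_add_le
          (continuous_const.mul hVs.continuous.abs).aestronglyMeasurable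
          (continuous_const.mul hc1).aestronglyMeasurable (by norm_num)).trans ?_)
          (by exact_mod_cast hsum2)
        rw [add_mul]
        refine add_le_add ?_ ?_
        · refine (eLpNorm_const_smul_le (c := (2 : ℝ)) (f := fun x => |V x|)).trans ?_
          have : ‖(2 : ℝ)‖ₑ = 2 := by simp [enorm_eq_nnnorm]
          rw [this]
          gcongr
        · refine (eLpNorm_const_smul_le (c := (4 : ℝ))
            (f := fun x => ∑ i, |partialDeriv i V x|)).trans ?_
          have : ‖(4 : ℝ)‖ₑ = 4 := by simp [enorm_eq_nnnorm]
          rw [this, mul_assoc]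
          gcongr
      calc C₂ * _ ≤ C₂ * (N * ENNReal.ofReal A) := by gcongr
        _ ≤ _ := by rw [add_mul (C₁ * N), mul_assoc C₂]; exact le_add_self
    · have hd : d = 0 := by
        have : s = 1 := by omega
        subst this
        by_contra h
        have h2 : (2 : ℝ) ≤ ((d + 1 : ℕ) : ℝ) := by exact_mod_cast (by omega : 2 ≤ d + 1)
        norm_num at hs h2
        linarith
      have hc3 : Continuous fun x => |V x| + ∑ i, |partialDeriv i V x| :=
        hVs.continuous.abs.add hc1
      have h4 := h₁ hd V _ hc3
        (fun x y hy => hVs.radial_bound_one x y hy) x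
      refine h4.trans ?_
      have h5 : eLpNorm (fun x => |V x| + ∑ i, |partialDeriv i V x|) 2 volume
          ≤ N * ENNReal.ofReal A := by
        refine (eLpNorm_add_le hVs.continuous.abs.aestronglyMeasurable hc1.aestronglyMeasurable
          (by norm_num)).trans ((add_le_add hVabs hsum1).trans ?_)
        rw [hN, add_mul, add_mul]
        refine le_add_right (add_le_add ?_ ?_)
        · exact le_mul_of_one_le_left zero_le (by norm_num)
        · rw [mul_assoc]
          exact le_mul_of_one_le_left zero_le (by norm_num)
      calc C₁ * _ ≤ C₁ * (N * ENNReal.ofReal A) := by gcongr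
        _ ≤ _ := by rw [add_mul (C₁ * N), mul_assoc C₁]; exact le_self_add
  have h6 := ENNReal.toReal_mono (ENNReal.mul_ne_top hCt ENNReal.ofReal_ne_top) hfin
  rw [toReal_enorm, ENNReal.toReal_mul, ENNReal.toReal_ofReal hA0.le, Real.norm_eq_abs] at h6
  refine h6.trans (mul_le_mul_of_nonneg_right ?_ hA0.le)
  rw [hC]; linarith

end SobolevInequality

end NonlocalFront

namespace NonlocalFront

/-! ### The `L²` norm and weak convergence -/

section LTwoNorm

variable {X : Type*} [MeasureSpace X] {u v w : X → ℝ}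

/-- The `L²` norm as a real number. -/
noncomputable def ltwo (u : X → ℝ) : ℝ := (eLpNorm u 2 volume).toReal

theorem ltwo_nonneg (u : X → ℝ) : 0 ≤ ltwo u := ENNReal.toReal_nonneg

theorem ltwo_eq_norm (hu : MemLp u 2 volume) : ltwo u = ‖hu.toLp u‖ := (Lp.norm_toLp u hu).symm

theorem ltwo_congr (h : u =ᵐ[volume] v) : ltwo u = ltwo v := by
  rw [ltwo, ltwo, eLpNorm_congr_ae h]

theorem ltwo_sq (hu : MemLp u 2 volume) : ltwo u ^ 2 = ∫ x, u x ^ 2 := by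
  rw [ltwo, ← ENNReal.toReal_pow, eLpNorm_two_sq, lintegral_enorm_sq hu,
    ENNReal.toReal_ofReal (integral_nonneg fun _ => sq_nonneg _)]

theorem ltwo_add_le (hu : MemLp u 2 volume) (hv : MemLp v 2 volume) :
    ltwo (fun x => u x + v x) ≤ ltwo u + ltwo v := by
  rw [ltwo, ltwo, ltwo, ← ENNReal.toReal_add hu.2.ne hv.2.ne]
  exact ENNReal.toReal_mono (ENNReal.add_ne_top.2 ⟨hu.2.ne, hv.2.ne⟩)
    (eLpNorm_add_le hu.1 hv.1 (by norm_num))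

theorem ltwo_sub_le (hu : MemLp u 2 volume) (hv : MemLp v 2 volume) :
    ltwo (fun x => u x - v x) ≤ ltwo u + ltwo v := by
  rw [ltwo, ltwo, ltwo, ← ENNReal.toReal_add hu.2.ne hv.2.ne]
  exact ENNReal.toReal_mono (ENNReal.add_ne_top.2 ⟨hu.2.ne, hv.2.ne⟩)
    (eLpNorm_sub_le hu.1 hv.1 (by norm_num))

theorem ltwo_mono (hv : MemLp v 2 volume) (h : ∀ᵐ x, |u x| ≤ |v x|) : ltwo u ≤ ltwo v :=
  ENNReal.toReal_mono hv.2.ne (eLpNorm_mono_ae h)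

theorem ltwo_const_mul (c : ℝ) (u : X → ℝ) : ltwo (fun x => c * u x) = |c| * ltwo u := by
  have := eLpNorm_const_smul c u 2 (volume : Measure X)
  rw [ltwo, ltwo]
  change (eLpNorm (c • u) 2 volume).toReal = _
  rw [this, ENNReal.toReal_mul, toReal_enorm, Real.norm_eq_abs]

theorem ltwo_le_const_mul (hv : MemLp v 2 volume) {c : ℝ} (hc : 0 ≤ c)
    (h : ∀ᵐ x, |u x| ≤ c * |v x|) : ltwo u ≤ c * ltwo v := by
  rw [← abs_of_nonneg hc, ← ltwo_const_mul]
  refine ltwo_mono (hv.const_mul c) ?_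
  filter_upwards [h] with x hx
  rwa [abs_mul, abs_of_nonneg hc]

theorem memLp_of_abs_le (hu : AEStronglyMeasurable u volume) (hv : MemLp v 2 volume) {c : ℝ}
    (h : ∀ᵐ x, |u x| ≤ c * |v x|) : MemLp u 2 volume :=
  hv.of_le_mul hu h

theorem abs_integral_mul_le (hu : MemLp u 2 volume) (hv : MemLp v 2 volume) :
    |∫ x, u x * v x| ≤ ltwo u * ltwo v := by
  rw [integral_mul_eq_inner hu hv, ltwo_eq_norm hu, ltwo_eq_norm hv]
  exact abs_real_inner_le_norm _ _

theorem ae_eq_zero_of_ltwo_eq_zero (hu : MemLp u 2 volume) (h : ltwo u = 0) :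
    u =ᵐ[volume] 0 := by
  rw [ltwo, ENNReal.toReal_eq_zero_iff, or_iff_left hu.2.ne,
    eLpNorm_eq_zero_iff hu.1 two_ne_zero] at h
  exact h

theorem tendsto_ltwo_zero {f : ℕ → X → ℝ}
    (h : Tendsto (fun n => eLpNorm (f n) 2 volume) atTop (𝓝 0)) :
    Tendsto (fun n => ltwo (f n)) atTop (𝓝 0) := by
  have := (ENNReal.tendsto_toReal ENNReal.zero_ne_top).comp h
  rwa [ENNReal.toReal_zero] at this

/-- Bounded sequences in a separable Hilbert space have weakly convergent subsequences. -/
theorem exists_weak_limit {H : Type*} [NormedAddCommGroup H] [InnerProductSpace ℝ H]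
    [CompleteSpace H] [TopologicalSpace.SeparableSpace H] {x : ℕ → H} {C : ℝ}
    (hx : ∀ n, ‖x n‖ ≤ C) :
    ∃ (y : H) (ns : ℕ → ℕ), StrictMono ns ∧
      ∀ z, Tendsto (fun n => inner ℝ (x (ns n)) z) atTop (𝓝 (inner ℝ y z)) := by
  obtain ⟨φ, -, ns, hns, hlim⟩ := WeakDual.isSeqCompact_closedBall (𝕜 := ℝ) (E := H) 0 C
    (x := fun n => StrongDual.toWeakDual (InnerProductSpace.toDual ℝ H (x n))) (fun n => by
      simpa using hx n)
  refine ⟨(InnerProductSpace.toDual ℝ H).symm (WeakDual.toStrongDual φ), ns, hns, fun z => ?_⟩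
  have h1 := ((WeakDual.eval_continuous z).tendsto φ).comp hlim
  rw [InnerProductSpace.toDual_symm_apply]
  refine h1.congr fun n => ?_
  simp [Function.comp]

theorem exists_weak_limit_memLp [SigmaFinite (volume : Measure X)]
    [MeasurableSpace.CountablyGenerated X] {f : ℕ → X → ℝ}
    (hf : ∀ n, MemLp (f n) 2 volume) {C : ℝ} (hC : ∀ n, ltwo (f n) ≤ C) :
    ∃ (g : X → ℝ) (ns : ℕ → ℕ), MemLp g 2 volume ∧ StrictMono ns ∧
      ∀ w : X → ℝ, MemLp w 2 volume →
        Tendsto (fun n => ∫ x, f (ns n) x * w x) atTop (𝓝 (∫ x, g x * w x)) := by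
  have : Fact ((2 : ℝ≥0∞) ≠ ⊤) := ⟨by norm_num⟩
  obtain ⟨y, ns, hns, h⟩ := exists_weak_limit (x := fun n => (hf n).toLp (f n))
    (fun n => by rw [← ltwo_eq_norm]; exact hC n)
  refine ⟨y, ns, Lp.memLp y, hns, fun w hw => ?_⟩
  simp_rw [fun n => integral_mul_eq_inner (hf n) hw]
  rw [integral_mul_eq_inner (Lp.memLp y) hw, Lp.toLp_coeFn]
  exact h _

end LTwoNorm

/-! ### Convolution operators on `L²` -/

section ConvolutionOperator

variable {d : ℕ} {L : ℝ} [Fact (0 < L)] {J : Cover d → ℝ} {u v w : Cyl d L → ℝ}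

/-- The kernel is bounded and supported in a ball, and that ball covers the cylinder with controlled
multiplicity. This bounds the kernel measure by volume without computing its periodized density. -/
theorem exists_lintegral_kernelMeasure_le (hJ : IsSmoothKernel J) :
    ∃ C : ℝ≥0∞, C ≠ ⊤ ∧ ∀ F : Cyl d L → ℝ≥0∞, Measurable F → ∀ x,
      ∫⁻ y, F (x - y) ∂kernelMeasure L J ≤ C * ∫⁻ x, F x := by
  obtain ⟨R, hR0, hR⟩ := exists_eq_zero_of_lt_norm hJ
  obtain ⟨S, hS⟩ := hJ.continuous.bounded_above_of_compact_support hJ.compactSupport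
  obtain ⟨C, hC, h⟩ := exists_lintegral_closedBall_le (d := d) (L := L) R hR0
  refine ⟨ENNReal.ofReal S * C, ENNReal.mul_ne_top ENNReal.ofReal_ne_top hC, fun F hF x => ?_⟩
  have hFx : Measurable fun y => F (x - y) := hF.comp (measurable_const_sub x)
  have hFz : Measurable fun z : Cover d => F (x - proj L z) :=
    hFx.comp continuous_proj.measurable
  rw [kernelMeasure, lintegral_map hFx continuous_proj.measurable,
    lintegral_withDensity_eq_lintegral_mul _ hJ.measurable_ofReal hFz]
  calc ∫⁻ z, ((fun z => ENNReal.ofReal (J z)) * fun z => F (x - proj L z) : Cover d → ℝ≥0∞) z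
      ≤ ∫⁻ z, (Metric.closedBall (0 : Cover d) R).indicator
          (fun z => ENNReal.ofReal S * F (x - proj L z)) z := by
        refine lintegral_mono fun z => ?_
        by_cases hz : z ∈ Metric.closedBall (0 : Cover d) R
        · rw [indicator_of_mem hz, Pi.mul_apply]
          gcongr
          exact (le_abs_self _).trans (hS z)
        · rw [mem_closedBall_zero_iff, not_le] at hz
          simp [hR z hz]
    _ = ENNReal.ofReal S * ∫⁻ z in Metric.closedBall (0 : Cover d) R, F (x - proj L z) := by
        rw [lintegral_indicator measurableSet_closedBall, lintegral_const_mul _ hFz]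
    _ ≤ ENNReal.ofReal S * (C * ∫⁻ y, F (x - y)) := by
        gcongr
        exact h _ hFx
    _ = ENNReal.ofReal S * C * ∫⁻ x, F x := by
        rw [lintegral_sub_left_eq_self (fun y => F y), mul_assoc]

theorem exists_memLp_shift (hJ : IsSmoothKernel J) :
    ∃ C : ℝ≥0∞, C ≠ ⊤ ∧ ∀ u : Cyl d L → ℝ, MemLp u 2 volume → ∀ x,
      MemLp (fun y => u (x - y)) 2 (kernelMeasure L J) ∧
      ‖conv J u x‖ₑ ^ 2 ≤ C * eLpNorm u 2 volume ^ 2 := by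
  obtain ⟨C, hC, h⟩ := exists_lintegral_kernelMeasure_le (L := L) hJ
  have := hJ.isProbabilityMeasure (L := L)
  refine ⟨C, hC, fun u hu x => ?_⟩
  have hm := aestronglyMeasurable_shift (J := J) hu.1 x
  have h1 : ∫⁻ y, ‖u (x - y)‖ₑ ^ 2 ∂kernelMeasure L J ≤ C * eLpNorm u 2 volume ^ 2 := by
    have h2 := h (fun y => ‖hu.1.mk u y‖ₑ ^ 2)
      (hu.1.stronglyMeasurable_mk.measurable.enorm.pow_const 2) x
    have e1 : ∫⁻ y, ‖u (x - y)‖ₑ ^ 2 ∂kernelMeasure L J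
        = ∫⁻ y, ‖hu.1.mk u (x - y)‖ₑ ^ 2 ∂kernelMeasure L J := by
      refine lintegral_congr_ae (kernelMeasure_absolutelyContinuous.ae_le ?_)
      filter_upwards [(quasiMeasurePreserving_sub_left volume x).ae hu.1.ae_eq_mk] with y hy
      rw [hy]
    have e2 : ∫⁻ y, ‖hu.1.mk u y‖ₑ ^ 2 = eLpNorm u 2 volume ^ 2 := by
      rw [eLpNorm_two_sq]
      refine lintegral_congr_ae ?_
      filter_upwards [hu.1.ae_eq_mk] with y hy
      rw [← hy]
    rw [e1, ← e2]
    exact h2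
  refine ⟨(memLp_two_iff_lintegral hm).2 (h1.trans_lt (ENNReal.mul_lt_top hC.lt_top
    (ENNReal.pow_lt_top hu.2))), ?_⟩
  rw [hJ.conv_eq_avg hu.1]
  exact (enorm_integral_sq_le hm).trans h1

theorem IsSmoothKernel.conv_add (hJ : IsSmoothKernel J) (hu : MemLp u 2 volume)
    (hv : MemLp v 2 volume) (x : Cyl d L) :
    conv J (fun x => u x + v x) x = conv J u x + conv J v x := by
  obtain ⟨C, hC, h⟩ := exists_memLp_shift (L := L) hJ
  have := hJ.isProbabilityMeasure (L := L)
  rw [hJ.conv_eq_avg hu.1, hJ.conv_eq_avg hv.1, hJ.conv_eq_avg (u := fun x => u x + v x) (hu.1.add hv.1)]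
  exact integral_add ((h u hu x).1.integrable (by norm_num)) ((h v hv x).1.integrable (by norm_num))

theorem conv_const_mul (c : ℝ) (u : Cyl d L → ℝ) (x : Cyl d L) :
    conv J (fun x => c * u x) x = c * conv J u x := by
  rw [conv, conv, ← integral_const_mul]
  refine integral_congr_ae (ae_of_all _ fun z => ?_)
  simp only; ring

theorem IsSmoothKernel.ltwo_conv_le (hJ : IsSmoothKernel J) (hu : MemLp u 2 volume) :
    ltwo (conv J u) ≤ ltwo u := ENNReal.toReal_mono hu.2.ne (hJ.eLpNorm_conv_le hu.1)

theorem exists_abs_conv_le_ltwo (hJ : IsSmoothKernel J) :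
    ∃ C : ℝ, 0 ≤ C ∧ ∀ u : Cyl d L → ℝ, MemLp u 2 volume → ∀ x, |conv J u x| ≤ C * ltwo u := by
  obtain ⟨C, hC, h⟩ := exists_memLp_shift (L := L) hJ
  refine ⟨√C.toReal, Real.sqrt_nonneg _, fun u hu x => ?_⟩
  have h1 := ENNReal.toReal_mono (ENNReal.mul_ne_top hC (ENNReal.pow_ne_top hu.2.ne)) (h u hu x).2
  rw [ENNReal.toReal_mul, ENNReal.toReal_pow, ENNReal.toReal_pow, toReal_enorm,
    Real.norm_eq_abs] at h1
  have h2 : C.toReal * (eLpNorm u 2 volume).toReal ^ 2 = (√C.toReal * ltwo u) ^ 2 := by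
    rw [mul_pow, Real.sq_sqrt ENNReal.toReal_nonneg]; rfl
  rw [h2] at h1
  exact (pow_le_pow_iff_left₀ (abs_nonneg _) (mul_nonneg (Real.sqrt_nonneg _) (ltwo_nonneg _))
    two_ne_zero).1 h1

/-- Evaluation of the convolution at a point is a bounded functional on L², so Riesz represents it.
Weak convergence therefore becomes pointwise convergence of convolutions. -/
theorem exists_conv_eq_inner (hJ : IsSmoothKernel J) (x : Cyl d L) :
    ∃ k : Cyl d L → ℝ, MemLp k 2 volume ∧ ∀ u : Cyl d L → ℝ, MemLp u 2 volume →
      conv J u x = ∫ y, u y * k y := by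
  obtain ⟨C, hC0, hC⟩ := exists_abs_conv_le_ltwo (L := L) hJ
  let ℓ : Lp ℝ 2 (volume : Measure (Cyl d L)) →ₗ[ℝ] ℝ :=
    { toFun := fun u => conv J u x
      map_add' := fun u v => by
        rw [conv_congr_ae (Lp.coeFn_add u v)]
        exact hJ.conv_add (Lp.memLp u) (Lp.memLp v) x
      map_smul' := fun c u => by
        rw [conv_congr_ae (Lp.coeFn_smul c u)]
        exact conv_const_mul c u x }
  let ℓc := ℓ.mkContinuous C fun u => by
    have := hC u (Lp.memLp u) x
    rw [ltwo_eq_norm (Lp.memLp u), Lp.toLp_coeFn] at this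
    exact this
  set k := (InnerProductSpace.toDual ℝ _).symm ℓc with hk
  refine ⟨k, Lp.memLp k, fun u hu => ?_⟩
  have h1 : inner ℝ k (hu.toLp u) = conv J (hu.toLp u) x := by
    rw [hk, InnerProductSpace.toDual_symm_apply]
    rfl
  rw [conv_congr_ae hu.coeFn_toLp] at h1
  rw [← h1, real_inner_comm, integral_mul_eq_inner hu (Lp.memLp k), Lp.toLp_coeFn]

end ConvolutionOperator

end NonlocalFront

namespace NonlocalFront

/-! ### Spectral gap of the linearized operator -/

section Profile

variable {β : ℝ} {K M P P₂ : ℝ → ℝ} {l l' c C lam : ℝ}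

/-- The multiplier `1 / (β (1 - M²))` of the linearized operator. -/
noncomputable def invMobility (β : ℝ) (M : ℝ → ℝ) (r : ℝ) : ℝ := 1 / (β * (1 - M r ^ 2))

namespace IsProfile

theorem nonneg (hM : IsProfile β K M P P₂ l l' c C lam) : 0 ≤ c :=
  (abs_nonneg _).trans (hM.abs_le 0)

theorem const_pos (hM : IsProfile β K M P P₂ l l' c C lam) : 0 < C := by
  have h := (hM.pos 0).trans_le (hM.deriv_le 0)
  exact pos_of_mul_pos_left h (Real.exp_pos _).le

theorem deriv_le_const (hM : IsProfile β K M P P₂ l l' c C lam) (r : ℝ) : P r ≤ C := by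
  refine (hM.deriv_le r).trans (mul_le_of_le_one_right hM.const_pos.le ?_)
  rw [Real.exp_le_one_iff]
  nlinarith [hM.lam_pos, abs_nonneg r]

theorem continuous (hM : IsProfile β K M P P₂ l l' c C lam) : Continuous M :=
  continuous_iff_continuousAt.2 fun x => (hM.hasDerivAt x).continuousAt

theorem continuous_deriv (hM : IsProfile β K M P P₂ l l' c C lam) : Continuous P :=
  continuous_iff_continuousAt.2 fun x => (hM.hasDerivAt_deriv x).continuousAt

theorem sq_le (hM : IsProfile β K M P P₂ l l' c C lam) (r : ℝ) : M r ^ 2 ≤ c ^ 2 :=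
  sq_le_sq' (by have := neg_le_of_abs_le (hM.abs_le r); linarith) (le_of_abs_le (hM.abs_le r))

theorem one_sub_sq_pos (hM : IsProfile β K M P P₂ l l' c C lam) : 0 < 1 - c ^ 2 := by
  nlinarith [hM.nonneg, hM.lt_one]

theorem mobility_pos (hM : IsProfile β K M P P₂ l l' c C lam) (hβ : 1 < β) (r : ℝ) :
    0 < β * (1 - M r ^ 2) :=
  mul_pos (by linarith) (by linarith [hM.sq_le r, hM.one_sub_sq_pos])

theorem invMobility_pos (hM : IsProfile β K M P P₂ l l' c C lam) (hβ : 1 < β) (r : ℝ) :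
    0 < invMobility β M r := one_div_pos.2 (hM.mobility_pos hβ r)

theorem le_invMobility (hM : IsProfile β K M P P₂ l l' c C lam) (hβ : 1 < β) (r : ℝ) :
    1 / β ≤ invMobility β M r := by
  refine one_div_le_one_div_of_le (hM.mobility_pos hβ r) ?_
  nlinarith [sq_nonneg (M r)]

theorem invMobility_le (hM : IsProfile β K M P P₂ l l' c C lam) (hβ : 1 < β) (r : ℝ) :
    invMobility β M r ≤ 1 / (β * (1 - c ^ 2)) := by
  have := hM.one_sub_sq_pos
  refine one_div_le_one_div_of_le (by positivity) ?_
  have := hM.sq_le r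
  gcongr

theorem continuous_invMobility (hM : IsProfile β K M P P₂ l l' c C lam) (hβ : 1 < β) :
    Continuous (invMobility β M) := by
  have := hM.continuous
  exact continuous_const.div (by fun_prop) fun r => (hM.mobility_pos hβ r).ne'

theorem tendsto_atTop (hM : IsProfile β K M P P₂ l l' c C lam) : Tendsto M atTop (𝓝 l) := by
  rw [tendsto_iff_dist_tendsto_zero]
  refine squeeze_zero (fun _ => dist_nonneg) (fun x => hM.sub_le x) ?_
  have h1 : Tendsto (fun x : ℝ => -lam * x) atTop atBot :=
    tendsto_id.const_mul_atTop_of_neg (by linarith [hM.lam_pos])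
  simpa using (Real.tendsto_exp_atBot.comp h1).const_mul C

theorem tendsto_atBot (hM : IsProfile β K M P P₂ l l' c C lam) : Tendsto M atBot (𝓝 (-l')) := by
  rw [tendsto_iff_dist_tendsto_zero]
  have h0 : ∀ x, dist (M x) (-l') ≤ C * Real.exp (lam * x) := fun x => by
    rw [Real.dist_eq, sub_neg_eq_add]; exact hM.add_le x
  refine squeeze_zero (fun _ => dist_nonneg) h0 ?_
  have h1 : Tendsto (fun x : ℝ => lam * x) atBot atBot :=
    tendsto_id.const_mul_atBot hM.lam_pos
  simpa using (Real.tendsto_exp_atBot.comp h1).const_mul C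

/-- The multiplier is bounded away from `1` far from the interface. -/
theorem exists_one_add_le_invMobility (hM : IsProfile β K M P P₂ l l' c C lam) (hβ : 1 < β) :
    ∃ c₀ R₀ : ℝ, 0 < c₀ ∧ ∀ r, R₀ < |r| → 1 + c₀ ≤ invMobility β M r := by
  have key : ∀ s : ℝ, β * (1 - s ^ 2) < 1 → 0 < β * (1 - s ^ 2) → ∀ F : Filter ℝ,
      Tendsto M F (𝓝 s) → ∃ c₀ > 0, ∀ᶠ r in F, 1 + c₀ ≤ invMobility β M r := by
    intro s hs hs0 F hF
    have h1 : 1 < 1 / (β * (1 - s ^ 2)) := by rwa [one_lt_div hs0]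
    obtain ⟨b, hb1, hb2⟩ := exists_between h1
    refine ⟨b - 1, by linarith, ?_⟩
    have h2 : Tendsto (invMobility β M) F (𝓝 (1 / (β * (1 - s ^ 2)))) :=
      tendsto_const_nhds.div (((tendsto_const_nhds.sub (hF.pow 2))).const_mul β) hs0.ne'
    filter_upwards [h2.eventually (lt_mem_nhds hb2)] with r hr
    linarith
  have hpos : ∀ s : ℝ, IsPositiveMinimizer β s → 0 < β * (1 - s ^ 2) := fun s hs => by
    have := hs.mem_Ioo hβ
    exact mul_pos (by linarith) (by nlinarith [this.1, this.2])
  obtain ⟨c₁, hc₁, h₁⟩ := key l (hM.minimizer.mul_lt_one hβ) (hpos l hM.minimizer) _ hM.tendsto_atTop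
  obtain ⟨c₂, hc₂, h₂⟩ := key (-l') (by rw [neg_sq]; exact hM.minimizer'.mul_lt_one hβ)
    (by rw [neg_sq]; exact hpos l' hM.minimizer') _ hM.tendsto_atBot
  obtain ⟨X, hX⟩ := eventually_atTop.1 h₁
  obtain ⟨Y, hY⟩ := eventually_atBot.1 h₂
  refine ⟨min c₁ c₂, max X (-Y), lt_min hc₁ hc₂, fun r hr => ?_⟩
  rcases le_total 0 r with h0 | h0
  · rw [abs_of_nonneg h0] at hr
    have := hX r ((le_max_left _ _).trans hr.le)
    linarith [min_le_left c₁ c₂]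
  · rw [abs_of_nonpos h0] at hr
    have := hY r (by linarith [(le_max_right X (-Y)).trans hr.le])
    linarith [min_le_right c₁ c₂]

end IsProfile

end Profile

theorem integrable_exp_neg_mul_abs {k : ℝ} (hk : 0 < k) :
    Integrable fun r : ℝ => Real.exp (-k * |r|) := by
  have h1 : IntegrableOn (fun r : ℝ => Real.exp (-k * |r|)) (Ioi 0) :=
    (exp_neg_integrableOn_Ioi 0 hk).congr_fun (fun r hr => by simp only [abs_of_pos (mem_Ioi.1 hr)])
      measurableSet_Ioi
  have h2 : IntegrableOn (fun r : ℝ => Real.exp (-k * |r|)) (Iic 0) := by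
    refine (integrableOn_exp_mul_Iic hk 0).congr_fun (fun r hr => ?_) measurableSet_Iic
    simp only [abs_of_nonpos (mem_Iic.1 hr)]
    ring_nf
  have := h2.union h1
  rwa [Iic_union_Ioi, integrableOn_univ] at this

section Gap

variable {d : ℕ} {L : ℝ} [Fact (0 < L)]

theorem integrable_exp_longitudinal {k : ℝ} (hk : 0 < k) :
    Integrable fun x : Cyl d L => Real.exp (-k * |x.1|) :=
  (integrable_exp_neg_mul_abs hk).comp_fst volume

theorem memLp_exp_longitudinal {k : ℝ} (hk : 0 < k) :
    MemLp (fun x : Cyl d L => Real.exp (-k * |x.1|)) 2 volume := by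
  have hc : Continuous fun x : Cyl d L => Real.exp (-k * |x.1|) := by fun_prop
  rw [memLp_two_iff_integrable_sq hc.aestronglyMeasurable]
  refine (integrable_exp_longitudinal (d := d) (L := L) (k := 2 * k) (by linarith)).congr
    (ae_of_all _ fun x => ?_)
  simp only [← Real.exp_nat_mul]
  congr 1; push_cast; ring

variable {J : Cover d → ℝ} {β : ℝ} {M P P₂ : ℝ → ℝ} {l l' c C lam : ℝ} {u v w : Cyl d L → ℝ}

namespace IsProfile

variable {K : ℝ → ℝ}

theorem memLp_deriv (hM : IsProfile β K M P P₂ l l' c C lam) :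
    MemLp (fun x : Cyl d L => P x.1) 2 volume := by
  refine memLp_of_abs_le (hM.continuous_deriv.comp continuous_fst).aestronglyMeasurable
    (memLp_exp_longitudinal (d := d) (L := L) hM.lam_pos) (c := C) (ae_of_all _ fun x => ?_)
  rw [abs_of_pos (hM.pos _), abs_of_pos (Real.exp_pos _)]
  exact hM.deriv_le _

theorem abs_invMobility_le (hM : IsProfile β K M P P₂ l l' c C lam) (hβ : 1 < β) (r : ℝ) :
    |invMobility β M r| ≤ 1 / (β * (1 - c ^ 2)) := by
  rw [abs_of_pos (hM.invMobility_pos hβ r)]; exact hM.invMobility_le hβ r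

theorem memLp_invMobility_mul (hM : IsProfile β K M P P₂ l l' c C lam) (hβ : 1 < β)
    (hu : MemLp u 2 volume) : MemLp (fun x => invMobility β M x.1 * u x) 2 volume :=
  memLp_mul_of_bounded
    ((hM.continuous_invMobility hβ).comp continuous_fst).aestronglyMeasurable
    (ae_of_all _ fun x => hM.abs_invMobility_le hβ x.1) hu

end IsProfile

/-- The linearized operator at a longitudinal profile. -/
noncomputable def frontOp (β : ℝ) (J : Cover d → ℝ) (M : ℝ → ℝ) (v : Cyl d L → ℝ) : Cyl d L → ℝ :=
  fun x => invMobility β M x.1 * v x - conv J v x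

theorem linOp_eq_frontOp (β : ℝ) (J : Cover d → ℝ) (M : ℝ → ℝ) (v : Cyl d L → ℝ) :
    linOp β J (fun x => M x.1) v = frontOp β J M v := by
  funext x
  simp only [linOp, frontOp, invMobility]
  ring

section

variable (hβ : 1 < β) (hJ : IsSmoothKernel J)
  (hM : IsProfile β (marginal J) M P P₂ l l' c C lam)

include hβ hJ hM

theorem memLp_frontOp (hu : MemLp u 2 volume) : MemLp (frontOp β J M u) 2 volume :=
  (hM.memLp_invMobility_mul hβ hu).sub (hJ.memLp_conv hu)

/-- This is the linear equation for the derivative of the front, transported to the cylinder: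
translations of the front produce a null vector of the linearized operator. -/
theorem conv_profile_deriv (x : Cyl d L) :
    conv J (fun x => P x.1) x = invMobility β M x.1 * P x.1 := by
  rw [hJ.conv_longitudinal hM.continuous_deriv.measurable (C := C) (fun r => ?_)]
  · have := hM.deriv_eq x.1
    have h0 := hM.mobility_pos hβ x.1
    rw [invMobility, one_div, eq_inv_mul_iff_mul_eq₀ h0.ne', ← this]
  · rw [abs_of_pos (hM.pos _)]
    exact hM.deriv_le_const r

theorem integral_mul_frontOp_comm (hu : MemLp u 2 volume) (hw : MemLp w 2 volume) :
    ∫ x, w x * frontOp β J M u x = ∫ x, u x * frontOp β J M w x := by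
  have key : ∀ a b : Cyl d L → ℝ, MemLp a 2 volume → MemLp b 2 volume →
      ∫ x, a x * frontOp β J M b x
        = (∫ x, a x * (invMobility β M x.1 * b x)) - ∫ x, a x * conv J b x := fun a b ha hb => by
    simp only [frontOp, mul_sub]
    exact integral_sub (ha.integrable_mul (hM.memLp_invMobility_mul hβ hb))
      (ha.integrable_mul (hJ.memLp_conv hb))
  rw [key w u hw hu, key u w hu hw, hJ.integral_mul_conv_comm hu hw]
  congr 1
  · exact integral_congr_ae (ae_of_all _ fun x => by ring)
  · exact integral_congr_ae (ae_of_all _ fun x => by ring)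

/-- By symmetry the range is orthogonal to the null vector. This is the mean value condition under
which the weighted Poincaré inequality is later applied to Bv. -/
theorem integral_frontOp_mul_deriv (hu : MemLp u 2 volume) :
    ∫ x, frontOp β J M u x * P x.1 = 0 := by
  have h := integral_mul_frontOp_comm (L := L) hβ hJ hM hu hM.memLp_deriv
  have e : ∀ x : Cyl d L, u x * frontOp β J M (fun x : Cyl d L => P x.1) x = 0 := fun x => by
    rw [frontOp, conv_profile_deriv hβ hJ hM]; ring
  simp only [e, integral_zero] at h
  rw [← h]
  exact integral_congr_ae (ae_of_all _ fun x => by ring)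

/-- Since |J⋆v| ≤ J⋆|v|, the function B|v| is nonpositive. Its integral against the strictly
positive null vector vanishes, so it is zero. -/
theorem ae_frontOp_abs_eq_zero (hv : MemLp v 2 volume) (h : frontOp β J M v =ᵐ[volume] 0) :
    frontOp β J M (fun x => |v x|) =ᵐ[volume] 0 := by
  have hv' : MemLp (fun x => |v x|) 2 volume := hv.abs
  have hle : ∀ᵐ x, 0 ≤ -(frontOp β J M (fun x => |v x|) x) := by
    filter_upwards [h] with x hx
    have h1 : invMobility β M x.1 * v x = conv J v x := by
      have : invMobility β M x.1 * v x - conv J v x = 0 := hx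
      linarith
    have h2 : |conv J v x| ≤ conv J (fun x => |v x|) x := by
      rw [conv, conv]
      refine (abs_integral_le_integral_abs).trans (le_of_eq (integral_congr_ae ?_))
      exact ae_of_all _ fun z => by simp only [abs_mul, abs_of_nonneg (hJ.nonneg z)]
    rw [← h1, abs_mul, abs_of_pos (hM.invMobility_pos hβ _)] at h2
    simp only [frontOp]
    linarith
  have hint := integral_frontOp_mul_deriv hβ hJ hM hv'
  have hi : Integrable fun x => -(frontOp β J M (fun x => |v x|) x) * P x.1 :=
    ((memLp_frontOp hβ hJ hM hv').neg).integrable_mul hM.memLp_deriv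
  have h0 : ∫ x, -(frontOp β J M (fun x => |v x|) x) * P x.1 = 0 := by
    simp only [neg_mul, integral_neg, hint, neg_zero]
  rw [integral_eq_zero_iff_of_nonneg_ae
    (hle.mono fun x hx => mul_nonneg hx (hM.pos _).le) hi] at h0
  filter_upwards [h0] with x hx
  have := (mul_eq_zero.1 hx).resolve_right (hM.pos _).ne'
  simpa using this

/-- A null function has the continuous representative (J⋆v)/ψ, where ψ = 1/(β(1 − M²)). At a zero of
this representative its average over the kernel vanishes, and zeros propagate over the whole
cylinder. -/
theorem frontOp_zero_dichotomy (hv : MemLp v 2 volume) (hv0 : ∀ x, 0 ≤ v x)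
    (h : frontOp β J M v =ᵐ[volume] 0) :
    v =ᵐ[volume] 0 ∨ ∀ᵐ x, 0 < v x := by
  set u : Cyl d L → ℝ := fun x => conv J v x / invMobility β M x.1 with hu
  have huv : v =ᵐ[volume] u := by
    filter_upwards [h] with x hx
    have : invMobility β M x.1 * v x - conv J v x = 0 := hx
    rw [hu]
    have h0 := (hM.invMobility_pos hβ x.1).ne'
    field_simp
    linarith
  have hcont : Continuous u :=
    (hJ.isSmoothFn_conv (locallyIntegrable_of_memLp hv)).continuous.div
      ((hM.continuous_invMobility hβ).comp continuous_fst) fun x => (hM.invMobility_pos hβ x.1).ne'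
  have hnn : ∀ x, 0 ≤ u x := fun x =>
    div_nonneg (integral_nonneg fun z => mul_nonneg (hJ.nonneg z) (hv0 _))
      (hM.invMobility_pos hβ x.1).le
  have hne : ∃ z, J z ≠ 0 := by
    by_contra! h
    have := hJ.integral_eq_one
    simp [h] at this
  have key : ∀ x, u x = 0 → ∀ z, u (x + projHom d L z) = 0 := fun x hx z =>
    eq_zero_of_propagation (μ := volume) (projHom d L) continuous_proj hJ.continuous
      hJ.compactSupport hJ.nonneg hJ.even hne hcont hnn
      (fun x hx => by
        have h1 : conv J v x = 0 := by
          rw [hu] at hx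
          exact (div_eq_zero_iff.1 hx).resolve_right (hM.invMobility_pos hβ x.1).ne'
        rw [conv_congr_ae huv] at h1
        exact h1) hx z
  by_cases hz : ∃ x, u x = 0
  · obtain ⟨x, hx⟩ := hz
    left
    filter_upwards [huv] with y hy
    obtain ⟨z, hz⟩ := surjective_proj (L := L) (y - x)
    have := key x hx z
    rw [show projHom d L z = proj L z from rfl, hz, add_sub_cancel] at this
    rw [hy, this]; rfl
  · push Not at hz
    right
    filter_upwards [huv] with y hy
    rw [hy]
    exact lt_of_le_of_ne (hnn y) (hz y).symm

/-- The kernel of the linearized operator is spanned by the derivative of the profile. -/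
theorem ae_eq_zero_of_frontOp_eq_zero (hv : MemLp v 2 volume) (h : frontOp β J M v =ᵐ[volume] 0)
    (hP : ∫ x, v x * P x.1 = 0) : v =ᵐ[volume] 0 := by
  have habs := ae_frontOp_abs_eq_zero hβ hJ hM hv h
  have hcomb : ∀ s : ℝ, frontOp β J M (fun x => |v x| + s * v x) =ᵐ[volume] 0 := fun s => by
    filter_upwards [h, habs] with x hx hx'
    simp only [frontOp, Pi.zero_apply] at hx hx' ⊢
    rw [hJ.conv_add (u := fun x => |v x|) hv.abs (hv.const_mul s), conv_const_mul]
    linear_combination hx' + s * hx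
  have hmem : ∀ s : ℝ, MemLp (fun x => |v x| + s * v x) 2 volume :=
    fun s => hv.abs.add (hv.const_mul s)
  have hPpos : ∀ x : Cyl d L, 0 < P x.1 := fun x => hM.pos _
  have hconcl : ∀ s : ℝ, (∀ᵐ x, 0 ≤ s * v x) → (s = 1 ∨ s = -1) → v =ᵐ[volume] 0 := by
    intro s hs hs1
    have hi : Integrable fun x => s * v x * P x.1 := (hv.const_mul s).integrable_mul hM.memLp_deriv
    have h0 : ∫ x, s * v x * P x.1 = 0 := by
      simp only [mul_assoc, integral_const_mul, hP, mul_zero]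
    rw [integral_eq_zero_iff_of_nonneg_ae (hs.mono fun x hx => mul_nonneg hx (hPpos x).le) hi] at h0
    filter_upwards [h0] with x hx
    have := (mul_eq_zero.1 hx).resolve_right (hPpos x).ne'
    rcases hs1 with rfl | rfl <;> simpa using this
  -- Applied to |v| + v, the dichotomy says that v is nonpositive or strictly positive almost
  -- everywhere. A function of one sign that is orthogonal to a positive function vanishes.
  rcases frontOp_zero_dichotomy hβ hJ hM (hmem 1)
    (fun x => by linarith [neg_abs_le (v x)]) (hcomb 1) with h1 | h1
  · refine hconcl (-1) ?_ (Or.inr rfl)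
    filter_upwards [h1] with x hx
    simp only [Pi.zero_apply] at hx
    linarith [abs_nonneg (v x)]
  · refine hconcl 1 ?_ (Or.inl rfl)
    filter_upwards [h1] with x hx
    by_contra! hn
    rw [abs_of_neg (by linarith)] at hx
    linarith

/-- A compactness argument by contradiction. A normalized sequence violating the bound has a weak
limit in the kernel and orthogonal to P, hence zero. Then J⋆fₙ vanishes in the limit near the
interface, while away from it the multiplier exceeds 1 and leaves no room for mass. -/
theorem exists_gap : ∃ Cg : ℝ, 0 < Cg ∧ ∀ u : Cyl d L → ℝ, MemLp u 2 volume →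
    ltwo u ≤ Cg * (ltwo (frontOp β J M u) + |∫ x, u x * P x.1|) := by
  by_contra! hcon
  have hn : ∀ n : ℕ, ∃ v : Cyl d L → ℝ, MemLp v 2 volume ∧ ltwo v = 1 ∧
      ltwo (frontOp β J M v) ≤ 1 / ((n : ℝ) + 1) ∧ |∫ x, v x * P x.1| ≤ 1 / ((n : ℝ) + 1) := by
    intro n
    have hn0 : (0 : ℝ) < (n : ℝ) + 1 := by positivity
    obtain ⟨u, hu, hlt⟩ := hcon ((n : ℝ) + 1) hn0
    have hpos : 0 < ltwo u := lt_of_le_of_lt (mul_nonneg hn0.le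
      (add_nonneg (ltwo_nonneg _) (abs_nonneg _))) hlt
    set s := (ltwo u)⁻¹ with hs
    have hs0 : 0 < s := inv_pos.2 hpos
    have hop : frontOp β J M (fun x => s * u x) = fun x => s * frontOp β J M u x := by
      funext x
      simp only [frontOp, conv_const_mul]; ring
    have hlt' : s * (ltwo (frontOp β J M u) + |∫ x, u x * P x.1|) ≤ 1 / ((n : ℝ) + 1) := by
      rw [hs, inv_mul_le_iff₀ hpos, mul_one_div, le_div_iff₀ hn0]
      linarith
    refine ⟨fun x => s * u x, hu.const_mul s, ?_, ?_, ?_⟩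
    · rw [ltwo_const_mul, abs_of_pos hs0, hs, inv_mul_cancel₀ hpos.ne']
    · rw [hop, ltwo_const_mul, abs_of_pos hs0]
      nlinarith [mul_nonneg hs0.le (abs_nonneg (∫ x, u x * P x.1))]
    · simp only [mul_assoc, integral_const_mul]
      rw [abs_mul, abs_of_pos hs0]
      nlinarith [mul_nonneg hs0.le (ltwo_nonneg (frontOp β J M u))]
  choose f hf hf1 hfB hfP using hn
  obtain ⟨g, ns, hg, hns, hlim⟩ := exists_weak_limit_memLp hf (C := 1) fun n => (hf1 n).le
  have h1n : Tendsto (fun n => 1 / (((ns n : ℕ) : ℝ) + 1)) atTop (𝓝 0) :=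
    tendsto_one_div_add_atTop_nhds_zero_nat.comp hns.tendsto_atTop
  -- Testing with B(Bg) and using symmetry gives ∫ fₙ B(Bg) = ∫ Bg·Bfₙ → 0, so ‖Bg‖² = 0. Weak
  -- convergence of Bfₙ is not needed.
  have hBg : frontOp β J M g =ᵐ[volume] 0 := by
    have hB2 := memLp_frontOp hβ hJ hM hg
    have hz : ∫ x, g x * frontOp β J M (frontOp β J M g) x = 0 := by
      refine tendsto_nhds_unique (hlim _ (memLp_frontOp hβ hJ hM hB2)) ?_
      refine squeeze_zero_norm (a := fun n => 1 / (((ns n : ℕ) : ℝ) + 1) * ltwo (frontOp β J M g))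
        (fun n => ?_) (by simpa using h1n.mul_const (ltwo (frontOp β J M g)))
      rw [← integral_mul_frontOp_comm hβ hJ hM (hf _) hB2, Real.norm_eq_abs]
      refine (abs_integral_mul_le hB2 (memLp_frontOp hβ hJ hM (hf _))).trans ?_
      rw [mul_comm]
      exact mul_le_mul_of_nonneg_right (hfB _) (ltwo_nonneg _)
    rw [← integral_mul_frontOp_comm hβ hJ hM hg hB2] at hz
    refine ae_eq_zero_of_ltwo_eq_zero hB2 (pow_eq_zero_iff two_ne_zero |>.1 ?_)
    rw [ltwo_sq hB2, ← hz]
    exact integral_congr_ae (ae_of_all _ fun x => by ring)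
  have hPg : ∫ x, g x * P x.1 = 0 :=
    tendsto_nhds_unique (hlim _ hM.memLp_deriv)
      (squeeze_zero_norm (fun n => hfP _) h1n)
  have hg0 := ae_eq_zero_of_frontOp_eq_zero hβ hJ hM hg hBg hPg
  obtain ⟨c₀, R₀, hc₀, hR₀⟩ := hM.exists_one_add_le_invMobility hβ
  obtain ⟨Cj, hCj0, hCj⟩ := exists_abs_conv_le_ltwo (L := L) hJ
  set W : Set (Cyl d L) := {x | |x.1| ≤ R₀} with hW
  have hWc : IsClosed W := isClosed_le (by fun_prop) (by fun_prop)
  have hWfin : volume W < ⊤ := by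
    have : W ⊆ Icc (-R₀) R₀ ×ˢ univ := fun x hx => ⟨abs_le.1 hx, trivial⟩
    refine (measure_mono this).trans_lt ?_
    rw [Measure.volume_eq_prod, Measure.prod_prod]
    exact ENNReal.mul_lt_top isCompact_Icc.measure_lt_top (measure_lt_top _ _)
  -- Weak convergence to zero gives pointwise convergence of the convolutions. Together with their
  -- uniform bound and the finite measure of the window this yields convergence in L² there.
  have hpt : ∀ x, Tendsto (fun n => conv J (f (ns n)) x) atTop (𝓝 0) := fun x => by
    obtain ⟨k, hk, hkx⟩ := exists_conv_eq_inner (L := L) hJ x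
    have := hlim k hk
    rw [integral_eq_zero_of_ae (by filter_upwards [hg0] with y hy; simp [hy])] at this
    exact this.congr fun n => (hkx _ (hf _)).symm
  have hconv : Tendsto (fun n => ltwo fun x => conv J (f (ns n)) x * W.indicator 1 x)
      atTop (𝓝 0) := by
    refine tendsto_ltwo_zero (tendsto_eLpNorm_mul_zero (C := Cj * 1)
      (fun n => (hJ.memLp_conv (hf _)).1) (fun n => ae_of_all _ fun x => ?_)
      (ae_of_all _ hpt) ?_)
    · exact (hCj _ (hf _) x).trans (by rw [hf1])
    · exact (memLp_indicator_const 2 hWc.measurableSet (1 : ℝ) (Or.inr hWfin.ne))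
  -- From ψv = Bv + J⋆v one divides by ψ ≥ 1/β inside the window and by ψ ≥ 1 + c₀ outside. In the
  -- limit only 1/(1 + c₀) < 1 remains on the right.
  have hmain : ∀ n, 1 ≤ β * (1 / (((ns n : ℕ) : ℝ) + 1))
      + β * (ltwo fun x => conv J (f (ns n)) x * W.indicator 1 x) + 1 / (1 + c₀) := by
    intro n
    set v := f (ns n) with hv
    have hvm : MemLp v 2 volume := hf _
    have m1 := memLp_frontOp hβ hJ hM hvm
    have m2 : MemLp (fun x => conv J v x * W.indicator 1 x) 2 volume := by
      refine memLp_of_abs_le ((hJ.memLp_conv hvm).1.mul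
        ((aestronglyMeasurable_const (b := (1 : ℝ))).indicator hWc.measurableSet))
        (hJ.memLp_conv hvm) (c := 1) (ae_of_all _ fun x => ?_)
      by_cases hx : x ∈ W <;> simp [hx]
    have m3 := hJ.memLp_conv hvm
    have hle : ltwo v ≤ ltwo fun x => (β * |frontOp β J M v x|
        + β * |conv J v x * W.indicator 1 x|) + 1 / (1 + c₀) * |conv J v x| := by
      refine ltwo_mono (((m1.abs.const_mul β).add (m2.abs.const_mul β)).add
        (m3.abs.const_mul _)) (ae_of_all _ fun x => ?_)
      have hψ := hM.invMobility_pos hβ x.1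
      have hβ0 : 0 < β := by linarith
      have e : invMobility β M x.1 * v x = frontOp β J M v x + conv J v x := by
        simp [frontOp]
      have e' : invMobility β M x.1 * |v x| ≤ |frontOp β J M v x| + |conv J v x| := by
        rw [← abs_of_pos hψ, ← abs_mul, e]; exact abs_add_le _ _
      refine le_trans ?_ (le_abs_self _)
      have hb := hM.le_invMobility hβ x.1
      rw [div_le_iff₀ hβ0] at hb
      by_cases hx : x ∈ W
      · have h3 : (0 : ℝ) ≤ 1 / (1 + c₀) * |conv J v x| := by positivity
        simp only [indicator_of_mem hx, Pi.one_apply, mul_one]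
        nlinarith [mul_le_mul_of_nonneg_left hb (abs_nonneg (v x)), abs_nonneg (v x)]
      · have h4 := hR₀ x.1 (not_le.1 hx)
        simp only [indicator_of_notMem hx, mul_zero, abs_zero, add_zero]
        have h5 : |v x| ≤ (|frontOp β J M v x| + |conv J v x|) / invMobility β M x.1 := by
          rw [le_div_iff₀ hψ]; linarith
        refine h5.trans ?_
        rw [add_div]
        gcongr
        · rw [div_le_iff₀ hψ]
          nlinarith [abs_nonneg (frontOp β J M v x)]
        · rw [div_eq_mul_one_div, mul_comm]
          gcongr
    rw [hf1] at hle
    refine hle.trans ((ltwo_add_le ((m1.abs.const_mul β).add (m2.abs.const_mul β))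
        (m3.abs.const_mul _)).trans ?_)
    have habs : ∀ u : Cyl d L → ℝ, MemLp u 2 volume → ∀ s : ℝ, 0 ≤ s →
        ltwo (fun x => s * |u x|) = s * ltwo u := fun u hu s hs => by
      rw [ltwo_const_mul, abs_of_nonneg hs]
      congr 1
      exact le_antisymm (ltwo_mono hu (ae_of_all _ fun x => by simp))
        (ltwo_mono hu.abs (ae_of_all _ fun x => by simp))
    have hβ0 : 0 ≤ β := by linarith
    gcongr ?_ + ?_
    · refine (ltwo_add_le (m1.abs.const_mul β) (m2.abs.const_mul β)).trans ?_
      change (ltwo fun x => β * |frontOp β J M v x|)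
        + (ltwo fun x => β * |conv J v x * W.indicator 1 x|) ≤ _
      rw [habs _ m1 β hβ0, habs _ m2 β hβ0]
      gcongr
      exact hfB _
    · change (ltwo fun x => 1 / (1 + c₀) * |conv J v x|) ≤ _
      rw [habs _ m3 _ (by positivity)]
      have := (hJ.ltwo_conv_le hvm).trans (hf1 _).le
      exact mul_le_of_le_one_right (by positivity) this
  have hlim2 := ((h1n.const_mul β).add (hconv.const_mul β)).add_const (1 / (1 + c₀))
  have := ge_of_tendsto' hlim2 hmain
  simp only [mul_zero, add_zero, zero_add] at this
  rw [le_div_iff₀ (by linarith)] at this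
  linarith

end

end Gap

end NonlocalFront

namespace NonlocalFront

/-! ### Weighted estimates and coercivity of the linearized dissipation -/

theorem abs_one_sub_exp_le (t : ℝ) : |1 - Real.exp t| ≤ Real.exp |t| - 1 := by
  rcases le_total 0 t with h | h
  · rw [abs_of_nonneg h, abs_of_nonpos (by linarith [Real.add_one_le_exp t])]; linarith
  · rw [abs_of_nonpos h, abs_of_nonneg (by linarith [Real.exp_le_one_iff.2 h])]
    linarith [Real.add_one_le_exp t, Real.add_one_le_exp (-t)]

section Weighted

variable {d : ℕ} {L : ℝ} [Fact (0 < L)]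
variable {J : Cover d → ℝ} {β : ℝ} {M P P₂ : ℝ → ℝ} {l l' c C lam : ℝ} {u v w : Cyl d L → ℝ}

/-- The exponential weight in the longitudinal direction. -/
noncomputable def expWeight (k : ℝ) (x : Cyl d L) : ℝ := Real.exp (-k * |x.1|)

theorem expWeight_pos (k : ℝ) (x : Cyl d L) : 0 < expWeight k x := Real.exp_pos _

theorem continuous_expWeight (k : ℝ) : Continuous (expWeight (d := d) (L := L) k) := by
  unfold expWeight; fun_prop

theorem expWeight_le_one {k : ℝ} (hk : 0 ≤ k) (x : Cyl d L) : expWeight k x ≤ 1 := by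
  rw [expWeight, Real.exp_le_one_iff]; nlinarith [abs_nonneg x.1]

theorem expWeight_anti {k k' : ℝ} (h : k ≤ k') (x : Cyl d L) : expWeight k' x ≤ expWeight k x :=
  Real.exp_le_exp.2 (by nlinarith [abs_nonneg x.1])

theorem memLp_expWeight_mul {k : ℝ} (hk : 0 ≤ k) (hu : MemLp u 2 volume) :
    MemLp (fun x => expWeight k x * u x) 2 volume :=
  memLp_mul_of_bounded (continuous_expWeight k).aestronglyMeasurable (C := 1)
    (ae_of_all _ fun x => by
      rw [abs_of_pos (expWeight_pos k x)]; exact expWeight_le_one hk x) hu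

theorem abs_expWeight_sub_le {k R : ℝ} (hk : 0 ≤ k) {x y : Cyl d L} (hy : |y.1| ≤ R) :
    |expWeight k (x - y) - expWeight k x| ≤ (Real.exp (k * R) - 1) * expWeight k (x - y) := by
  have e : expWeight k (x - y) - expWeight k x
      = expWeight k (x - y) * (1 - Real.exp (k * (|(x - y).1| - |x.1|))) := by
    rw [mul_sub, expWeight, expWeight, ← Real.exp_add]
    ring_nf
  have h1 : |k * (|(x - y).1| - |x.1|)| ≤ k * R := by
    rw [abs_mul, abs_of_nonneg hk]
    refine mul_le_mul_of_nonneg_left ((abs_abs_sub_abs_le _ _).trans ?_) hk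
    simpa using hy
  rw [e, abs_mul, abs_of_pos (expWeight_pos k _), mul_comm]
  refine mul_le_mul_of_nonneg_right ?_ (expWeight_pos k _).le
  exact (abs_one_sub_exp_le _).trans (sub_le_sub_right (Real.exp_le_exp.2 h1) 1)

theorem IsSmoothKernel.exists_ae_abs_fst_le (hJ : IsSmoothKernel J) :
    ∃ R : ℝ, 0 < R ∧ ∀ᵐ y ∂kernelMeasure L J, |y.1| ≤ R := by
  obtain ⟨R, hR0, hR⟩ := exists_eq_zero_of_lt_norm hJ
  refine ⟨R, hR0, ?_⟩
  filter_upwards [hJ.ae_mem_support] with y hy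
  obtain ⟨z, hz, rfl⟩ := hy
  have hcl : tsupport J ⊆ Metric.closedBall 0 R :=
    closure_minimal (fun z hz => by
      rw [mem_closedBall_zero_iff]
      by_contra! h
      exact hz (hR z h)) Metric.isClosed_closedBall
  exact (abs_apply_le_norm z 0).trans (by simpa using hcl hz)

/-- The kernel has finite range R, over which the logarithm of the weight changes by at most kR. The
commutator of weight and convolution is therefore small for slowly varying weights. -/
theorem IsSmoothKernel.exists_abs_conv_expWeight_le (hJ : IsSmoothKernel J) :
    ∃ R : ℝ, 0 < R ∧ ∀ k : ℝ, 0 ≤ k → ∀ v : Cyl d L → ℝ, MemLp v 2 volume → ∀ x,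
      |conv J (fun x => expWeight k x * v x) x - expWeight k x * conv J v x|
        ≤ (Real.exp (k * R) - 1) * conv J (fun x => expWeight k x * |v x|) x := by
  obtain ⟨R, hR0, hsupp⟩ := hJ.exists_ae_abs_fst_le (L := L)
  obtain ⟨C, -, hC⟩ := exists_memLp_shift (L := L) hJ
  have := hJ.isProbabilityMeasure (L := L)
  refine ⟨R, hR0, fun k hk v hv x => ?_⟩
  have hkv := memLp_expWeight_mul hk hv
  have hkv' : MemLp (fun x => expWeight k x * |v x|) 2 volume := memLp_expWeight_mul hk hv.abs
  have i1 : Integrable (fun y => expWeight k (x - y) * v (x - y)) (kernelMeasure L J) :=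
    ((hC _ hkv x).1.integrable (by norm_num))
  have i2 : Integrable (fun y => v (x - y)) (kernelMeasure L J) :=
    ((hC _ hv x).1.integrable (by norm_num))
  have i3 : Integrable (fun y => expWeight k (x - y) * |v (x - y)|) (kernelMeasure L J) :=
    ((hC _ hkv' x).1.integrable (by norm_num))
  rw [hJ.conv_eq_avg hkv.1, hJ.conv_eq_avg hv.1, hJ.conv_eq_avg hkv'.1, avg, avg, avg,
    ← integral_const_mul, ← integral_sub i1 (i2.const_mul _), ← integral_const_mul]
  refine (abs_integral_le_integral_abs).trans (integral_mono_ae (i1.sub (i2.const_mul _)).abs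
    (i3.const_mul _) ?_)
  filter_upwards [hsupp] with y hy
  rw [← sub_mul, abs_mul, ← mul_assoc]
  exact mul_le_mul_of_nonneg_right (abs_expWeight_sub_le hk hy) (abs_nonneg _)

/-- Each transversal coordinate has a representative in [0, L), so only the longitudinal distance
can be large. -/
theorem exists_lift_norm_sq_le (w : Cyl d L) :
    ∃ z : Cover d, proj L z = w ∧ ‖z‖ ^ 2 ≤ w.1 ^ 2 + d * L ^ 2 := by
  have hL : 0 < L := Fact.out
  have h : ∀ j, ∃ t : ℝ, (t : AddCircle L) = w.2 j ∧ t ^ 2 ≤ L ^ 2 := fun j => by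
    refine ⟨(AddCircle.equivIco L 0 (w.2 j) : ℝ), (AddCircle.equivIco L 0).symm_apply_apply _, ?_⟩
    have h1 := (AddCircle.equivIco L 0 (w.2 j)).2
    exact pow_le_pow_left₀ h1.1 (h1.2.le.trans_eq (zero_add L)) 2
  choose t ht ht' using h
  refine ⟨WithLp.toLp 2 (Fin.cons w.1 t), ?_, ?_⟩
  · refine Prod.ext rfl (funext fun j => ?_)
    simp [proj, ht]
  · rw [EuclideanSpace.norm_sq_eq, Fin.sum_univ_succ]
    simp only [Fin.cons_zero, Fin.cons_succ, Real.norm_eq_abs, sq_abs]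
    refine add_le_add_right ((Finset.sum_le_sum fun j _ => ht' j).trans ?_) _
    simp

section

variable (hβ : 1 < β) (hJ : IsSmoothKernel J)
  (hM : IsProfile β (marginal J) M P P₂ l l' c C lam)

include hβ hJ hM

/-- The gap is applied to ρv. The commutator of B with ρ and the pairing of ρv with P are both
bounded by a factor tending to 0 with k times ‖ρv‖; k is chosen so that together they are absorbed.
-/
theorem exists_weighted_gap : ∃ k C₁ : ℝ, 0 < k ∧ k ≤ lam / 2 ∧ 0 < C₁ ∧
    ∀ v : Cyl d L → ℝ, MemLp v 2 volume → ∫ x, v x * P x.1 = 0 →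
      ltwo (fun x => expWeight k x * v x)
        ≤ C₁ * ltwo (fun x => expWeight k x * frontOp β J M v x) := by
  obtain ⟨Cg, hCg, hgap⟩ := exists_gap (L := L) hβ hJ hM
  obtain ⟨R, hR0, hR⟩ := hJ.exists_abs_conv_expWeight_le (L := L)
  have hlam := hM.lam_pos
  have hC := hM.const_pos
  set N := ltwo (expWeight (d := d) (L := L) (lam / 4)) with hN
  have hE : MemLp (expWeight (d := d) (L := L) (lam / 4)) 2 volume :=
    memLp_exp_longitudinal (by linarith)
  have hlim : Tendsto (fun k => Cg * ((Real.exp (k * R) - 1) + k * (C * (4 / lam)) * N))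
      (𝓝[>] 0) (𝓝 0) := by
    have : Continuous fun k => Cg * ((Real.exp (k * R) - 1) + k * (C * (4 / lam)) * N) := by
      fun_prop
    have h := this.tendsto 0
    simp only [zero_mul, Real.exp_zero, sub_self, add_zero, mul_zero] at h
    exact h.mono_left nhdsWithin_le_nhds
  have hex : ∀ᶠ k in 𝓝[>] (0 : ℝ),
      Cg * ((Real.exp (k * R) - 1) + k * (C * (4 / lam)) * N) < 1 / 2 ∧ k ≤ lam / 2 ∧ 0 < k := by
    refine (hlim.eventually (gt_mem_nhds (by norm_num))).and (Eventually.and ?_ ?_)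
    · exact nhdsWithin_le_nhds (ge_mem_nhds (by linarith))
    · exact self_mem_nhdsWithin
  obtain ⟨k, hk1, hk2, hk0⟩ := hex.exists
  refine ⟨k, 2 * Cg, hk0, hk2, by positivity, fun v hv hvP => ?_⟩
  set ρ := expWeight (d := d) (L := L) k with hρ
  have hρv : MemLp (fun x => ρ x * v x) 2 volume := memLp_expWeight_mul hk0.le hv
  have hρB : MemLp (fun x => ρ x * frontOp β J M v x) 2 volume :=
    memLp_expWeight_mul hk0.le (memLp_frontOp hβ hJ hM hv)
  have hρv' : MemLp (fun x => ρ x * |v x|) 2 volume := memLp_expWeight_mul hk0.le hv.abs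
  have habs : ltwo (fun x => ρ x * |v x|) ≤ ltwo (fun x => ρ x * v x) :=
    ltwo_mono hρv (ae_of_all _ fun x => by simp [abs_mul])
  have hE0 : 0 ≤ Real.exp (k * R) - 1 := by
    linarith [Real.one_le_exp (mul_nonneg hk0.le hR0.le)]
  have hcomm : ltwo (frontOp β J M fun x => ρ x * v x)
      ≤ ltwo (fun x => ρ x * frontOp β J M v x)
        + (Real.exp (k * R) - 1) * ltwo (fun x => ρ x * v x) := by
    have e : frontOp β J M (fun x => ρ x * v x) = fun x => ρ x * frontOp β J M v x
        - (conv J (fun x => ρ x * v x) x - ρ x * conv J v x) := by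
      funext x; simp only [frontOp]; ring
    have m : MemLp (fun x => conv J (fun x => ρ x * v x) x - ρ x * conv J v x) 2 volume :=
      (hJ.memLp_conv hρv).sub (memLp_expWeight_mul hk0.le (hJ.memLp_conv hv))
    rw [e]
    refine (ltwo_sub_le hρB m).trans (add_le_add_right ?_ _)
    refine (ltwo_le_const_mul (hJ.memLp_conv hρv') hE0 (ae_of_all _ fun x =>
      (hR k hk0.le v hv x).trans (mul_le_mul_of_nonneg_left (le_abs_self _) hE0))).trans ?_
    exact mul_le_mul_of_nonneg_left ((hJ.ltwo_conv_le hρv').trans habs) hE0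
  -- Orthogonality allows subtracting ∫ vP = 0, which replaces P by (1 − 1/ρ)P. This is of order k,
  -- and k ≤ lam/2 leaves enough decay in P for square integrability.
  have hP : |∫ x, ρ x * v x * P x.1|
      ≤ k * (C * (4 / lam)) * N * ltwo (fun x => ρ x * v x) := by
    have hρinv : ∀ x, ρ x * Real.exp (k * |x.1|) = 1 := fun x => by
      rw [hρ, expWeight, ← Real.exp_add]; simp
    have hbd : ∀ x : Cyl d L, |(1 - Real.exp (k * |x.1|)) * P x.1|
        ≤ k * (C * (4 / lam)) * |expWeight (lam / 4) x| := fun x => by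
      set t := |x.1| with ht
      have ht0 : 0 ≤ t := abs_nonneg _
      have h1 : |1 - Real.exp (k * t)| ≤ k * t * Real.exp (k * t) := by
        rw [abs_of_nonpos (by linarith [Real.one_le_exp (mul_nonneg hk0.le ht0)])]
        have h2 := Real.add_one_le_exp (-(k * t))
        have h3 : Real.exp (k * t) * Real.exp (-(k * t)) = 1 := by rw [← Real.exp_add]; simp
        nlinarith [Real.exp_pos (k * t)]
      have h4 : t ≤ 4 / lam * Real.exp (lam / 4 * t) := by
        have := Real.add_one_le_exp (lam / 4 * t)
        rw [div_mul_eq_mul_div, le_div_iff₀ hlam]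
        nlinarith
      have h5 : Real.exp (k * t) * Real.exp (-lam * t) ≤ Real.exp (-(lam / 2) * t) := by
        rw [← Real.exp_add]
        exact Real.exp_le_exp.2 (by nlinarith)
      have h6 : Real.exp (lam / 4 * t) * Real.exp (-(lam / 2) * t) = expWeight (lam / 4) x := by
        rw [← Real.exp_add, expWeight]; congr 1; ring
      rw [abs_mul, abs_of_pos (hM.pos _), abs_of_pos (expWeight_pos _ _)]
      calc |1 - Real.exp (k * t)| * P x.1
          ≤ (k * t * Real.exp (k * t)) * (C * Real.exp (-lam * t)) :=
            mul_le_mul h1 (hM.deriv_le _) (hM.pos _).le (by positivity)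
        _ = k * C * (t * (Real.exp (k * t) * Real.exp (-lam * t))) := by ring
        _ ≤ k * C * ((4 / lam * Real.exp (lam / 4 * t)) * Real.exp (-(lam / 2) * t)) := by
            gcongr
        _ = k * (C * (4 / lam)) * expWeight (lam / 4) x := by rw [← h6]; ring
    have hm : MemLp (fun x : Cyl d L => (1 - Real.exp (k * |x.1|)) * P x.1) 2 volume := by
      refine memLp_of_abs_le ?_ hE (ae_of_all _ hbd)
      have := hM.continuous_deriv
      exact Continuous.aestronglyMeasurable (by fun_prop)
    have e : ∫ x, ρ x * v x * P x.1
        = ∫ x, (ρ x * v x) * ((1 - Real.exp (k * |x.1|)) * P x.1) := by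
      have i1 : Integrable fun x => ρ x * v x * P x.1 := hρv.integrable_mul hM.memLp_deriv
      have i2 : Integrable fun x => v x * P x.1 := hv.integrable_mul hM.memLp_deriv
      rw [← sub_zero (∫ x, ρ x * v x * P x.1), ← hvP, ← integral_sub i1 i2]
      refine integral_congr_ae (ae_of_all _ fun x => ?_)
      simp only
      linear_combination -(v x * P x.1) * (-hρinv x)
    rw [e]
    refine (abs_integral_mul_le hρv hm).trans ?_
    rw [mul_comm]
    refine mul_le_mul_of_nonneg_right ?_ (ltwo_nonneg _)
    exact ltwo_le_const_mul hE (by positivity) (ae_of_all _ hbd)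
  have h := hgap _ hρv
  have h0 := ltwo_nonneg (fun x => ρ x * v x)
  have h2 : ltwo (fun x => ρ x * v x) ≤ Cg * ltwo (fun x => ρ x * frontOp β J M v x)
      + (Cg * ((Real.exp (k * R) - 1) + k * (C * (4 / lam)) * N)) * ltwo (fun x => ρ x * v x) := by
    refine h.trans ?_
    have := mul_le_mul_of_nonneg_left (add_le_add hcomm hP) hCg.le
    linarith
  nlinarith

end

/-- Orthogonality to P gives ∫P · q(x)² ≤ ∫ P(y)(q(x) − q(y))² dy. With the weight inserted and y =
x − w, the translation estimate bounds the increments by |w|² times the Dirichlet integral, and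
exponential decay in w makes the integral over w finite. -/
theorem IsProfile.exists_weighted_poincare {K : ℝ → ℝ} (hM : IsProfile β K M P P₂ l l' c C lam)
    {k : ℝ} (hk0 : 0 < k) (hk : k ≤ lam) :
    ∃ C₂ : ℝ, 0 < C₂ ∧ ∀ (q : Cyl d L → ℝ) (g : Fin (d + 1) → Cyl d L → ℝ), MemLp q 2 volume →
      (∀ i, MemLp (g i) 2 volume) → (∀ i, IsWeakPartial i q (g i)) → ∫ x, q x * P x.1 = 0 →
      ltwo (fun x => expWeight k x * q x) ^ 2 ≤ C₂ * ∑ i, ltwo (g i) ^ 2 := by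
  have hC := hM.const_pos
  have hL : 0 < L := Fact.out
  have hPi : Integrable fun x : Cyl d L => P x.1 := by
    refine ((integrable_exp_longitudinal hM.lam_pos).const_mul C).mono'
      (hM.continuous_deriv.comp continuous_fst).aestronglyMeasurable (ae_of_all _ fun x => ?_)
    rw [Real.norm_eq_abs, abs_of_pos (hM.pos _)]
    exact hM.deriv_le _
  set S := ∫ x : Cyl d L, P x.1 with hS
  have hS0 : 0 < S :=
    (integral_pos_iff_support_of_nonneg (fun x => (hM.pos _).le) hPi).2 (by
      have : Function.support (fun x : Cyl d L => P x.1) = univ :=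
        eq_univ_of_forall fun x => (hM.pos _).ne'
      rw [this]
      exact isOpen_univ.measure_pos _ univ_nonempty)
  set A : ℝ := C * (8 / k ^ 2 + d * L ^ 2) with hA
  have hA0 : 0 < A := by positivity
  set T : ℝ := ∫ w : Cyl d L, A * Real.exp (-(k / 2) * |w.1|) with hT
  have hTi : Integrable fun w : Cyl d L => A * Real.exp (-(k / 2) * |w.1|) :=
    (integrable_exp_longitudinal (by linarith)).const_mul A
  have hT0 : 0 ≤ T := integral_nonneg fun w => by positivity
  refine ⟨T / S + 1, by positivity, fun q₀ g hq₀ hg h₀ hqP₀ => ?_⟩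
  -- A Borel representative makes the double integrals jointly measurable and the pointwise estimate
  -- below meaningful.
  obtain ⟨q, hqm, hqq⟩ : ∃ q, Measurable q ∧ q₀ =ᵐ[volume] q :=
    ⟨_, hq₀.1.stronglyMeasurable_mk.measurable, hq₀.1.ae_eq_mk⟩
  have hq : MemLp q 2 volume := hq₀.ae_eq hqq
  have h : ∀ i, IsWeakPartial i q (g i) := fun i => (h₀ i).congr hqq (ae_eq_refl _)
  have hqP : ∫ x, q x * P x.1 = 0 := by
    rw [← hqP₀]
    refine integral_congr_ae ?_
    filter_upwards [hqq] with x hx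
    rw [hx]
  rw [ltwo_congr (u := fun x => expWeight k x * q₀ x) (v := fun x => expWeight k x * q x)
    (by filter_upwards [hqq] with x hx; rw [hx])]
  have hPm : Measurable fun x : Cyl d L => P x.1 := (hM.continuous_deriv.measurable).comp measurable_fst
  have hpt : ∀ x, ENNReal.ofReal S * ‖q x‖ₑ ^ 2
      ≤ ∫⁻ y, ENNReal.ofReal (P y.1) * ‖q x - q y‖ₑ ^ 2 := by
    intro x
    have i1 : Integrable fun y => q y ^ 2 * P y.1 := by
      refine (hq.integrable_sq.mul_const C).mono' (hq.1.pow 2 |>.mul hPm.aestronglyMeasurable)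
        (ae_of_all _ fun y => ?_)
      rw [Real.norm_eq_abs, abs_of_nonneg (mul_nonneg (sq_nonneg _) (hM.pos _).le)]
      exact mul_le_mul_of_nonneg_left (hM.deriv_le_const _) (sq_nonneg _)
    have i2 : Integrable fun y => q y * P y.1 := hq.integrable_mul hM.memLp_deriv
    have e : ∀ y, P y.1 * (q x - q y) ^ 2
        = q x ^ 2 * P y.1 - 2 * q x * (q y * P y.1) + q y ^ 2 * P y.1 := fun y => by ring
    have i3 : Integrable fun y => P y.1 * (q x - q y) ^ 2 := by
      simp only [e]
      exact ((hPi.const_mul _).sub (i2.const_mul _)).add i1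
    have h1 : S * q x ^ 2 ≤ ∫ y, P y.1 * (q x - q y) ^ 2 := by
      simp only [e]
      have j1 : Integrable fun y : Cyl d L => q x ^ 2 * P y.1 := hPi.const_mul _
      have j2 : Integrable fun y => 2 * q x * (q y * P y.1) := i2.const_mul _
      rw [integral_add (f := fun y : Cyl d L => q x ^ 2 * P y.1 - 2 * q x * (q y * P y.1))
        (j1.sub j2) i1, integral_sub j1 j2, integral_const_mul, integral_const_mul, hqP]
      have : 0 ≤ ∫ y, q y ^ 2 * P y.1 :=
        integral_nonneg fun y => mul_nonneg (sq_nonneg _) (hM.pos _).le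
      linarith
    have h2 := ENNReal.ofReal_le_ofReal h1
    rw [ENNReal.ofReal_mul hS0.le, ← enorm_sq_eq_ofReal, ofReal_integral_eq_lintegral_ofReal i3
      (ae_of_all _ fun y => mul_nonneg (hM.pos _).le (sq_nonneg _))] at h2
    refine h2.trans (le_of_eq (lintegral_congr fun y => ?_))
    rw [ENNReal.ofReal_mul (hM.pos _).le, ← enorm_sq_eq_ofReal]
  -- One weight factor controls x and P controls x − w; together they control w by the triangle
  -- inequality. The second weight factor is simply bounded by 1, and k ≤ lam lets both rates be
  -- compared with k.
  have hwt : ∀ x w : Cyl d L, expWeight k x ^ 2 * P (x - w).1 ≤ C * Real.exp (-k * |w.1|) := by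
    intro x w
    have h1 : |w.1| ≤ |x.1| + |(x - w).1| := by
      have := abs_sub_abs_le_abs_sub w.1 x.1
      rw [abs_sub_comm] at this
      rw [Prod.fst_sub]; linarith
    calc expWeight k x ^ 2 * P (x - w).1 ≤ expWeight k x * (C * Real.exp (-lam * |(x - w).1|)) := by
          refine mul_le_mul ?_ (hM.deriv_le _) (hM.pos _).le (expWeight_pos _ _).le
          rw [sq]
          exact mul_le_of_le_one_right (expWeight_pos _ _).le (expWeight_le_one hk0.le x)
      _ = C * Real.exp (-k * |x.1| + -lam * |(x - w).1|) := by
          rw [expWeight, Real.exp_add]; ring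
      _ ≤ C * Real.exp (-k * |w.1|) := by
          gcongr
          nlinarith [abs_nonneg x.1, abs_nonneg (x - w).1]
  set G : ℝ≥0∞ := ∑ i, ∫⁻ x, ‖g i x‖ₑ ^ 2 with hG
  have hshift : ∀ w : Cyl d L, ENNReal.ofReal (C * Real.exp (-k * |w.1|))
      * ∫⁻ x, ‖q x - q (x - w)‖ₑ ^ 2 ≤ ENNReal.ofReal (A * Real.exp (-(k / 2) * |w.1|)) * G := by
    intro w
    obtain ⟨z, rfl, hz⟩ := exists_lift_norm_sq_le w
    set w := proj L z with hw
    have h1 : ∫⁻ x, ‖q x - q (x - w)‖ₑ ^ 2 ≤ ENNReal.ofReal (‖z‖ ^ 2) * G := by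
      rw [← lintegral_add_right_eq_self (fun x => ‖q x - q (x - w)‖ₑ ^ 2) w]
      simp only [add_sub_cancel_right]
      exact lintegral_translate_le hq hg h z
    refine (mul_le_mul_right h1 _).trans ?_
    rw [← mul_assoc, ← ENNReal.ofReal_mul (by positivity)]
    refine mul_le_mul_left (ENNReal.ofReal_le_ofReal ?_) _
    set t := |w.1| with ht
    have ht0 : 0 ≤ t := abs_nonneg _
    have h2 : t ^ 2 ≤ 8 / k ^ 2 * Real.exp (k / 2 * t) := by
      have := Real.quadratic_le_exp_of_nonneg (x := k / 2 * t) (by positivity)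
      rw [div_mul_eq_mul_div, le_div_iff₀ (by positivity)]
      nlinarith [mul_nonneg hk0.le ht0]
    have h3 : (1 : ℝ) ≤ Real.exp (k / 2 * t) := Real.one_le_exp (by positivity)
    have h4 : ‖z‖ ^ 2 ≤ (8 / k ^ 2 + d * L ^ 2) * Real.exp (k / 2 * t) := by
      rw [← sq_abs w.1] at hz
      have : (d : ℝ) * L ^ 2 ≤ d * L ^ 2 * Real.exp (k / 2 * t) :=
        le_mul_of_one_le_right (by positivity) h3
      linarith
    have h5 : Real.exp (-k * t) * Real.exp (k / 2 * t) = Real.exp (-(k / 2) * t) := by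
      rw [← Real.exp_add]; congr 1; ring
    calc C * Real.exp (-k * t) * ‖z‖ ^ 2
        ≤ C * Real.exp (-k * t) * ((8 / k ^ 2 + d * L ^ 2) * Real.exp (k / 2 * t)) := by gcongr
      _ = A * Real.exp (-(k / 2) * t) := by rw [hA, ← h5]; ring
  have hmain : ENNReal.ofReal S * ∫⁻ x, ‖expWeight k x * q x‖ₑ ^ 2 ≤ ENNReal.ofReal T * G := by
    have hmeas : Measurable fun p : Cyl d L × Cyl d L =>
        ENNReal.ofReal (C * Real.exp (-k * |p.2.1|)) * ‖q p.1 - q (p.1 - p.2)‖ₑ ^ 2 := by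
      have m1 : Measurable fun p : Cyl d L × Cyl d L => q p.1 := hqm.comp measurable_fst
      have m2 : Measurable fun p : Cyl d L × Cyl d L => q (p.1 - p.2) :=
        hqm.comp (measurable_fst.sub measurable_snd)
      have m3 : Measurable fun p : Cyl d L × Cyl d L => C * Real.exp (-k * |p.2.1|) :=
        Continuous.measurable (by fun_prop)
      exact m3.ennreal_ofReal.mul ((m1.sub m2).enorm.pow_const 2)
    calc ENNReal.ofReal S * ∫⁻ x, ‖expWeight k x * q x‖ₑ ^ 2
        = ∫⁻ x, ENNReal.ofReal S * ‖expWeight k x * q x‖ₑ ^ 2 := by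
          refine (lintegral_const_mul _ ?_).symm
          exact (((continuous_expWeight k).measurable.mul hqm).enorm.pow_const 2)
      _ ≤ ∫⁻ x, ∫⁻ w, ENNReal.ofReal (C * Real.exp (-k * |w.1|)) * ‖q x - q (x - w)‖ₑ ^ 2 := by
          refine lintegral_mono fun x => ?_
          have hmx : Measurable fun y => ENNReal.ofReal (P y.1) * ‖q x - q y‖ₑ ^ 2 :=
            hPm.ennreal_ofReal.mul ((hqm.const_sub (q x)).enorm.pow_const 2)
          rw [enorm_mul, mul_pow, mul_left_comm]
          refine (mul_le_mul_right (hpt x) _).trans ?_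
          rw [← lintegral_const_mul _ hmx,← lintegral_sub_left_eq_self _ x]
          refine lintegral_mono fun w => ?_
          rw [← mul_assoc, enorm_sq_eq_ofReal, ← ENNReal.ofReal_mul (sq_nonneg _)]
          exact mul_le_mul_left (ENNReal.ofReal_le_ofReal (hwt x w)) _
      _ = ∫⁻ w, ENNReal.ofReal (C * Real.exp (-k * |w.1|)) * ∫⁻ x, ‖q x - q (x - w)‖ₑ ^ 2 := by
          rw [lintegral_lintegral_swap hmeas.aemeasurable]
          refine lintegral_congr fun w => lintegral_const_mul _ ?_
          exact (hqm.sub (hqm.comp (measurable_id.sub_const w))).enorm.pow_const 2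
      _ ≤ ∫⁻ w, ENNReal.ofReal (A * Real.exp (-(k / 2) * |w.1|)) * G := lintegral_mono hshift
      _ = ENNReal.ofReal T * G := by
          rw [lintegral_mul_const _ (by fun_prop), hT,
            ofReal_integral_eq_lintegral_ofReal hTi (ae_of_all _ fun w => by positivity)]
  have hGr : G = ENNReal.ofReal (∑ i, ltwo (g i) ^ 2) := by
    rw [hG, ENNReal.ofReal_sum_of_nonneg fun i _ => sq_nonneg _]
    refine Finset.sum_congr rfl fun i _ => ?_
    rw [ltwo_sq (hg i), lintegral_enorm_sq (hg i)]
  have hq2 : ∫⁻ x, ‖expWeight k x * q x‖ₑ ^ 2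
      = ENNReal.ofReal (ltwo (fun x => expWeight k x * q x) ^ 2) := by
    rw [ltwo_sq (memLp_expWeight_mul hk0.le hq), lintegral_enorm_sq (memLp_expWeight_mul hk0.le hq)]
  rw [hGr, hq2, ← ENNReal.ofReal_mul hS0.le, ← ENNReal.ofReal_mul hT0] at hmain
  have hs : 0 ≤ ∑ i, ltwo (g i) ^ 2 := Finset.sum_nonneg fun i _ => sq_nonneg _
  have h3 := (ENNReal.ofReal_le_ofReal_iff (mul_nonneg hT0 hs)).1 hmain
  rw [add_mul, div_mul_eq_mul_div, one_mul]
  have h4 : ltwo (fun x => expWeight k x * q x) ^ 2 ≤ T * (∑ i, ltwo (g i) ^ 2) / S := by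
    rw [le_div_iff₀ hS0]; linarith
  linarith

end Weighted

end NonlocalFront

namespace NonlocalFront

/-! ### The gradient of the linearized operator -/

/-- The derivative of `1 / (β (1 - M²))`. -/
noncomputable def invMobilityDeriv (β : ℝ) (M P : ℝ → ℝ) (r : ℝ) : ℝ :=
  2 * M r * P r / (β * (1 - M r ^ 2) ^ 2)

section Profile

variable {β : ℝ} {K M P P₂ : ℝ → ℝ} {l l' c C lam : ℝ}

namespace IsProfile

theorem hasDerivAt_invMobility (hM : IsProfile β K M P P₂ l l' c C lam) (hβ : 1 < β) (r : ℝ) :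
    HasDerivAt (invMobility β M) (invMobilityDeriv β M P r) r := by
  have h0 := (hM.mobility_pos hβ r).ne'
  have h1 : HasDerivAt (fun r => β * (1 - M r ^ 2)) (β * (-(2 * M r * P r))) r := by
    have := (((hM.hasDerivAt r).pow 2).const_sub 1).const_mul β
    refine this.congr_deriv ?_
    push_cast; ring
  have h2 : HasDerivAt (fun r => (β * (1 - M r ^ 2))⁻¹) _ r := h1.inv h0
  have h3 : invMobility β M = fun r => (β * (1 - M r ^ 2))⁻¹ := by
    funext r; rw [invMobility, one_div]
  rw [h3]
  refine h2.congr_deriv ?_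
  have h4 : 1 - M r ^ 2 ≠ 0 := fun h => h0 (by rw [h, mul_zero])
  have h5 : β ≠ 0 := by linarith
  rw [invMobilityDeriv]
  field_simp

theorem continuous_invMobilityDeriv (hM : IsProfile β K M P P₂ l l' c C lam) (hβ : 1 < β) :
    Continuous (invMobilityDeriv β M P) := by
  have h1 := hM.continuous
  have h2 := hM.continuous_deriv
  refine Continuous.div (by fun_prop) (by fun_prop) fun r => ?_
  have h0 := (hM.mobility_pos hβ r).ne'
  have h4 : 1 - M r ^ 2 ≠ 0 := fun h => h0 (by rw [h, mul_zero])
  have h5 : β ≠ 0 := by linarith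
  positivity

/-- The commutator of ∂₁ with B is multiplication by this derivative. Being bounded by a multiple of
P, it is localized near the interface and visible to the weighted norm. -/
theorem abs_invMobilityDeriv_le (hM : IsProfile β K M P P₂ l l' c C lam) (hβ : 1 < β) (r : ℝ) :
    |invMobilityDeriv β M P r| ≤ 2 / (β * (1 - c ^ 2) ^ 2) * P r := by
  have h1 := hM.one_sub_sq_pos
  have h2 := hM.sq_le r
  have h3 : |M r| ≤ 1 := (hM.abs_le r).trans hM.lt_one.le
  have h4 := (hM.pos r).le
  have h5 : 0 < β := by linarith
  have h6 : 0 < 1 - M r ^ 2 := by linarith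
  rw [invMobilityDeriv, abs_div, abs_mul, abs_mul, abs_of_pos (hM.pos r),
    abs_of_pos (by positivity : 0 < β * (1 - M r ^ 2) ^ 2), div_mul_eq_mul_div]
  refine div_le_div₀ (by positivity) ?_ (by positivity) ?_
  · rw [abs_two]; nlinarith
  · gcongr

/-- The constant C deteriorates with |a|. Estimates that must be uniform in a are therefore proved
for the centred profile and transported by translation; otherwise only qualitative properties of the
shifted profile and the invariant bound c are used. -/
theorem shift (hM : IsProfile β K M P P₂ l l' c C lam) (a : ℝ) :
    IsProfile β K (fun r => M (r - a)) (fun r => P (r - a)) (fun r => P₂ (r - a)) l l' c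
      (C * Real.exp (lam * |a|)) lam := by
  have hC := hM.const_pos.le
  have hl := hM.lam_pos
  have havg : ∀ (u : ℝ → ℝ) (x : ℝ), avg (lineMeasure K) (fun r => u (r - a)) x
      = avg (lineMeasure K) u (x - a) := fun u x => by
    rw [avg, avg]
    simp only [sub_right_comm]
  have hexp : ∀ s t : ℝ, s ≤ lam * |a| + t → C * Real.exp s
      ≤ C * Real.exp (lam * |a|) * Real.exp t := fun s t h => by
    rw [mul_assoc, ← Real.exp_add]; gcongr
  have habs : ∀ x : ℝ, |x| ≤ |a| + |x - a| := fun x => by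
    have := abs_add_le a (x - a); rwa [add_sub_cancel] at this
  refine ⟨fun x => (hM.hasDerivAt _).comp_sub_const x a,
    fun x => (hM.hasDerivAt_deriv _).comp_sub_const x a,
    hM.continuous_deriv₂.comp (continuous_id.sub continuous_const), fun x => hM.pos _,
    fun x => ?_, fun x => ?_, fun x => hM.abs_le _, hM.lt_one, fun x => ?_, fun x => ?_,
    fun x => ?_, fun x => ?_, hM.minimizer, hM.minimizer', hM.lam_pos⟩
  · rw [havg]; exact hM.eq_tanh _
  · rw [havg]; exact hM.deriv_eq _
  · refine (hM.deriv_le _).trans (hexp _ _ ?_)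
    have := habs x; nlinarith
  · refine (hM.deriv₂_le _).trans (hexp _ _ ?_)
    have := habs x; nlinarith
  · refine (hM.sub_le _).trans (hexp _ _ ?_)
    have := le_abs_self a; nlinarith
  · refine (hM.add_le _).trans (hexp _ _ ?_)
    have := neg_abs_le a; nlinarith

end IsProfile

end Profile

theorem ltwo_comp_add {d : ℕ} {L : ℝ} [Fact (0 < L)] {u : Cyl d L → ℝ} (hu : MemLp u 2 volume)
    (y : Cyl d L) : ltwo (fun x => u (x + y)) = ltwo u := by
  rw [ltwo, ltwo]
  exact congrArg _ (eLpNorm_comp_measurePreserving hu.1 (measurePreserving_add_right volume y))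

/-! ### Coercivity of the linearized dissipation. -/

section Coercivity

variable {d : ℕ} {L : ℝ} [Fact (0 < L)]
variable {J : Cover d → ℝ} {β : ℝ} {M P P₂ : ℝ → ℝ} {l l' c C lam : ℝ} {u v w : Cyl d L → ℝ}

/-- The `i`-th partial derivative of `frontOp β J M v`, where `g` is the one of `v`. -/
noncomputable def frontOpDeriv (β : ℝ) (J : Cover d → ℝ) (M P : ℝ → ℝ) (v : Cyl d L → ℝ)
    (i : Fin (d + 1)) (g : Cyl d L → ℝ) : Cyl d L → ℝ :=
  fun x => frontOp β J M g x + if i = 0 then invMobilityDeriv β M P x.1 * v x else 0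

variable (hβ : 1 < β) (hJ : IsSmoothKernel J)
  (hM : IsProfile β (marginal J) M P P₂ l l' c C lam)

include hβ hJ hM

theorem memLp_invMobilityDeriv_mul (hv : MemLp v 2 volume) :
    MemLp (fun x => invMobilityDeriv β M P x.1 * v x) 2 volume := by
  refine memLp_mul_of_bounded
    ((hM.continuous_invMobilityDeriv hβ).comp continuous_fst).aestronglyMeasurable
    (C := 2 / (β * (1 - c ^ 2) ^ 2) * C) (ae_of_all _ fun x => ?_) hv
  refine (hM.abs_invMobilityDeriv_le hβ _).trans ?_
  have := hM.one_sub_sq_pos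
  have : 0 < β := by linarith
  exact mul_le_mul_of_nonneg_left (hM.deriv_le_const _) (by positivity)

theorem memLp_frontOpDeriv (hv : MemLp v 2 volume) (i : Fin (d + 1)) {g : Cyl d L → ℝ}
    (hg : MemLp g 2 volume) : MemLp (frontOpDeriv β J M P v i g) 2 volume := by
  refine (memLp_frontOp hβ hJ hM hg).add ?_
  split_ifs
  · exact memLp_invMobilityDeriv_mul hβ hJ hM hv
  · exact MemLp.zero'

theorem isWeakPartial_frontOp {i : Fin (d + 1)} {g : Cyl d L → ℝ} (h : IsWeakPartial i v g)
    (hv : MemLp v 2 volume) (hg : MemLp g 2 volume) {B : ℝ} (hB0 : 0 ≤ B)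
    (hB : ∀ᵐ x, |v x| ≤ B) :
    IsWeakPartial i (frontOp β J M v) (frontOpDeriv β J M P v i g) := by
  set A := 1 / (β * (1 - c ^ 2)) with hA
  set A' := 2 / (β * (1 - c ^ 2) ^ 2) * C with hA'
  have hpos := hM.one_sub_sq_pos
  have hβ0 : 0 < β := by linarith
  have hC := hM.const_pos
  have hA0 : 0 ≤ A := by positivity
  have hA0' : 0 ≤ A' := by positivity
  have h1 : IsWeakPartial i (fun x => invMobility β M x.1 * v x) (fun x =>
      invMobility β M x.1 * g x + if i = 0 then invMobilityDeriv β M P x.1 * v x else 0) := by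
    refine IsWeakPartial.chain (Γ := fun r s => invMobility β M r * s)
      (Γr := fun r s => invMobilityDeriv β M P r * s) (Γs := fun r _ => invMobility β M r)
      (B := B) (C := A * B + A' * B + A) (fun r s _ => ?_) ?_ ?_ (fun r s hs => ?_) h hv hg hB
    · have e1 := (hM.hasDerivAt_invMobility hβ r).comp_hasFDerivAt (r, s)
        (hasFDerivAt_fst (𝕜 := ℝ) (E := ℝ) (F := ℝ) (p := (r, s)))
      have e2 := e1.mul (hasFDerivAt_snd (𝕜 := ℝ) (E := ℝ) (F := ℝ) (p := (r, s)))
      refine e2.congr_fderiv ?_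
      ext <;> simp [mul_comm]
    · have := hM.continuous_invMobilityDeriv hβ
      exact Continuous.continuousOn (by fun_prop)
    · have := hM.continuous_invMobility hβ
      exact Continuous.continuousOn (by fun_prop)
    · have b1 := hM.abs_invMobility_le hβ r
      have b2 : |invMobilityDeriv β M P r| ≤ A' := (hM.abs_invMobilityDeriv_le hβ r).trans
        (mul_le_mul_of_nonneg_left (hM.deriv_le_const r) (by positivity))
      have b3 : |invMobility β M r * s| ≤ A * B := by
        rw [abs_mul]; exact mul_le_mul b1 hs (abs_nonneg _) hA0
      have b4 : |invMobilityDeriv β M P r * s| ≤ A' * B := by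
        rw [abs_mul]; exact mul_le_mul b2 hs (abs_nonneg _) hA0'
      have b5 : 0 ≤ A * B := by positivity
      have b6 : 0 ≤ A' * B := by positivity
      exact ⟨by linarith, by linarith, by linarith⟩
  refine (h1.sub (h.convolve hJ hv hg)).congr (ae_of_all _ fun x => rfl) (ae_of_all _ fun x => ?_)
  simp only [frontOpDeriv, frontOp]
  ring

/-- The derivative is moved onto P, leaving −∫ v P₂ for i = 0 and zero otherwise. Since k ≤ lam/2,
the decay of P₂ splits into the weight for v and a square integrable factor. -/
theorem abs_integral_partial_mul_deriv_le {k : ℝ} (hk0 : 0 < k) (hk : k ≤ lam / 2)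
    {i : Fin (d + 1)} {g : Cyl d L → ℝ}
    (h : IsWeakPartial i v g) (hv : MemLp v 2 volume) (hg : MemLp g 2 volume) :
    |∫ x, g x * P x.1|
      ≤ C * ltwo (expWeight (d := d) (L := L) (lam / 2)) * ltwo (fun x => expWeight k x * v x) := by
  have hlam := hM.lam_pos
  have hC := hM.const_pos.le
  have hE : MemLp (expWeight (d := d) (L := L) (lam / 2)) 2 volume :=
    memLp_exp_longitudinal (by linarith)
  have hP₂ : MemLp (fun x : Cyl d L => P₂ x.1) 2 volume := by
    refine memLp_of_abs_le (hM.continuous_deriv₂.comp continuous_fst).aestronglyMeasurable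
      (memLp_exp_longitudinal (d := d) (L := L) hM.lam_pos) (c := C) (ae_of_all _ fun x => ?_)
    rw [abs_of_pos (Real.exp_pos _)]
    exact hM.deriv₂_le _
  have hgrad : ∀ j : Fin (d + 1), MemLp (fun x : Cyl d L => if j = 0 then P₂ x.1 else 0) 2 volume :=
    fun j => by
      split_ifs
      · exact hP₂
      · exact MemLp.zero'
  have key := integral_eq_of_testFunction (v := g) (p := fun j x => if j = i then v x else 0) hg
    (fun j => by
      split_ifs
      · exact hv
      · exact MemLp.zero')
    (fun φ hφ => by
      have := h.2.2 φ hφ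
      simp only [ite_mul, zero_mul]
      rw [Finset.sum_eq_single i (fun j _ hj => by simp [hj]) (by simp)]
      simp only [if_true]
      linarith)
    hM.memLp_deriv hgrad
    (fun j => (hasPartial_longitudinal hM.hasDerivAt_deriv).isWeakPartial
      (hM.continuous_deriv.comp continuous_fst) (by
        split_ifs
        · exact hM.continuous_deriv₂.comp continuous_fst
        · exact continuous_const))
  rw [key, Finset.sum_eq_single i (fun j _ hj => by simp [hj]) (by simp), abs_neg]
  simp only [if_true]
  have hsplit : |∫ x, v x * (if i = 0 then P₂ x.1 else 0)|
      ≤ ∫ x, |expWeight k x * v x| * (C * |expWeight (lam / 2) x|) := by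
    refine (abs_integral_le_integral_abs).trans (integral_mono (hv.integrable_mul (hgrad i)).abs
      ((memLp_expWeight_mul hk0.le hv).abs.integrable_mul (hE.abs.const_mul C)) fun x => ?_)
    have h2 : |(if i = 0 then P₂ x.1 else 0)| ≤ C * (expWeight k x * expWeight (lam / 2) x) := by
      have h3 : Real.exp (-lam * |x.1|) ≤ expWeight k x * expWeight (lam / 2) x := by
        rw [expWeight, expWeight, ← Real.exp_add]
        exact Real.exp_le_exp.2 (by nlinarith [abs_nonneg x.1])
      split_ifs
      · exact (hM.deriv₂_le _).trans (mul_le_mul_of_nonneg_left h3 hC)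
      · rw [abs_zero]
        exact mul_nonneg hC (mul_nonneg (expWeight_pos _ _).le (expWeight_pos _ _).le)
    simp only [abs_mul, abs_of_pos (expWeight_pos _ _)]
    nlinarith [mul_le_mul_of_nonneg_left h2 (abs_nonneg (v x))]
  refine hsplit.trans ((le_abs_self _).trans ((abs_integral_mul_le
    (memLp_expWeight_mul hk0.le hv).abs (hE.abs.const_mul C)).trans (le_of_eq ?_)))
  have habs : ∀ u : Cyl d L → ℝ, ltwo |u| = ltwo u := fun u => by
    rw [ltwo, ltwo]; exact congrArg _ (eLpNorm_norm u)
  rw [ltwo_const_mul, habs, habs, abs_of_nonneg hC]; ring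

/-- Bv is orthogonal to P, so the weighted Poincaré inequality followed by the weighted gap bounds
‖ρv‖ by E, the norm of the gradient of Bv. Every remaining term in the gap for ∂ᵢv carries a
decaying coefficient and is bounded through ‖ρv‖. -/
theorem exists_coercivity_zero : ∃ Cc : ℝ, 0 < Cc ∧
    ∀ (v : Cyl d L → ℝ) (g : Fin (d + 1) → Cyl d L → ℝ) (B : ℝ), MemLp v 2 volume →
      (∀ i, MemLp (g i) 2 volume) → (∀ i, IsWeakPartial i v (g i)) → 0 ≤ B →
      (∀ᵐ x, |v x| ≤ B) → ∫ x, v x * P x.1 = 0 →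
      (∀ i, ltwo (g i) ≤ Cc * √(∑ i, ltwo (frontOpDeriv β J M P v i (g i)) ^ 2)) ∧
      ltwo (fun x => P x.1 * v x) ≤ Cc * √(∑ i, ltwo (frontOpDeriv β J M P v i (g i)) ^ 2) := by
  obtain ⟨k, C₁, hk0, hk, hC₁, hgapw⟩ := exists_weighted_gap (L := L) hβ hJ hM
  have hlam := hM.lam_pos
  have hC := hM.const_pos
  have hpos := hM.one_sub_sq_pos
  have hβ0 : 0 < β := by linarith
  obtain ⟨C₂, hC₂, hpoin⟩ := hM.exists_weighted_poincare (d := d) (L := L) hk0 (by linarith)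
  obtain ⟨Cg, hCg, hgap⟩ := exists_gap (L := L) hβ hJ hM
  set N := ltwo (expWeight (d := d) (L := L) (lam / 2)) with hN
  have hN0 : 0 ≤ N := ltwo_nonneg _
  set A := 2 / (β * (1 - c ^ 2) ^ 2) * C with hA
  have hA0 : 0 ≤ A := by positivity
  set C₃ := C₁ * √C₂ with hC₃
  have hC₃0 : 0 < C₃ := by positivity
  clear_value N A C₃
  refine ⟨Cg * (1 + A * C₃ + C * N * C₃) + C * C₃, by positivity, ?_⟩
  intro v g B hv hg h hB0 hB hvP
  set p := fun i => frontOpDeriv β J M P v i (g i) with hp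
  have hpm : ∀ i, MemLp (p i) 2 volume := fun i => memLp_frontOpDeriv hβ hJ hM hv i (hg i)
  set E := √(∑ i, ltwo (p i) ^ 2) with hE
  have hE0 : 0 ≤ E := Real.sqrt_nonneg _
  clear_value E
  have hρ : ltwo (fun x => expWeight k x * v x) ≤ C₃ * E := by
    refine (hgapw v hv hvP).trans ?_
    rw [hC₃, mul_assoc]
    refine mul_le_mul_of_nonneg_left ?_ hC₁.le
    rw [hE, ← Real.sqrt_mul hC₂.le]
    refine Real.le_sqrt_of_sq_le (hpoin _ p (memLp_frontOp hβ hJ hM hv) hpm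
      (fun i => isWeakPartial_frontOp hβ hJ hM (h i) hv (hg i) hB0 hB)
      (integral_frontOp_mul_deriv hβ hJ hM hv))
  have hkv := memLp_expWeight_mul hk0.le hv
  have hle : ∀ x : Cyl d L, P x.1 ≤ C * expWeight k x := fun x =>
    (hM.deriv_le _).trans (mul_le_mul_of_nonneg_left (expWeight_anti (by linarith) x) hC.le)
  have hPv : ltwo (fun x => P x.1 * v x) ≤ C * (C₃ * E) := by
    refine (ltwo_le_const_mul hkv hC.le (ae_of_all _ fun x => ?_)).trans
      (mul_le_mul_of_nonneg_left hρ hC.le)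
    rw [abs_mul, abs_mul, abs_of_pos (hM.pos _), abs_of_pos (expWeight_pos _ _), ← mul_assoc]
    exact mul_le_mul_of_nonneg_right (hle x) (abs_nonneg _)
  refine ⟨fun i => ?_, hPv.trans ?_⟩
  -- B(∂ᵢv) is ∂ᵢ(Bv) up to the localized commutator, so it is bounded by E and ‖ρv‖.
  · have h1 : ltwo (frontOp β J M (g i)) ≤ E + A * (C₃ * E) := by
      have e : frontOp β J M (g i) = fun x => p i x
          - if i = 0 then invMobilityDeriv β M P x.1 * v x else 0 := by
        funext x; simp [hp, frontOpDeriv]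
      have hm : MemLp (fun x => if i = 0 then invMobilityDeriv β M P x.1 * v x else 0) 2 volume := by
        split_ifs
        · exact memLp_invMobilityDeriv_mul hβ hJ hM hv
        · exact MemLp.zero'
      rw [e]
      refine (ltwo_sub_le (hpm i) hm).trans (add_le_add ?_ ?_)
      · rw [hE]
        refine Real.le_sqrt_of_sq_le ?_
        exact Finset.single_le_sum (f := fun i => ltwo (p i) ^ 2) (fun i _ => sq_nonneg _)
          (Finset.mem_univ i)
      · refine (ltwo_le_const_mul hkv hA0 (ae_of_all _ fun x => ?_)).trans
          (mul_le_mul_of_nonneg_left hρ hA0)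
        split_ifs
        · rw [abs_mul, abs_mul, abs_of_pos (expWeight_pos _ _), ← mul_assoc]
          refine mul_le_mul_of_nonneg_right ?_ (abs_nonneg _)
          refine (hM.abs_invMobilityDeriv_le hβ _).trans ?_
          rw [hA, mul_assoc]
          exact mul_le_mul_of_nonneg_left (hle x) (by positivity)
        · rw [abs_zero]; positivity
    have h2 : |∫ x, g i x * P x.1| ≤ C * N * (C₃ * E) := by
      refine (abs_integral_partial_mul_deriv_le hβ hJ hM hk0 hk (h i) hv (hg i)).trans ?_
      rw [← hN]
      exact mul_le_mul_of_nonneg_left hρ (by positivity)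
    calc ltwo (g i) ≤ Cg * (ltwo (frontOp β J M (g i)) + |∫ x, g i x * P x.1|) := hgap _ (hg i)
      _ ≤ Cg * ((E + A * (C₃ * E)) + C * N * (C₃ * E)) :=
          mul_le_mul_of_nonneg_left (add_le_add h1 h2) hCg.le
      _ = Cg * (1 + A * C₃ + C * N * C₃) * E := by ring
      _ ≤ (Cg * (1 + A * C₃ + C * N * C₃) + C * C₃) * E :=
          mul_le_mul_of_nonneg_right (le_add_of_nonneg_right (mul_pos hC hC₃0).le) hE0
  · have : 0 ≤ Cg * (1 + A * C₃ + C * N * C₃) * E := by positivity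
    rw [add_mul, ← mul_assoc]; linarith

/-- Coercivity of the linearized dissipation on perturbations orthogonal to the translations of
the front. -/
theorem exists_coercivity : ∃ Cc : ℝ, 0 < Cc ∧
    ∀ (a : ℝ) (v : Cyl d L → ℝ) (g : Fin (d + 1) → Cyl d L → ℝ) (B : ℝ), MemLp v 2 volume →
      (∀ i, MemLp (g i) 2 volume) → (∀ i, IsWeakPartial i v (g i)) → 0 ≤ B →
      (∀ᵐ x, |v x| ≤ B) → ∫ x, v x * P (x.1 - a) = 0 →
      (∀ i, ltwo (g i) ≤ Cc * √(∑ i, ltwo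
        (frontOpDeriv β J (fun r => M (r - a)) (fun r => P (r - a)) v i (g i)) ^ 2)) ∧
      ltwo (fun x => P (x.1 - a) * v x) ≤ Cc * √(∑ i, ltwo
        (frontOpDeriv β J (fun r => M (r - a)) (fun r => P (r - a)) v i (g i)) ^ 2) := by
  obtain ⟨Cc, hCc, hco⟩ := exists_coercivity_zero (L := L) hβ hJ hM
  refine ⟨Cc, hCc, fun a v g B hv hg h hB0 hB hvP => ?_⟩
  -- Translating by a reduces to the centred profile. All norms involved are translation invariant,
  -- so the constant does not depend on a.
  set y : Cyl d L := (a, 0) with hy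
  have hmp : MeasurePreserving (fun x : Cyl d L => x + y) volume volume :=
    measurePreserving_add_right volume y
  have hfst : ∀ x : Cyl d L, (x + y).1 - a = x.1 := fun x => by simp [hy]
  have hv' : MemLp (fun x => v (x + y)) 2 volume := hv.comp_measurePreserving hmp
  have hg' : ∀ i, MemLp (fun x => g i (x + y)) 2 volume := fun i =>
    (hg i).comp_measurePreserving hmp
  have h' : ∀ i, IsWeakPartial i (fun x => v (x + y)) (fun x => g i (x + y)) := fun i => by
    have := (h i).translate hv (hg i) (-y)
    simpa only [sub_neg_eq_add] using this
  have hB' : ∀ᵐ x, |v (x + y)| ≤ B := hmp.quasiMeasurePreserving.ae hB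
  have hvP' : ∫ x, v (x + y) * P x.1 = 0 := by
    rw [← hvP, ← integral_add_right_eq_self (fun x => v x * P (x.1 - a)) y]
    exact integral_congr_ae (ae_of_all _ fun x => by simp only [hfst])
  have hMa := hM.shift a
  have hp : ∀ i, ltwo (frontOpDeriv β J M P (fun x => v (x + y)) i fun x => g i (x + y))
      = ltwo (frontOpDeriv β J (fun r => M (r - a)) (fun r => P (r - a)) v i (g i)) := fun i => by
    rw [← ltwo_comp_add (memLp_frontOpDeriv hβ hJ hMa hv i (hg i)) y]
    congr 1
    funext x
    simp only [frontOpDeriv, frontOp, invMobility, invMobilityDeriv, hfst, conv]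
    simp only [sub_add_eq_add_sub]
  obtain ⟨h1, h2⟩ := hco _ (fun i x => g i (x + y)) B hv' hg' h' hB0 hB' hvP'
  have hs := Finset.sum_congr (s₁ := Finset.univ) rfl fun i _ => congrArg (· ^ 2) (hp i)
  rw [hs] at h1 h2
  refine ⟨fun i => ?_, ?_⟩
  · rw [← ltwo_comp_add (hg i) y]; exact h1 i
  · have hm : MemLp (fun x => P (x.1 - a) * v x) 2 volume :=
      memLp_mul_of_bounded (hMa.continuous_deriv.comp continuous_fst).aestronglyMeasurable
        (C := C) (ae_of_all _ fun x => by
          rw [abs_of_pos (hM.pos _)]; exact hM.deriv_le_const _) hv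
    rw [← ltwo_comp_add hm y]
    simp only [hfst]
    exact h2

end Coercivity

end NonlocalFront

namespace NonlocalFront

/-! ### Translates of the front and expansion of the free energy -/

section Profile

variable {β : ℝ} {K M P P₂ : ℝ → ℝ} {l l' c C lam : ℝ}

namespace IsProfile

theorem exp_le_of_mem_uIcc (hM : IsProfile β K M P P₂ l l' c C lam) {r h ξ : ℝ}
    (hξ : ξ ∈ uIcc r (r - h)) :
    C * Real.exp (-lam * |ξ|) ≤ C * Real.exp (lam * |h|) * Real.exp (-lam * |r|) := by
  have h1 : |ξ - r| ≤ |h| := by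
    have := abs_sub_left_of_mem_uIcc hξ
    simpa using this
  have h2 : |r| ≤ |ξ| + |ξ - r| := by
    have := abs_sub_abs_le_abs_sub r ξ
    rw [abs_sub_comm] at this
    linarith
  have hC := hM.const_pos.le
  rw [mul_assoc, ← Real.exp_add]
  gcongr
  nlinarith [hM.lam_pos]

theorem abs_shift_sub_le (hM : IsProfile β K M P P₂ l l' c C lam) (r h : ℝ) :
    |M (r - h) - M r| ≤ C * Real.exp (lam * |h|) * |h| * Real.exp (-lam * |r|) := by
  have := (convex_uIcc r (r - h)).norm_image_sub_le_of_norm_hasDerivWithin_le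
    (fun ξ _ => (hM.hasDerivAt ξ).hasDerivWithinAt)
    (C := C * Real.exp (lam * |h|) * Real.exp (-lam * |r|)) (fun ξ hξ => by
      rw [Real.norm_eq_abs, abs_of_pos (hM.pos ξ)]
      exact (hM.deriv_le ξ).trans (hM.exp_le_of_mem_uIcc hξ)) left_mem_uIcc right_mem_uIcc
  simp only [Real.norm_eq_abs, sub_sub_cancel_left, abs_neg] at this
  linarith

theorem abs_deriv_sub_le (hM : IsProfile β K M P P₂ l l' c C lam) {r h ξ : ℝ}
    (hξ : ξ ∈ uIcc r (r - h)) :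
    |P ξ - P r| ≤ C * Real.exp (lam * |h|) * Real.exp (-lam * |r|) * |h| := by
  have hC := hM.const_pos.le
  have h0 := (convex_uIcc r (r - h)).norm_image_sub_le_of_norm_hasDerivWithin_le
    (fun ξ _ => (hM.hasDerivAt_deriv ξ).hasDerivWithinAt)
    (C := C * Real.exp (lam * |h|) * Real.exp (-lam * |r|)) (fun ξ hξ =>
      (hM.deriv₂_le ξ).trans (hM.exp_le_of_mem_uIcc hξ)) left_mem_uIcc hξ
  simp only [Real.norm_eq_abs] at h0
  refine h0.trans (mul_le_mul_of_nonneg_left ?_ (by positivity))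
  have := abs_sub_left_of_mem_uIcc hξ
  simpa using this

theorem abs_taylor_le (hM : IsProfile β K M P P₂ l l' c C lam) (r h : ℝ) :
    |M (r - h) - M r + h * P r| ≤ C * Real.exp (lam * |h|) * h ^ 2 * Real.exp (-lam * |r|) := by
  have h0 := (convex_uIcc r (r - h)).norm_image_sub_le_of_norm_hasDerivWithin_le
    (f := fun ξ => M ξ - ξ * P r) (f' := fun ξ => P ξ - P r)
    (fun ξ _ => (((hM.hasDerivAt ξ).sub ((hasDerivAt_id ξ).mul_const (P r))).congr_deriv
      (by ring)).hasDerivWithinAt)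
    (C := C * Real.exp (lam * |h|) * Real.exp (-lam * |r|) * |h|)
    (fun ξ hξ => hM.abs_deriv_sub_le hξ) left_mem_uIcc right_mem_uIcc
  simp only [Real.norm_eq_abs, sub_sub_cancel_left, abs_neg] at h0
  have e : M (r - h) - (r - h) * P r - (M r - r * P r) = M (r - h) - M r + h * P r := by ring
  rw [e] at h0
  refine h0.trans (le_of_eq ?_)
  rw [← sq_abs h]; ring

theorem artanh_eq (hM : IsProfile β K M P P₂ l l' c C lam) (hβ : 1 < β) (r : ℝ) :
    1 / β * Real.artanh (M r) = avg (lineMeasure K) M r := by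
  have : β ≠ 0 := by linarith
  rw [hM.eq_tanh r, Real.artanh_tanh]
  field_simp

theorem mem_Icc (hM : IsProfile β K M P P₂ l l' c C lam) (r : ℝ) : M r ∈ Icc (-1 : ℝ) 1 :=
  _root_.abs_le.1 ((hM.abs_le r).trans hM.lt_one.le)

end IsProfile

end Profile

section Cylinder

variable {d : ℕ} {L : ℝ} [Fact (0 < L)]
variable {J : Cover d → ℝ} {β mβ : ℝ} {M P P₂ : ℝ → ℝ} {l l' c C lam : ℝ} {u v w : Cyl d L → ℝ}

theorem planarFront_ae_eq {mbar : ℝ → ℝ} (h : mbar =ᵐ[volume] M) (a : ℝ) :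
    planarFront (d := d) (L := L) mbar a =ᵐ[volume] fun x => M (x.1 - a) := by
  have h1 := (measurePreserving_sub_right (volume : Measure ℝ) a).quasiMeasurePreserving.ae h
  exact (Measure.quasiMeasurePreserving_fst (μ := (volume : Measure ℝ))
    (ν := (volume : Measure (Fin d → AddCircle L)))).ae h1

/-- A perturbation which is closest to the front at `a` is orthogonal to the translations. -/
theorem integral_mul_deriv_eq_zero_of_isClosestFront {K : ℝ → ℝ}
    (hM : IsProfile β K M P P₂ l l' c C lam) {mbar : ℝ → ℝ} (hbar : mbar =ᵐ[volume] M)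
    {m : Cyl d L → ℝ} {a : ℝ} (ha : IsClosestFront mbar m a)
    (hv : MemLp (m - planarFront mbar a) 2 volume) :
    ∫ x : Cyl d L, (m x - planarFront mbar a x) * P (x.1 - a) = 0 := by
  set v := m - planarFront mbar a with hvdef
  have hMa := hM.shift a
  set C' := C * Real.exp (lam * |a|) with hC'
  have hC'0 : 0 < C' := hMa.const_pos
  have hlam := hM.lam_pos
  set E := fun x : Cyl d L => Real.exp (-lam * |x.1|) with hE
  have hEm : MemLp E 2 volume := memLp_exp_longitudinal hlam
  set p := ∫ x, v x * P (x.1 - a) with hp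
  have hPm : MemLp (fun x : Cyl d L => P (x.1 - a)) 2 volume := hMa.memLp_deriv
  have hS : 0 ≤ ltwo E := ltwo_nonneg _
  -- the first order condition in the direction of the translation by `h`
  have key : ∀ h : ℝ, |h| ≤ 1 → 0 ≤ 2 * h * p
      + h ^ 2 * (2 * C' * Real.exp lam * ltwo v * ltwo E + (C' * Real.exp lam * ltwo E) ^ 2) := by
    intro h hh
    set D := fun x : Cyl d L => M (x.1 - a) - M (x.1 - h - a) with hD
    have hbd1 : ∀ x, |D x| ≤ C' * Real.exp lam * |h| * |E x| := fun x => by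
      have h1 := hMa.abs_shift_sub_le x.1 h
      rw [hE, abs_of_pos (Real.exp_pos _), hD, abs_sub_comm]
      refine h1.trans ?_
      have h2 : Real.exp (lam * |h|) ≤ Real.exp lam := Real.exp_le_exp.2 (by nlinarith)
      gcongr
    have hcM := hM.continuous
    have hDm : MemLp D 2 volume :=
      memLp_of_abs_le (Continuous.aestronglyMeasurable (by fun_prop)) hEm (ae_of_all _ hbd1)
    have hbd2 : ∀ x : Cyl d L, |D x - h * P (x.1 - a)| ≤ C' * Real.exp lam * h ^ 2 * |E x| := fun x => by
      have h1 := hMa.abs_taylor_le x.1 h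
      rw [hE, abs_of_pos (Real.exp_pos _), hD, ← abs_neg]
      have e : -(M (x.1 - a) - M (x.1 - h - a) - h * P (x.1 - a))
          = M (x.1 - h - a) - M (x.1 - a) + h * P (x.1 - a) := by ring
      simp only [e]
      refine h1.trans ?_
      have h2 : Real.exp (lam * |h|) ≤ Real.exp lam := Real.exp_le_exp.2 (by nlinarith)
      gcongr
    have hRm : MemLp (fun x : Cyl d L => D x - h * P (x.1 - a)) 2 volume :=
      hDm.sub (hPm.const_mul h)
    have hle : ltwo v ≤ ltwo fun x => v x + D x := by
      have e : m - planarFront mbar (a + h) =ᵐ[volume] fun x => v x + D x := by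
        filter_upwards [planarFront_ae_eq (d := d) (L := L) hbar a,
          planarFront_ae_eq (d := d) (L := L) hbar (a + h)] with x h1 h2
        simp only [hvdef, Pi.sub_apply, h1, h2, hD]
        rw [show x.1 - h - a = x.1 - (a + h) by ring]; ring
      have h1 := ha (a + h)
      rw [eLpNorm_congr_ae e] at h1
      exact ENNReal.toReal_mono (hv.add hDm).2.ne h1
    have hsq : ltwo v ^ 2 ≤ ltwo (fun x => v x + D x) ^ 2 :=
      pow_le_pow_left₀ (ltwo_nonneg _) hle 2
    have hvD : MemLp (fun x => v x + D x) 2 volume := hv.add hDm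
    have i1 := hv.integrable_sq
    have i2 : Integrable fun x => v x * D x := hv.integrable_mul hDm
    have i3 := hDm.integrable_sq
    have i4 : Integrable fun x => v x ^ 2 + 2 * (v x * D x) := i1.add (i2.const_mul 2)
    have e2 : ltwo (fun x => v x + D x) ^ 2 = ltwo v ^ 2 + 2 * (∫ x, v x * D x) + ltwo D ^ 2 := by
      rw [ltwo_sq hvD, ltwo_sq hv, ltwo_sq hDm, ← integral_const_mul,
        ← integral_add i1 (i2.const_mul 2), ← integral_add i4 i3]
      exact integral_congr_ae (ae_of_all _ fun x => by simp only; ring)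
    have e3 : ∫ x, v x * D x = h * p + ∫ x, v x * (D x - h * P (x.1 - a)) := by
      have j1 : Integrable fun x => v x * P (x.1 - a) := hv.integrable_mul hPm
      have j2 : Integrable fun x => v x * (D x - h * P (x.1 - a)) := hv.integrable_mul hRm
      rw [hp, ← integral_const_mul, ← integral_add (j1.const_mul h) j2]
      exact integral_congr_ae (ae_of_all _ fun x => by simp only; ring)
    have h4 := (le_abs_self _).trans (abs_integral_mul_le hv hRm)
    have h5 : ltwo (fun x : Cyl d L => D x - h * P (x.1 - a)) ≤ C' * Real.exp lam * h ^ 2 * ltwo E :=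
      ltwo_le_const_mul hEm (by positivity) (ae_of_all _ hbd2)
    have h6 : ltwo D ≤ C' * Real.exp lam * |h| * ltwo E :=
      ltwo_le_const_mul hEm (by positivity) (ae_of_all _ hbd1)
    have h7 : ltwo D ^ 2 ≤ (C' * Real.exp lam * |h| * ltwo E) ^ 2 :=
      pow_le_pow_left₀ (ltwo_nonneg _) h6 2
    have h8 : (C' * Real.exp lam * |h| * ltwo E) ^ 2 = h ^ 2 * (C' * Real.exp lam * ltwo E) ^ 2 := by
      rw [← sq_abs h]; ring
    have h9 := mul_le_mul_of_nonneg_left h5 (ltwo_nonneg v)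
    rw [h8] at h7
    nlinarith
  set Q := 2 * C' * Real.exp lam * ltwo v * ltwo E + (C' * Real.exp lam * ltwo E) ^ 2 with hQ
  have hQ0 : 0 ≤ Q := by have := ltwo_nonneg v; positivity
  change p = 0
  by_contra hp0
  -- test with a small multiple of `-p`
  set s := 1 / (1 + |p| + Q) with hs
  have hden : 0 < 1 + |p| + Q := by positivity
  have hs0 : 0 < s := by positivity
  have hsp : |-(s * p)| ≤ 1 := by
    rw [abs_neg, abs_mul, abs_of_pos hs0, hs, one_div_mul_eq_div, div_le_one hden]
    linarith
  have h1 := key (-(s * p)) hsp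
  have h2 : s * Q < 1 := by
    rw [hs, one_div_mul_eq_div, div_lt_one hden]
    linarith [abs_nonneg p]
  have h3 : 0 < s * p ^ 2 := by positivity
  nlinarith

variable (hβ : 1 < β) (hJ : IsSmoothKernel J)

include hβ hJ

theorem conv_profile (hM : IsProfile β (marginal J) M P P₂ l l' c C lam) (x : Cyl d L) :
    conv J (fun x => M x.1) x = 1 / β * Real.artanh (M x.1) := by
  rw [hJ.conv_longitudinal hM.continuous.measurable hM.abs_le, hM.artanh_eq hβ]

/-- The potential is quadratic near its wells, so exponential decay makes its part finite.
Increments of the profile over the bounded range of the kernel decay exponentially, which handles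
the interaction part. -/
theorem freeEnergy_profile_ne_top (hM : IsProfile β (marginal J) M P P₂ l l' c C lam)
    (hmβ : IsPositiveMinimizer β mβ) : freeEnergy β mβ J (fun x : Cyl d L => M x.1) ≠ ⊤ := by
  have hκ := hJ.isProbabilityMeasure (L := L)
  have hlam := hM.lam_pos
  have hC := hM.const_pos
  have hcM := hM.continuous
  have hE2 : ∀ A : ℝ, ∫⁻ x : Cyl d L, ENNReal.ofReal (A * Real.exp (-(2 * lam) * |x.1|)) ≠ ⊤ := fun A =>
    ((integrable_exp_longitudinal (by linarith)).const_mul A).lintegral_lt_top.ne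
  have hexp : ∀ r : ℝ, Real.exp (-lam * |r|) ^ 2 = Real.exp (-(2 * lam) * |r|) := fun r => by
    rw [← Real.exp_nat_mul]; congr 1; push_cast; ring
  rw [hJ.freeEnergy_eq β mβ (Continuous.aestronglyMeasurable (by fun_prop))]
  refine ENNReal.add_ne_top.2 ⟨?_, ENNReal.mul_ne_top (by simp) ?_⟩
  · set D := 1 / (1 - l ^ 2) + 1 + (1 / (1 - l' ^ 2) + 1) with hD
    have hl := hM.minimizer.mem_Ioo hβ
    have hl' := hM.minimizer'.mem_Ioo hβ
    have hl2 : 0 < 1 - l ^ 2 := by nlinarith [hl.1, hl.2]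
    have hl2' : 0 < 1 - l' ^ 2 := by nlinarith [hl'.1, hl'.2]
    have hsq : ∀ t A B : ℝ, |t| ≤ C * B → 0 ≤ A → A * t ^ 2 ≤ A * C ^ 2 * B ^ 2 := fun t A B h hA => by
      rw [mul_assoc, ← mul_pow, ← sq_abs t]
      gcongr
    refine ne_top_of_le_ne_top (hE2 (D * C ^ 2)) (lintegral_mono fun x => ENNReal.ofReal_le_ofReal ?_)
    rw [← hexp]
    have hA1 : 0 ≤ 1 / (1 - l ^ 2) + 1 := by positivity
    have hA2 : 0 ≤ 1 / (1 - l' ^ 2) + 1 := by positivity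
    have hB := sq_nonneg (C * Real.exp (-lam * |x.1|))
    rcases le_total 0 x.1 with h0 | h0
    · have h1 := hmβ.potential_sub_le hβ hM.minimizer (hM.mem_Icc x.1) (χ := l) (Or.inl rfl)
      have h2 := hM.sub_le x.1
      have h3 := hsq _ _ _ h2 hA1
      rw [abs_of_nonneg h0] at hB ⊢
      nlinarith [mul_nonneg hA2 hB]
    · have h1 := hmβ.potential_sub_le hβ hM.minimizer' (hM.mem_Icc x.1) (χ := -l') (Or.inr rfl)
      have h2 := hM.add_le x.1
      rw [← sub_neg_eq_add] at h2
      rw [abs_of_nonpos h0] at hB ⊢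
      rw [show lam * x.1 = -lam * -x.1 by ring] at h2
      have h3 := hsq _ _ _ h2 hA2
      nlinarith [mul_nonneg hA1 hB]
  · obtain ⟨R, hR0, hsupp⟩ := hJ.exists_ae_abs_fst_le (L := L)
    refine ne_top_of_le_ne_top (hE2 ((C * Real.exp (lam * R) * R) ^ 2)) (lintegral_mono fun x => ?_)
    calc ∫⁻ y, ENNReal.ofReal ((M x.1 - M (x - y).1) ^ 2) ∂kernelMeasure L J
        ≤ ∫⁻ _, ENNReal.ofReal ((C * Real.exp (lam * R) * R) ^ 2
            * Real.exp (-(2 * lam) * |x.1|)) ∂kernelMeasure L J := by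
          refine lintegral_mono_ae ?_
          filter_upwards [hsupp] with y hy
          refine ENNReal.ofReal_le_ofReal ?_
          rw [← hexp, ← mul_pow, ← sq_abs (M x.1 - M (x - y).1), abs_sub_comm]
          refine pow_le_pow_left₀ (abs_nonneg _) ((hM.abs_shift_sub_le x.1 y.1).trans ?_) 2
          gcongr
      _ = _ := by simp

/-- First order expansion of the free energy, with a quadratic remainder. -/
theorem freeEnergy_expansion (hmβ : IsPositiveMinimizer β mβ) {c' : ℝ} (hc' : c' < 1)
    {m : Cyl d L → ℝ} (hm : AEStronglyMeasurable m volume) (hmc : ∀ᵐ x, |m x| ≤ c')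
    (hw : MemLp w 2 volume) (hwI : ∀ᵐ x, m x + w x ∈ Icc (-1 : ℝ) 1)
    (hE : freeEnergy β mβ J m ≠ ⊤)
    (hh : MemLp (fun x => 1 / β * Real.artanh (m x) - conv J m x) 2 volume) :
    freeEnergy β mβ J (fun x => m x + w x) ≠ ⊤ ∧
      |(freeEnergy β mβ J (fun x => m x + w x)).toReal - (freeEnergy β mβ J m).toReal
        - ∫ x, (1 / β * Real.artanh (m x) - conv J m x) * w x|
        ≤ (1 / (1 - c' ^ 2) + 2) * ltwo w ^ 2 := by
  have hκ := hJ.isProbabilityMeasure (L := L)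
  have hκ' := hJ.isNegInvariant (L := L)
  rw [hJ.freeEnergy_eq β mβ hm] at hE ⊢
  rw [hJ.freeEnergy_eq β mβ (m := fun x => m x + w x) (hm.add hw.1)]
  rw [hJ.conv_eq_avg hm] at hh ⊢
  have hD : MemLp (incr m) 2 (volume.prod (kernelMeasure L J)) := by
    refine memLp_incr_of_lintegral hm fun h => hE ?_
    rw [energy, h, ENNReal.mul_top (by simp)]
    simp
  have hav := memLp_sub_avg hm hD
  set A := 1 / (1 - c' ^ 2) + 1 with hA
  set r := fun x => potential β (m x + w x) - potential β (m x)
    - (1 / β * Real.artanh (m x) - m x) * w x with hr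
  have hr0 : ∀ᵐ x, |r x| ≤ A * w x ^ 2 := by
    filter_upwards [hmc, hwI] with x h1 h2
    have := abs_potential_sub_le hβ hc' h2 h1
    simpa only [add_sub_cancel_left] using this
  have hrm : AEStronglyMeasurable r volume :=
    (((continuous_potential β).comp_aestronglyMeasurable (hm.add hw.1)).sub
      ((continuous_potential β).comp_aestronglyMeasurable hm)).sub
      (((((measurable_artanh.comp_aemeasurable hm.aemeasurable).const_mul _).sub
        hm.aemeasurable).mul hw.1.aemeasurable).aestronglyMeasurable)
  have hri : Integrable r := (hw.integrable_sq.const_mul A).mono' hrm hr0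
  -- Neither artanh m nor m has to be in L², but the local part of the variation is the chemical
  -- potential minus m − J⋆m, and both of these are.
  have hlin : MemLp (fun x => 1 / β * Real.artanh (m x) - m x) 2 volume := by
    refine (hh.sub hav).ae_eq (ae_of_all _ fun x => ?_)
    simp only [Pi.sub_apply]; ring
  have i1 : Integrable fun x => (1 / β * Real.artanh (m x) - m x) * w x := hlin.integrable_mul hw
  have i2 : Integrable fun x => w x * (m x - avg (kernelMeasure L J) m x) := hw.integrable_mul hav
  have hpe : ∀ x, potential β (m x + w x) - potential β (m x)
      = (1 / β * Real.artanh (m x) - m x) * w x + r x := fun x => by simp only [hr]; ring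
  have hpi : Integrable fun x => potential β (m x + w x) - potential β (m x) := by
    simp only [hpe]; exact i1.add hri
  have hmI : ∀ᵐ x, m x ∈ Icc (-1 : ℝ) 1 := by
    filter_upwards [hmc] with x hx
    exact abs_le.1 (hx.trans hc'.le)
  obtain ⟨h1, h2⟩ := energy_expansion hm hw hmβ.2.2 hmI hwI hE hpi
  refine ⟨h1, ?_⟩
  change |(energy volume (kernelMeasure L J) β mβ (m + w)).toReal - _ - _| ≤ _
  have e1 : ∫ x, (1 / β * Real.artanh (m x) - avg (kernelMeasure L J) m x) * w x
      = (∫ x, (1 / β * Real.artanh (m x) - m x) * w x)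
        + ∫ x, w x * (m x - avg (kernelMeasure L J) m x) := by
    rw [← integral_add i1 i2]
    exact integral_congr_ae (ae_of_all _ fun x => by simp only; ring)
  have e2 : ∫ x, (potential β (m x + w x) - potential β (m x))
      = (∫ x, (1 / β * Real.artanh (m x) - m x) * w x) + ∫ x, r x := by
    simp only [hpe]; exact integral_add i1 hri
  have h3 := integral_incr_sq_le (μ := volume) (ν := kernelMeasure L J) hw
  have h4 : 0 ≤ ∫ p, incr w p ^ 2 ∂(volume.prod (kernelMeasure L J)) :=
    integral_nonneg fun p => sq_nonneg _
  have h5 : |∫ x, r x| ≤ A * ltwo w ^ 2 := by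
    rw [ltwo_sq hw, ← integral_const_mul]
    exact (abs_integral_le_integral_abs).trans
      (integral_mono_ae hri.abs (hw.integrable_sq.const_mul A) hr0)
  rw [← ltwo_sq hw] at h3
  rw [h2, e1, e2]
  have h6 := abs_le.1 h5
  rw [abs_le]
  constructor <;> simp only [hA] at h6 ⊢ <;> linarith [h6.1, h6.2]

theorem freeEnergy_planar (hM : IsProfile β (marginal J) M P P₂ l l' c C lam) (a : ℝ) :
    freeEnergy β mβ J (fun x : Cyl d L => M (x.1 - a)) = freeEnergy β mβ J (fun x : Cyl d L => M x.1) := by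
  have hκ := hJ.isProbabilityMeasure (L := L)
  have hcM := hM.continuous
  rw [hJ.freeEnergy_eq β mβ (Continuous.aestronglyMeasurable (by fun_prop)),
    hJ.freeEnergy_eq β mβ (Continuous.aestronglyMeasurable (by fun_prop))]
  exact energy_comp_sub (fun x : Cyl d L => M x.1) ((a, 0) : Cyl d L)

end Cylinder

end NonlocalFront

namespace NonlocalFront

/-! ### Comparison of the dissipation with its linearization -/

theorem abs_inv_one_sub_sq_sub_le {x s k : ℝ} (hk : 0 < k) (hx : k ≤ 1 - x ^ 2)
    (hxs : k ≤ 1 - (x + s) ^ 2) (hs : |s| ≤ 1) :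
    |1 / (1 - (x + s) ^ 2) - 1 / (1 - x ^ 2)| ≤ 7 / k ^ 3 * |s| ∧
    |1 / (1 - (x + s) ^ 2) - 1 / (1 - x ^ 2) - 2 * x * s / (1 - x ^ 2) ^ 2| ≤ 7 / k ^ 3 * s ^ 2 := by
  set X := 1 - x ^ 2 with hX
  set Y := 1 - (x + s) ^ 2 with hY
  have hX0 : 0 < X := hk.trans_le hx
  have hY0 : 0 < Y := hk.trans_le hxs
  have hx1 : |x| ≤ 1 := abs_le.2 ⟨by nlinarith, by nlinarith⟩
  have hX1 : X ≤ 1 := by nlinarith [sq_nonneg x]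
  have hlin : |2 * x * s + s ^ 2| ≤ 3 * |s| := by
    refine (abs_add_le _ _).trans ?_
    rw [abs_mul, abs_mul, abs_two, abs_pow]
    nlinarith [abs_nonneg s, abs_nonneg x, mul_le_mul_of_nonneg_right hx1 (abs_nonneg s)]
  have hk3 : k ^ 3 ≤ X ^ 2 * Y := by
    calc k ^ 3 = k ^ 2 * k := by ring
      _ ≤ X ^ 2 * Y := by gcongr
  have hk3' : k ^ 3 ≤ X * Y := by
    refine hk3.trans ?_
    rw [sq]
    exact mul_le_mul_of_nonneg_right (mul_le_of_le_one_right hX0.le hX1) hY0.le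
  constructor
  · have e : 1 / Y - 1 / X = (2 * x * s + s ^ 2) / (X * Y) := by
      rw [div_sub_div _ _ hY0.ne' hX0.ne', hX, hY]
      ring
    rw [e, abs_div, abs_of_pos (mul_pos hX0 hY0), div_mul_eq_mul_div]
    exact div_le_div₀ (by positivity) (by linarith [abs_nonneg s]) (by positivity) hk3'
  · have e : 1 / Y - 1 / X - 2 * x * s / X ^ 2
        = (s ^ 2 * X + 2 * x * s * (2 * x * s + s ^ 2)) / (X ^ 2 * Y) := by
      have h1 : X - Y = 2 * x * s + s ^ 2 := by rw [hX, hY]; ring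
      rw [← h1]
      field_simp
      linear_combination X * h1
    have hnum : |s ^ 2 * X + 2 * x * s * (2 * x * s + s ^ 2)| ≤ 7 * s ^ 2 := by
      refine (abs_add_le _ _).trans ?_
      rw [abs_mul, abs_mul (2 * x * s), abs_of_pos hX0, abs_pow, abs_mul, abs_mul, abs_two]
      have h2 : 2 * |x| * |s| * |2 * x * s + s ^ 2| ≤ 2 * 1 * |s| * (3 * |s|) := by gcongr
      nlinarith [mul_le_mul_of_nonneg_left hX1 (sq_nonneg |s|), sq_abs s]
    rw [e, abs_div, abs_of_pos (mul_pos (pow_pos hX0 2) hY0), div_mul_eq_mul_div]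
    exact div_le_div₀ (by positivity) hnum (by positivity) hk3

theorem abs_artanh_sub_le {x s b : ℝ} (hb1 : b < 1) (hx : |x| ≤ b) (hxs : |x + s| ≤ b) :
    |Real.artanh (x + s) - Real.artanh x| ≤ 1 / (1 - b ^ 2) * |s| := by
  have hb0 : 0 ≤ b := (abs_nonneg _).trans hx
  have h := (convex_Icc (-b) b).norm_image_sub_le_of_norm_hasDerivWithin_le
    (f := Real.artanh) (f' := fun t => 1 / (1 - t ^ 2)) (C := 1 / (1 - b ^ 2))
    (fun t ht => (hasDerivAt_artanh ⟨by linarith [ht.1], by linarith [ht.2]⟩).hasDerivWithinAt)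
    (fun t ht => by
      have h1 : t ^ 2 ≤ b ^ 2 := sq_le_sq' ht.1 ht.2
      have h2 : 0 < 1 - b ^ 2 := by nlinarith
      rw [Real.norm_eq_abs, abs_of_pos (one_div_pos.2 (by linarith))]
      exact one_div_le_one_div_of_le h2 (by linarith))
    (abs_le.1 hx) (abs_le.1 hxs)
  simpa using h

section Cylinder

variable {d : ℕ} {L : ℝ} [Fact (0 < L)]

/-- Weak gradients are almost everywhere unique, so the infimum runs over equal values and any known
square integrable gradient computes it. -/
theorem weightedDirichlet_eq {ρ h : Cyl d L → ℝ} {q : Fin (d + 1) → Cyl d L → ℝ} {A : ℝ}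
    (hq : ∀ i, IsWeakPartial i h (q i)) (hq2 : ∀ i, MemLp (q i) 2 volume)
    (hρm : AEStronglyMeasurable ρ volume) (hρ0 : ∀ᵐ x, 0 ≤ ρ x) (hρA : ∀ᵐ x, ρ x ≤ A) :
    weightedDirichlet ρ h = ENNReal.ofReal (∑ i, ∫ x, ρ x * q i x ^ 2) := by
  have h1 : ∀ i, ∫⁻ x, ENNReal.ofReal (ρ x * q i x ^ 2)
      = ENNReal.ofReal (∫ x, ρ x * q i x ^ 2) := fun i => by
    refine (ofReal_integral_eq_lintegral_ofReal ?_ ?_).symm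
    · refine ((hq2 i).integrable_sq.const_mul A).mono' (hρm.mul ((hq2 i).1.pow 2)) ?_
      filter_upwards [hρ0, hρA] with x h0 hA
      rw [Real.norm_eq_abs, abs_of_nonneg (mul_nonneg h0 (sq_nonneg _))]
      exact mul_le_mul_of_nonneg_right hA (sq_nonneg _)
    · filter_upwards [hρ0] with x h0
      exact mul_nonneg h0 (sq_nonneg _)
  have h2 : ∀ i, 0 ≤ ∫ x, ρ x * q i x ^ 2 := fun i => integral_nonneg_of_ae (by
    filter_upwards [hρ0] with x h0
    exact mul_nonneg h0 (sq_nonneg _))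
  rw [ENNReal.ofReal_sum_of_nonneg fun i _ => h2 i]
  refine le_antisymm ((iInf₂_le q hq).trans_eq (Finset.sum_congr rfl fun i _ => h1 i))
    (le_iInf₂ fun g hg => le_of_eq (Finset.sum_congr rfl fun i _ => ?_))
  rw [← h1 i]
  refine lintegral_congr_ae ?_
  filter_upwards [(hq i).ae_unique (hg i)] with x hx
  rw [hx]

variable {J : Cover d → ℝ} {β mβ : ℝ} {M P P₂ : ℝ → ℝ} {l l' c C lam : ℝ} {u v w : Cyl d L → ℝ}

/-- The `i`-th partial derivative of the chemical potential of `M + v`, where `g` is the one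
of `v`. -/
noncomputable def chemDeriv (β : ℝ) (J : Cover d → ℝ) (M P : ℝ → ℝ) (v : Cyl d L → ℝ)
    (i : Fin (d + 1)) (g : Cyl d L → ℝ) : Cyl d L → ℝ :=
  fun x => 1 / (β * (1 - (M x.1 + v x) ^ 2)) * g x - conv J g x
    + if i = 0 then (1 / (β * (1 - (M x.1 + v x) ^ 2)) - invMobility β M x.1) * P x.1 else 0

theorem IsProfile.abs_add_le {K : ℝ → ℝ} (hM : IsProfile β K M P P₂ l l' c C lam) (r : ℝ) {s : ℝ}
    (hs : |s| ≤ (1 - c) / 2) : |M r + s| ≤ (1 + c) / 2 := by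
  refine (_root_.abs_add_le _ _).trans ?_
  linarith [hM.abs_le r]

theorem IsProfile.half_lt_one {K : ℝ → ℝ} (hM : IsProfile β K M P P₂ l l' c C lam) :
    (1 + c) / 2 < 1 := by linarith [hM.lt_one]

theorem IsProfile.gap_pos {K : ℝ → ℝ} (hM : IsProfile β K M P P₂ l l' c C lam) :
    0 < 1 - ((1 + c) / 2) ^ 2 := by nlinarith [hM.lt_one, hM.nonneg]

theorem IsProfile.gap_le {K : ℝ → ℝ} (hM : IsProfile β K M P P₂ l l' c C lam) (r : ℝ) {s : ℝ}
    (hs : |s| ≤ (1 - c) / 2) : 1 - ((1 + c) / 2) ^ 2 ≤ 1 - (M r + s) ^ 2 := by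
  have h := _root_.abs_le.1 (hM.abs_add_le r hs)
  have := sq_le_sq' h.1 h.2
  linarith

theorem IsProfile.gap_le' {K : ℝ → ℝ} (hM : IsProfile β K M P P₂ l l' c C lam) (r : ℝ) :
    1 - ((1 + c) / 2) ^ 2 ≤ 1 - M r ^ 2 := by
  simpa using hM.gap_le r (s := 0) (by rw [abs_zero]; linarith [hM.lt_one])

variable (hβ : 1 < β) (hJ : IsSmoothKernel J)

include hβ hJ

theorem conv_profile_add (hM : IsProfile β (marginal J) M P P₂ l l' c C lam)
    (hv : MemLp v 2 volume) (x : Cyl d L) :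
    conv J (fun x => M x.1 + v x) x = conv J (fun x => M x.1) x + conv J v x := by
  obtain ⟨A, -, hA⟩ := exists_memLp_shift (L := L) hJ
  have hκ := hJ.isProbabilityMeasure (L := L)
  have hcM := hM.continuous
  have hm : AEStronglyMeasurable (fun x : Cyl d L => M x.1) volume :=
    Continuous.aestronglyMeasurable (by fun_prop)
  rw [hJ.conv_eq_avg (u := fun x => M x.1 + v x) (hm.add hv.1), hJ.conv_eq_avg hm,
    hJ.conv_eq_avg hv.1]
  refine integral_add (f := fun y => M (x - y).1) ?_ ((hA v hv x).1.integrable (by norm_num))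
  refine Integrable.of_bound (C := c) (Continuous.aestronglyMeasurable ?_)
    (ae_of_all _ fun y => hM.abs_le _)
  have : Continuous fun y : Cyl d L => (x - y).1 := continuous_const.sub continuous_fst
  exact hcM.comp this

/-- The chemical potential of the front vanishes by the Euler–Lagrange equation. Subtracting it
leaves an expression of the size of v, which is why it lies in L². -/
theorem chemicalPotential_ae_eq (hM : IsProfile β (marginal J) M P P₂ l l' c C lam)
    (hv : MemLp v 2 volume) {m : Cyl d L → ℝ} (hm : m =ᵐ[volume] fun x => M x.1 + v x) :
    (fun x => 1 / β * Real.artanh (m x) - conv J m x) =ᵐ[volume]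
      fun x => 1 / β * (Real.artanh (M x.1 + v x) - Real.artanh (M x.1)) - conv J v x := by
  filter_upwards [hm] with x hx
  rw [conv_congr_ae hm, conv_profile_add hβ hJ hM hv, conv_profile hβ hJ hM, hx]
  ring

theorem memLp_chemicalPotential (hM : IsProfile β (marginal J) M P P₂ l l' c C lam)
    (hv : MemLp v 2 volume) (hvb : ∀ᵐ x, |v x| ≤ (1 - c) / 2) {m : Cyl d L → ℝ}
    (hm : m =ᵐ[volume] fun x => M x.1 + v x) :
    MemLp (fun x => 1 / β * Real.artanh (m x) - conv J m x) 2 volume := by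
  refine MemLp.ae_eq (chemicalPotential_ae_eq hβ hJ hM hv hm).symm (MemLp.sub ?_ (hJ.memLp_conv hv))
  have hcM := hM.continuous
  have hMm : AEMeasurable (fun x : Cyl d L => M x.1) volume :=
    (Continuous.measurable (by fun_prop)).aemeasurable
  refine MemLp.const_mul (memLp_of_abs_le (((measurable_artanh.comp_aemeasurable
    (hMm.add hv.1.aemeasurable)).sub
    (measurable_artanh.comp_aemeasurable hMm)).aestronglyMeasurable) hv
    (c := 1 / (1 - ((1 + c) / 2) ^ 2)) ?_) _
  filter_upwards [hvb] with x hx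
  exact abs_artanh_sub_le hM.half_lt_one ((hM.abs_le _).trans (by linarith [hM.lt_one]))
    (hM.abs_add_le _ hx)

theorem isWeakPartial_chemicalPotential (hM : IsProfile β (marginal J) M P P₂ l l' c C lam)
    {i : Fin (d + 1)} {g : Cyl d L → ℝ} (h : IsWeakPartial i v g)
    (hv : MemLp v 2 volume) (hg : MemLp g 2 volume) (hvb : ∀ᵐ x, |v x| ≤ (1 - c) / 2)
    {m : Cyl d L → ℝ} (hm : m =ᵐ[volume] fun x => M x.1 + v x) :
    IsWeakPartial i (fun x => 1 / β * Real.artanh (m x) - conv J m x) (chemDeriv β J M P v i g) := by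
  have hgap := hM.gap_pos
  have hβ0 : 0 < β := by linarith
  have hC := hM.const_pos
  have hc := hM.lt_one
  set k := 1 - ((1 + c) / 2) ^ 2 with hk
  have hcont := hM.continuous
  have hcontP := hM.continuous_deriv
  have hcs : ContinuousOn (fun p : ℝ × ℝ => 1 / (β * (1 - (M p.1 + p.2) ^ 2)))
      {p | |p.2| ≤ (1 - c) / 2} := by
    refine ContinuousOn.div continuousOn_const (Continuous.continuousOn (by fun_prop)) fun p hp => ?_
    exact (mul_pos hβ0 (hgap.trans_le (hM.gap_le _ hp))).ne'
  have hbd : ∀ r s, |s| ≤ (1 - c) / 2 → |1 / (β * (1 - (M r + s) ^ 2))| ≤ 1 / (β * k) := by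
    intro r s hs
    have h1 := hM.gap_le r hs
    have h2 : 0 < 1 - (M r + s) ^ 2 := hgap.trans_le h1
    rw [abs_of_pos (by positivity)]
    gcongr
  have h1 : IsWeakPartial i
      (fun x => 1 / β * (Real.artanh (M x.1 + v x) - Real.artanh (M x.1))) (fun x =>
      1 / (β * (1 - (M x.1 + v x) ^ 2)) * g x
        + if i = 0 then (1 / (β * (1 - (M x.1 + v x) ^ 2)) - invMobility β M x.1) * P x.1 else 0) := by
    refine IsWeakPartial.chain
      (Γ := fun r s => 1 / β * (Real.artanh (M r + s) - Real.artanh (M r)))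
      (Γr := fun r s => (1 / (β * (1 - (M r + s) ^ 2)) - invMobility β M r) * P r)
      (Γs := fun r s => 1 / (β * (1 - (M r + s) ^ 2)))
      (B := (1 - c) / 2) (C := 1 / β * (1 / k * ((1 - c) / 2)) + (1 / (β * k) + 1 / (β * k)) * C
        + 1 / (β * k)) (fun r s hs => ?_) ?_ hcs (fun r s hs => ?_) h hv hg hvb
    · have hin : M r + s ∈ Ioo (-1 : ℝ) 1 := by
        have := _root_.abs_le.1 (hM.abs_add_le r hs)
        exact ⟨by linarith, by linarith⟩
      have hin' : M r ∈ Ioo (-1 : ℝ) 1 := by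
        have := _root_.abs_le.1 (hM.abs_le r)
        exact ⟨by linarith, by linarith⟩
      have e1 : HasFDerivAt (fun p : ℝ × ℝ => M p.1) (P r • ContinuousLinearMap.fst ℝ ℝ ℝ) (r, s) :=
        (hM.hasDerivAt r).comp_hasFDerivAt (r, s)
          (hasFDerivAt_fst (𝕜 := ℝ) (E := ℝ) (F := ℝ) (p := (r, s)))
      have e2 := e1.add (hasFDerivAt_snd (𝕜 := ℝ) (E := ℝ) (F := ℝ) (p := (r, s)))
      have e3 := (hasDerivAt_artanh hin).comp_hasFDerivAt (r, s) e2
      have e4 := (hasDerivAt_artanh hin').comp_hasFDerivAt (r, s) e1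
      have e5 := (e3.sub e4).const_mul (1 / β)
      have hX : 0 < 1 - (M r + s) ^ 2 := hgap.trans_le (hM.gap_le r hs)
      have hY : 0 < 1 - M r ^ 2 := hgap.trans_le (hM.gap_le' r)
      refine e5.congr_fderiv ?_
      ext <;> simp [invMobility] <;> field_simp
    · have := hM.continuous_invMobility hβ
      exact (hcs.sub (Continuous.continuousOn (by fun_prop))).mul
        (Continuous.continuousOn (by fun_prop))
    · have b1 := hbd r s hs
      have b2 : |invMobility β M r| ≤ 1 / (β * k) := by
        have := hbd r 0 (by rw [abs_zero]; linarith)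
        simpa [invMobility] using this
      have b3 : |1 / β * (Real.artanh (M r + s) - Real.artanh (M r))|
          ≤ 1 / β * (1 / k * ((1 - c) / 2)) := by
        rw [abs_mul, abs_of_pos (one_div_pos.2 hβ0)]
        refine mul_le_mul_of_nonneg_left ((abs_artanh_sub_le hM.half_lt_one
          ((hM.abs_le _).trans (by linarith)) (hM.abs_add_le _ hs)).trans ?_) (by positivity)
        gcongr
      have b4 : |(1 / (β * (1 - (M r + s) ^ 2)) - invMobility β M r) * P r|
          ≤ (1 / (β * k) + 1 / (β * k)) * C := by
        rw [abs_mul, abs_of_pos (hM.pos r)]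
        exact mul_le_mul ((abs_sub _ _).trans (add_le_add b1 b2)) (hM.deriv_le_const r)
          (hM.pos r).le (by positivity)
      have b5 : 0 ≤ 1 / β * (1 / k * ((1 - c) / 2)) := (abs_nonneg _).trans b3
      have b6 : 0 ≤ (1 / (β * k) + 1 / (β * k)) * C := by positivity
      have b7 : 0 ≤ 1 / (β * k) := by positivity
      exact ⟨by linarith, by linarith, by linarith⟩
  refine (h1.sub (h.convolve hJ hv hg)).congr (chemicalPotential_ae_eq hβ hJ hM hv hm).symm
    (ae_of_all _ fun x => ?_)
  simp only [chemDeriv]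
  ring

/-- The gradient of the chemical potential is close to its linearization. -/
theorem abs_chemDeriv_sub_le (hM : IsProfile β (marginal J) M P P₂ l l' c C lam)
    (i : Fin (d + 1)) (g : Cyl d L → ℝ) {x : Cyl d L} (hx : |v x| ≤ (1 - c) / 2) :
    |chemDeriv β J M P v i g x - frontOpDeriv β J M P v i g x|
      ≤ 7 / (β * (1 - ((1 + c) / 2) ^ 2) ^ 3) * |v x| * (|g x| + |P x.1 * v x|) := by
  have hgap := hM.gap_pos
  have hβ0 : 0 < β := by linarith
  have hc := hM.lt_one
  have hc0 := hM.nonneg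
  have hPpos := hM.pos x.1
  set k := 1 - ((1 + c) / 2) ^ 2 with hk
  obtain ⟨h1, h2⟩ := abs_inv_one_sub_sq_sub_le hgap (hM.gap_le' x.1) (hM.gap_le x.1 hx)
    (hx.trans (by linarith))
  set A := 1 / (1 - (M x.1 + v x) ^ 2) - 1 / (1 - M x.1 ^ 2) with hA
  have e1 : 1 / (β * (1 - (M x.1 + v x) ^ 2)) - invMobility β M x.1 = 1 / β * A := by
    rw [invMobility, one_div_mul_eq_div, hA, sub_div, div_div, div_div, mul_comm β, mul_comm β]
  have e2 : chemDeriv β J M P v i g x - frontOpDeriv β J M P v i g x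
      = 1 / β * A * g x + if i = 0 then
        1 / β * (A - 2 * M x.1 * v x / (1 - M x.1 ^ 2) ^ 2) * P x.1 else 0 := by
    have h3 : invMobilityDeriv β M P x.1 * v x
        = 1 / β * (2 * M x.1 * v x / (1 - M x.1 ^ 2) ^ 2) * P x.1 := by
      rw [invMobilityDeriv]; field_simp
    rw [← e1]
    split_ifs with hi
    · simp only [chemDeriv, frontOpDeriv, frontOp, hi, if_true]
      rw [h3, e1]
      linear_combination g x * e1
    · simp only [chemDeriv, frontOpDeriv, frontOp, hi, if_false]
      ring
  have hβ1 : 0 ≤ 1 / β := by positivity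
  have h4 : |1 / β * A * g x| ≤ 7 / (β * k ^ 3) * |v x| * |g x| := by
    rw [abs_mul, abs_mul, abs_of_nonneg hβ1]
    calc 1 / β * |A| * |g x| ≤ 1 / β * (7 / k ^ 3 * |v x|) * |g x| := by gcongr
      _ = _ := by field_simp
  have h5 : |if i = 0 then 1 / β * (A - 2 * M x.1 * v x / (1 - M x.1 ^ 2) ^ 2) * P x.1 else 0|
      ≤ 7 / (β * k ^ 3) * |v x| * |P x.1 * v x| := by
    split_ifs
    · rw [abs_mul, abs_mul, abs_of_nonneg hβ1, abs_mul, abs_of_pos hPpos]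
      calc 1 / β * |A - 2 * M x.1 * v x / (1 - M x.1 ^ 2) ^ 2| * P x.1
          ≤ 1 / β * (7 / k ^ 3 * v x ^ 2) * P x.1 := by gcongr
        _ = _ := by rw [← sq_abs (v x)]; field_simp
    · rw [abs_zero]; positivity
  rw [e2]
  refine (abs_add_le _ _).trans ?_
  rw [mul_add]
  exact add_le_add h4 h5

theorem memLp_chemDeriv (hM : IsProfile β (marginal J) M P P₂ l l' c C lam)
    (hv : MemLp v 2 volume) (i : Fin (d + 1)) {g : Cyl d L → ℝ} (hg : MemLp g 2 volume)
    (hvb : ∀ᵐ x, |v x| ≤ (1 - c) / 2) : MemLp (chemDeriv β J M P v i g) 2 volume := by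
  have hcM := hM.continuous
  have hp := memLp_frontOpDeriv hβ hJ hM hv i hg
  have hPv : MemLp (fun x => P x.1 * v x) 2 volume :=
    memLp_mul_of_bounded (hM.continuous_deriv.comp continuous_fst).aestronglyMeasurable
      (C := C) (ae_of_all _ fun x => by
        rw [abs_of_pos (hM.pos _)]; exact hM.deriv_le_const _) hv
  have hMv : AEMeasurable (fun x => 1 / (β * (1 - (M x.1 + v x) ^ 2))) volume := by
    have hMm : AEMeasurable (fun x : Cyl d L => M x.1) volume :=
      (Continuous.measurable (by fun_prop)).aemeasurable
    have hv1 := hv.1.aemeasurable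
    fun_prop
  have hψ : AEMeasurable (fun x : Cyl d L => invMobility β M x.1) volume :=
    ((hM.continuous_invMobility hβ).comp continuous_fst).measurable.aemeasurable
  have hP : AEMeasurable (fun x : Cyl d L => P x.1) volume :=
    (hM.continuous_deriv.comp continuous_fst).measurable.aemeasurable
  have hm : AEStronglyMeasurable (chemDeriv β J M P v i g) volume := by
    refine (((hMv.mul hg.1.aemeasurable).sub (hJ.memLp_conv hg).1.aemeasurable).add
      ?_).aestronglyMeasurable
    split_ifs
    · exact (hMv.sub hψ).mul hP
    · exact aemeasurable_const
  have hb : MemLp (fun x => |g x| + |P x.1 * v x|) 2 volume := hg.abs.add hPv.abs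
  have hdiff : MemLp (fun x => chemDeriv β J M P v i g x - frontOpDeriv β J M P v i g x) 2 volume := by
    refine memLp_of_abs_le (hm.sub hp.1) hb
      (c := 7 / (β * (1 - ((1 + c) / 2) ^ 2) ^ 3) * ((1 - c) / 2)) ?_
    filter_upwards [hvb] with x hx
    refine (abs_chemDeriv_sub_le hβ hJ hM i g hx).trans ?_
    have h0 : 0 < (1 - ((1 + c) / 2) ^ 2) := hM.gap_pos
    have hβ0 : 0 < β := by linarith
    rw [abs_of_nonneg (by positivity : 0 ≤ |g x| + |P x.1 * v x|)]
    gcongr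
  refine (hdiff.add hp).ae_eq (ae_of_all _ fun x => ?_)
  simp

theorem dissipation_eq (hM : IsProfile β (marginal J) M P P₂ l l' c C lam)
    {g : Fin (d + 1) → Cyl d L → ℝ} (h : ∀ i, IsWeakPartial i v (g i))
    (hv : MemLp v 2 volume) (hg : ∀ i, MemLp (g i) 2 volume) (hvb : ∀ᵐ x, |v x| ≤ (1 - c) / 2)
    {m : Cyl d L → ℝ} (hm : m =ᵐ[volume] fun x => M x.1 + v x) :
    dissipation β J m
      = ENNReal.ofReal (∑ i, ∫ x, mobility β (M x.1 + v x) * chemDeriv β J M P v i (g i) x ^ 2) := by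
  have hcM := hM.continuous
  have hβ0 : 0 < β := by linarith
  have hmm : AEStronglyMeasurable m volume := by
    refine AEStronglyMeasurable.congr ?_ hm.symm
    exact AEStronglyMeasurable.add (Continuous.aestronglyMeasurable (by fun_prop)) hv.1
  rw [dissipation, weightedDirichlet_eq (A := β)
    (fun i => isWeakPartial_chemicalPotential hβ hJ hM (h i) hv (hg i) hvb hm)
    (fun i => memLp_chemDeriv hβ hJ hM hv i (hg i) hvb)]
  · congr 1
    refine Finset.sum_congr rfl fun i _ => integral_congr_ae ?_
    filter_upwards [hm] with x hx
    rw [hx]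
  · exact ((aestronglyMeasurable_const.sub (hmm.pow 2)).const_mul β)
  · filter_upwards [hm, hvb] with x hx hb
    rw [hx, mobility]
    exact mul_nonneg hβ0.le (hM.gap_pos.le.trans (hM.gap_le _ hb))
  · refine ae_of_all _ fun x => ?_
    rw [mobility]
    nlinarith [sq_nonneg (m x)]

theorem linDissipation_eq (hM : IsProfile β (marginal J) M P P₂ l l' c C lam)
    {g : Fin (d + 1) → Cyl d L → ℝ} (h : ∀ i, IsWeakPartial i v (g i))
    (hv : MemLp v 2 volume) (hg : ∀ i, MemLp (g i) 2 volume) (hvb : ∀ᵐ x, |v x| ≤ (1 - c) / 2)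
    {N : Cyl d L → ℝ} (hN : N =ᵐ[volume] fun x => M x.1) :
    linDissipation β J N v
      = ENNReal.ofReal (∑ i, ∫ x, mobility β (M x.1) * frontOpDeriv β J M P v i (g i) x ^ 2) := by
  have hcM := hM.continuous
  have hβ0 : 0 < β := by linarith
  have hop : frontOp β J M v =ᵐ[volume] linOp β J N v := by
    rw [← linOp_eq_frontOp]
    filter_upwards [hN] with x hx
    rw [linOp, linOp, hx]
  rw [linDissipation, weightedDirichlet_eq (A := β)
    (fun i => (isWeakPartial_frontOp hβ hJ hM (h i) hv (hg i) (by linarith [hM.lt_one])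
      hvb).congr hop (ae_eq_refl _))
    (fun i => memLp_frontOpDeriv hβ hJ hM hv i (hg i))]
  · congr 1
    refine Finset.sum_congr rfl fun i _ => integral_congr_ae ?_
    filter_upwards [hN] with x hx
    rw [hx]
  · have hNm : AEStronglyMeasurable N volume :=
      (Continuous.aestronglyMeasurable (by fun_prop)).congr hN.symm
    exact ((aestronglyMeasurable_const.sub (hNm.pow 2)).const_mul β)
  · filter_upwards [hN] with x hx
    rw [hx, mobility]
    exact (hM.mobility_pos hβ _).le
  · refine ae_of_all _ fun x => ?_
    rw [mobility]
    nlinarith [sq_nonneg (N x)]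

end Cylinder

end NonlocalFront

namespace NonlocalFront

/-! ### The dissipation inequality and the time derivative of the free energy -/

section Quadratic

variable {X ι : Type*} [MeasureSpace X] [Fintype ι]

/-- Stability of a weighted quadratic form under perturbation of the weight and of the argument. -/
theorem sum_integral_weight_le {p q : ι → X → ℝ} {ρ ρ₀ : X → ℝ} {η τ σ₀ A : ℝ}
    (hp : ∀ i, MemLp (p i) 2 volume) (hq : ∀ i, MemLp (q i) 2 volume)
    (hρm : AEStronglyMeasurable ρ volume) (hρ₀m : AEStronglyMeasurable ρ₀ volume)
    (hη : 0 < η) (hη1 : η ≤ 1) (hσ₀ : 0 < σ₀) (h₀ : ∀ᵐ x, σ₀ ≤ ρ₀ x) (h₀A : ∀ᵐ x, ρ₀ x ≤ A)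
    (h : ∀ᵐ x, (1 - η) * ρ₀ x ≤ ρ x) (hA : ∀ᵐ x, ρ x ≤ A) (hA0 : 0 ≤ A)
    (hpq : ∀ i, ltwo (fun x => q i x - p i x) ≤ τ * √(∑ i, ltwo (p i) ^ 2))
    (hτ : A * (Fintype.card ι * τ ^ 2) ≤ η ^ 2 * σ₀) :
    (1 - 3 * η) * ∑ i, ∫ x, ρ₀ x * p i x ^ 2 ≤ ∑ i, ∫ x, ρ x * q i x ^ 2 := by
  have hi : ∀ {w : X → ℝ} {u : X → ℝ}, AEStronglyMeasurable w volume → (∀ᵐ x, 0 ≤ w x) →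
      (∀ᵐ x, w x ≤ A) → MemLp u 2 volume → Integrable fun x => w x * u x ^ 2 := by
    intro w u hw hw0 hwA hu
    refine (hu.integrable_sq.const_mul A).mono' (hw.mul (hu.1.pow 2)) ?_
    filter_upwards [hw0, hwA] with x h1 h2
    rw [Real.norm_eq_abs, abs_of_nonneg (mul_nonneg h1 (sq_nonneg _))]
    exact mul_le_mul_of_nonneg_right h2 (sq_nonneg _)
  have hρ₀0 : ∀ᵐ x, 0 ≤ ρ₀ x := h₀.mono fun x hx => hσ₀.le.trans hx
  have hρ0 : ∀ᵐ x, 0 ≤ ρ x := by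
    filter_upwards [hρ₀0, h] with x h1 h2
    exact (mul_nonneg (by linarith) h1).trans h2
  set S := ∑ i, ltwo (p i) ^ 2 with hS
  have hS0 : 0 ≤ S := Finset.sum_nonneg fun i _ => sq_nonneg _
  have hpt : ∀ i, (1 - 2 * η) * (∫ x, ρ₀ x * p i x ^ 2)
      - A / η * ltwo (fun x => q i x - p i x) ^ 2 ≤ ∫ x, ρ x * q i x ^ 2 := by
    intro i
    have hd : MemLp (fun x => q i x - p i x) 2 volume := (hq i).sub (hp i)
    have i1 := hi hρ₀m hρ₀0 h₀A (hp i)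
    have i2 := hd.integrable_sq
    rw [ltwo_sq hd, ← integral_const_mul, ← integral_const_mul,
      ← integral_sub (i1.const_mul _) (i2.const_mul _)]
    refine integral_mono_ae ((i1.const_mul _).sub (i2.const_mul _)) (hi hρm hρ0 hA (hq i)) ?_
    filter_upwards [hρ₀0, h₀A, h] with x h1 h2 h3
    obtain ⟨s, hs⟩ : ∃ s, q i x - p i x = η * s := ⟨(q i x - p i x) / η, by field_simp⟩
    have hqe : q i x = p i x + η * s := by linarith
    rw [hs]
    have e1 : A / η * (η * s) ^ 2 = A * η * s ^ 2 := by field_simp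
    have e2 : (1 - η) * ρ₀ x * q i x ^ 2 ≤ ρ x * q i x ^ 2 :=
      mul_le_mul_of_nonneg_right h3 (sq_nonneg _)
    have e3 : ρ₀ x * η * s ^ 2 ≤ A * η * s ^ 2 := by gcongr
    -- With q = p + ηs, this is the expanded form of ρ₀ times (1 − η)(p + ηs)² − (1 − 2η)p² + ηs²,
    -- arranged so that its sign is visible.
    have e4 : 0 ≤ ρ₀ x * (η * ((1 - η) * (p i x + s) ^ 2 + η * (p i x ^ 2 + s ^ 2))
        + (1 - η) * (η * s) ^ 2) := by
      have : 0 ≤ 1 - η := by linarith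
      positivity
    rw [e1]
    rw [hqe] at e2 ⊢
    nlinarith
  have hsum := Finset.sum_le_sum fun i (_ : i ∈ Finset.univ) => hpt i
  rw [Finset.sum_sub_distrib, ← Finset.mul_sum, ← Finset.mul_sum] at hsum
  have he : ∑ i, ltwo (fun x => q i x - p i x) ^ 2 ≤ Fintype.card ι * τ ^ 2 * S := by
    calc ∑ i, ltwo (fun x => q i x - p i x) ^ 2 ≤ ∑ _i : ι, τ ^ 2 * S := by
          refine Finset.sum_le_sum fun i _ => ?_
          calc ltwo (fun x => q i x - p i x) ^ 2 ≤ (τ * √S) ^ 2 :=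
                pow_le_pow_left₀ (ltwo_nonneg _) (hpq i) 2
            _ = τ ^ 2 * S := by rw [mul_pow, Real.sq_sqrt hS0]
      _ = _ := by rw [Finset.sum_const, Finset.card_univ, nsmul_eq_mul, mul_assoc]
  have hLin : σ₀ * S ≤ ∑ i, ∫ x, ρ₀ x * p i x ^ 2 := by
    rw [hS, Finset.mul_sum]
    refine Finset.sum_le_sum fun i _ => ?_
    rw [ltwo_sq (hp i), ← integral_const_mul]
    refine integral_mono_ae ((hp i).integrable_sq.const_mul _) (hi hρ₀m hρ₀0 h₀A (hp i)) ?_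
    filter_upwards [h₀] with x hx
    exact mul_le_mul_of_nonneg_right hx (sq_nonneg _)
  have h1 : A / η * ∑ i, ltwo (fun x => q i x - p i x) ^ 2 ≤ η * (σ₀ * S) := by
    calc A / η * ∑ i, ltwo (fun x => q i x - p i x) ^ 2
        ≤ A / η * (Fintype.card ι * τ ^ 2 * S) := by gcongr
      _ = (A * (Fintype.card ι * τ ^ 2)) * S / η := by ring
      _ ≤ (η ^ 2 * σ₀) * S / η := by gcongr
      _ = η * (σ₀ * S) := by field_simp
  have h2 := mul_le_mul_of_nonneg_left hLin hη.le
  linarith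

end Quadratic

section Cylinder

variable {d : ℕ} {L : ℝ} [Fact (0 < L)]
variable {J : Cover d → ℝ} {β mβ : ℝ} {M P P₂ : ℝ → ℝ} {l l' c C lam : ℝ} {u v w : Cyl d L → ℝ}
variable (hβ : 1 < β) (hJ : IsSmoothKernel J)

include hβ hJ

/-- If |v| ≤ b, the weights differ by O(b). The gradients differ in L² by at most 2kC_c b times the
norm of the linearized gradient, thanks to coercivity. A quadratic form is stable under such
perturbations once b is small, uniformly in a. -/
theorem exists_dissipation_comparison (hM : IsProfile β (marginal J) M P P₂ l l' c C lam)
    {ε : ℝ} (hε : 0 < ε) :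
    ∃ b : ℝ, 0 < b ∧ b ≤ (1 - c) / 2 ∧
      ∀ (a : ℝ) (v : Cyl d L → ℝ) (g : Fin (d + 1) → Cyl d L → ℝ), MemLp v 2 volume →
        (∀ i, MemLp (g i) 2 volume) → (∀ i, IsWeakPartial i v (g i)) → (∀ᵐ x, |v x| ≤ b) →
        ∫ x, v x * P (x.1 - a) = 0 →
        (1 - 3 * ε) * ∑ i, ∫ x, mobility β (M (x.1 - a)) *
            frontOpDeriv β J (fun r => M (r - a)) (fun r => P (r - a)) v i (g i) x ^ 2
          ≤ ∑ i, ∫ x, mobility β (M (x.1 - a) + v x) *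
            chemDeriv β J (fun r => M (r - a)) (fun r => P (r - a)) v i (g i) x ^ 2 := by
  obtain ⟨Cc, hCc, hco⟩ := exists_coercivity (L := L) hβ hJ hM
  have hβ0 : 0 < β := by linarith
  have hc1 := hM.one_sub_sq_pos
  have hclt := hM.lt_one
  have hgap := hM.gap_pos
  -- The perturbation lemma wants η ≤ 1. For larger ε the claim is weaker, since the linearized form
  -- is nonnegative.
  set η := min ε 1 with hη
  have hη0 : 0 < η := lt_min hε one_pos
  set k := 7 / (β * (1 - ((1 + c) / 2) ^ 2) ^ 3) with hk
  have hk0 : 0 < k := by positivity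
  -- The three conditions keep M + v inside the region where artanh is controlled, keep the weight
  -- above (1 − η) times its value at the front, and make the gradient error absorbable.
  have hev : ∀ᶠ b in 𝓝[>] (0 : ℝ), ((b ≤ (1 - c) / 2 ∧ 3 * b ≤ η * (1 - c ^ 2)) ∧
      β * ((Fintype.card (Fin (d + 1)) : ℝ) * (2 * k * Cc * b) ^ 2) ≤ η ^ 2 * (β * (1 - c ^ 2)))
      ∧ 0 < b := by
    have hcont : ∀ {f : ℝ → ℝ} {y : ℝ}, Continuous f → f 0 = 0 → 0 < y →
        ∀ᶠ b in 𝓝[>] (0 : ℝ), f b ≤ y := fun {f y} hf hf0 hy =>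
      nhdsWithin_le_nhds (hf.continuousAt.eventually (ge_mem_nhds (by rwa [hf0])))
    exact (((hcont (f := fun b => b) continuous_id rfl (by linarith)).and
      (hcont (by fun_prop) (by simp) (by positivity))).and
      (hcont (by fun_prop) (by simp) (by positivity))).and self_mem_nhdsWithin
  obtain ⟨b, ⟨⟨hb1, hb2⟩, hb3⟩, hb0⟩ := hev.exists
  refine ⟨b, hb0, hb1, fun a v g hv hg h hvb hvP => ?_⟩
  have hMa := hM.shift a
  have hcM := hMa.continuous
  have hvb' : ∀ᵐ x, |v x| ≤ (1 - c) / 2 := hvb.mono fun x hx => hx.trans hb1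
  have hpm := fun i => memLp_frontOpDeriv hβ hJ hMa hv i (hg i)
  have hqm := fun i => memLp_chemDeriv hβ hJ hMa hv i (hg i) hvb'
  obtain ⟨hco1, hco2⟩ := hco a v g b hv hg h hb0.le hvb hvP
  set p := fun i => frontOpDeriv β J (fun r => M (r - a)) (fun r => P (r - a)) v i (g i) with hp
  set q := fun i => chemDeriv β J (fun r => M (r - a)) (fun r => P (r - a)) v i (g i) with hq
  have hm1 : AEStronglyMeasurable (fun x : Cyl d L => M (x.1 - a)) volume :=
    (hcM.comp continuous_fst).aestronglyMeasurable
  have hPv : MemLp (fun x => P (x.1 - a) * v x) 2 volume :=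
    memLp_mul_of_bounded (hMa.continuous_deriv.comp continuous_fst).aestronglyMeasurable
      (C := C) (ae_of_all _ fun x => by
        rw [abs_of_pos (hM.pos _)]; exact hM.deriv_le_const _) hv
  have hlin0 : 0 ≤ ∑ i, ∫ x, mobility β (M (x.1 - a)) * p i x ^ 2 :=
    Finset.sum_nonneg fun i _ => integral_nonneg fun x =>
      mul_nonneg (hMa.mobility_pos hβ x.1).le (sq_nonneg _)
  refine le_trans (mul_le_mul_of_nonneg_right (b := 1 - 3 * ε) (c := 1 - 3 * η) ?_ hlin0)
    (sum_integral_weight_le (A := β) (τ := 2 * k * Cc * b) (σ₀ := β * (1 - c ^ 2)) hpm hqm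
      ((aestronglyMeasurable_const.sub ((hm1.add hv.1).pow 2)).const_mul β)
      ((aestronglyMeasurable_const.sub (hm1.pow 2)).const_mul β) hη0 (min_le_right _ _)
      (by positivity) (ae_of_all _ fun x => ?_) (ae_of_all _ fun x => ?_) ?_
      (ae_of_all _ fun x => ?_) hβ0.le (fun i => ?_) hb3)
  · linarith [min_le_left ε 1]
  · have := hM.sq_le (x.1 - a)
    rw [mobility]
    gcongr
  · rw [mobility]; nlinarith [sq_nonneg (M (x.1 - a))]
  · filter_upwards [hvb] with x hx
    rw [mobility, mobility]
    have h1 := hM.sq_le (x.1 - a)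
    have h2 := (hM.abs_le (x.1 - a)).trans hclt.le
    have hb1' : |v x| ≤ 1 := hx.trans (by linarith [hM.nonneg])
    have h3 : |2 * M (x.1 - a) * v x + v x ^ 2| ≤ 3 * b := by
      refine (_root_.abs_add_le _ _).trans ?_
      rw [abs_mul, abs_mul, abs_two, abs_pow]
      nlinarith [abs_nonneg (v x), mul_le_mul_of_nonneg_right h2 (abs_nonneg (v x))]
    have h4 := (abs_le.1 h3).2
    have h5 : η * (1 - c ^ 2) ≤ η * (1 - M (x.1 - a) ^ 2) := by gcongr
    nlinarith
  · rw [mobility]; nlinarith [sq_nonneg (M (x.1 - a) + v x)]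
  · set E := √(∑ i, ltwo (p i) ^ 2) with hE
    have h1 : ltwo (fun x => q i x - p i x)
        ≤ k * b * ltwo (fun x => |g i x| + |P (x.1 - a) * v x|) := by
      refine ltwo_le_const_mul ((hg i).abs.add hPv.abs) (by positivity) ?_
      filter_upwards [hvb, hvb'] with x hx hx'
      refine (abs_chemDeriv_sub_le hβ hJ hMa i (g i) hx').trans ?_
      change _ ≤ k * b * |(|g i x| + |P (x.1 - a) * v x|)|
      rw [abs_of_nonneg (by positivity : 0 ≤ |g i x| + |P (x.1 - a) * v x|)]
      gcongr
    have h2 : ltwo (fun x => |g i x| + |P (x.1 - a) * v x|) ≤ Cc * E + Cc * E := by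
      refine (ltwo_add_le (hg i).abs hPv.abs).trans (add_le_add ?_ ?_)
      · exact (ltwo_mono (hg i) (ae_of_all _ fun x => by simp)).trans (hco1 i)
      · exact (ltwo_mono hPv (ae_of_all _ fun x => by simp)).trans hco2
    refine h1.trans ((mul_le_mul_of_nonneg_left h2 (by positivity)).trans (le_of_eq ?_))
    ring

/-- Along a solution near the front, the chemical potential paired with the time derivative is
minus the dissipation. -/
theorem integral_chemicalPotential_mul (hM : IsProfile β (marginal J) M P P₂ l l' c C lam)
    {g : Fin (d + 1) → Cyl d L → ℝ} (h : ∀ i, IsWeakPartial i v (g i))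
    (hv : MemLp v 2 volume) (hg : ∀ i, MemLp (g i) 2 volume) (hvb : ∀ᵐ x, |v x| ≤ (1 - c) / 2)
    {m : Cyl d L → ℝ} (hm : m =ᵐ[volume] fun x => M x.1 + v x)
    (hw : MemLp w 2 volume) {p : Fin (d + 1) → Cyl d L → ℝ} (hp : ∀ i, IsWeakPartial i m (p i))
    (heq : ∀ φ : Cyl d L → ℝ, IsTestFunction φ → ∫ x, w x * φ x
      = - ∑ i, ∫ x, (p i x - β * (1 - m x ^ 2) * conv J (p i) x) * partialDeriv i φ x) :
    ∫ x, (1 / β * Real.artanh (m x) - conv J m x) * w x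
      = - ∑ i, ∫ x, mobility β (M x.1 + v x) * chemDeriv β J M P v i (g i) x ^ 2 := by
  have hcM := hM.continuous
  have hcP := hM.continuous_deriv
  have hβ0 : 0 < β := by linarith
  have hpe : ∀ i, p i =ᵐ[volume] fun x => (if i = 0 then P x.1 else 0) + g i x := fun i => by
    refine (hp i).ae_unique (IsWeakPartial.congr (IsWeakPartial.add
      ((hasPartial_longitudinal hM.hasDerivAt).isWeakPartial (hcM.comp continuous_fst) ?_) (h i))
      hm.symm (ae_eq_refl _))
    split_ifs
    · exact hcP.comp continuous_fst
    · exact continuous_const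
  have hPm : ∀ i : Fin (d + 1), MemLp (fun x : Cyl d L => if i = 0 then P x.1 else 0) 2 volume :=
    fun i => by
      split_ifs
      · exact hM.memLp_deriv
      · exact MemLp.zero'
  have hconv : ∀ i x, conv J (p i) x
      = (if i = 0 then invMobility β M x.1 * P x.1 else 0) + conv J (g i) x := fun i x => by
    rw [conv_congr_ae (hpe i), hJ.conv_add (hPm i) (hg i)]
    congr 1
    split_ifs
    · exact conv_profile_deriv hβ hJ hM x
    · simp [conv]
  -- The factor σ(m) cancels 1/(β(1 − m²)), and ψP = J⋆P cancels the contribution of the profile.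
  -- The flux of the equation is therefore σ(m) times the gradient of the chemical potential.
  have hflux : ∀ i, (fun x => mobility β (M x.1 + v x) * chemDeriv β J M P v i (g i) x)
      =ᵐ[volume] fun x => p i x - β * (1 - m x ^ 2) * conv J (p i) x := fun i => by
    filter_upwards [hpe i, hm, hvb] with x h1 h2 h3
    rw [h1, h2, hconv, mobility, chemDeriv]
    have h4 : 0 < 1 - (M x.1 + v x) ^ 2 := hM.gap_pos.trans_le (hM.gap_le _ h3)
    split_ifs
    · field_simp
      ring
    · field_simp
      ring
  have hqm := fun i => memLp_chemDeriv hβ hJ hM hv i (hg i) hvb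
  have hσ : MemLp v 2 volume → ∀ i,
      MemLp (fun x => mobility β (M x.1 + v x) * chemDeriv β J M P v i (g i) x) 2 volume :=
    fun hv i => by
      refine memLp_mul_of_bounded (C := β) ((aestronglyMeasurable_const.sub
        (((hcM.comp continuous_fst).aestronglyMeasurable.add hv.1).pow 2)).const_mul β) ?_ (hqm i)
      filter_upwards [hvb] with x hx
      have h4 : 0 < 1 - (M x.1 + v x) ^ 2 := hM.gap_pos.trans_le (hM.gap_le _ hx)
      change |β * (1 - (M x.1 + v x) ^ 2)| ≤ β
      rw [abs_of_pos (by positivity)]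
      nlinarith [sq_nonneg (M x.1 + v x)]
  -- The chemical potential is not a test function, but it lies in H¹ and the flux is square
  -- integrable, so density allows it in the weak equation.
  have key := integral_eq_of_testFunction hw (fun i => (hσ hv i).ae_eq (hflux i)) heq
    (memLp_chemicalPotential hβ hJ hM hv hvb hm) hqm
    (fun i => isWeakPartial_chemicalPotential hβ hJ hM (h i) hv (hg i) hvb hm)
  simp only [mul_comm _ (w _)]
  rw [key]
  congr 1
  refine Finset.sum_congr rfl fun i _ => integral_congr_ae ?_
  filter_upwards [hflux i] with x hx
  rw [← hx]; ring

/-- The free energy is differentiable along an `L²`-differentiable curve, at a time where the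
profile is uniformly close to a front. -/
theorem hasDerivAt_freeEnergy (hM : IsProfile β (marginal J) M P P₂ l l' c C lam)
    (hmβ : IsPositiveMinimizer β mβ) {m : ℝ → Cyl d L → ℝ} {t : ℝ} (hv : MemLp v 2 volume)
    (hvb : ∀ᵐ x, |v x| ≤ (1 - c) / 2) (hm : m t =ᵐ[volume] fun x => M x.1 + v x)
    (hE : freeEnergy β mβ J (m t) ≠ ⊤) {u : ℝ → Lp ℝ 2 (volume : Measure (Cyl d L))}
    {u' : Lp ℝ 2 (volume : Measure (Cyl d L))} (hu : HasDerivAt u u' t)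
    (hmu : ∀ᶠ τ in 𝓝 t, m τ =ᵐ[volume] fun x => m t x + (u τ - u t : Lp ℝ 2 volume) x)
    (hmI : ∀ᶠ τ in 𝓝 t, ∀ᵐ x, m τ x ∈ Icc (-1 : ℝ) 1) :
    HasDerivAt (fun τ => (freeEnergy β mβ J (m τ)).toReal)
      (∫ x, (1 / β * Real.artanh (m t x) - conv J (m t) x) * u' x) t := by
  have hcM := hM.continuous
  have hh := memLp_chemicalPotential hβ hJ hM hv hvb hm
  have hmm : AEStronglyMeasurable (m t) volume := by
    refine AEStronglyMeasurable.congr ?_ hm.symm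
    exact AEStronglyMeasurable.add (Continuous.aestronglyMeasurable (by fun_prop)) hv.1
  have hmc : ∀ᵐ x, |m t x| ≤ (1 + c) / 2 := by
    filter_upwards [hm, hvb] with x h1 h2
    rw [h1]; exact hM.abs_add_le _ h2
  set A := 1 / (1 - ((1 + c) / 2) ^ 2) + 2 with hA
  have hinner : ∀ f : Lp ℝ 2 (volume : Measure (Cyl d L)),
      ∫ x, (1 / β * Real.artanh (m t x) - conv J (m t) x) * f x = inner ℝ (hh.toLp _) f := fun f => by
    rw [integral_mul_eq_inner hh (Lp.memLp f), Lp.toLp_coeFn]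
  set H := hh.toLp _ with hH
  -- After the linear functional is removed, the increment is bounded by ‖u(τ) − u(t)‖², hence is
  -- o(τ − t). Only the profile at time t is required to stay away from ±1.
  set G := fun τ => (freeEnergy β mβ J (m τ)).toReal - inner ℝ H (u τ) with hG
  have hGb : ∀ᶠ τ in 𝓝 t, ‖G τ - G t‖ ≤ A * ‖‖u τ - u t‖ ^ 2‖ := by
    filter_upwards [hmu, hmI] with τ h1 h2
    have hI : ∀ᵐ x, m t x + (u τ - u t : Lp ℝ 2 volume) x ∈ Icc (-1 : ℝ) 1 := by
      filter_upwards [h1, h2] with x h3 h4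
      rwa [← h3]
    have h5 := (freeEnergy_expansion hβ hJ hmβ hM.half_lt_one hmm hmc (Lp.memLp (u τ - u t)) hI
      hE hh).2
    have hmτ : AEStronglyMeasurable (fun x => m t x + (u τ - u t : Lp ℝ 2 volume) x) volume :=
      hmm.add (Lp.memLp (u τ - u t)).1
    rw [freeEnergy_congr_ae β mβ hJ hmτ h1.symm, hinner, ltwo_eq_norm (Lp.memLp _),
      Lp.toLp_coeFn, inner_sub_right] at h5
    rw [Real.norm_eq_abs, norm_pow, norm_norm]
    refine le_trans (le_of_eq ?_) h5
    congr 1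
    simp only [hG]; ring
  have hGO : (fun τ => G τ - G t) =o[𝓝 t] fun τ => τ - t := by
    refine (Asymptotics.IsBigO.of_bound A hGb).trans_isLittleO ?_
    have h1 := (hu.isBigO_sub.norm_left.pow 2)
    have h2 := (Asymptotics.isLittleO_pow_sub_sub t one_lt_two)
    refine (h1.trans ?_).trans_isLittleO h2
    exact Asymptotics.IsBigO.of_bound 1 (Eventually.of_forall fun τ => by simp)
  have hGd : HasDerivAt G 0 t := by
    rw [hasDerivAt_iff_isLittleO]
    simpa using hGO
  have hin : HasDerivAt (fun τ => inner ℝ H (u τ)) (inner ℝ H u') t := by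
    have := (hasDerivAt_const t H).inner ℝ hu
    simpa using this
  rw [hinner]
  have := hGd.add hin
  rw [zero_add] at this
  refine this.congr_of_eventuallyEq (Eventually.of_forall fun τ => ?_)
  simp [hG]

end Cylinder

end NonlocalFront

/-! ### Assembly of the theorem. -/

theorem theorem3p1 {d : ℕ} (hD : d + 1 ≤ 3) {L : ℝ} [Fact (0 < L)] {β : ℝ} (hβ : 1 < β)
    {J : EuclideanSpace ℝ (Fin (d + 1)) → ℝ} (hJ : IsInteractionKernel J)
    {mβ : ℝ} (hmβ : IsPositiveMinimizer β mβ)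
    {mbar : ℝ → ℝ} (hmbar : IsFront β mβ (marginal J) mbar)
    (ε : ℝ) (hε : 0 < ε) :
    ∃ δ : ℝ, 0 < δ ∧
      ∀ (s : ℕ), ((d + 1 : ℕ) : ℝ) / 2 < (s : ℝ) →
      ∀ (T : ℝ) (m : ℝ → Cyl d L → ℝ) (a : ℝ → ℝ),
        IsSolution β J mbar T m →
        (∀ t ∈ Ico 0 T, IsClosestFront mbar (m t) (a t)) →
        (∀ t ∈ Ico 0 T, freeEnergy β mβ J (m t) ≠ ⊤ ∧
          freeEnergy β mβ J (planarFront (d := d) (L := L) mbar (a t)) ≠ ⊤) ∧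
        ∀ t ∈ Ico 0 T,
          sobolevNorm s (m t - planarFront mbar (a t)) ≤ ENNReal.ofReal δ →
          dissipation β J (m t) ≠ ⊤ ∧
          linDissipation β J (planarFront mbar (a t)) (m t - planarFront mbar (a t)) ≠ ⊤ ∧
          (0 < t →
            HasDerivAt
              (fun τ => (freeEnergy β mβ J (m τ)).toReal
                - (freeEnergy β mβ J (planarFront (d := d) (L := L) mbar (a τ))).toReal)
              (-(dissipation β J (m t)).toReal) t) ∧
          -(dissipation β J (m t)).toReal ≤
            -((1 - 3 * ε) * (linDissipation β J (planarFront mbar (a t))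
                (m t - planarFront mbar (a t))).toReal) := by
  have hJs := hJ.isSmoothKernel
  obtain ⟨R, hK⟩ := hJs.isLineKernel_marginal
  obtain ⟨M, P, P₂, l, l', c, C, lam, hbar, hM⟩ := hmbar.exists_profile hβ hK hmβ
  obtain ⟨Cs, hCs, hsob⟩ := exists_sobolev_bound (L := L) hD
  obtain ⟨b, hb0, hb1, hcomp⟩ := exists_dissipation_comparison (L := L) hβ hJs hM hε
  have hcM := hM.continuous
  have hplanar : ∀ a : ℝ, freeEnergy β mβ J (planarFront (d := d) (L := L) mbar a)
      = freeEnergy β mβ J (fun x : Cyl d L => M x.1) := fun a => by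
    rw [← freeEnergy_planar hβ hJs hM a]
    exact (freeEnergy_congr_ae β mβ hJs (Continuous.aestronglyMeasurable (by fun_prop))
      (planarFront_ae_eq hbar a).symm).symm
  have hfin := freeEnergy_profile_ne_top (L := L) hβ hJs hM hmβ
  -- The Sobolev bound is stated for a strict inequality, so it is applied with 2δ; the factor 2
  -- makes the resulting uniform bound on v exactly b.
  refine ⟨b / (2 * Cs), by positivity, fun s hs T m a hsol hcl => ?_⟩
  obtain ⟨u, u', hu, -, hu', -, heq⟩ := hsol.evolution
  have hmu : ∀ t ∈ Ico 0 T, m t =ᵐ[volume] fun x => M x.1 + u t x := fun t ht => by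
    filter_upwards [hu t ht, planarFront_ae_eq (d := d) (L := L) hbar 0] with x h1 h2
    rw [h1, Pi.sub_apply, h2, sub_zero]; ring
  -- Finiteness at every time needs no smallness: the expansion is taken at the front itself, whose
  -- chemical potential vanishes, with an arbitrary L² perturbation.
  have hmfin : ∀ t ∈ Ico 0 T, freeEnergy β mβ J (m t) ≠ ⊤ := fun t ht => by
    have hzero : MemLp (fun x : Cyl d L => 1 / β * Real.artanh (M x.1)
        - conv J (fun x : Cyl d L => M x.1) x) 2 volume := by
      simp only [conv_profile hβ hJs hM, sub_self]
      exact MemLp.zero'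
    have hI : ∀ᵐ x, M x.1 + u t x ∈ Icc (-1 : ℝ) 1 := by
      filter_upwards [hmu t ht, hsol.mem_Icc t ht] with x h1 h2
      rwa [← h1]
    have hMm : AEStronglyMeasurable (fun x : Cyl d L => M x.1) volume :=
      Continuous.aestronglyMeasurable (by fun_prop)
    rw [← freeEnergy_congr_ae β mβ hJs (hMm.add (Lp.memLp (u t)).1) (hmu t ht).symm]
    exact (freeEnergy_expansion hβ hJs hmβ hM.lt_one hMm (ae_of_all _ fun x => hM.abs_le _)
      (Lp.memLp (u t)) hI hfin hzero).1
  refine ⟨fun t ht => ⟨hmfin t ht, by rw [hplanar]; exact hfin⟩, fun t ht hsm => ?_⟩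
  set v := m t - planarFront mbar (a t) with hvdef
  obtain ⟨g, hv, hgw, hg, hvb₀⟩ := hsob s hs v (2 * (b / (2 * Cs))) (hsm.trans_lt
    ((ENNReal.ofReal_lt_ofReal_iff (by positivity)).2 (by
      have : 0 < b / (2 * Cs) := by positivity
      linarith)))
  have hvb : ∀ᵐ x, |v x| ≤ b := hvb₀.mono fun x hx => hx.trans (le_of_eq (by field_simp))
  have hvb' : ∀ᵐ x, |v x| ≤ (1 - c) / 2 := hvb.mono fun x hx => hx.trans hb1
  have hMa := hM.shift (a t)
  have hvP : ∫ x, v x * P (x.1 - a t) = 0 :=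
    integral_mul_deriv_eq_zero_of_isClosestFront hM hbar (hcl t ht) hv
  have hfront := planarFront_ae_eq (d := d) (L := L) hbar (a t)
  have hm : m t =ᵐ[volume] fun x => M (x.1 - a t) + v x := by
    filter_upwards [hfront] with x hx
    rw [hvdef, Pi.sub_apply, hx]; ring
  have hdis := dissipation_eq hβ hJs hMa hgw hv hg hvb' hm
  have hlin := linDissipation_eq hβ hJs hMa hgw hv hg hvb' hfront
  have hdis0 : 0 ≤ ∑ i, ∫ x, mobility β (M (x.1 - a t) + v x) *
      chemDeriv β J (fun r => M (r - a t)) (fun r => P (r - a t)) v i (g i) x ^ 2 :=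
    Finset.sum_nonneg fun i _ => integral_nonneg_of_ae (by
      filter_upwards [hvb'] with x hx
      exact mul_nonneg (mul_nonneg (by linarith) (hMa.gap_pos.le.trans (hMa.gap_le x.1 hx)))
        (sq_nonneg _))
  have hlin0 : 0 ≤ ∑ i, ∫ x : Cyl d L, mobility β (M (x.1 - a t)) *
      frontOpDeriv β J (fun r => M (r - a t)) (fun r => P (r - a t)) v i (g i) x ^ 2 :=
    Finset.sum_nonneg fun i _ => integral_nonneg fun x =>
      mul_nonneg (hMa.mobility_pos hβ x.1).le (sq_nonneg _)
  refine ⟨by rw [hdis]; exact ENNReal.ofReal_ne_top, by rw [hlin]; exact ENNReal.ofReal_ne_top,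
    fun ht0 => ?_, ?_⟩
  · obtain ⟨p, hp, hpeq⟩ := heq t ⟨ht0, ht.2⟩
    -- The free energy of the closest front is constant in time whatever the choice of a, so it
    -- drops out of the derivative.
    simp only [hplanar]
    refine HasDerivAt.sub_const _ ?_
    rw [hdis, ENNReal.toReal_ofReal hdis0,
      ← integral_chemicalPotential_mul hβ hJs hMa hgw hv hg hvb' hm (Lp.memLp (u' t)) hp hpeq]
    have hnhds : ∀ᶠ τ in 𝓝 t, τ ∈ Ico 0 T :=
      mem_of_superset (Ioo_mem_nhds ht0 ht.2) Ioo_subset_Ico_self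
    refine hasDerivAt_freeEnergy hβ hJs hMa hmβ hv hvb' hm (hmfin t ht) (hu' t ⟨ht0, ht.2⟩) ?_ ?_
    · filter_upwards [hnhds] with τ hτ
      filter_upwards [hmu τ hτ, hmu t ht, Lp.coeFn_sub (u τ) (u t)] with x h1 h2 h3
      rw [h1, h2, h3, Pi.sub_apply]; ring
    · filter_upwards [hnhds] with τ hτ
      exact hsol.mem_Icc τ hτ
  · rw [hdis, hlin, ENNReal.toReal_ofReal hdis0, ENNReal.toReal_ofReal hlin0]
    exact neg_le_neg (hcomp (a t) v g hv hg hgw hvb hvP)
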